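/- Let $M$ be a compact connected smooth manifold (without boundary) of dimension $m$ with smooth Riemannian metric $g$, and let $N\subset M$ be a compact submanifold of dimension $n$ with $m\ge n+2$. Suppose that $N$ is covered by local coordinates $(x,y)=(x_1,\dots,x_{m-n},y_1,\dots,y_n)$ of $M$ in which $N=\{x=0\}$, such that the differentials $dx_1,\dots,dx_{m-n},dy_1,\dots,dy_n$ agree on overlaps (so that they are globally defined in a neighborhood of $N$) and such that in these coordinates $$g=\begin{pmatrix} g_1&0\\0&g_2\end{pmatrix}$$ with $g_1$ of size $(m-n)\times(m-n)$ and $g_2$ of size $n\times n$. Let $\tilde g$ be a smooth Riemannian metric on $M\setminus N$ and $f\in C^\infty(M\setminus N)$ such that $$\tilde g=\begin{pmatrix} f^2g_1&0\\0&g_2\end{pmatrix}$$ in a neighborhood of $N$ (with $N$ removed). If $m=2$, assume $f\in L^{2+\epsilon}_g(M)$ for some $\epsilon>0$; if $m\ge 3$, assume $\inf f>0$ and $f\in L_g^{m(m-n)/2+\epsilon}(M)$ for some $\epsilon>0$. Let $W^{1,2}_{\tilde g}(M\setminus N)$ be the space of real functions in $L^2_{\tilde g}(M\setminus N)$ whose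 weak gradient is in $L^2_{\tilde g}$, with norm $(\|u\|^2+\|\nabla u\|^2)^{1/2}$, let $W^{1,2}_{0,\tilde g}(M\setminus N)$ be the closure of $C_0^\infty(M\setminus N)$ in it, and let $\overline{\triangle}^F_{\tilde g}$ be the Friedrichs extension of the nonnegative Laplacian $-\operatorname{div}_{\tilde g}\nabla$ with domain $C_0^\infty(M\setminus N)\subset L^2_{\tilde g}(M\setminus N)$. Then $\overline{\triangle}^F_{\tilde g}$ is a self-adjoint extension of this Laplacian, and it has discrete spectrum (each point of the spectrum is isolated and is an eigenvalue of finite multiplicity). The spectrum consists of eigenvalues $$0=\lambda_1<\lambda_2\le\dots\le\lambda_j\le\dots\to+\infty ,$$ each repeated according to its multiplicity. Corresponding eigenfunctions $\phi_1,\phi_2,\dots\in W^{1,2}_{\tilde g}(M\setminus N)$, with $\overline{\triangle}^F_{\tilde g}\phi_j=\lambda_j\phi_j$, can be chosen as an orthonormal basis of $L^2_{\tilde g}(M\setminus N)$. Furthermore, for every $j\ge1$, $$\lambda_j=\inf_{V^j}\ \sup_{\phi\in V^j,\ \phi\ne0}\ \frac{\|\nabla\phi\|^2_{L^2_{\tilde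 g}(M\setminus N)}}{\|\phi\|^2_{L^2_{\tilde g}(M\setminus N)}},$$ where $V^j$ ranges over all $j$-dimensional subspaces of $W^{1,2}_{0,\tilde g}(M\setminus N)$. -/

import Mathlib

open Set Filter Topology MeasureTheory
open scoped Manifold ContDiff ENNReal InnerProductSpace

noncomputable section

namespace IncompleteSpectrum

/-! ### Unbounded operators on a real Hilbert space -/

section Operators

variable {H : Type*} [NormedAddCommGroup H] [InnerProductSpace ℝ H]

/-- The real numbers `z` for which `A - z : dom A → H` has a bounded everywhere defined inverse. -/
def resolventSet (A : H →ₗ.[ℝ] H) : Set ℝ :=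
  {z | ∃ R : H →L[ℝ] H,
      (∀ w : H, ∃ h : R w ∈ A.domain, A ⟨R w, h⟩ - z • R w = w) ∧
      ∀ u : A.domain, R (A u - z • (u : H)) = u}

/-- The spectrum of `A`. It is used for self-adjoint operators, whose spectrum is real. -/
def spectrum (A : H →ₗ.[ℝ] H) : Set ℝ := (resolventSet A)ᶜ

/-- The eigenspace `ker (A - z)`, as a subspace of the domain of `A`. -/
def eigenspace (A : H →ₗ.[ℝ] H) (z : ℝ) : Submodule ℝ A.domain :=
  LinearMap.ker (A.toFun - z • A.domain.subtype)

/-- Every point of the spectrum is isolated in the spectrum and is an eigenvalue of finite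
multiplicity. -/
def HasDiscreteSpectrum (A : H →ₗ.[ℝ] H) : Prop :=
  ∀ z ∈ spectrum A,
    (∃ ε > 0, spectrum A ∩ Metric.ball z ε = {z}) ∧
    eigenspace A z ≠ ⊥ ∧ FiniteDimensional ℝ (eigenspace A z)

/-- The form domain of a symmetric operator `T` that is bounded below: the limits `u` in `H` of
sequences in `dom T` which are Cauchy for the quadratic form `⟪T v, v⟫`. For such `T` these limits
form a subspace, which is therefore its own span. -/
def formDomain (T : H →ₗ.[ℝ] H) : Submodule ℝ H :=
  Submodule.span ℝ
    {u | ∃ s : ℕ → T.domain,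
        Tendsto (fun k => (s k : H)) atTop (𝓝 u) ∧
        ∀ ε > 0, ∃ K : ℕ, ∀ k ≥ K, ∀ l ≥ K, |⟪T (s k - s l), ((s k - s l : T.domain) : H)⟫_ℝ| < ε}

/-- The Friedrichs extension of a densely defined symmetric operator `T` that is bounded below:
the restriction of the adjoint of `T` to the elements of its domain that lie in the form domain. -/
def friedrichs [CompleteSpace H] (T : H →ₗ.[ℝ] H) : H →ₗ.[ℝ] H :=
  T.adjoint.domRestrict (formDomain T)

end Operators

/-! ### Riemannian manifolds: volume, Laplacian, Sobolev spaces -/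

/-- Smooth Riemannian metrics on a smooth manifold `X` of dimension `m`. -/
abbrev RMetric (m : ℕ) (X : Type*) [TopologicalSpace X] [ChartedSpace (EuclideanSpace ℝ (Fin m)) X]
    [IsManifold (𝓡 m) ∞ X] :=
  Bundle.ContMDiffRiemannianMetric (𝓡 m) ∞ (EuclideanSpace ℝ (Fin m))
    (fun x : X => TangentSpace (𝓡 m) x)

section Riemannian

variable {m : ℕ} {X : Type*} [TopologicalSpace X] [ChartedSpace (EuclideanSpace ℝ (Fin m)) X]

/-- The coordinate vector `∂ᵢ` of the chart `φ` at `c`, at the point `φ⁻¹ y`. -/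
def coordVec (c : X) (i : Fin m) (y : EuclideanSpace ℝ (Fin m)) :
    TangentSpace (𝓡 m) ((chartAt (EuclideanSpace ℝ (Fin m)) c).symm y) :=
  mfderiv (𝓡 m) (𝓡 m) (chartAt (EuclideanSpace ℝ (Fin m)) c).symm y
    (EuclideanSpace.single i (1 : ℝ))

variable [IsManifold (𝓡 m) ∞ X]

/-- The matrix `gᵢⱼ` of the metric in the chart at `c`. -/
def gram (g : RMetric m X) (c : X) (y : EuclideanSpace ℝ (Fin m)) : Matrix (Fin m) (Fin m) ℝ :=
  Matrix.of fun i j => g.inner _ (coordVec c i y) (coordVec c j y)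

/-- The volume density `√ det gᵢⱼ` in the chart at `c`. -/
def volDensity (g : RMetric m X) (c : X) (y : EuclideanSpace ℝ (Fin m)) : ℝ :=
  √((gram g c y).det)

/-- The Laplace–Beltrami operator with the sign that makes it nonnegative,
`Δψ = - (det g)^(-1/2) ∑ᵢ ∂ᵢ ((det g)^(1/2) ∑ⱼ gⁱʲ ∂ⱼψ)`,
evaluated at `x` in the preferred chart at `x`. -/
def laplaceBeltrami (g : RMetric m X) (ψ : X → ℝ) (x : X) : ℝ :=
  let φ := chartAt (EuclideanSpace ℝ (Fin m)) x
  let flux : Fin m → EuclideanSpace ℝ (Fin m) → ℝ := fun i z =>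
    volDensity g x z * ∑ j : Fin m, (gram g x z)⁻¹ i j *
      fderiv ℝ (fun y => ψ (φ.symm y)) z (EuclideanSpace.single j (1 : ℝ));
  (-(volDensity g x (φ x))⁻¹) *
    ∑ i : Fin m, fderiv ℝ (flux i) (φ x) (EuclideanSpace.single i (1 : ℝ))

/-- The vector field `V` is the weak gradient of `u`: in every chart, `g (V, ∂ᵢ)` is the weak
`i`-th partial derivative of `u`. -/
def IsWeakGradient (g : RMetric m X) (u : X → ℝ) (V : ∀ x : X, TangentSpace (𝓡 m) x) : Prop :=
  ∀ c : X,
    let φ := chartAt (EuclideanSpace ℝ (Fin m)) c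
    LocallyIntegrableOn (fun y => u (φ.symm y)) φ.target volume ∧
    ∀ i : Fin m,
      LocallyIntegrableOn (fun y => g.inner (φ.symm y) (V (φ.symm y)) (coordVec c i y))
        φ.target volume ∧
      ∀ ψ : EuclideanSpace ℝ (Fin m) → ℝ, ContDiff ℝ ∞ ψ → HasCompactSupport ψ →
        tsupport ψ ⊆ φ.target →
        ∫ y, u (φ.symm y) * fderiv ℝ ψ y (EuclideanSpace.single i (1 : ℝ)) =
          -∫ y, g.inner (φ.symm y) (V (φ.symm y)) (coordVec c i y) * ψ y

open scoped Classical in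
/-- The weak gradient of `u` (which is unique up to null sets), and `0` if there is none. -/
def weakGrad (g : RMetric m X) (u : X → ℝ) : ∀ x : X, TangentSpace (𝓡 m) x :=
  if h : ∃ V, IsWeakGradient g u V then h.choose else 0

variable [MeasurableSpace X] [BorelSpace X]

/-- The Riemannian volume on the domain of the chart at `c`: the image under the inverse chart of
`√ det gᵢⱼ dy`. -/
def chartVolume (g : RMetric m X) (c : X) : Measure X :=
  ((volume.restrict (chartAt (EuclideanSpace ℝ (Fin m)) c).target).withDensity
    (fun y => ENNReal.ofReal (volDensity g c y))).map
      (chartAt (EuclideanSpace ℝ (Fin m)) c).symm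

/-- The Riemannian volume measure of `(X, g)`. The chart volumes agree on overlaps, and (for second
countable `X`) their supremum is the only measure that restricts to each of them. -/
def riemVolume (g : RMetric m X) : Measure X := ⨆ c : X, chartVolume g c

/-- The Hilbert space `L²` of `(X, g)`. -/
abbrev L2 (g : RMetric m X) := Lp ℝ 2 (riemVolume g)

/-- The Dirichlet integral `‖∇u‖²`. -/
def energy (g : RMetric m X) (u : L2 g) : ℝ :=
  ∫ x, g.inner x (weakGrad g u x) (weakGrad g u x) ∂(riemVolume g)

/-- The Sobolev space `W^{1,2}` of `(X, g)`: the functions in `L²` with a weak gradient in `L²`. -/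
def W12 (g : RMetric m X) : Set (L2 g) :=
  {u | ∃ V, IsWeakGradient g u V ∧ Integrable (fun x => g.inner x (V x) (V x)) (riemVolume g)}

/-- `v ∈ L²` is the class of the smooth compactly supported function `ψ`. -/
def IsTestClass (g : RMetric m X) (ψ : X → ℝ) (v : L2 g) : Prop :=
  ContMDiff (𝓡 m) 𝓘(ℝ, ℝ) ∞ ψ ∧ HasCompactSupport ψ ∧ v =ᵐ[riemVolume g] ψ

/-- The closure `W₀^{1,2}` of the smooth compactly supported functions in `W^{1,2}`, for the norm
`(‖u‖² + ‖∇u‖²)^{1/2}`. -/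
def W12Zero (g : RMetric m X) : Set (L2 g) :=
  {u | u ∈ W12 g ∧
    ∀ ε > 0, ∃ (ψ : X → ℝ) (v : L2 g), IsTestClass g ψ v ∧ ‖u - v‖ ^ 2 + energy g (u - v) < ε}

/-- The Laplacian as an operator in `L²` with domain the smooth compactly supported functions.
It is given by its graph `{(ψ, Δψ)}`, which is a subspace and therefore its own span. -/
def laplacian (g : RMetric m X) : L2 g →ₗ.[ℝ] L2 g :=
  (Submodule.span ℝ {p : L2 g × L2 g | ∃ ψ : X → ℝ,
    IsTestClass g ψ p.1 ∧ p.2 =ᵐ[riemVolume g] laplaceBeltrami g ψ}).toLinearPMap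

/-- The Friedrichs extension of the Laplacian on smooth compactly supported functions. -/
def friedrichsLaplacian (g : RMetric m X) : L2 g →ₗ.[ℝ] L2 g := friedrichs (laplacian g)

end Riemannian

/-! ### The singular set and the singular metric -/

section Singular

variable {m : ℕ} {M : Type*} [TopologicalSpace M] [ChartedSpace (EuclideanSpace ℝ (Fin m)) M]

/-- The open submanifold `M ∖ N`. -/
abbrev puncture [T2Space M] (N : Set M) (hN : IsCompact N) : TopologicalSpace.Opens M :=
  ⟨Nᶜ, hN.isClosed.isOpen_compl⟩

/-- The value on the tangent vector `v` at `p` of the differential of the `i`-th coordinate of the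
chart `e`. -/
def coordDiff (e : OpenPartialHomeomorph M (EuclideanSpace ℝ (Fin m))) (p : M)
    (v : TangentSpace (𝓡 m) p) (i : Fin m) : ℝ :=
  let w : EuclideanSpace ℝ (Fin m) := mfderiv (𝓡 m) (𝓡 m) e p v
  w i

/-- `dy = 0` on `v`, where the coordinates of `e` are `(x₁, …, x_{m-n}, y₁, …, y_n)`. -/
def IsXVector (n : ℕ) (e : OpenPartialHomeomorph M (EuclideanSpace ℝ (Fin m))) (p : M)
    (v : TangentSpace (𝓡 m) p) : Prop :=
  ∀ i : Fin m, m ≤ i + n → coordDiff e p v i = 0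

/-- `dx = 0` on `v`, where the coordinates of `e` are `(x₁, …, x_{m-n}, y₁, …, y_n)`. -/
def IsYVector (n : ℕ) (e : OpenPartialHomeomorph M (EuclideanSpace ℝ (Fin m))) (p : M)
    (v : TangentSpace (𝓡 m) p) : Prop :=
  ∀ i : Fin m, i + n < m → coordDiff e p v i = 0

variable [IsManifold (𝓡 m) ∞ M]

/-- `N` is an `n`-dimensional embedded submanifold, and the charts in `𝒜` are coordinates
`(x₁, …, x_{m-n}, y₁, …, y_n)` around the points of `N` in which `N` is `{x = 0}`, whose
differentials `dx, dy` do not depend on the chart, and in which `g` is block diagonal. -/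
structure IsDiagonalizedNear (g : RMetric m M) (N : Set M) (n : ℕ)
    (𝒜 : Set (OpenPartialHomeomorph M (EuclideanSpace ℝ (Fin m)))) : Prop where
  mem_maximalAtlas : ∀ e ∈ 𝒜, e ∈ IsManifold.maximalAtlas (𝓡 m) ∞ M
  covers : ∀ p ∈ N, ∃ e ∈ 𝒜, p ∈ e.source
  slice : ∀ e ∈ 𝒜, ∀ p ∈ e.source, p ∈ N ↔ ∀ i : Fin m, i + n < m → e p i = 0
  differentials_agree : ∀ e ∈ 𝒜, ∀ e' ∈ 𝒜, ∀ p ∈ e.source ∩ e'.source,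
    ∀ (v : TangentSpace (𝓡 m) p) (i : Fin m), coordDiff e p v i = coordDiff e' p v i
  block : ∀ e ∈ 𝒜, ∀ p ∈ e.source, ∀ v w : TangentSpace (𝓡 m) p,
    IsXVector n e p v → IsYVector n e p w → g.inner p v w = 0

/-- In the coordinates `𝒜`, the metric `gt` on `M ∖ N` has on `U ∖ N` the blocks `f² g₁` and `g₂`,
where `g` has the blocks `g₁` and `g₂`. Tangent vectors of `M ∖ N` are regarded as tangent vectors
of `M` through the differential of the inclusion. -/
def IsBlockRescaling [T2Space M] (g : RMetric m M) (N : Set M) (hN : IsCompact N) (n : ℕ)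
    (𝒜 : Set (OpenPartialHomeomorph M (EuclideanSpace ℝ (Fin m))))
    (gt : RMetric m (puncture N hN)) (f : M → ℝ) (U : Set M) : Prop :=
  ∀ e ∈ 𝒜, ∀ p : puncture N hN, (p : M) ∈ e.source → (p : M) ∈ U →
    let ι := mfderiv (𝓡 m) (𝓡 m) (Subtype.val : puncture N hN → M) p
    ∀ v w : TangentSpace (𝓡 m) p,
      (IsXVector n e p (ι v) → IsXVector n e p (ι w) →
        gt.inner p v w = f p ^ 2 * g.inner (p : M) (ι v) (ι w)) ∧
      (IsYVector n e p (ι v) → IsYVector n e p (ι w) →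
        gt.inner p v w = g.inner (p : M) (ι v) (ι w)) ∧
      (IsXVector n e p (ι v) → IsYVector n e p (ι w) → gt.inner p v w = 0)

end Singular

end IncompleteSpectrum

end

noncomputable section

set_option linter.unusedSectionVars false

/-! The abstract half is Friedrichs' argument. Let `T` be the Laplacian on test functions, complete
`dom T` for the inner product `⟪u, v⟫ + ⟪T u, v⟫` to a Hilbert space `V`, and let `J : V → H` extend
the inclusion. Then `B = J J*` is `(1 + A)⁻¹` for the Friedrichs extension `A`. If `J` is compact,
`B` is compact, symmetric, injective and positive, so it has an orthonormal eigenbasis with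
eigenvalues `μ_j` decreasing to `0`. With `λ_j = 1 / μ_j - 1`, self-adjointness, discreteness,
multiplicities and the min-max formula are read off this basis (`friedrichs_spectral_theorem`). The
form domain is `W₀^{1,2}`, and the closed form is the Dirichlet integral, because weak gradients are
closed under `L²` limits (`coe_formDomain`, `tendsto_form_energy`).

The analytic half is the compactness of `J`: for each `ε`, `‖u‖²` must be bounded by `ε` times the
squared form norm plus the square of a finite rank seminorm. On a convex set `Q` of diameter `d` and
for a weight `w`, `∬ w(x) (u(x) - u(y))² ≤ C d^{m + 2 - m/q} ‖w‖_q ∫ |∇u|²` over `Q`, provided `q >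
1` and `q > m/2` (`exists_poincare_const`). Applied on a cube to the volume density of `gt`, this
gives a Poincaré constant of order `h^{2 - m/q}` in the side `h`, which tends to `0`; the finite
rank part consists of the means over a finite family of cubes.

The hypotheses on `f` are what makes this work across `N`. In adapted coordinates the density of
`gt` is `|f|^{m-n}` times that of `g`, so `f ∈ L^{m(m-n)/2 + ε}` puts it in `L^q` with `q > m/2`.
The density times the inverse metric is `|f|^{m-n-2}` in the `x` directions and `|f|^{m-n}` in the
`y` directions, up to bounded factors. Both are bounded below when `f` is; if `m = 2`, then `n = 0`,
the first exponent is `0` and there are no `y` directions. Hence the `gt`-energy controls the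
Euclidean Dirichlet integral. Test functions vanish near `N`, so they extend smoothly across it, and
`N` is a null set.

For the bottom of the spectrum, codimension at least `2` gives cutoffs around `N` with bounded
energy: Hölder's inequality balances `|∇θ|² ~ J²` against the slab volume `~ J^{-(m-n)}`. A bounded
sequence in `V` has weak limit points in `V`, so the constant `1` lies in the form domain and `λ_1 =
0`. Conversely, Poincaré on coordinate balls makes a function of zero energy locally constant, and
the connectedness of `M` makes it constant, so the second eigenvalue is positive.

The structure `IsPatch` isolates the local information: the density in `L^q` and the lower bound
serve compactness and the kernel of the form, while the upper bound and the cutoffs serve to place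
`1` in the form domain. Patches exist around points off `N` (`exists_isPatch_of_mem`) and on `N`
(`exists_isPatch_of_singular`), and `M` is compact. -/

namespace IncompleteSpectrum

/-! ### The form space of a nonnegative symmetric operator -/

section FormSpace

universe u v

variable {H : Type u} [NormedAddCommGroup H] [InnerProductSpace ℝ H]

/-- A Hilbert space `V` that is a completion of `dom T` for the inner product
`⟪u, v⟫ + ⟪T u, v⟫`, together with its map to `H`. -/
structure FormSpace (T : H →ₗ.[ℝ] H) (V : Type v) [NormedAddCommGroup V]
    [InnerProductSpace ℝ V] where
  /-- the extension of the inclusion of `dom T` -/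
  toH : V →L[ℝ] H
  /-- the inclusion of `dom T` in its completion -/
  incl : T.domain →ₗ[ℝ] V
  dense : DenseRange incl
  toH_incl : ∀ u, toH (incl u) = u
  inner_incl : ∀ u v, ⟪incl u, incl v⟫_ℝ = ⟪(u : H), (v : H)⟫_ℝ + ⟪T u, (v : H)⟫_ℝ

/-- A copy of `dom T`, to carry the form inner product. -/
def FormCopy (T : H →ₗ.[ℝ] H) : Type u := T.domain

instance (T : H →ₗ.[ℝ] H) : AddCommGroup (FormCopy T) :=
  inferInstanceAs (AddCommGroup T.domain)

instance (T : H →ₗ.[ℝ] H) : Module ℝ (FormCopy T) :=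
  inferInstanceAs (Module ℝ T.domain)

/-- The form inner product. -/
@[reducible] def formCore (T : H →ₗ.[ℝ] H)
    (hs : ∀ u v : T.domain, ⟪T u, (v : H)⟫_ℝ = ⟪(u : H), T v⟫_ℝ)
    (hp : ∀ u : T.domain, 0 ≤ ⟪T u, (u : H)⟫_ℝ) : InnerProductSpace.Core ℝ (FormCopy T) where
  inner u v := ⟪((show T.domain from u) : H), ((show T.domain from v) : H)⟫_ℝ +
    ⟪T (show T.domain from u), ((show T.domain from v) : H)⟫_ℝ
  conj_inner_symm u v := by
    change _ + ⟪T (show T.domain from v), _⟫_ℝ = _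
    rw [hs (show T.domain from v) (show T.domain from u)]

    rw [real_inner_comm, real_inner_comm (T _)]
  re_inner_nonneg u := add_nonneg real_inner_self_nonneg (hp u)
  add_left u v w := by
    have h1 : (((show T.domain from u) + (show T.domain from v) : T.domain) : H) =
      (show T.domain from u) + (show T.domain from v) := rfl
    change ⟪(((show T.domain from u) + (show T.domain from v) : T.domain) : H), _⟫_ℝ +
      ⟪T ((show T.domain from u) + (show T.domain from v)), _⟫_ℝ = _
    rw [h1, T.map_add, inner_add_left, inner_add_left]
    ring
  smul_left u v r := by
    change ⟪((r • (show T.domain from u) : T.domain) : H), _⟫_ℝ +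
      ⟪T (r • (show T.domain from u)), _⟫_ℝ = _
    rw [T.map_smul, Submodule.coe_smul, inner_smul_left, inner_smul_left, ← mul_add]
  definite u h := by
    have h1 : ⟪((show T.domain from u) : H), ((show T.domain from u) : H)⟫_ℝ +
      ⟪T (show T.domain from u), ((show T.domain from u) : H)⟫_ℝ = 0 := h
    have h2 := hp u
    have h3 : 0 ≤ ⟪((show T.domain from u) : H), ((show T.domain from u) : H)⟫_ℝ :=
      real_inner_self_nonneg
    have h4 : ⟪((show T.domain from u) : H), ((show T.domain from u) : H)⟫_ℝ = 0 := by
      have h2' : 0 ≤ ⟪T (show T.domain from u), ((show T.domain from u) : H)⟫_ℝ := h2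
      linarith
    exact Subtype.ext (inner_self_eq_zero.mp h4)

/-- The inclusion of `dom T` is a contraction for the form norm, so it extends to the completion.
Injectivity of the extension is not recorded: the later arguments work with any preimage. -/
theorem exists_formSpace [CompleteSpace H] (T : H →ₗ.[ℝ] H)
    (hs : ∀ u v : T.domain, ⟪T u, (v : H)⟫_ℝ = ⟪(u : H), T v⟫_ℝ)
    (hp : ∀ u : T.domain, 0 ≤ ⟪T u, (u : H)⟫_ℝ) :
    ∃ (V : Type u) (_ : NormedAddCommGroup V) (_ : InnerProductSpace ℝ V) (_ : CompleteSpace V),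
      Nonempty (FormSpace T V) := by
  let core := formCore T hs hp
  let i1 : NormedAddCommGroup (FormCopy T) := core.toNormedAddCommGroup
  let i2 : InnerProductSpace ℝ (FormCopy T) := InnerProductSpace.ofCore core.toCore
  have hin : ∀ u v : FormCopy T, ⟪u, v⟫_ℝ = ⟪((show T.domain from u) : H),
    ((show T.domain from v) : H)⟫_ℝ + ⟪T (show T.domain from u), ((show T.domain from v) : H)⟫_ℝ :=
    fun _ _ => rfl
  let ι₀ : FormCopy T →ₗ[ℝ] H :=
    { toFun := fun u => ((show T.domain from u) : H)
      map_add' := fun _ _ => rfl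
      map_smul' := fun _ _ => rfl }
  have hb : ∀ u, ‖ι₀ u‖ ≤ 1 * ‖u‖ := by
    intro u
    rw [one_mul]
    refine le_of_sq_le_sq ?_ (norm_nonneg _)
    rw [← real_inner_self_eq_norm_sq, ← real_inner_self_eq_norm_sq, hin]
    have := hp u
    exact le_add_of_nonneg_right this
  let ι : FormCopy T →L[ℝ] H := ι₀.mkContinuous 1 hb
  let e : FormCopy T →L[ℝ] UniformSpace.Completion (FormCopy T) := UniformSpace.Completion.toComplL
  have hd : DenseRange e := UniformSpace.Completion.denseRange_coe
  have hu : IsUniformInducing e := UniformSpace.Completion.isUniformInducing_coe _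
  refine ⟨UniformSpace.Completion (FormCopy T), inferInstance, inferInstance, inferInstance,
    ⟨{  toH := ι.extend e
        incl :=
          { toFun := fun u => e u
            map_add' := fun u v => e.map_add u v
            map_smul' := fun r u => e.map_smul r u }
        dense := hd
        toH_incl := fun u => ContinuousLinearMap.extend_eq _ hd hu _
        inner_incl := fun u v => ?_ }⟩⟩
  exact UniformSpace.Completion.inner_coe (𝕜 := ℝ) (E := FormCopy T) u v

end FormSpace

namespace FormSpace

universe u v

variable {H : Type u} [NormedAddCommGroup H] [InnerProductSpace ℝ H]
  {V : Type v} [NormedAddCommGroup V] [InnerProductSpace ℝ V] {T : H →ₗ.[ℝ] H}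

theorem norm_incl_sq (F : FormSpace T V) (u : T.domain) :
    ‖F.incl u‖ ^ 2 = ‖(u : H)‖ ^ 2 + ⟪T u, (u : H)⟫_ℝ := by
  rw [← real_inner_self_eq_norm_sq, F.inner_incl, real_inner_self_eq_norm_sq]

/-- On `dom T` symmetry moves `T` to the second argument, and then both sides are continuous in `x`
for the norm of `V`. This is the weak form of `1 + T`, and it links the completion to the adjoint of
`T`. -/
theorem inner_incl_right (F : FormSpace T V)
    (hs : ∀ u v : T.domain, ⟪T u, (v : H)⟫_ℝ = ⟪(u : H), T v⟫_ℝ) (x : V) (u : T.domain) :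
    ⟪x, F.incl u⟫_ℝ = ⟪F.toH x, u + T u⟫_ℝ := by
  refine F.dense.induction_on x (isClosed_eq (by fun_prop) (by fun_prop)) fun v => ?_
  rw [F.inner_incl, F.toH_incl, hs, inner_add_right]

theorem norm_toH_le (F : FormSpace T V)
    (hp : ∀ u : T.domain, 0 ≤ ⟪T u, (u : H)⟫_ℝ) (x : V) : ‖F.toH x‖ ≤ ‖x‖ := by
  refine F.dense.induction_on x (isClosed_le (by fun_prop) (by fun_prop)) fun u => ?_
  refine le_of_sq_le_sq ?_ (norm_nonneg _)
  rw [F.norm_incl_sq, F.toH_incl]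
  linarith [hp u]

/-- A sequence in `dom T` that converges in `H` and is Cauchy for the form converges in `V`. -/
theorem exists_tendsto_incl [CompleteSpace V] (F : FormSpace T V) {s : ℕ → T.domain} {u : H}
    (hu : Tendsto (fun k => (s k : H)) atTop (𝓝 u))
    (hc : ∀ ε > 0, ∃ K : ℕ, ∀ k ≥ K, ∀ l ≥ K,
      |⟪T (s k - s l), ((s k - s l : T.domain) : H)⟫_ℝ| < ε) :
    ∃ x : V, Tendsto (fun k => F.incl (s k)) atTop (𝓝 x) ∧ F.toH x = u := by
  have hC : CauchySeq fun k => F.incl (s k) := by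
    rw [Metric.cauchySeq_iff]
    intro ε hε
    -- The squared norm in `V` of a difference is the squared norm in `H`, below `ε² / 4`, plus the
    -- form, below `ε² / 2`.
    obtain ⟨K₁, h₁⟩ := hc (ε ^ 2 / 2) (by positivity)
    obtain ⟨K₂, h₂⟩ := Metric.cauchySeq_iff.mp hu.cauchySeq (ε / 2) (by positivity)
    refine ⟨max K₁ K₂, fun k hk l hl => ?_⟩
    have a := h₁ k (le_of_max_le_left hk) l (le_of_max_le_left hl)
    have b := h₂ k (le_of_max_le_right hk) l (le_of_max_le_right hl)
    rw [dist_eq_norm] at b ⊢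
    rw [← map_sub]
    refine lt_of_pow_lt_pow_left₀ 2 hε.le ?_
    rw [F.norm_incl_sq]
    have b' : ‖((s k - s l : T.domain) : H)‖ ^ 2 < (ε / 2) ^ 2 := by
      gcongr
      exact b
    have := (abs_lt.mp a).2
    nlinarith
  obtain ⟨x, hx⟩ := cauchySeq_tendsto_of_complete hC
  refine ⟨x, hx, tendsto_nhds_unique ((F.toH.continuous.tendsto x).comp hx) ?_⟩
  simpa [Function.comp_def, F.toH_incl] using hu

theorem tendsto_form (F : FormSpace T V) {s : ℕ → T.domain} {x : V}
    (hx : Tendsto (fun k => F.incl (s k)) atTop (𝓝 x)) :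
    Tendsto (fun k => ⟪T (s k), (s k : H)⟫_ℝ) atTop (𝓝 (‖x‖ ^ 2 - ‖F.toH x‖ ^ 2)) := by
  have h1 := (hx.norm.pow 2).sub ((((F.toH.continuous.tendsto x).comp hx).norm).pow 2)
  refine h1.congr fun k => ?_
  simp [F.norm_incl_sq, F.toH_incl]

/-- Every element of the form space is the limit of a sequence in `dom T`. -/
theorem exists_seq (F : FormSpace T V) (x : V) :
    ∃ s : ℕ → T.domain, Tendsto (fun k => F.incl (s k)) atTop (𝓝 x) ∧
      Tendsto (fun k => (s k : H)) atTop (𝓝 (F.toH x)) ∧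
      ∀ ε > 0, ∃ K : ℕ, ∀ k ≥ K, ∀ l ≥ K,
        |⟪T (s k - s l), ((s k - s l : T.domain) : H)⟫_ℝ| < ε := by
  obtain ⟨y, hy, hyx⟩ := mem_closure_iff_seq_limit.mp (F.dense x)
  choose s hs using hy
  have hx : Tendsto (fun k => F.incl (s k)) atTop (𝓝 x) := by simpa [hs] using hyx
  have hH : Tendsto (fun k => (s k : H)) atTop (𝓝 (F.toH x)) := by
    simpa [Function.comp_def, F.toH_incl] using (F.toH.continuous.tendsto x).comp hx
  refine ⟨s, hx, hH, fun ε hε => ?_⟩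
  have hε' : 0 < √(ε / 2) := by positivity
  obtain ⟨K₁, h₁⟩ := Metric.cauchySeq_iff.mp hx.cauchySeq _ hε'
  obtain ⟨K₂, h₂⟩ := Metric.cauchySeq_iff.mp hH.cauchySeq _ hε'
  refine ⟨max K₁ K₂, fun k hk l hl => ?_⟩
  have a := h₁ k (le_of_max_le_left hk) l (le_of_max_le_left hl)
  have b := h₂ k (le_of_max_le_right hk) l (le_of_max_le_right hl)
  rw [dist_eq_norm] at a b
  rw [← map_sub] at a
  have hsq : √(ε / 2) ^ 2 = ε / 2 := Real.sq_sqrt (by positivity)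
  have a' : ‖F.incl (s k - s l)‖ ^ 2 < ε / 2 := by rw [← hsq]; gcongr
  have b' : ‖((s k - s l : T.domain) : H)‖ ^ 2 < ε / 2 := by
    rw [← hsq]
    gcongr
    exact b
  rw [F.norm_incl_sq] at a'
  rw [abs_lt]
  have h3 := F.norm_incl_sq (s k - s l)
  have h4 := sq_nonneg ‖F.incl (s k - s l)‖
  have h5 := sq_nonneg ‖((s k - s l : T.domain) : H)‖
  constructor <;> linarith

/-- The limits that generate `formDomain` are exactly the range of `toH`, which is already a
subspace. -/
theorem mem_formDomain_iff [CompleteSpace V] (F : FormSpace T V) (u : H) :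
    u ∈ formDomain T ↔ ∃ x, F.toH x = u := by
  constructor
  · intro hu
    change u ∈ F.toH.range
    refine Submodule.span_le.mpr ?_ hu
    rintro w ⟨s, hs, hc⟩
    obtain ⟨x, -, hx⟩ := F.exists_tendsto_incl hs hc
    exact ⟨x, hx⟩
  · rintro ⟨x, rfl⟩
    obtain ⟨s, -, hs, hc⟩ := F.exists_seq x
    exact Submodule.subset_span ⟨s, hs, hc⟩

/-- A weak limit in `H` of a sequence that is bounded in `V` lies in the form domain. -/
theorem exists_toH_eq_of_bounded [CompleteSpace H] [CompleteSpace V] (F : FormSpace T V)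
    {s : ℕ → T.domain} {u : H} {C : ℝ}
    (hw : ∀ h : H, Tendsto (fun k => ⟪(s k : H), h⟫_ℝ) atTop (𝓝 ⟪u, h⟫_ℝ))
    (hC : ∀ k, ‖F.incl (s k)‖ ≤ C) : ∃ x, F.toH x = u := by
  let Φ : ℕ → WeakDual ℝ V := fun k =>
    StrongDual.toWeakDual (InnerProductSpace.toDual ℝ V (F.incl (s k)))
  have hΦ : ∀ k, Φ k ∈ WeakDual.toStrongDual ⁻¹' Metric.closedBall (0 : StrongDual ℝ V) C := by
    intro k
    simp only [mem_preimage, Metric.mem_closedBall, dist_zero_right, Φ]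
    exact ((InnerProductSpace.toDual ℝ V).norm_map _).trans_le (hC k)
  -- The closed balls of the dual of `V` are weak-* compact. The limit is taken along an ultrafilter
  -- finer than `atTop`, which needs no separability of `V`.
  let U : Ultrafilter ℕ := Ultrafilter.of atTop
  have hU : (U : Filter ℕ) ≤ atTop := Ultrafilter.of_le _
  obtain ⟨φ, -, hφ⟩ := (WeakDual.isCompact_closedBall (0 : StrongDual ℝ V) C).ultrafilter_le_nhds
    (U.map Φ) (by
      rw [le_principal_iff]
      exact Filter.mem_map.mpr (Filter.univ_mem' hΦ))
  have hφ' : Tendsto Φ U (𝓝 φ) := hφ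
  refine ⟨(InnerProductSpace.toDual ℝ V).symm (WeakDual.toStrongDual φ), ?_⟩
  refine ext_inner_right ℝ fun h => ?_
  rw [← ContinuousLinearMap.adjoint_inner_right, InnerProductSpace.toDual_symm_apply]
  have h1 : Tendsto (fun k => Φ k (F.toH.adjoint h)) U (𝓝 (φ (F.toH.adjoint h))) :=
    ((WeakDual.eval_continuous _).tendsto φ).comp hφ'
  refine tendsto_nhds_unique h1 (((hw h).mono_left hU).congr fun k => ?_)
  change _ = ⟪F.incl (s k), F.toH.adjoint h⟫_ℝ
  rw [ContinuousLinearMap.adjoint_inner_right, F.toH_incl]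

/-- The kernel `K` of `l ∘ J` has finite codimension, and the estimate bounds `J` by `√ε = δ / 2` on
it. So `J` is within `δ` of the finite rank operator `J ∘ P`, with `P` the projection on `Kᗮ`, and
compact operators are closed in norm. -/
theorem isCompactOperator_toH [CompleteSpace H] [CompleteSpace V] (F : FormSpace T V)
    (hK : ∀ ε > 0, ∃ (r : ℕ) (l : H →L[ℝ] (Fin r → ℝ)), ∀ u : T.domain,
      ‖(u : H)‖ ^ 2 ≤ ε * (⟪T u, (u : H)⟫_ℝ + ‖(u : H)‖ ^ 2) + ‖l u‖ ^ 2) :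
    IsCompactOperator F.toH := by
  have key : F.toH ∈ closure {A : V →L[ℝ] H | IsCompactOperator A} := by
    rw [Metric.mem_closure_iff]
    intro δ hδ
    obtain ⟨r, l, hl⟩ := hK ((δ / 2) ^ 2) (by positivity)
    have hl' : ∀ x : V, ‖F.toH x‖ ^ 2 ≤ (δ / 2) ^ 2 * ‖x‖ ^ 2 + ‖l (F.toH x)‖ ^ 2 := fun x =>
      F.dense.induction_on x (isClosed_le (by fun_prop) (by fun_prop)) fun u => by
        rw [F.norm_incl_sq, F.toH_incl, add_comm (‖(u : H)‖ ^ 2)]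
        exact hl u
    let L : V →L[ℝ] (Fin r → ℝ) := l.comp F.toH
    let K : Submodule ℝ V := L.ker
    have hKc : IsClosed (K : Set V) := L.isClosed_ker
    have : CompleteSpace K := hKc.completeSpace_coe
    have hfin : FiniteDimensional ℝ Kᗮ := by
      let f : Kᗮ →ₗ[ℝ] (Fin r → ℝ) := L.toLinearMap.comp Kᗮ.subtype
      refine FiniteDimensional.of_injective f ?_
      rw [← LinearMap.ker_eq_bot, LinearMap.ker_eq_bot']
      intro x hx
      have h1 : (x : V) ∈ K := hx
      have h2 := K.inner_right_of_mem_orthogonal h1 x.2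
      exact Subtype.ext (inner_self_eq_zero.mp h2)
    let A : V →L[ℝ] H := F.toH.comp Kᗮ.starProjection
    refine ⟨A, ?_, ?_⟩
    · have : IsCompactOperator (Kᗮ.subtypeL : Kᗮ →L[ℝ] V) :=
        have := FiniteDimensional.proper ℝ Kᗮ
        isCompactOperator_of_locallyCompactSpace_rng _
      have h2 := (this.comp_clm Kᗮ.orthogonalProjectionOnto).clm_comp F.toH
      exact h2
    · rw [dist_eq_norm]
      refine lt_of_le_of_lt (ContinuousLinearMap.opNorm_le_bound _ (M := δ / 2) (by positivity)
        fun x => ?_) (half_lt_self hδ)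
      have h1 : (F.toH - A) x = F.toH (K.starProjection x) := by
        have := K.starProjection_add_starProjection_orthogonal x
        simp only [A, _root_.sub_apply, ContinuousLinearMap.comp_apply]
        rw [← map_sub]
        congr 1
        exact sub_eq_of_eq_add this.symm
      rw [h1]
      have h2 : l (F.toH (K.starProjection x)) = 0 := (K.starProjection_apply_mem x : _)
      have h3 := hl' (K.starProjection x)
      rw [h2, norm_zero] at h3
      have h4 : ‖K.starProjection x‖ ≤ ‖x‖ := by
        simpa using K.norm_starProjection_apply_le x
      refine le_of_sq_le_sq ?_ (by positivity)
      calc _ ≤ (δ / 2) ^ 2 * ‖K.starProjection x‖ ^ 2 := by simpa using h3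
        _ ≤ (δ / 2) ^ 2 * ‖x‖ ^ 2 := by gcongr
        _ = _ := by ring
  have := isClosed_setOfPred_isCompactOperator (𝕜₁ := ℝ) (𝕜₂ := ℝ) (σ₁₂ := RingHom.id ℝ)
    (M₁ := V) (M₂ := H)
  rw [this.closure_eq] at key
  exact key

end FormSpace

/-! ### Eigenbases of compact operators -/

/-- A family of reals with finite sublevel sets can be enumerated in increasing order. -/
theorem exists_equiv_monotone {ι : Type*} [Infinite ι] (a : ι → ℝ)
    (ha : ∀ C : ℝ, {i | a i ≤ C}.Finite) : ∃ e : ℕ ≃ ι, Monotone fun j => a (e j) := by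
  have hcount : Countable ι := by
    rw [← Set.countable_univ_iff]
    have : (univ : Set ι) = ⋃ k : ℕ, {i | a i ≤ k} := by
      ext i
      simpa using exists_nat_ge (a i)
    rw [this]
    exact countable_iUnion fun k => (ha k).countable
  obtain ⟨c, hc⟩ := exists_injective_nat ι
  -- Ties of `a` are broken by an injection into `ℕ`. The resulting linear order has finite initial
  -- segments and no maximum, hence is isomorphic to `ℕ`.
  let key : ι → ℝ ×ₗ ℕ := fun i => toLex (a i, c i)
  have hkey : Function.Injective key := fun i j h => by
    have := congrArg (fun p => (ofLex p).2) h
    exact hc this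
  let : LinearOrder ι := LinearOrder.lift' key hkey
  have hle : ∀ i j : ι, i ≤ j → a i ≤ a j := fun i j h => by
    have h' : key i ≤ key j := h
    rcases Prod.Lex.toLex_le_toLex.mp h' with h1 | h1
    · exact h1.le
    · exact h1.1.le
  have hfin : ∀ j : ι, (Set.Iic j).Finite := fun j => (ha (a j)).subset fun i hi => hle i j hi
  let : LocallyFiniteOrder ι := LocallyFiniteOrder.ofFiniteIcc fun i j =>
    (hfin j).subset Set.Icc_subset_Iic_self
  let : SuccOrder ι := LinearLocallyFiniteOrder.succOrder ι
  let : PredOrder ι := LinearLocallyFiniteOrder.predOrder ι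
  obtain ⟨i₀⟩ : Nonempty ι := inferInstance
  obtain ⟨b, hbm, hb⟩ := (hfin i₀).exists_minimalFor id _ ⟨i₀, Set.mem_Iic.mpr le_rfl⟩
  have hb' : ∀ i, b ≤ i := by
    intro i
    rcases le_total b i with h | h
    · exact h
    · exact hb (Set.mem_Iic.mpr (h.trans hbm)) h
  let : OrderBot ι := { bot := b, bot_le := hb' }
  have : NoMaxOrder ι := ⟨fun i => by
    by_contra! h
    exact Set.infinite_univ ((hfin i).subset fun j _ => h j)⟩
  let e := orderIsoNatOfLinearSuccPredArch (ι := ι)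
  exact ⟨e.symm.toEquiv, fun i j hij => hle _ _ (e.symm.monotone hij)⟩

section EigenBasis

variable {H : Type*} [NormedAddCommGroup H] [InnerProductSpace ℝ H]

/-- An orthonormal family of eigenvectors of a compact operator has only finitely many eigenvalues
above a given positive number. -/
theorem finite_setOf_le_eigenvalue {B : H →L[ℝ] H} (hB : IsCompactOperator B) {ι : Type*}
    {v : ι → H} (hv : Orthonormal ℝ v) {μ : ι → ℝ} (hμ : ∀ i, B (v i) = μ i • v i)
    {c : ℝ} (hc : 0 < c) : {i | c ≤ μ i}.Finite := by
  by_contra hinf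
  have hinf : {i | c ≤ μ i}.Infinite := hinf
  obtain ⟨s⟩ : Nonempty (ℕ ↪ {i | c ≤ μ i}) := ⟨hinf.natEmbedding⟩
  -- With infinitely many eigenvalues at least `c`, the images of the eigenvectors would have a
  -- convergent subsequence. By orthogonality, though, any two of them are at squared distance `μ² +
  -- μ'² ≥ c²`.
  obtain ⟨K, hK, hK'⟩ := hB.image_closedBall_subset_compact 1
  obtain ⟨y, -, ψ, hψ, hy⟩ := hK.tendsto_subseq (x := fun k => B (v (s k)))
    (fun k => hK' ⟨v (s k), by simp [hv.1], rfl⟩)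
  obtain ⟨k₀, hk₀⟩ := Metric.cauchySeq_iff.mp hy.cauchySeq c hc
  have h1 := hk₀ k₀ le_rfl (k₀ + 1) (by omega)
  have hne : ((s (ψ k₀) : ι)) ≠ s (ψ (k₀ + 1)) := by
    intro h
    have := hψ.injective (s.injective (Subtype.ext h))
    omega
  have h0 : ⟪v (s (ψ k₀)), v (s (ψ (k₀ + 1)))⟫_ℝ = 0 := hv.2 hne
  simp only [Function.comp_apply, dist_eq_norm, hμ] at h1
  have h2 : ‖μ (s (ψ k₀)) • v (s (ψ k₀)) - μ (s (ψ (k₀ + 1))) • v (s (ψ (k₀ + 1)))‖ ^ 2 =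
      μ (s (ψ k₀)) ^ 2 + μ (s (ψ (k₀ + 1))) ^ 2 := by
    rw [@norm_sub_sq_real, inner_smul_left, inner_smul_right, h0, norm_smul, norm_smul, hv.1, hv.1]
    simp
  have h3 : c ≤ μ (s (ψ k₀)) := (s (ψ k₀)).2
  have h4 : ‖μ (s (ψ k₀)) • v (s (ψ k₀)) - μ (s (ψ (k₀ + 1))) • v (s (ψ (k₀ + 1)))‖ ^ 2 < c ^ 2 := by
    gcongr
  rw [h2] at h4
  nlinarith [sq_nonneg (μ (s (ψ (k₀ + 1))))]

/-- A compact symmetric operator all of whose eigenvalues are positive has an orthonormal basis of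
eigenvectors, with eigenvalues decreasing to `0`. -/
theorem exists_eigenbasis [CompleteSpace H] {B : H →L[ℝ] H} (hB : IsCompactOperator B)
    (hs : B.IsSymmetric) (hinj : Function.Injective B)
    (hpos : ∀ (μ : ℝ) (u : H), u ≠ 0 → B u = μ • u → 0 < μ)
    (hinf : ¬ FiniteDimensional ℝ H) :
    ∃ (b : HilbertBasis ℕ ℝ H) (μ : ℕ → ℝ), (∀ j, 0 < μ j) ∧ Antitone μ ∧
      (∀ j, B (b j) = μ j • b j) ∧ ∀ c > 0, {j | c ≤ μ j}.Finite := by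
  let E : ℝ → Submodule ℝ H := fun μ => Module.End.eigenspace (B : Module.End ℝ H) μ
  have hE : ∀ μ u, u ∈ E μ ↔ B u = μ • u := fun μ u => Module.End.mem_eigenspace_iff
  have hfd : ∀ μ, FiniteDimensional ℝ (E μ) := by
    intro μ
    by_cases h : μ = 0
    · have : E μ = ⊥ := by
        rw [eq_bot_iff]
        intro u hu
        rw [hE, h, zero_smul] at hu
        exact hinj (hu.trans B.map_zero.symm)
      rw [this]
      infer_instance
    · exact ContinuousLinearMap.finite_dimensional_eigenspace hB μ h
  let w : ∀ μ, OrthonormalBasis (Fin (Module.finrank ℝ (E μ))) ℝ (E μ) :=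
    fun μ => stdOrthonormalBasis ℝ (E μ)
  let v : (Σ μ, Fin (Module.finrank ℝ (E μ))) → H := fun a => (w a.1 a.2 : H)
  have hv : Orthonormal ℝ v :=
    (LinearMap.IsSymmetric.orthogonalFamily_eigenspaces hs).orthonormal_sigma_orthonormal
      fun μ => (w μ).orthonormal
  have hspan : (Submodule.span ℝ (range v))ᗮ = ⊥ := by
    rw [eq_bot_iff, ← ContinuousLinearMap.orthogonalComplement_iSup_eigenspaces_eq_bot hB hs]
    refine Submodule.orthogonal_le (iSup_le fun μ => ?_)
    intro u hu
    have h1 := (w μ).sum_repr ⟨u, hu⟩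
    have h2 : u = ∑ i, (w μ).repr ⟨u, hu⟩ i • (w μ i : H) := by
      have := congrArg (fun z : E μ => (z : H)) h1
      simpa using this.symm
    rw [h2]
    exact Submodule.sum_mem _ fun i _ => Submodule.smul_mem _ _
      (Submodule.subset_span ⟨⟨μ, i⟩, rfl⟩)
  have hBv : ∀ a, B (v a) = a.1 • v a := fun a => (hE _ _).mp (w a.1 a.2).2
  have hpos' : ∀ a : (Σ μ, Fin (Module.finrank ℝ (E μ))), 0 < a.1 := fun a =>
    hpos a.1 (v a) (hv.ne_zero a) (hBv a)
  have hinf' : Infinite (Σ μ, Fin (Module.finrank ℝ (E μ))) := by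
    by_contra hfin
    rw [not_infinite_iff_finite] at hfin
    apply hinf
    have hfs : FiniteDimensional ℝ (Submodule.span ℝ (range v)) :=
      FiniteDimensional.span_of_finite ℝ (finite_range v)
    have : Submodule.span ℝ (range v) = ⊤ := by
      rw [← Submodule.orthogonal_orthogonal (Submodule.span ℝ (range v)), hspan,
        Submodule.bot_orthogonal_eq_top]
    rw [this] at hfs
    exact Module.Finite.equiv (Submodule.topEquiv (R := ℝ) (M := H))
  -- Enumerating by increasing `μ⁻¹` makes `μ` decrease. The sublevel sets of `μ⁻¹` are finite
  -- because eigenvalues of a compact operator accumulate only at `0`.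
  obtain ⟨e, he⟩ := exists_equiv_monotone (fun a : (Σ μ, Fin (Module.finrank ℝ (E μ))) => a.1⁻¹)
    (fun C => by
      rcases le_or_gt C 0 with hC | hC
      · refine Set.finite_empty.subset fun a ha => ?_
        have : 0 < a.1⁻¹ := inv_pos.mpr (hpos' a)
        simp only [mem_ofPred_eq] at ha
        linarith
      · refine (finite_setOf_le_eigenvalue hB hv hBv (inv_pos.mpr hC)).subset fun a ha => ?_
        simp only [mem_ofPred_eq] at ha ⊢
        rw [inv_le_comm₀ hC (hpos' a)]
        linarith)
  have hve : Orthonormal ℝ (fun j => v (e j)) := hv.comp e e.injective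
  have hrange : range (fun j => v (e j)) = range v := by
    exact e.surjective.range_comp v
  refine ⟨HilbertBasis.mkOfOrthogonalEqBot hve (by rw [hrange, hspan]), fun j => (e j).1,
    fun j => hpos' _, ?_, ?_, ?_⟩
  · intro i j hij
    have := he hij
    simp only at this
    have h2 : ((e i).1)⁻¹ ≤ ((e j).1)⁻¹ := by linarith
    exact (inv_le_inv₀ (hpos' _) (hpos' _)).mp h2
  · intro j
    rw [HilbertBasis.coe_mkOfOrthogonalEqBot]
    exact hBv _
  · intro c hc
    exact finite_setOf_le_eigenvalue hB hve (fun j => hBv (e j)) hc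

end EigenBasis

/-! ### Operators of the form `B⁻¹ - 1` -/

section Inverse

variable {H : Type*} [NormedAddCommGroup H] [InnerProductSpace ℝ H]
  {A : H →ₗ.[ℝ] H} {B : H →L[ℝ] H}

theorem isFormalAdjoint_of_inverse (hBs : B.IsSymmetric)
    (h2 : ∀ u : A.domain, B (u + A u) = u) : A.IsFormalAdjoint A := by
  intro u v
  have hu := h2 u
  have hv := h2 v
  have e := hBs (u + A u) (v + A v)
  simp only [ContinuousLinearMap.coe_coe] at e
  rw [hu, hv, inner_add_left, inner_add_right] at e
  linarith

/-- A vector orthogonal to the range of `B` is killed by `B`, by symmetry, so it vanishes. -/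
theorem dense_domain_of_inverse [CompleteSpace H] (hBs : B.IsSymmetric) (hBi : Function.Injective B)
    (h1 : ∀ w, B w ∈ A.domain) : Dense (A.domain : Set H) := by
  rw [Submodule.dense_iff_topologicalClosure_eq_top, Submodule.topologicalClosure_eq_top_iff,
    eq_bot_iff]
  intro x hx
  have hx0 : B x = 0 := by
    refine ext_inner_right ℝ fun w => ?_
    have e : ⟪B x, w⟫_ℝ = ⟪x, B w⟫_ℝ := hBs x w
    rw [e, inner_zero_left, real_inner_comm]
    exact hx _ (h1 w)
  exact hBi (hx0.trans B.map_zero.symm)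

/-- For `y` in the domain of the adjoint, pairing with `B w` gives `y = B (y + A* y)`. Hence `y`
lies in the range of `B`, which is contained in `dom A`. -/
theorem isSelfAdjoint_of_inverse [CompleteSpace H] (hBs : B.IsSymmetric) (hBi : Function.Injective B)
    (h1 : ∀ w, ∃ h : B w ∈ A.domain, A ⟨B w, h⟩ = w - B w)
    (h2 : ∀ u : A.domain, B (u + A u) = u) : IsSelfAdjoint A := by
  have hd := dense_domain_of_inverse hBs hBi fun w => (h1 w).1
  have hle := (isFormalAdjoint_of_inverse hBs h2).le_adjoint hd
  rw [LinearPMap.isSelfAdjoint_def]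
  refine (LinearPMap.eq_of_le_of_domain_eq hle (le_antisymm hle.1 fun y hy => ?_)).symm
  have key : y = B (y + A.adjoint ⟨y, hy⟩) := by
    refine ext_inner_right ℝ fun w => ?_
    obtain ⟨hw, hAw⟩ := h1 w
    have e : ⟪A.adjoint ⟨y, hy⟩, B w⟫_ℝ = ⟪y, A ⟨B w, hw⟩⟫_ℝ :=
      A.adjoint_isFormalAdjoint hd ⟨y, hy⟩ ⟨B w, hw⟩
    have e2 : ⟪B (y + A.adjoint ⟨y, hy⟩), w⟫_ℝ = ⟪y + A.adjoint ⟨y, hy⟩, B w⟫_ℝ := hBs _ _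
    rw [e2, inner_add_left, e, hAw, inner_sub_right]
    ring
  rw [key]
  exact (h1 _).1

/-- If `z` is not an eigenvalue of `A`, it is in the resolvent set. -/
theorem mem_resolventSet_of_inverse [CompleteSpace H] (hBc : IsCompactOperator B)
    (h1 : ∀ w, ∃ h : B w ∈ A.domain, A ⟨B w, h⟩ = w - B w)
    (h2 : ∀ u : A.domain, B (u + A u) = u) {z : ℝ}
    (hz : ∀ u : A.domain, A u = z • (u : H) → (u : H) = 0) : z ∈ resolventSet A := by
  -- Since `A B = 1 - B`, this is `(A - z) B`; once `S` is invertible, `B S⁻¹` inverts `A - z`.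
  let S : H →L[ℝ] H := 1 - (1 + z) • B
  have hSw : ∀ w, S w = w - (1 + z) • B w := fun _ => rfl
  have hAB : ∀ w, ∃ h : B w ∈ A.domain, A ⟨B w, h⟩ - z • B w = S w := by
    intro w
    obtain ⟨h, e⟩ := h1 w
    refine ⟨h, ?_⟩
    rw [e]
    rw [hSw, add_smul, one_smul]
    abel
  have hS : IsUnit S := by
    by_cases hz1 : 1 + z = 0
    · simp [S, hz1]
    -- Fredholm alternative for `B` at `(1 + z)⁻¹`: an eigenvector of `B` there would be an
    -- eigenvector of `A` for `z`.
    · rcases hBc.hasEigenvalue_or_mem_resolventSet (μ := (1 + z)⁻¹) (inv_ne_zero hz1) with h | h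
      · exfalso
        obtain ⟨u, hu⟩ := h.exists_hasEigenvector
        have hBu : B u = (1 + z)⁻¹ • u := hu.apply_eq_smul
        obtain ⟨h, e⟩ := hAB u
        have hSu : S u = 0 := by
          simp [S, hBu, smul_smul, mul_inv_cancel₀ hz1]
        rw [hSu, sub_eq_zero] at e
        have h0 : B u = 0 := hz ⟨B u, h⟩ e
        rw [hBu] at h0
        exact hu.2 ((smul_eq_zero.mp h0).resolve_left (inv_ne_zero hz1))
      · have h' := spectrum.mem_resolventSet_iff.mp h
        have : S = (Units.mk0 (1 + z) hz1) • (algebraMap ℝ (H →L[ℝ] H) (1 + z)⁻¹ - B) := by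
          ext w
          simp [S, Units.smul_def, Algebra.algebraMap_eq_smul_one, smul_sub, smul_smul,
            mul_inv_cancel₀ hz1]
        rw [this]
        exact (isUnit_smul_iff _ _).mpr h'
  obtain ⟨U, hU⟩ := hS
  have hU1 : ∀ w, S ((↑U⁻¹ : H →L[ℝ] H) w) = w := fun w => by
    rw [← hU]
    exact DFunLike.congr_fun U.mul_inv w
  have hU2 : ∀ w, (↑U⁻¹ : H →L[ℝ] H) (S w) = w := fun w => by
    rw [← hU]
    exact DFunLike.congr_fun U.inv_mul w
  refine ⟨B.comp (↑U⁻¹ : H →L[ℝ] H), fun w => ?_, fun u => ?_⟩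
  · obtain ⟨h, e⟩ := hAB ((↑U⁻¹ : H →L[ℝ] H) w)
    exact ⟨h, e.trans (hU1 w)⟩
  · have e : A u - z • (u : H) = S (u + A u) := by
      rw [hSw, h2 u, add_smul, one_smul]
      abel
    rw [e, ContinuousLinearMap.comp_apply, hU2, h2]

end Inverse

/-! ### Operators with an orthonormal basis of eigenvectors -/

section Diagonal

variable {H : Type*} [NormedAddCommGroup H] [InnerProductSpace ℝ H]
  {A : H →ₗ.[ℝ] H} {b : HilbertBasis ℕ ℝ H} {ev : ℕ → ℝ}

theorem coeff_eq_zero_of_eigen (hA : A.IsFormalAdjoint A)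
    (hb : ∀ j, ∃ h : b j ∈ A.domain, A ⟨b j, h⟩ = ev j • b j) {z : ℝ} {u : A.domain}
    (hu : A u = z • (u : H)) {j : ℕ} (hj : ev j ≠ z) : ⟪b j, (u : H)⟫_ℝ = 0 := by
  obtain ⟨h, e⟩ := hb j
  have := hA ⟨b j, h⟩ u
  rw [e, hu, inner_smul_left, inner_smul_right] at this
  simp only [conj_trivial] at this
  have h2 : (ev j - z) * ⟪b j, (u : H)⟫_ℝ = 0 := by linarith
  exact (mul_eq_zero.mp h2).resolve_left (sub_ne_zero.mpr hj)

/-- An eigenvector is orthogonal to the basis vectors with a different eigenvalue, so its expansion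
is a finite sum over the index set of `z`. -/
theorem map_eigenspace_eq_span (hA : A.IsFormalAdjoint A)
    (hb : ∀ j, ∃ h : b j ∈ A.domain, A ⟨b j, h⟩ = ev j • b j) {z : ℝ}
    (hz : {j | ev j = z}.Finite) :
    (eigenspace A z).map A.domain.subtype = Submodule.span ℝ (b '' {j | ev j = z}) := by
  have hmem : ∀ u : A.domain, u ∈ eigenspace A z ↔ A u = z • (u : H) := by
    intro u
    rw [eigenspace, LinearMap.mem_ker, LinearMap.sub_apply, sub_eq_zero]
    rfl
  apply le_antisymm
  · rintro _ ⟨u, hu, rfl⟩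
    have hu' := (hmem u).mp hu
    have h1 := b.hasSum_repr (u : H)
    have h2 : HasSum (fun j => b.repr (u : H) j • b j)
        (∑ j ∈ hz.toFinset, b.repr (u : H) j • b j) := by
      refine hasSum_sum_of_ne_finset_zero fun j hj => ?_
      rw [b.repr_apply_apply, coeff_eq_zero_of_eigen hA hb hu' (by simpa using hj), zero_smul]
    have h3 := h1.unique h2
    change (u : H) ∈ _
    rw [h3]
    exact Submodule.sum_mem _ fun j hj => Submodule.smul_mem _ _
      (Submodule.subset_span ⟨j, by simpa using hj, rfl⟩)
  · rw [Submodule.span_le]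
    rintro _ ⟨j, hj, rfl⟩
    obtain ⟨h, e⟩ := hb j
    refine ⟨⟨b j, h⟩, (hmem _).mpr ?_, rfl⟩
    rw [e, (hj : ev j = z)]

theorem finiteDimensional_eigenspace (hA : A.IsFormalAdjoint A)
    (hb : ∀ j, ∃ h : b j ∈ A.domain, A ⟨b j, h⟩ = ev j • b j) {z : ℝ}
    (hz : {j | ev j = z}.Finite) : FiniteDimensional ℝ (eigenspace A z) := by
  have hfin : FiniteDimensional ℝ ((eigenspace A z).map A.domain.subtype) := by
    rw [map_eigenspace_eq_span hA hb hz]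
    exact FiniteDimensional.span_of_finite ℝ (hz.image _)
  exact Module.Finite.equiv
    (Submodule.equivMapOfInjective _ A.domain.injective_subtype (eigenspace A z)).symm

theorem finrank_eigenspace (hA : A.IsFormalAdjoint A)
    (hb : ∀ j, ∃ h : b j ∈ A.domain, A ⟨b j, h⟩ = ev j • b j) {z : ℝ}
    (hz : {j | ev j = z}.Finite) :
    {j | ev j = z}.ncard = Module.finrank ℝ (eigenspace A z) := by
  rw [(Submodule.equivMapOfInjective _ A.domain.injective_subtype (eigenspace A z)).finrank_eq,
    map_eigenspace_eq_span hA hb hz]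
  have hf : Fintype {j | ev j = z} := hz.fintype
  have hli : LinearIndependent ℝ (fun j : {j | ev j = z} => b j) :=
    (b.orthonormal.comp _ Subtype.val_injective).linearIndependent
  have hr : b '' {j | ev j = z} = range (fun j : {j | ev j = z} => b j) := by
    rw [image_eq_range]
  rw [hr, finrank_span_eq_card hli, ← Nat.card_eq_fintype_card]
  rfl

/-- Outside the range of `ev`, an eigenvector would have all its coefficients equal to zero, so
`hres` applies. A value `ev j` cannot be in the resolvent set, since `A - ev j` kills `b j`. -/
theorem spectrum_eq_range (hb : ∀ j, ∃ h : b j ∈ A.domain, A ⟨b j, h⟩ = ev j • b j)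
    (hA : A.IsFormalAdjoint A)
    (hres : ∀ z, (∀ u : A.domain, A u = z • (u : H) → (u : H) = 0) → z ∈ resolventSet A) :
    spectrum A = range ev := by
  ext z
  constructor
  · intro hz
    by_contra hne
    refine hz (hres z fun u hu => ?_)
    have : ∀ j, b.repr (u : H) j = 0 := fun j => by
      rw [b.repr_apply_apply, coeff_eq_zero_of_eigen hA hb hu fun h => hne ⟨j, h⟩]
    have h0 : b.repr (u : H) = 0 := by
      ext j
      simp [this j]
    exact (LinearIsometryEquiv.map_eq_zero_iff _).mp h0
  · rintro ⟨j, rfl⟩ ⟨R, -, hR⟩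
    obtain ⟨h, e⟩ := hb j
    have := hR ⟨b j, h⟩
    rw [e, sub_self, map_zero] at this
    exact b.orthonormal.ne_zero j this.symm

theorem finite_setOf_eq_of_tendsto (hev : Tendsto ev atTop atTop) (C : ℝ) :
    {j | ev j ≤ C}.Finite := by
  obtain ⟨J, hJ⟩ := (hev.eventually_gt_atTop C).exists_forall_of_atTop
  refine (Set.finite_Iio J).subset fun j hj => ?_
  by_contra h
  exact absurd (hJ j (by simpa using h)) (not_lt.mpr hj)

theorem hasDiscreteSpectrum_of_diagonal
    (hb : ∀ j, ∃ h : b j ∈ A.domain, A ⟨b j, h⟩ = ev j • b j) (hA : A.IsFormalAdjoint A)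
    (hsp : spectrum A = range ev) (hev : Tendsto ev atTop atTop) : HasDiscreteSpectrum A := by
  rw [HasDiscreteSpectrum, hsp]
  rintro z ⟨j, rfl⟩
  have hfin : {i | ev i = ev j}.Finite :=
    (finite_setOf_eq_of_tendsto hev (ev j)).subset fun i (hi : ev i = ev j) => hi.le
  refine ⟨?_, ?_, finiteDimensional_eigenspace hA hb hfin⟩
  -- Only finitely many spectral values are at most `ev j + 1`. A ball of radius at most `1` sees no
  -- others, and the finitely many different from `ev j` are at positive distance.
  · have hF : (ev '' {i | ev i ≤ ev j + 1} \ {ev j}).Finite :=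
      ((finite_setOf_eq_of_tendsto hev _).image _).subset sdiff_subset
    have hnot : ev j ∈ (ev '' {i | ev i ≤ ev j + 1} \ {ev j})ᶜ := by simp
    obtain ⟨ε, hε, hsub⟩ := Metric.isOpen_iff.mp hF.isClosed.isOpen_compl _ hnot
    refine ⟨min ε 1, by positivity, ?_⟩
    ext y
    constructor
    · rintro ⟨⟨i, rfl⟩, hy⟩
      by_contra hne
      refine hsub (Metric.ball_subset_ball (min_le_left _ _) hy) ⟨⟨i, ?_, rfl⟩, hne⟩
      have := Metric.ball_subset_ball (min_le_right _ _) hy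
      rw [Metric.mem_ball, Real.dist_eq] at this
      have := (abs_lt.mp this).2
      change ev i ≤ ev j + 1
      linarith
    · rintro rfl
      exact ⟨⟨j, rfl⟩, Metric.mem_ball_self (by positivity)⟩
  · intro h0
    obtain ⟨h, e⟩ := hb j
    have hm : (⟨b j, h⟩ : A.domain) ∈ eigenspace A (ev j) := by
      rw [eigenspace, LinearMap.mem_ker, LinearMap.sub_apply, sub_eq_zero]
      exact e
    rw [h0] at hm
    exact b.orthonormal.ne_zero j (congrArg Subtype.val hm)

end Diagonal

/-! ### The Friedrichs extension through `(1 + A)⁻¹ = J J*`, and spectral bounds of its form. -/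

namespace FormSpace

universe u v

variable {H : Type u} [NormedAddCommGroup H] [InnerProductSpace ℝ H] [CompleteSpace H]
  {V : Type v} [NormedAddCommGroup V] [InnerProductSpace ℝ V] [CompleteSpace V] {T : H →ₗ.[ℝ] H}

/-- The operator `(1 + A)⁻¹`, where `A` is the Friedrichs extension of `T`. -/
def resolvent (F : FormSpace T V) : H →L[ℝ] H := F.toH.comp F.toH.adjoint

theorem inner_resolvent (F : FormSpace T V) (w w' : H) :
    ⟪F.resolvent w, w'⟫_ℝ = ⟪F.toH.adjoint w, F.toH.adjoint w'⟫_ℝ := by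
  rw [resolvent, ContinuousLinearMap.comp_apply, ← ContinuousLinearMap.adjoint_inner_right]

theorem isSymmetric_resolvent (F : FormSpace T V) : F.resolvent.IsSymmetric := fun w w' => by
  simp only [ContinuousLinearMap.coe_coe]
  rw [F.inner_resolvent, real_inner_comm, ← F.inner_resolvent, real_inner_comm]

/-- If `J J* w = 0`, then `J* w = 0`, so `w` is orthogonal to the range of `J`, which contains the
dense subspace `dom T`. -/
theorem resolvent_injective (F : FormSpace T V)
    (hd : Dense (T.domain : Set H)) : Function.Injective F.resolvent := by
  rw [injective_iff_map_eq_zero]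
  intro w hw
  have h1 : F.toH.adjoint w = 0 := by
    have := F.inner_resolvent w w
    rw [hw, inner_zero_left] at this
    exact inner_self_eq_zero.mp this.symm
  have h2 : ∀ y : H, ⟪w, y⟫_ℝ = 0 := fun y =>
    hd.induction (P := fun y => ⟪w, y⟫_ℝ = 0) (fun x hx => by
      have e : x = F.toH (F.incl ⟨x, hx⟩) := (F.toH_incl ⟨x, hx⟩).symm
      rw [e, ← ContinuousLinearMap.adjoint_inner_left, h1, inner_zero_left])
      (isClosed_eq (by fun_prop) (by fun_prop)) y
  exact inner_self_eq_zero.mp (h2 w)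

/-- Existence for the weak equation `(1 + A) u = w`: the vector `J* w` pairs with `v` in `V` as `w`
does in `H`. By `inner_incl_right` this says that `T* (J J* w) = w - J J* w`. -/
theorem friedrichs_resolvent (F : FormSpace T V)
    (hd : Dense (T.domain : Set H))
    (hs : ∀ u v : T.domain, ⟪T u, (v : H)⟫_ℝ = ⟪(u : H), T v⟫_ℝ) (w : H) :
    ∃ h : F.resolvent w ∈ (friedrichs T).domain,
      friedrichs T ⟨F.resolvent w, h⟩ = w - F.resolvent w := by
  have key : ∀ v : T.domain, ⟪w - F.resolvent w, (v : H)⟫_ℝ = ⟪F.resolvent w, T v⟫_ℝ := by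
    intro v
    have h1 := F.inner_incl_right hs (F.toH.adjoint w) v
    rw [ContinuousLinearMap.adjoint_inner_left, F.toH_incl, inner_add_right] at h1
    rw [inner_sub_left, h1]
    change ⟪F.resolvent w, _⟫_ℝ + ⟪F.resolvent w, _⟫_ℝ - _ = _
    ring
  have hdom : F.resolvent w ∈ T.adjoint.domain :=
    LinearPMap.mem_adjoint_domain_of_exists _ ⟨w - F.resolvent w, key⟩
  refine ⟨⟨(F.mem_formDomain_iff _).mpr ⟨F.toH.adjoint w, rfl⟩, hdom⟩, ?_⟩
  exact T.adjoint_apply_eq hd ⟨F.resolvent w, hdom⟩ key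

/-- Uniqueness for the weak equation: `J* (u + T* u)` and the preimage `x` of `u` have the same
inner products with the image of `dom T`, which is dense in `V`. -/
theorem resolvent_friedrichs (F : FormSpace T V)
    (hd : Dense (T.domain : Set H))
    (hs : ∀ u v : T.domain, ⟪T u, (v : H)⟫_ℝ = ⟪(u : H), T v⟫_ℝ) (u : (friedrichs T).domain) :
    F.resolvent (u + friedrichs T u) = u := by
  obtain ⟨u, hu1, hu2⟩ := u
  obtain ⟨x, rfl⟩ := (F.mem_formDomain_iff u).mp hu1
  have e : friedrichs T ⟨F.toH x, hu1, hu2⟩ = T.adjoint ⟨F.toH x, hu2⟩ := rfl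
  rw [e]
  change F.toH (F.toH.adjoint _) = F.toH x
  congr 1
  refine (ext_inner_right ℝ fun y => ?_)
  refine F.dense.induction_on y (isClosed_eq (by fun_prop) (by fun_prop)) fun v => ?_
  rw [ContinuousLinearMap.adjoint_inner_left, F.toH_incl, F.inner_incl_right hs, inner_add_left,
    inner_add_right]
  congr 1
  exact T.adjoint_isFormalAdjoint hd ⟨F.toH x, hu2⟩ v

theorem le_friedrichs (F : FormSpace T V)
    (hd : Dense (T.domain : Set H))
    (hs : ∀ u v : T.domain, ⟪T u, (v : H)⟫_ℝ = ⟪(u : H), T v⟫_ℝ) : T ≤ friedrichs T := by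
  have hle : T ≤ T.adjoint := by
    refine LinearPMap.IsFormalAdjoint.le_adjoint hd fun u v => ?_
    exact hs u v
  refine ⟨fun u hu => ⟨(F.mem_formDomain_iff u).mpr ⟨F.incl ⟨u, hu⟩, F.toH_incl _⟩, hle.1 hu⟩,
    fun u v huv => ?_⟩
  exact hle.2 (y := ⟨v, v.2.2⟩) huv

/-! #### Comparison of the form with the eigenvalues -/

variable {b : HilbertBasis ℕ ℝ H} {μ : ℕ → ℝ}

/-- The vectors `J* b_i / √μ_i` are orthonormal in `V`, because `⟪J* b_i, J* b_k⟫ = ⟪B b_i, b_k⟫`.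
Bessel's inequality reads `∑ μ_i⁻¹ ⟪b_i, J x⟫² ≤ ‖x‖²`, and only the terms with `i ≥ j`, where `μ_i
≤ μ_j`, are present. -/
theorem norm_toH_sq_le (F : FormSpace T V) (hμ : ∀ j, 0 < μ j) (hanti : Antitone μ)
    (hb : ∀ j, F.resolvent (b j) = μ j • b j) {j : ℕ} {x : V}
    (hx : ∀ i < j, ⟪b i, F.toH x⟫_ℝ = 0) : ‖F.toH x‖ ^ 2 ≤ μ j * ‖x‖ ^ 2 := by
  let β : ℕ → V := fun i => (√(μ i))⁻¹ • F.toH.adjoint (b i)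
  have hsq : ∀ i, √(μ i) ^ 2 = μ i := fun i => Real.sq_sqrt (hμ i).le
  have hsp : ∀ i, 0 < √(μ i) := fun i => Real.sqrt_pos.mpr (hμ i)
  have hin : ∀ i k, ⟪β i, β k⟫_ℝ = (√(μ i))⁻¹ * ((√(μ k))⁻¹ * (μ i * ⟪b i, b k⟫_ℝ)) := by
    intro i k
    simp only [β]
    rw [inner_smul_left, inner_smul_right, ← F.inner_resolvent, hb, inner_smul_left]
    simp
  have hβ : Orthonormal ℝ β := by
    rw [orthonormal_iff_ite]
    intro i k
    rw [hin, orthonormal_iff_ite.mp b.orthonormal]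
    split_ifs with h
    · subst h
      have := hsp i
      field_simp
      rw [hsq]
    · simp
  have hc : ∀ i, ⟪b i, F.toH x⟫_ℝ ^ 2 ≤ μ j * ‖⟪β i, x⟫_ℝ‖ ^ 2 := by
    intro i
    rcases lt_or_ge i j with h | h
    · rw [hx i h]
      simpa using mul_nonneg (hμ j).le (sq_nonneg |⟪β i, x⟫_ℝ|)
    · simp only [β]
      rw [inner_smul_left, ContinuousLinearMap.adjoint_inner_left, Real.norm_eq_abs, sq_abs,
        mul_pow, conj_trivial, inv_pow, hsq]
      have h1 : 1 ≤ μ j * (μ i)⁻¹ := by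
        rw [← div_eq_mul_inv, one_le_div (hμ i)]
        exact hanti h
      nlinarith [sq_nonneg ⟪b i, F.toH x⟫_ℝ]
  have hsum : HasSum (fun i => ⟪b i, F.toH x⟫_ℝ ^ 2) (‖F.toH x‖ ^ 2) := by
    have := b.hasSum_inner_mul_inner (F.toH x) (F.toH x)
    rw [real_inner_self_eq_norm_sq] at this
    refine this.congr_fun fun i => ?_
    rw [real_inner_comm, sq]
  have hS := hβ.inner_products_summable x
  calc ‖F.toH x‖ ^ 2 = ∑' i, ⟪b i, F.toH x⟫_ℝ ^ 2 := hsum.tsum_eq.symm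
    _ ≤ ∑' i, μ j * ‖⟪β i, x⟫_ℝ‖ ^ 2 := hsum.summable.tsum_le_tsum hc (hS.mul_left _)
    _ = μ j * ∑' i, ‖⟪β i, x⟫_ℝ‖ ^ 2 := tsum_mul_left
    _ ≤ μ j * ‖x‖ ^ 2 := mul_le_mul_of_nonneg_left (hβ.tsum_inner_products_le x) (hμ j).le

/-- For `u = ∑ a_i b_i` the preimage `∑ a_i μ_i⁻¹ J* b_i` has squared norm `∑ a_i² / μ_i`. With the
previous lemma this gives both halves of the min-max principle. -/
theorem exists_norm_sq_le (F : FormSpace T V) (hμ : ∀ j, 0 < μ j) (hanti : Antitone μ)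
    (hb : ∀ j, F.resolvent (b j) = μ j • b j) {j : ℕ} {u : H}
    (hu : u ∈ Submodule.span ℝ (range fun i : Fin (j + 1) => b i)) :
    ∃ x, F.toH x = u ∧ ‖x‖ ^ 2 ≤ (μ j)⁻¹ * ‖u‖ ^ 2 := by
  obtain ⟨a, rfl⟩ := (Submodule.mem_span_range_iff_exists_fun ℝ).mp hu
  have hJ : F.toH (∑ i : Fin (j + 1), (a i * (μ i)⁻¹) • F.toH.adjoint (b i)) =
      ∑ i : Fin (j + 1), a i • b i := by
    rw [map_sum]
    refine Finset.sum_congr rfl fun i _ => ?_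
    have h1 : F.toH (F.toH.adjoint (b i)) = μ i • b i := hb i
    rw [map_smul, h1, smul_smul, mul_assoc, inv_mul_cancel₀ (hμ i).ne', mul_one]
  refine ⟨_, hJ, ?_⟩
  have hon : Orthonormal ℝ fun i : Fin (j + 1) => b i :=
    b.orthonormal.comp _ Fin.val_injective
  rw [← real_inner_self_eq_norm_sq, sum_inner, ← real_inner_self_eq_norm_sq (∑ i, a i • b i),
    hon.inner_sum, Finset.mul_sum]
  refine Finset.sum_le_sum fun i _ => ?_
  rw [inner_smul_left, ContinuousLinearMap.adjoint_inner_left, hJ,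
    hon.inner_right_fintype]
  simp only [conj_trivial]
  have h2 : (μ i)⁻¹ ≤ (μ j)⁻¹ := inv_anti₀ (hμ j) (hanti (by omega))
  nlinarith [mul_self_nonneg (a i)]

end FormSpace

/-- The spectral theory of the Friedrichs extension of a nonnegative symmetric operator `T` whose
form domain embeds compactly in `H`. Here `q` is the closure of the quadratic form of `T`. -/
theorem friedrichs_spectral_theorem {H : Type*} [NormedAddCommGroup H] [InnerProductSpace ℝ H]
    [CompleteSpace H] (T : H →ₗ.[ℝ] H) (hd : Dense (T.domain : Set H))
    (hs : ∀ u v : T.domain, ⟪T u, (v : H)⟫_ℝ = ⟪(u : H), T v⟫_ℝ)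
    (hp : ∀ u : T.domain, 0 ≤ ⟪T u, (u : H)⟫_ℝ)
    (hK : ∀ ε > 0, ∃ (r : ℕ) (l : H →L[ℝ] (Fin r → ℝ)), ∀ u : T.domain,
      ‖(u : H)‖ ^ 2 ≤ ε * (⟪T u, (u : H)⟫_ℝ + ‖(u : H)‖ ^ 2) + ‖l u‖ ^ 2)
    (hinf : ¬ FiniteDimensional ℝ H) (q : H → ℝ)
    (hq : ∀ (u : H) (s : ℕ → T.domain), Tendsto (fun k => (s k : H)) atTop (𝓝 u) →
      (∀ ε > 0, ∃ K : ℕ, ∀ k ≥ K, ∀ l ≥ K,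
        |⟪T (s k - s l), ((s k - s l : T.domain) : H)⟫_ℝ| < ε) →
      Tendsto (fun k => ⟪T (s k), (s k : H)⟫_ℝ) atTop (𝓝 (q u))) :
    T ≤ friedrichs T ∧ IsSelfAdjoint (friedrichs T) ∧ HasDiscreteSpectrum (friedrichs T) ∧
    ∃ ev : ℕ → ℝ, (∀ j, 0 ≤ ev j) ∧ Monotone ev ∧ Tendsto ev atTop atTop ∧
      spectrum (friedrichs T) = range ev ∧
      (∀ z : ℝ, {j | ev j = z}.ncard = Module.finrank ℝ (eigenspace (friedrichs T) z)) ∧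
      (∃ b : HilbertBasis ℕ ℝ H, ∀ j : ℕ, b j ∈ formDomain T ∧ q (b j) = ev j ∧
        ∃ h : b j ∈ (friedrichs T).domain, friedrichs T ⟨b j, h⟩ = ev j • b j) ∧
      (∀ u ∈ formDomain T, ev 0 * ‖u‖ ^ 2 ≤ q u) ∧
      ∀ j : ℕ, ((ev j : ℝ) : EReal) =
        ⨅ (V : Submodule ℝ H) (_ : (V : Set H) ⊆ formDomain T) (_ : Module.finrank ℝ V = j + 1),
          ⨆ (u : H) (_ : u ∈ V) (_ : u ≠ 0), ((q u / ‖u‖ ^ 2 : ℝ) : EReal) := by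
  obtain ⟨V, _, _, _, ⟨F⟩⟩ := exists_formSpace T hs hp
  have hBs := F.isSymmetric_resolvent
  have hBi := F.resolvent_injective hd
  have hBc : IsCompactOperator F.resolvent := (F.isCompactOperator_toH hK).comp_clm _
  have h1 := F.friedrichs_resolvent hd hs
  have h2 := F.resolvent_friedrichs hd hs
  have hJ := F.norm_toH_le hp
  -- The hypothesis `hq` is used only to identify `q` on the form domain with the closed form, the
  -- difference of the squared norms of `V` and `H`.
  have hqx : ∀ x, q (F.toH x) = ‖x‖ ^ 2 - ‖F.toH x‖ ^ 2 := by
    intro x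
    obtain ⟨s, hs1, hs2, hs3⟩ := F.exists_seq x
    exact tendsto_nhds_unique (hq _ s hs2 hs3) (F.tendsto_form hs1)
  obtain ⟨b, μ, hμ, hanti, hb, hfin⟩ := exists_eigenbasis hBc hBs hBi (fun c u hu hc => by
    have e := F.inner_resolvent u u
    rw [hc, inner_smul_left, real_inner_self_eq_norm_sq, real_inner_self_eq_norm_sq] at e
    simp only [conj_trivial] at e
    have hu' : 0 < ‖u‖ ^ 2 := by positivity
    have hc0 : c ≠ 0 := by
      rintro rfl
      rw [zero_smul] at hc
      exact hu (hBi (hc.trans (map_zero _).symm))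
    have : 0 ≤ c := by
      by_contra! hneg
      nlinarith [sq_nonneg ‖F.toH.adjoint u‖]
    exact lt_of_le_of_ne this hc0.symm) hinf
  have hfa : (friedrichs T).IsFormalAdjoint (friedrichs T) := isFormalAdjoint_of_inverse hBs h2
  -- `B = (1 + A)⁻¹`, so `B b = μ b` means `A b = (μ⁻¹ - 1) b`.
  let ev : ℕ → ℝ := fun j => (μ j)⁻¹ - 1
  have hbA : ∀ j, ∃ h : b j ∈ (friedrichs T).domain, friedrichs T ⟨b j, h⟩ = ev j • b j := by
    intro j
    have e : F.resolvent ((μ j)⁻¹ • b j) = b j := by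
      rw [map_smul, hb, smul_smul, inv_mul_cancel₀ (hμ j).ne', one_smul]
    have := h1 ((μ j)⁻¹ • b j)
    rw [e] at this
    obtain ⟨h, h'⟩ := this
    refine ⟨h, h'.trans ?_⟩
    simp only [ev, sub_smul, one_smul]
  have hmono : Monotone ev := fun i j hij => sub_le_sub_right (inv_anti₀ (hμ j) (hanti hij)) 1
  have htend : Tendsto ev atTop atTop := by
    rw [tendsto_atTop_atTop]
    intro C
    -- Once `μ j` is below `1 / (C + 1)`, the eigenvalue is at least `C`; the maximum with `1` keeps
    -- the threshold positive for negative `C`.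
    have hc : 0 < (max (C + 1) 1)⁻¹ := by positivity
    obtain ⟨J, hJ⟩ := (hfin _ hc).bddAbove
    refine ⟨J + 1, fun j hj => ?_⟩
    have hlt : μ j < (max (C + 1) 1)⁻¹ := by
      by_contra! h
      have := hJ h
      omega
    have h3 : max (C + 1) 1 ≤ (μ j)⁻¹ := (le_inv_comm₀ (by positivity) (hμ j)).mpr hlt.le
    have := le_max_left (C + 1) 1
    simp only [ev]
    linarith
  have hres : ∀ z, (∀ u : (friedrichs T).domain, friedrichs T u = z • (u : H) → (u : H) = 0) →
      z ∈ resolventSet (friedrichs T) := fun z hz => mem_resolventSet_of_inverse hBc h1 h2 hz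
  have hsp := spectrum_eq_range hbA hfa hres
  have hlow : ∀ (j : ℕ) (u : H), u ∈ formDomain T → (∀ i < j, ⟪b i, u⟫_ℝ = 0) →
      ev j * ‖u‖ ^ 2 ≤ q u := by
    intro j u hu hi
    obtain ⟨x, rfl⟩ := (F.mem_formDomain_iff u).mp hu
    have h3 := F.norm_toH_sq_le hμ hanti hb hi
    rw [hqx]
    have h4 : (μ j)⁻¹ * ‖F.toH x‖ ^ 2 ≤ ‖x‖ ^ 2 := by
      rw [inv_mul_le_iff₀ (hμ j)]
      exact h3
    simp only [ev, sub_mul, one_mul]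
    linarith
  have hup : ∀ (j : ℕ) (u : H), u ∈ Submodule.span ℝ (range fun i : Fin (j + 1) => b i) →
      u ∈ formDomain T ∧ q u ≤ ev j * ‖u‖ ^ 2 := by
    intro j u hu
    obtain ⟨x, rfl, hx⟩ := F.exists_norm_sq_le hμ hanti hb hu
    refine ⟨(F.mem_formDomain_iff _).mpr ⟨x, rfl⟩, ?_⟩
    rw [hqx]
    simp only [ev, sub_mul, one_mul]
    linarith
  have hbq : ∀ j, b j ∈ formDomain T ∧ q (b j) = ev j := by
    intro j
    have h3 := hup j (b j) (Submodule.subset_span ⟨Fin.last j, rfl⟩)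
    have h4 := hlow j (b j) h3.1 fun i hi => b.orthonormal.2 hi.ne
    have hn : ‖b j‖ ^ 2 = 1 := by rw [b.orthonormal.1, one_pow]
    rw [hn, mul_one] at h3 h4
    exact ⟨h3.1, le_antisymm h3.2 h4⟩
  refine ⟨F.le_friedrichs hd hs, isSelfAdjoint_of_inverse hBs hBi h1 h2,
    hasDiscreteSpectrum_of_diagonal hbA hfa hsp htend, ev, fun j => ?_, hmono, htend, hsp,
    fun z => finrank_eigenspace hfa hbA
      ((finite_setOf_eq_of_tendsto htend z).subset fun i (hi : ev i = z) => hi.le),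
    ⟨b, fun j => ⟨(hbq j).1, (hbq j).2, hbA j⟩⟩,
    fun u hu => hlow 0 u hu fun i hi => absurd hi (Nat.not_lt_zero i), fun j => ?_⟩
  · rw [← (hbq j).2]
    obtain ⟨x, hx⟩ := (F.mem_formDomain_iff _).mp (hbq j).1
    rw [← hx, hqx]
    have := hJ x
    have := pow_le_pow_left₀ (norm_nonneg _) this 2
    linarith
  · apply le_antisymm
    -- Indices start at `0`, so `W` has dimension `j + 1` and contains a nonzero vector orthogonal
    -- to `b 0, …, b (j - 1)`. Its Rayleigh quotient is at least `ev j`.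
    · refine le_iInf fun W => le_iInf fun hW => le_iInf fun hWj => ?_
      let f : W →ₗ[ℝ] (Fin j → ℝ) := LinearMap.pi fun i => (innerSL ℝ (b i)).toLinearMap.comp W.subtype
      have : FiniteDimensional ℝ W := Module.finite_of_finrank_pos (by omega)
      have hker : f.ker ≠ ⊥ := LinearMap.ker_ne_bot_of_finrank_lt (by simp [hWj])
      obtain ⟨w, hw, hw0⟩ := Submodule.exists_mem_ne_zero_of_ne_bot hker
      have hw0' : (w : H) ≠ 0 := fun h => hw0 (Subtype.ext h)
      refine le_iSup_of_le (w : H) (le_iSup_of_le w.2 (le_iSup_of_le hw0' ?_))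
      rw [EReal.coe_le_coe_iff, le_div_iff₀ (by positivity)]
      exact hlow j w (hW w.2) fun i hi => congrFun (LinearMap.mem_ker.mp hw) ⟨i, hi⟩
    · have hli : LinearIndependent ℝ fun i : Fin (j + 1) => b i :=
        (b.orthonormal.comp _ Fin.val_injective).linearIndependent
      -- The infimum is attained on the span of the first `j + 1` eigenvectors.
      refine iInf_le_of_le (Submodule.span ℝ (range fun i : Fin (j + 1) => b i))
        (iInf_le_of_le (fun u hu => (hup j u hu).1) (iInf_le_of_le ?_ ?_))
      · rw [finrank_span_eq_card hli, Fintype.card_fin]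
      · refine iSup_le fun u => iSup_le fun hu => iSup_le fun hu0 => ?_
        rw [EReal.coe_le_coe_iff, div_le_iff₀ (by positivity)]
        exact (hup j u hu).2

/-- A weak limit of elements of `dom T` with bounded form is in the form domain. -/
theorem mem_formDomain_of_bounded {H : Type*} [NormedAddCommGroup H] [InnerProductSpace ℝ H]
    [CompleteSpace H] (T : H →ₗ.[ℝ] H)
    (hs : ∀ u v : T.domain, ⟪T u, (v : H)⟫_ℝ = ⟪(u : H), T v⟫_ℝ)
    (hp : ∀ u : T.domain, 0 ≤ ⟪T u, (u : H)⟫_ℝ) {s : ℕ → T.domain} {u : H} {C : ℝ}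
    (hw : ∀ h : H, Tendsto (fun k => ⟪(s k : H), h⟫_ℝ) atTop (𝓝 ⟪u, h⟫_ℝ))
    (hC : ∀ k, ‖(s k : H)‖ ^ 2 + ⟪T (s k), (s k : H)⟫_ℝ ≤ C) : u ∈ formDomain T := by
  obtain ⟨V, _, _, _, ⟨F⟩⟩ := exists_formSpace T hs hp
  refine (F.mem_formDomain_iff u).mpr (F.exists_toH_eq_of_bounded (C := √C) hw fun k => ?_)
  refine Real.le_sqrt_of_sq_le ?_
  rw [F.norm_incl_sq]
  exact hC k

/-! ### A weighted Poincaré inequality on convex sets -/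

section Poincare

theorem lintegral_rpow_Ioo_lt_top {r : ℝ} (hr : -1 < r) :
    ∫⁻ t in Ioo (0 : ℝ) 1, ENNReal.ofReal (t ^ r) < ⊤ := by
  have h : IntegrableOn (fun t : ℝ => t ^ r) (Ioo 0 1) :=
    (intervalIntegral.integrableOn_Ioo_rpow_iff one_pos).mpr hr
  refine lt_of_le_of_lt (lintegral_mono fun t => ?_) h.2
  exact Real.ofReal_le_enorm _

variable {E : Type*} [NormedAddCommGroup E] [NormedSpace ℝ E] [MeasurableSpace E] [BorelSpace E]

/-- The increment of `u` along a segment, with a weighted Cauchy–Schwarz inequality. -/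
theorem enorm_sub_sq_le {u : E → ℝ} {Ω : Set E} (hΩ : IsOpen Ω) (hu : ContDiffOn ℝ 1 u Ω)
    {x y : E} (hxy : segment ℝ x y ⊆ Ω) (b : ℝ) :
    ‖u x - u y‖ₑ ^ 2 ≤ (∫⁻ t in Ioo (0 : ℝ) 1, ENNReal.ofReal (t ^ (-b))) * ‖y - x‖ₑ ^ 2 *
      ∫⁻ t in Ioo (0 : ℝ) 1, ENNReal.ofReal (t ^ b) * ‖fderiv ℝ u (x + t • (y - x))‖ₑ ^ 2 := by
  let γ : ℝ → E := fun t => x + t • (y - x)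
  have hγmem : ∀ t ∈ Icc (0 : ℝ) 1, γ t ∈ Ω := by
    intro t ht
    apply hxy
    rw [segment_eq_image']
    exact ⟨t, ht, rfl⟩
  have hγ : ContDiff ℝ 1 γ := by fun_prop
  have hγ' : ∀ t, HasDerivAt γ (y - x) t := fun t => by
    have := ((hasDerivAt_id t).smul_const (y - x)).const_add x
    rwa [one_smul] at this
  have hcomp : ContDiffOn ℝ 1 (u ∘ γ) (Icc 0 1) := hu.comp hγ.contDiffOn hγmem
  have h1 := enorm_sub_le_lintegral_deriv_of_contDiffOn_Icc hcomp zero_le_one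
  have hderiv : ∀ t ∈ Ioo (0 : ℝ) 1, deriv (u ∘ γ) t = fderiv ℝ u (γ t) (y - x) := by
    intro t ht
    have hd : DifferentiableAt ℝ u (γ t) :=
      (hu.differentiableOn one_ne_zero).differentiableAt
        (hΩ.mem_nhds (hγmem t (Ioo_subset_Icc_self ht)))
    exact (hd.hasFDerivAt.comp_hasDerivAt t (hγ' t)).deriv
  have hGm : Measurable fun t : ℝ => ‖fderiv ℝ u (γ t)‖ₑ := by
    refine (measurable_fderiv ℝ u).enorm.comp ?_
    exact hγ.continuous.measurable
  have h2 : ‖u x - u y‖ₑ ≤ ‖y - x‖ₑ * ∫⁻ t in Ioo (0 : ℝ) 1, ‖fderiv ℝ u (γ t)‖ₑ := by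
    have e0 : γ 0 = x := by simp [γ]
    have e1 : γ 1 = y := by simp [γ]
    rw [← lintegral_const_mul _ hGm, enorm_sub_rev]
    simp only [Function.comp_apply, e0, e1] at h1
    refine h1.trans ?_
    rw [← restrict_Ioo_eq_restrict_Icc]
    refine setLIntegral_mono' measurableSet_Ioo fun t ht => ?_
    have := hderiv t ht
    simp only [Function.comp_def] at this ⊢
    rw [this, mul_comm]
    exact ContinuousLinearMap.le_opENorm _ _
  have hm1 : Measurable fun t : ℝ => ENNReal.ofReal (t ^ (-b / 2)) :=
    (measurable_id.pow_const _).ennreal_ofReal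
  have hm2 : Measurable fun t : ℝ => ENNReal.ofReal (t ^ (b / 2)) :=
    (measurable_id.pow_const _).ennreal_ofReal
  -- Cauchy–Schwarz after writing `1 = t^(-b/2) t^(b/2)`. The weight `t^b` will compensate for the
  -- singularity at `t = 0` created by the substitution `z = x + t (y - x)`.
  have h3 : (∫⁻ t in Ioo (0 : ℝ) 1, ‖fderiv ℝ u (γ t)‖ₑ) ^ 2 ≤
      (∫⁻ t in Ioo (0 : ℝ) 1, ENNReal.ofReal (t ^ (-b))) *
        ∫⁻ t in Ioo (0 : ℝ) 1, ENNReal.ofReal (t ^ b) * ‖fderiv ℝ u (γ t)‖ₑ ^ 2 := by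
    have hH := ENNReal.lintegral_mul_le_Lp_mul_Lq (volume.restrict (Ioo (0 : ℝ) 1))
      Real.HolderConjugate.two_two hm1.aemeasurable (hm2.mul hGm).aemeasurable
    have hL : ∫⁻ t in Ioo (0 : ℝ) 1, ‖fderiv ℝ u (γ t)‖ₑ =
        ∫⁻ t in Ioo (0 : ℝ) 1, ((fun t : ℝ => ENNReal.ofReal (t ^ (-b / 2))) *
          ((fun t : ℝ => ENNReal.ofReal (t ^ (b / 2))) * fun t => ‖fderiv ℝ u (γ t)‖ₑ)) t := by
      refine setLIntegral_congr_fun measurableSet_Ioo fun t ht => ?_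
      simp only [Pi.mul_apply]
      rw [← mul_assoc, ← ENNReal.ofReal_mul (by have := ht.1; positivity),
        ← Real.rpow_add ht.1]
      simp [neg_div]
    have hA : ∫⁻ t in Ioo (0 : ℝ) 1, ENNReal.ofReal (t ^ (-b / 2)) ^ (2 : ℝ) =
        ∫⁻ t in Ioo (0 : ℝ) 1, ENNReal.ofReal (t ^ (-b)) := by
      refine setLIntegral_congr_fun measurableSet_Ioo fun t ht => ?_
      rw [ENNReal.ofReal_rpow_of_pos (Real.rpow_pos_of_pos ht.1 _), ← Real.rpow_mul ht.1.le]
      congr 2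
      ring
    have hB : ∫⁻ t in Ioo (0 : ℝ) 1, ((fun t : ℝ => ENNReal.ofReal (t ^ (b / 2))) *
          fun t => ‖fderiv ℝ u (γ t)‖ₑ) t ^ (2 : ℝ) =
        ∫⁻ t in Ioo (0 : ℝ) 1, ENNReal.ofReal (t ^ b) * ‖fderiv ℝ u (γ t)‖ₑ ^ 2 := by
      refine setLIntegral_congr_fun measurableSet_Ioo fun t ht => ?_
      simp only [Pi.mul_apply]
      rw [ENNReal.mul_rpow_of_nonneg _ _ (by norm_num),
        ENNReal.ofReal_rpow_of_pos (Real.rpow_pos_of_pos ht.1 _), ← Real.rpow_mul ht.1.le,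
        ENNReal.rpow_two]
      congr 3
      ring
    rw [hL]
    refine (pow_le_pow_left₀ zero_le hH 2).trans_eq ?_
    rw [hA, hB, mul_pow, ← ENNReal.rpow_natCast, ← ENNReal.rpow_natCast, ← ENNReal.rpow_mul,
      ← ENNReal.rpow_mul]
    norm_num
  calc ‖u x - u y‖ₑ ^ 2 ≤ (‖y - x‖ₑ * ∫⁻ t in Ioo (0 : ℝ) 1, ‖fderiv ℝ u (γ t)‖ₑ) ^ 2 := by gcongr
    _ = ‖y - x‖ₑ ^ 2 * (∫⁻ t in Ioo (0 : ℝ) 1, ‖fderiv ℝ u (γ t)‖ₑ) ^ 2 := mul_pow _ _ _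
    _ ≤ ‖y - x‖ₑ ^ 2 * _ := mul_le_mul_right h3 _
    _ = _ := by ring

variable [FiniteDimensional ℝ E] (μ : Measure E)
  [μ.IsAddHaarMeasure]

theorem lintegral_comp_homothety (G : E → ℝ≥0∞) (hG : Measurable G) (x : E) {t : ℝ} (ht : 0 < t) :
    ∫⁻ y, G (x + t • (y - x)) ∂μ =
      ENNReal.ofReal (t ^ (-(Module.finrank ℝ E : ℝ))) * ∫⁻ z, G z ∂μ := by
  have h1 : ∫⁻ y, G (x + t • (y - x)) ∂μ = ∫⁻ y, G (x + t • y) ∂μ :=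
    lintegral_sub_right_eq_self (μ := μ) (fun y => G (x + t • y)) x
  have hG' : Measurable fun z => G (x + z) := hG.comp (measurable_const_add x)
  have h2 : ∫⁻ y, G (x + t • y) ∂μ = ∫⁻ z, G (x + z) ∂(μ.map (t • ·)) :=
    (lintegral_map hG' (measurable_const_smul t)).symm
  rw [h1, h2, Measure.map_addHaar_smul μ ht.ne', lintegral_smul_measure,
    lintegral_add_left_eq_self (μ := μ) G x, Real.rpow_neg ht.le, Real.rpow_natCast,
    abs_of_pos (by positivity), smul_eq_mul]

/-- The double integral in the Poincaré inequality, for one value of the parameter on segments. -/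
theorem lintegral_homothety_le {Q : Set E} (hQ : Convex ℝ Q) (hQm : MeasurableSet Q) {d : ℝ}
    (hQd : ∀ x ∈ Q, ∀ y ∈ Q, ‖y - x‖ ≤ d) {w G : E → ℝ≥0∞} (hw : Measurable w)
    (hG : Measurable G) {p : ℝ} (hp : 1 < p) {t : ℝ} (ht : t ∈ Ioo (0 : ℝ) 1) :
    ∫⁻ x in Q, w x * ∫⁻ y in Q, G (x + t • (y - x)) ∂μ ∂μ ≤
      ENNReal.ofReal (t ^ (-(Module.finrank ℝ E : ℝ))) *
        ((∫⁻ x in Q, w x ^ p ∂μ) ^ (1 / p) *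
          (μ (Metric.closedBall (0 : E) (t * d))) ^ (1 - 1 / p)) * ∫⁻ z in Q, G z ∂μ := by
  -- The point `z = x + t (y - x)` stays within `t d` of `x`. So, for fixed `z`, only the `x` in a
  -- ball of radius `t d` contribute, and Hölder's inequality against `w` turns this into a positive
  -- power of `t d`.
  let k : E → E → ℝ≥0∞ := fun x z => (Metric.closedBall (0 : E) (t * d)).indicator 1 (z - x)
  have hk : Measurable (Function.uncurry k) :=
    (measurable_one.indicator Metric.isClosed_closedBall.measurableSet).comp
      (measurable_snd.sub measurable_fst)
  have h1 : ∀ x ∈ Q, ∫⁻ y in Q, G (x + t • (y - x)) ∂μ ≤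
      ENNReal.ofReal (t ^ (-(Module.finrank ℝ E : ℝ))) * ∫⁻ z in Q, k x z * G z ∂μ := by
    intro x hx
    let F : E → ℝ≥0∞ := Q.indicator fun z => k x z * G z
    have hF : Measurable F :=
      ((hk.comp (measurable_const.prodMk measurable_id)).mul hG).indicator hQm
    rw [← lintegral_indicator hQm (fun z => k x z * G z), ← lintegral_comp_homothety μ F hF x ht.1,
      ← lintegral_indicator hQm]
    refine lintegral_mono fun y => ?_
    by_cases hy : y ∈ Q
    · have hz : x + t • (y - x) ∈ Q := by
        have := hQ hx hy (sub_nonneg.mpr ht.2.le) ht.1.le (by ring)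
        convert this using 1
        module
      have hz' : x + t • (y - x) - x ∈ Metric.closedBall (0 : E) (t * d) := by
        rw [add_sub_cancel_left, mem_closedBall_zero_iff, norm_smul, Real.norm_of_nonneg ht.1.le]
        exact mul_le_mul_of_nonneg_left (hQd x hx y hy) ht.1.le
      simp only [indicator_of_mem hy, F, indicator_of_mem hz, k, indicator_of_mem hz', Pi.one_apply,
        one_mul, le_refl]
    · simp [indicator_of_notMem hy]
  have h2 : ∀ z, ∫⁻ x in Q, w x * k x z ∂μ ≤ (∫⁻ x in Q, w x ^ p ∂μ) ^ (1 / p) *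
      (μ (Metric.closedBall (0 : E) (t * d))) ^ (1 - 1 / p) := by
    intro z
    have hpq := Real.HolderConjugate.conjExponent hp
    have hkz : Measurable fun x => k x z := hk.comp (measurable_id.prodMk measurable_const)
    refine (ENNReal.lintegral_mul_le_Lp_mul_Lq (μ.restrict Q) hpq hw.aemeasurable
      hkz.aemeasurable).trans ?_
    have e : 1 / (Real.conjExponent p) = 1 - 1 / p := by
      rw [one_div, one_div, hpq.one_sub_inv]
    rw [e]
    gcongr
    · rw [← e]
      have := hpq.symm.pos
      positivity
    calc ∫⁻ x in Q, k x z ^ Real.conjExponent p ∂μ ≤ ∫⁻ x, k x z ^ Real.conjExponent p ∂μ :=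
          setLIntegral_le_lintegral _ _
      _ = ∫⁻ x, (Metric.closedBall z (t * d)).indicator 1 x ∂μ := by
          refine lintegral_congr fun x => ?_
          have hiff : z - x ∈ Metric.closedBall (0 : E) (t * d) ↔ x ∈ Metric.closedBall z (t * d) := by
            rw [mem_closedBall_zero_iff, Metric.mem_closedBall, dist_comm, dist_eq_norm]
          by_cases hx : x ∈ Metric.closedBall z (t * d)
          · simp [k, indicator_of_mem hx, indicator_of_mem (hiff.mpr hx)]
          · simp [k, indicator_of_notMem hx, indicator_of_notMem (fun h => hx (hiff.mp h)),
              hpq.symm.pos]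
      _ = μ (Metric.closedBall z (t * d)) := lintegral_indicator_one Metric.isClosed_closedBall.measurableSet
      _ = μ (Metric.closedBall (0 : E) (t * d)) := by
          rw [Measure.addHaar_closedBall_center]
  calc ∫⁻ x in Q, w x * ∫⁻ y in Q, G (x + t • (y - x)) ∂μ ∂μ
      ≤ ∫⁻ x in Q, w x * (ENNReal.ofReal (t ^ (-(Module.finrank ℝ E : ℝ))) *
          ∫⁻ z in Q, k x z * G z ∂μ) ∂μ :=
        setLIntegral_mono' hQm fun x hx => by gcongr; exact h1 x hx
    _ = ENNReal.ofReal (t ^ (-(Module.finrank ℝ E : ℝ))) *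
          ∫⁻ x in Q, ∫⁻ z in Q, w x * (k x z * G z) ∂μ ∂μ := by
        rw [← lintegral_const_mul' _ _ ENNReal.ofReal_ne_top]
        refine lintegral_congr fun x => ?_
        have hkx : Measurable fun z => k x z := hk.comp (measurable_const.prodMk measurable_id)
        have e : ∫⁻ z in Q, w x * (k x z * G z) ∂μ = w x * ∫⁻ z in Q, k x z * G z ∂μ :=
          lintegral_const_mul _ (hkx.mul hG)
        rw [e]
        ring
    _ = ENNReal.ofReal (t ^ (-(Module.finrank ℝ E : ℝ))) *
          ∫⁻ z in Q, ∫⁻ x in Q, w x * (k x z * G z) ∂μ ∂μ := by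
        rw [lintegral_lintegral_swap]
        exact ((hw.comp measurable_fst).mul (hk.mul (hG.comp measurable_snd))).aemeasurable
    _ ≤ ENNReal.ofReal (t ^ (-(Module.finrank ℝ E : ℝ))) *
          ∫⁻ z in Q, ((∫⁻ x in Q, w x ^ p ∂μ) ^ (1 / p) *
          (μ (Metric.closedBall (0 : E) (t * d))) ^ (1 - 1 / p)) * G z ∂μ := by
        gcongr with z
        have hkz : Measurable fun x => k x z := hk.comp (measurable_id.prodMk measurable_const)
        calc ∫⁻ x in Q, w x * (k x z * G z) ∂μ = ∫⁻ x in Q, w x * k x z * G z ∂μ := by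
              simp only [mul_assoc]
          _ = (∫⁻ x in Q, w x * k x z ∂μ) * G z := lintegral_mul_const _ (hw.mul hkz)
          _ ≤ _ := by gcongr; exact h2 z
    _ = _ := by rw [lintegral_const_mul _ hG]; ring

/-- The Tonelli theorem for a weighted triple integral. -/
theorem lintegral_triple_swap {α τ : Type*} [MeasurableSpace α] [MeasurableSpace τ]
    (μ : Measure α) (ν : Measure τ) [SFinite μ] [SFinite ν] {w : α → ℝ≥0∞} (hw : Measurable w)
    {θ : τ → ℝ≥0∞} (hθ : Measurable θ) {g : α → α → τ → ℝ≥0∞}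
    (hg : Measurable fun z : (α × α) × τ => g z.1.1 z.1.2 z.2) (K : ℝ≥0∞) :
    ∫⁻ y, ∫⁻ x, w x * (K * ∫⁻ t, θ t * g x y t ∂ν) ∂μ ∂μ =
      K * ∫⁻ t, θ t * ∫⁻ x, w x * ∫⁻ y, g x y t ∂μ ∂μ ∂ν := by
  have hθg : Measurable fun z : (α × α) × τ => θ z.2 * g z.1.1 z.1.2 z.2 :=
    (hθ.comp measurable_snd).mul hg
  have h1 : Measurable fun z : α × α => ∫⁻ t, θ t * g z.1 z.2 t ∂ν := hθg.lintegral_prod_right'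
  have hH : Measurable fun z : α × τ => ∫⁻ y, g z.1 y z.2 ∂μ := by
    have : Measurable fun z : (α × τ) × α => g z.1.1 z.2 z.1.2 :=
      hg.comp (((measurable_fst.comp measurable_fst).prodMk measurable_snd).prodMk
        (measurable_snd.comp measurable_fst))
    exact this.lintegral_prod_right'
  have hm3 : Measurable fun z : α × τ => θ z.2 * (w z.1 * ∫⁻ y, g z.1 y z.2 ∂μ) :=
    (hθ.comp measurable_snd).mul ((hw.comp measurable_fst).mul hH)
  have hA : AEMeasurable (Function.uncurry fun y x => w x * (K * ∫⁻ t, θ t * g x y t ∂ν))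
      (μ.prod μ) :=
    ((hw.comp measurable_snd).mul ((h1.comp measurable_swap).const_mul K)).aemeasurable
  rw [lintegral_lintegral_swap hA]
  have hx : ∀ x, ∫⁻ y, w x * (K * ∫⁻ t, θ t * g x y t ∂ν) ∂μ =
      K * ∫⁻ t, θ t * (w x * ∫⁻ y, g x y t ∂μ) ∂ν := by
    intro x
    have hm1 : Measurable fun y => ∫⁻ t, θ t * g x y t ∂ν :=
      h1.comp (measurable_const.prodMk measurable_id)
    have hm2 : Measurable fun t => θ t * ∫⁻ y, g x y t ∂μ :=
      hθ.mul (hH.comp (measurable_const.prodMk measurable_id))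
    have hm4 : Measurable fun z : α × τ => θ z.2 * g x z.1 z.2 :=
      hθg.comp ((measurable_const.prodMk measurable_fst).prodMk measurable_snd)
    have hsw : ∫⁻ y, ∫⁻ t, θ t * g x y t ∂ν ∂μ = ∫⁻ t, θ t * ∫⁻ y, g x y t ∂μ ∂ν := by
      rw [lintegral_lintegral_swap hm4.aemeasurable]
      refine lintegral_congr fun t => ?_
      rw [lintegral_const_mul]
      exact hg.comp ((measurable_const.prodMk measurable_id).prodMk measurable_const)
    rw [lintegral_const_mul _ (hm1.const_mul _), lintegral_const_mul _ hm1, hsw,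
      ← mul_assoc, mul_comm (w x), mul_assoc, ← lintegral_const_mul _ hm2]
    congr 1
    refine lintegral_congr fun t => ?_
    ring
  simp_rw [hx]
  rw [lintegral_const_mul _ hm3.lintegral_prod_right', lintegral_lintegral_swap hm3.aemeasurable]
  congr 1
  refine lintegral_congr fun t => ?_
  have hm5 : Measurable fun x => w x * ∫⁻ y, g x y t ∂μ :=
    hw.mul (hH.comp (measurable_id.prodMk measurable_const))
  exact lintegral_const_mul (θ t) hm5

/-- A weighted Poincaré inequality on a convex set `Q` of diameter at most `d`: the double integral
of `w(x) (u(x) - u(y))²` is bounded by the Dirichlet integral. -/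
theorem exists_poincare_const {p : ℝ} (hp : 1 < p) (hpm : (Module.finrank ℝ E : ℝ) / 2 < p) :
    ∃ C : ℝ≥0∞, C < ⊤ ∧ ∀ (Q Ω : Set E) (u : E → ℝ) (w : E → ℝ≥0∞) (d : ℝ), Convex ℝ Q →
      MeasurableSet Q → IsOpen Ω → Q ⊆ Ω → ContDiffOn ℝ 1 u Ω → Measurable w → 0 < d →
      (∀ x ∈ Q, ∀ y ∈ Q, ‖y - x‖ ≤ d) →
      ∫⁻ y in Q, ∫⁻ x in Q, w x * ‖u x - u y‖ₑ ^ 2 ∂μ ∂μ ≤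
        C * ENNReal.ofReal (d ^ (Module.finrank ℝ E + (2 - Module.finrank ℝ E / p))) *
          (∫⁻ x in Q, w x ^ p ∂μ) ^ (1 / p) * ∫⁻ z in Q, ‖fderiv ℝ u z‖ₑ ^ 2 ∂μ := by
  set m : ℕ := Module.finrank ℝ E with hm
  have hp0 : 0 < p := by linarith
  -- This exponent balances the powers of `t`: `t^b t^(-m) t^(m - m/p) = t^(-b)`. The condition `p >
  -- m / 2` says `b < 1`, so the two integrals of `t^(-b)` are finite.
  let b : ℝ := m / (2 * p)
  have hb1 : b < 1 := by
    rw [div_lt_one (by positivity)]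
    linarith
  let A : ℝ≥0∞ := ∫⁻ t in Ioo (0 : ℝ) 1, ENNReal.ofReal (t ^ (-b))
  have hA : A < ⊤ := lintegral_rpow_Ioo_lt_top (by linarith)
  let c : ℝ≥0∞ := μ (Metric.closedBall (0 : E) 1)
  have hc : c < ⊤ := measure_closedBall_lt_top
  have hp1 : 0 ≤ 1 - 1 / p := by
    rw [sub_nonneg, div_le_one hp0]
    exact hp.le
  refine ⟨A * A * c ^ (1 - 1 / p), ENNReal.mul_lt_top (ENNReal.mul_lt_top hA hA)
    (ENNReal.rpow_lt_top_of_nonneg hp1 hc.ne), ?_⟩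
  intro Q Ω u w d hQ hQm hΩ hQΩ hu hw hd hQd
  let G : E → ℝ≥0∞ := fun z => ‖fderiv ℝ u z‖ₑ ^ 2
  have hG : Measurable G := (measurable_fderiv ℝ u).enorm.pow_const 2
  let W : ℝ≥0∞ := (∫⁻ x in Q, w x ^ p ∂μ) ^ (1 / p)
  let D : ℝ≥0∞ := ∫⁻ z in Q, G z ∂μ
  have hTm : Measurable fun t : ℝ => ENNReal.ofReal (t ^ b) :=
    (measurable_id.pow_const _).ennreal_ofReal
  have hpt : ∀ x ∈ Q, ∀ y ∈ Q, ‖u x - u y‖ₑ ^ 2 ≤ A * ENNReal.ofReal d ^ 2 *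
      ∫⁻ t in Ioo (0 : ℝ) 1, ENNReal.ofReal (t ^ b) * G (x + t • (y - x)) := by
    intro x hx y hy
    refine (enorm_sub_sq_le hΩ hu ((hQ.segment_subset hx hy).trans hQΩ) b).trans ?_
    gcongr
    rw [← ofReal_norm]
    exact ENNReal.ofReal_le_ofReal (hQd x hx y hy)
  have hkey : ∀ t ∈ Ioo (0 : ℝ) 1, ENNReal.ofReal (t ^ b) *
      ∫⁻ x in Q, w x * ∫⁻ y in Q, G (x + t • (y - x)) ∂μ ∂μ ≤
        ENNReal.ofReal (t ^ (-b)) * (ENNReal.ofReal (d ^ (m - m / p)) * c ^ (1 - 1 / p) * W * D) := by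
    intro t ht
    have ht0 := ht.1
    have htd : 0 < t * d := mul_pos ht.1 hd
    have hball : μ (Metric.closedBall (0 : E) (t * d)) ^ (1 - 1 / p) =
        ENNReal.ofReal (t ^ (m - m / p) * d ^ (m - m / p)) * c ^ (1 - 1 / p) := by
      rw [Measure.addHaar_closedBall' μ _ htd.le, ENNReal.mul_rpow_of_nonneg _ _ hp1,
        ENNReal.ofReal_rpow_of_pos (by positivity), ← Real.rpow_natCast, ← Real.rpow_mul htd.le,
        Real.mul_rpow ht0.le hd.le, ← hm]
      congr 4 <;> ring
    refine (mul_le_mul_right (lintegral_homothety_le μ hQ hQm hQd hw hG hp ht) _).trans_eq ?_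
    rw [hball, ← hm]
    have e : t ^ (-b) = t ^ b * t ^ (-(m : ℝ)) * t ^ (m - m / p) := by
      rw [← Real.rpow_add ht0, ← Real.rpow_add ht0]
      congr 1
      simp only [b]
      field_simp
      ring
    rw [e, ENNReal.ofReal_mul (by positivity), ENNReal.ofReal_mul (by positivity),
      ENNReal.ofReal_mul (by positivity)]
    ring
  have hFm : Measurable fun z : (E × E) × ℝ => G (z.1.1 + z.2 • (z.1.2 - z.1.1)) :=
    hG.comp (by fun_prop)
  have hswap := lintegral_triple_swap (μ.restrict Q) (volume.restrict (Ioo (0 : ℝ) 1)) hw hTm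
    (g := fun x y t => G (x + t • (y - x))) hFm (A * ENNReal.ofReal d ^ 2)
  calc ∫⁻ y in Q, ∫⁻ x in Q, w x * ‖u x - u y‖ₑ ^ 2 ∂μ ∂μ
      ≤ ∫⁻ y in Q, ∫⁻ x in Q, w x * (A * ENNReal.ofReal d ^ 2 *
          ∫⁻ t in Ioo (0 : ℝ) 1, ENNReal.ofReal (t ^ b) * G (x + t • (y - x))) ∂μ ∂μ := by
        refine setLIntegral_mono' hQm fun y hy => setLIntegral_mono' hQm fun x hx => ?_
        gcongr
        exact hpt x hx y hy
    _ = A * ENNReal.ofReal d ^ 2 * ∫⁻ t in Ioo (0 : ℝ) 1, ENNReal.ofReal (t ^ b) *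
          ∫⁻ x in Q, w x * ∫⁻ y in Q, G (x + t • (y - x)) ∂μ ∂μ := hswap
    _ ≤ A * ENNReal.ofReal d ^ 2 * ∫⁻ t in Ioo (0 : ℝ) 1, ENNReal.ofReal (t ^ (-b)) *
          (ENNReal.ofReal (d ^ (m - m / p)) * c ^ (1 - 1 / p) * W * D) := by
        exact mul_le_mul_right (setLIntegral_mono' measurableSet_Ioo hkey) _
    _ = A * ENNReal.ofReal d ^ 2 * (A *
          (ENNReal.ofReal (d ^ (m - m / p)) * c ^ (1 - 1 / p) * W * D)) := by
        have hTm' : Measurable fun t : ℝ => ENNReal.ofReal (t ^ (-b)) :=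
          (measurable_id.pow_const _).ennreal_ofReal
        rw [lintegral_mul_const _ hTm']
    _ = _ := by
        have e : d ^ ((m : ℝ) + (2 - m / p)) = d ^ 2 * d ^ ((m : ℝ) - m / p) := by
          rw [← Real.rpow_natCast, ← Real.rpow_add hd]
          congr 1
          push_cast
          ring
        rw [e, ENNReal.ofReal_mul (by positivity), ENNReal.ofReal_pow hd.le]
        ring

/-- Some value `c = u y` does at least as well as the average of `∫ w (u - u y)²` over `y ∈ Q`.
Comparing with a strict upper bound `K * μ Q` avoids dividing by `μ Q`. -/
theorem exists_lintegral_sub_sq_le {p : ℝ} (hp : 1 < p) (hpm : (Module.finrank ℝ E : ℝ) / 2 < p) :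
    ∃ C : ℝ≥0∞, C < ⊤ ∧ ∀ (Q Ω : Set E) (u : E → ℝ) (w : E → ℝ≥0∞) (d : ℝ), Convex ℝ Q →
      MeasurableSet Q → IsOpen Ω → Q ⊆ Ω → ContDiffOn ℝ 1 u Ω →
      AEMeasurable w (μ.restrict Q) → 0 < d → (∀ x ∈ Q, ∀ y ∈ Q, ‖y - x‖ ≤ d) →
      ∀ K : ℝ≥0∞, C * ENNReal.ofReal (d ^ (Module.finrank ℝ E + (2 - Module.finrank ℝ E / p))) *
          (∫⁻ x in Q, w x ^ p ∂μ) ^ (1 / p) * ∫⁻ z in Q, ‖fderiv ℝ u z‖ₑ ^ 2 ∂μ < K * μ Q →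
      ∃ c : ℝ, ∫⁻ x in Q, w x * ‖u x - c‖ₑ ^ 2 ∂μ ≤ K := by
  obtain ⟨C, hC, h⟩ := exists_poincare_const μ hp hpm
  refine ⟨C, hC, fun Q Ω u w d hQ hQm hΩ hQΩ hu hw hd hQd K hK => ?_⟩
  have hww : w =ᵐ[μ.restrict Q] hw.mk w := hw.ae_eq_mk
  have e1 : ∀ c : ℝ, ∫⁻ x in Q, w x * ‖u x - c‖ₑ ^ 2 ∂μ =
      ∫⁻ x in Q, hw.mk w x * ‖u x - c‖ₑ ^ 2 ∂μ := fun c =>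
    lintegral_congr_ae (hww.mono fun x hx => by simp only [hx])
  have e2 : ∫⁻ x in Q, w x ^ p ∂μ = ∫⁻ x in Q, hw.mk w x ^ p ∂μ :=
    lintegral_congr_ae (hww.mono fun x hx => by simp only [hx])
  have h1 := h Q Ω u (hw.mk w) d hQ hQm hΩ hQΩ hu hw.measurable_mk hd hQd
  rw [← e2] at h1
  by_contra! hcon
  have h2 : K * μ Q ≤ ∫⁻ y in Q, ∫⁻ x in Q, hw.mk w x * ‖u x - u y‖ₑ ^ 2 ∂μ ∂μ := by
    rw [← setLIntegral_const]
    refine lintegral_mono fun y => ?_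
    rw [← e1]
    exact (hcon (u y)).le
  exact absurd (h2.trans h1) (not_le.mpr hK)

end Poincare

/-- The second moment is controlled by the mean and the second moment about any constant. -/
theorem integral_sq_le_add_sq_integral {α : Type*} [MeasurableSpace α] {ν : Measure α}
    [IsFiniteMeasure ν] {u : α → ℝ} (hu : MemLp u 2 ν) (c : ℝ) :
    ∫ x, u x ^ 2 ∂ν ≤ ∫ x, (u x - c) ^ 2 ∂ν + (∫ x, u x ∂ν) ^ 2 / ν.real univ := by
  have hu1 : Integrable u ν := hu.integrable (by norm_num)
  have hu2 : Integrable (fun x => u x ^ 2) ν := hu.integrable_sq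
  have e : ∫ x, (u x - c) ^ 2 ∂ν =
      ∫ x, u x ^ 2 ∂ν - 2 * c * ∫ x, u x ∂ν + c ^ 2 * ν.real univ := by
    have : ∀ x, (u x - c) ^ 2 = (u x ^ 2 - 2 * c * u x) + c ^ 2 := fun x => by ring
    simp_rw [this]
    have hu3 : Integrable (fun x => u x ^ 2 - 2 * c * u x) ν := hu2.sub (hu1.const_mul _)
    rw [integral_add hu3 (integrable_const _), integral_sub hu2 (hu1.const_mul _), integral_const_mul, integral_const, smul_eq_mul]
    ring
  rw [e]
  rcases eq_or_ne (ν.real univ) 0 with h0 | h0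
  · have : ν = 0 := by
      rw [← Measure.measure_univ_eq_zero]
      exact (measureReal_eq_zero_iff).mp h0
    simp [this]
  · have hpos : 0 < ν.real univ := lt_of_le_of_ne measureReal_nonneg h0.symm
    -- Completing the square in `c`: the second moment about `c` exceeds the minimal one by this
    -- quantity.
    have : 0 ≤ (c * ν.real univ - ∫ x, u x ∂ν) ^ 2 / ν.real univ := by positivity
    have e2 : (c * ν.real univ - ∫ x, u x ∂ν) ^ 2 / ν.real univ = c ^ 2 * ν.real univ -
        2 * c * ∫ x, u x ∂ν + (∫ x, u x ∂ν) ^ 2 / ν.real univ := by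
      field_simp
      ring
    linarith

/-! ### The metric in a chart -/

section Bilinear

variable {m : ℕ}

/-- The standard basis of the model space. -/
def stdVec (i : Fin m) : EuclideanSpace ℝ (Fin m) := EuclideanSpace.single i (1 : ℝ)

theorem sum_smul_stdVec (v : EuclideanSpace ℝ (Fin m)) : ∑ i, v i • stdVec i = v := by
  ext j
  simp [stdVec, Finset.sum_apply, Pi.single_apply]

/-- The matrix of a bilinear form. -/
def bilinMatrix (B : EuclideanSpace ℝ (Fin m) →L[ℝ] EuclideanSpace ℝ (Fin m) →L[ℝ] ℝ) :
    Matrix (Fin m) (Fin m) ℝ := Matrix.of fun i j => B (stdVec i) (stdVec j)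

theorem bilin_eq_sum (B : EuclideanSpace ℝ (Fin m) →L[ℝ] EuclideanSpace ℝ (Fin m) →L[ℝ] ℝ)
    (v w : EuclideanSpace ℝ (Fin m)) :
    B v w = ∑ i, ∑ j, v i * w j * bilinMatrix B i j := by
  conv_lhs => rw [← sum_smul_stdVec v, ← sum_smul_stdVec w]
  simp only [map_sum, map_smul, sum_apply, smul_apply, smul_eq_mul, bilinMatrix, Matrix.of_apply,
    Finset.mul_sum]
  rw [Finset.sum_comm]
  refine Finset.sum_congr rfl fun i _ => Finset.sum_congr rfl fun j _ => ?_
  ring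

/-- The pullback of a bilinear form. -/
def pullBilin (B : EuclideanSpace ℝ (Fin m) →L[ℝ] EuclideanSpace ℝ (Fin m) →L[ℝ] ℝ)
    (L : EuclideanSpace ℝ (Fin m) →L[ℝ] EuclideanSpace ℝ (Fin m)) :
    EuclideanSpace ℝ (Fin m) →L[ℝ] EuclideanSpace ℝ (Fin m) →L[ℝ] ℝ := B.bilinearComp L L

theorem pullBilin_apply (B : EuclideanSpace ℝ (Fin m) →L[ℝ] EuclideanSpace ℝ (Fin m) →L[ℝ] ℝ)
    (L : EuclideanSpace ℝ (Fin m) →L[ℝ] EuclideanSpace ℝ (Fin m)) (v w) :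
    pullBilin B L v w = B (L v) (L w) := rfl

theorem bilinMatrix_pull
    (B : EuclideanSpace ℝ (Fin m) →L[ℝ] EuclideanSpace ℝ (Fin m) →L[ℝ] ℝ)
    (L : EuclideanSpace ℝ (Fin m) →L[ℝ] EuclideanSpace ℝ (Fin m)) (J : Matrix (Fin m) (Fin m) ℝ)
    (hJ : ∀ i j, J i j = L (stdVec j) i) :
    bilinMatrix (pullBilin B L) = J.transpose * bilinMatrix B * J := by
  ext i j
  rw [bilinMatrix, Matrix.of_apply, pullBilin_apply, bilin_eq_sum B]
  simp only [Matrix.mul_apply, Matrix.transpose_apply, hJ, Finset.sum_mul]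
  rw [Finset.sum_comm]
  refine Finset.sum_congr rfl fun k _ => Finset.sum_congr rfl fun l _ => ?_
  ring

theorem exists_matrix_det_eq (L : EuclideanSpace ℝ (Fin m) →L[ℝ] EuclideanSpace ℝ (Fin m)) :
    ∃ J : Matrix (Fin m) (Fin m) ℝ, (∀ i j, J i j = L (stdVec j) i) ∧ J.det = L.det := by
  refine ⟨LinearMap.toMatrix (EuclideanSpace.basisFun (Fin m) ℝ).toBasis
    (EuclideanSpace.basisFun (Fin m) ℝ).toBasis
      (L : EuclideanSpace ℝ (Fin m) →ₗ[ℝ] EuclideanSpace ℝ (Fin m)), fun i j => ?_, ?_⟩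
  · simp [LinearMap.toMatrix_apply, stdVec]
  · rw [LinearMap.det_toMatrix, ContinuousLinearMap.det]

theorem det_bilinMatrix_pull
    (B : EuclideanSpace ℝ (Fin m) →L[ℝ] EuclideanSpace ℝ (Fin m) →L[ℝ] ℝ)
    (L : EuclideanSpace ℝ (Fin m) →L[ℝ] EuclideanSpace ℝ (Fin m)) :
    (bilinMatrix (pullBilin B L)).det = L.det ^ 2 * (bilinMatrix B).det := by
  obtain ⟨J, hJ, hdet⟩ := exists_matrix_det_eq L
  rw [bilinMatrix_pull B L J hJ, Matrix.det_mul, Matrix.det_mul, Matrix.det_transpose, hdet]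
  ring

theorem dotProduct_bilinMatrix_mulVec
    (B : EuclideanSpace ℝ (Fin m) →L[ℝ] EuclideanSpace ℝ (Fin m) →L[ℝ] ℝ) (x y : Fin m → ℝ) :
    x ⬝ᵥ (bilinMatrix B).mulVec y = B (WithLp.toLp 2 x) (WithLp.toLp 2 y) := by
  rw [bilin_eq_sum]
  simp only [dotProduct, Matrix.mulVec, Finset.mul_sum]
  refine Finset.sum_congr rfl fun i _ => Finset.sum_congr rfl fun j _ => ?_
  ring

theorem posDef_bilinMatrix
    (B : EuclideanSpace ℝ (Fin m) →L[ℝ] EuclideanSpace ℝ (Fin m) →L[ℝ] ℝ)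
    (hs : ∀ v w, B v w = B w v) (hp : ∀ v, v ≠ 0 → 0 < B v v) : (bilinMatrix B).PosDef := by
  refine Matrix.PosDef.of_dotProduct_mulVec_pos ?_ fun x hx => ?_
  · ext i j
    simp only [bilinMatrix, Matrix.conjTranspose_apply, Matrix.of_apply, star_trivial]
    exact hs _ _
  rw [star_trivial, dotProduct_bilinMatrix_mulVec]
  refine hp _ fun h => hx ?_
  ext i
  exact congrFun (congrArg WithLp.ofLp h) i

/-- The vector dual to a linear form with respect to a bilinear form. -/
def gradAt (B : EuclideanSpace ℝ (Fin m) →L[ℝ] EuclideanSpace ℝ (Fin m) →L[ℝ] ℝ)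
    (l : EuclideanSpace ℝ (Fin m) →L[ℝ] ℝ) : EuclideanSpace ℝ (Fin m) :=
  WithLp.toLp 2 ((bilinMatrix B)⁻¹.mulVec fun i => l (stdVec i))

theorem linearForm_eq_sum (l : EuclideanSpace ℝ (Fin m) →L[ℝ] ℝ) (v : EuclideanSpace ℝ (Fin m)) :
    l v = ∑ i, v i * l (stdVec i) := by
  conv_lhs => rw [← sum_smul_stdVec v]
  simp

theorem bilin_gradAt (B : EuclideanSpace ℝ (Fin m) →L[ℝ] EuclideanSpace ℝ (Fin m) →L[ℝ] ℝ)
    (hs : ∀ v w, B v w = B w v) (hp : ∀ v, v ≠ 0 → 0 < B v v)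
    (l : EuclideanSpace ℝ (Fin m) →L[ℝ] ℝ) (w : EuclideanSpace ℝ (Fin m)) :
    B (gradAt B l) w = l w := by
  have h := dotProduct_bilinMatrix_mulVec B (fun i => w i)
    ((bilinMatrix B)⁻¹.mulVec fun i => l (stdVec i))
  rw [Matrix.mulVec_mulVec, Matrix.mul_nonsing_inv _
    (isUnit_iff_ne_zero.2 (posDef_bilinMatrix B hs hp).det_pos.ne'), Matrix.one_mulVec] at h
  rw [hs, linearForm_eq_sum l]
  exact h.symm

end Bilinear

/-! ### Charts of the maximal atlas, transition maps, and the metric read in a chart. -/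

section Chart

variable {m : ℕ} {X : Type*} [TopologicalSpace X]

theorem isOpen_transition_source
    {e e' : OpenPartialHomeomorph X (EuclideanSpace ℝ (Fin m))} : IsOpen (e.target ∩ e.symm ⁻¹' e'.source) :=
  e.isOpen_inter_preimage_symm e'.open_source

variable [ChartedSpace (EuclideanSpace ℝ (Fin m)) X]

/-- The differential of the inverse of the chart `e`, with the tangent spaces of `X` identified with
the model space. -/
def chartD (e : OpenPartialHomeomorph X (EuclideanSpace ℝ (Fin m)))
    (y : EuclideanSpace ℝ (Fin m)) : EuclideanSpace ℝ (Fin m) →L[ℝ] EuclideanSpace ℝ (Fin m) :=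
  mfderiv (𝓡 m) (𝓡 m) e.symm y

/-- The differential of the chart `e`. -/
def chartDInv (e : OpenPartialHomeomorph X (EuclideanSpace ℝ (Fin m)))
    (p : X) : EuclideanSpace ℝ (Fin m) →L[ℝ] EuclideanSpace ℝ (Fin m) :=
  mfderiv (𝓡 m) (𝓡 m) e p

variable {e e' : OpenPartialHomeomorph X (EuclideanSpace ℝ (Fin m))}

theorem chart_mdifferentiable (he : e ∈ IsManifold.maximalAtlas (𝓡 m) ∞ X) :
    e.MDifferentiable (𝓡 m) (𝓡 m) :=
  ⟨(contMDiffOn_of_mem_maximalAtlas he).mdifferentiableOn (by simp),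
    (contMDiffOn_symm_of_mem_maximalAtlas he).mdifferentiableOn (by simp)⟩

theorem contDiffOn_transition (he : e ∈ IsManifold.maximalAtlas (𝓡 m) ∞ X)
    (he' : e' ∈ IsManifold.maximalAtlas (𝓡 m) ∞ X) :
    ContDiffOn ℝ ∞ (fun y => e' (e.symm y)) (e.target ∩ e.symm ⁻¹' e'.source) := by
  rw [← contMDiffOn_iff_contDiffOn]
  exact (contMDiffOn_of_mem_maximalAtlas he').comp
    ((contMDiffOn_symm_of_mem_maximalAtlas he).mono inter_subset_left) fun y hy => hy.2

theorem chartDInv_chartD (he : e ∈ IsManifold.maximalAtlas (𝓡 m) ∞ X)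
    {y : EuclideanSpace ℝ (Fin m)} (hy : y ∈ e.target) (v : EuclideanSpace ℝ (Fin m)) :
    chartDInv e (e.symm y) (chartD e y v) = v :=
  DFunLike.congr_fun ((chart_mdifferentiable he).comp_symm_deriv hy) v

theorem chartD_chartDInv (he : e ∈ IsManifold.maximalAtlas (𝓡 m) ∞ X)
    {p : X} (hp : p ∈ e.source) (v : EuclideanSpace ℝ (Fin m)) :
    chartD e (e p) (chartDInv e p v) = v :=
  DFunLike.congr_fun ((chart_mdifferentiable he).symm_comp_deriv hp) v

theorem chartD_bijective (he : e ∈ IsManifold.maximalAtlas (𝓡 m) ∞ X)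
    {y : EuclideanSpace ℝ (Fin m)} (hy : y ∈ e.target) : Function.Bijective (chartD e y) := by
  refine ⟨fun v w h => ?_, fun v => ⟨chartDInv e (e.symm y) v, ?_⟩⟩
  · rw [← chartDInv_chartD he hy v, h, chartDInv_chartD he hy w]
  · have := chartD_chartDInv he (e.map_target hy) v
    rwa [e.right_inv hy] at this

theorem hasFDerivAt_transition (he : e ∈ IsManifold.maximalAtlas (𝓡 m) ∞ X)
    (he' : e' ∈ IsManifold.maximalAtlas (𝓡 m) ∞ X) {y : EuclideanSpace ℝ (Fin m)}
    (hy : y ∈ e.target) (hy' : e.symm y ∈ e'.source) :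
    HasFDerivAt (fun y => e' (e.symm y)) (fderiv ℝ (fun y => e' (e.symm y)) y) y :=
  (((contDiffOn_transition he he').differentiableOn (by simp)).differentiableAt
    (isOpen_transition_source.mem_nhds ⟨hy, hy'⟩)).hasFDerivAt

theorem chartD_eq_comp (he : e ∈ IsManifold.maximalAtlas (𝓡 m) ∞ X)
    (he' : e' ∈ IsManifold.maximalAtlas (𝓡 m) ∞ X) {y : EuclideanSpace ℝ (Fin m)}
    (hy : y ∈ e.target) (hy' : e.symm y ∈ e'.source) :
    chartD e y = (chartD e' (e' (e.symm y))).comp (fderiv ℝ (fun y => e' (e.symm y)) y) := by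
  have h1 : e.symm =ᶠ[𝓝 y] e'.symm ∘ fun y => e' (e.symm y) := by
    filter_upwards [isOpen_transition_source.mem_nhds ⟨hy, hy'⟩] with z hz
    exact (e'.left_inv hz.2).symm
  have h2 : MDifferentiableAt (𝓡 m) (𝓡 m) e'.symm (e' (e.symm y)) :=
    (chart_mdifferentiable he').mdifferentiableAt_symm (e'.map_source hy')
  have h3 : MDifferentiableAt (𝓡 m) (𝓡 m) (fun y => e' (e.symm y)) y :=
    (hasFDerivAt_transition he he' hy hy').differentiableAt.mdifferentiableAt
  have h4 := mfderiv_comp y h2 h3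
  rw [mfderiv_eq_fderiv] at h4
  unfold chartD
  rw [h1.mfderiv_eq]
  exact h4

variable [IsManifold (𝓡 m) ∞ X]

/-- The inner product at `p`, with the tangent space of `X` identified with the model space. -/
def metr (g : RMetric m X) (p : X) :
    EuclideanSpace ℝ (Fin m) →L[ℝ] EuclideanSpace ℝ (Fin m) →L[ℝ] ℝ := g.inner p

theorem metr_symm (g : RMetric m X) (p : X) (v w : EuclideanSpace ℝ (Fin m)) :
    metr g p v w = metr g p w v := g.symm p v w

theorem metr_pos (g : RMetric m X) (p : X) {v : EuclideanSpace ℝ (Fin m)} (hv : v ≠ 0) :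
    0 < metr g p v v := g.pos p v hv

theorem metr_nonneg (g : RMetric m X) (p : X) (v : EuclideanSpace ℝ (Fin m)) :
    0 ≤ metr g p v v := by
  by_cases hv : v = 0
  · simp [hv]
  · exact (metr_pos g p hv).le

theorem metr_add_self (g : RMetric m X) (p : X) (v w : EuclideanSpace ℝ (Fin m)) :
    metr g p (v + w) (v + w) = metr g p v v + 2 * metr g p v w + metr g p w w := by
  simp only [map_add, add_apply]
  rw [metr_symm g p w v]
  ring

theorem metr_cauchy_schwarz (g : RMetric m X) (p : X) (v w : EuclideanSpace ℝ (Fin m)) :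
    metr g p v w ^ 2 ≤ metr g p v v * metr g p w w := by
  by_cases hw : w = 0
  · simp [hw]
  have hpos := metr_pos g p hw
  have h := metr_nonneg g p (metr g p w w • v - metr g p v w • w)
  simp only [map_sub, map_smul, sub_apply, smul_apply, smul_eq_mul] at h
  rw [metr_symm g p w v] at h
  have : 0 ≤ metr g p w w * (metr g p v v * metr g p w w - metr g p v w ^ 2) := by linarith
  have := nonneg_of_mul_nonneg_right this hpos
  linarith

/-- The metric in the chart `e`, as a bilinear form on the model space. -/
def metrIn (g : RMetric m X) (e : OpenPartialHomeomorph X (EuclideanSpace ℝ (Fin m)))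
    (y : EuclideanSpace ℝ (Fin m)) :
    EuclideanSpace ℝ (Fin m) →L[ℝ] EuclideanSpace ℝ (Fin m) →L[ℝ] ℝ :=
  pullBilin (metr g (e.symm y)) (chartD e y)

theorem metrIn_apply (g : RMetric m X) (e : OpenPartialHomeomorph X (EuclideanSpace ℝ (Fin m)))
    (y v w : EuclideanSpace ℝ (Fin m)) :
    metrIn g e y v w = metr g (e.symm y) (chartD e y v) (chartD e y w) := rfl

/-- The Gram matrix in the chart `e`. -/
def gramIn (g : RMetric m X) (e : OpenPartialHomeomorph X (EuclideanSpace ℝ (Fin m)))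
    (y : EuclideanSpace ℝ (Fin m)) : Matrix (Fin m) (Fin m) ℝ := bilinMatrix (metrIn g e y)

/-- The volume density in the chart `e`. -/
def densIn (g : RMetric m X) (e : OpenPartialHomeomorph X (EuclideanSpace ℝ (Fin m)))
    (y : EuclideanSpace ℝ (Fin m)) : ℝ := √((gramIn g e y).det)

theorem metrIn_symm (g : RMetric m X) (e : OpenPartialHomeomorph X (EuclideanSpace ℝ (Fin m)))
    (y v w : EuclideanSpace ℝ (Fin m)) : metrIn g e y v w = metrIn g e y w v :=
  metr_symm _ _ _ _

theorem metrIn_pos (g : RMetric m X) (he : e ∈ IsManifold.maximalAtlas (𝓡 m) ∞ X)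
    {y : EuclideanSpace ℝ (Fin m)} (hy : y ∈ e.target) {v : EuclideanSpace ℝ (Fin m)}
    (hv : v ≠ 0) : 0 < metrIn g e y v v :=
  metr_pos _ _ fun h => hv ((chartD_bijective he hy).1 (h.trans (map_zero _).symm))

theorem posDef_gramIn (g : RMetric m X) (he : e ∈ IsManifold.maximalAtlas (𝓡 m) ∞ X)
    {y : EuclideanSpace ℝ (Fin m)} (hy : y ∈ e.target) : (gramIn g e y).PosDef :=
  posDef_bilinMatrix _ (metrIn_symm g e y) fun _ => metrIn_pos g he hy

theorem det_gramIn_pos (g : RMetric m X) (he : e ∈ IsManifold.maximalAtlas (𝓡 m) ∞ X)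
    {y : EuclideanSpace ℝ (Fin m)} (hy : y ∈ e.target) : 0 < (gramIn g e y).det :=
  (posDef_gramIn g he hy).det_pos

theorem densIn_pos (g : RMetric m X) (he : e ∈ IsManifold.maximalAtlas (𝓡 m) ∞ X)
    {y : EuclideanSpace ℝ (Fin m)} (hy : y ∈ e.target) : 0 < densIn g e y :=
  Real.sqrt_pos.mpr (det_gramIn_pos g he hy)

/-- A change of coordinates with Jacobian `L` multiplies the Gram determinant by `det L ^ 2`. The
resulting factor `|det L|` is the one in the change of variables formula. -/
theorem densIn_transition (g : RMetric m X) (he : e ∈ IsManifold.maximalAtlas (𝓡 m) ∞ X)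
    (he' : e' ∈ IsManifold.maximalAtlas (𝓡 m) ∞ X) {y : EuclideanSpace ℝ (Fin m)}
    (hy : y ∈ e.target) (hy' : e.symm y ∈ e'.source) :
    densIn g e y = |(fderiv ℝ (fun y => e' (e.symm y)) y).det| * densIn g e' (e' (e.symm y)) := by
  have h : metrIn g e y = pullBilin (metrIn g e' (e' (e.symm y)))
      (fderiv ℝ (fun y => e' (e.symm y)) y) := by
    ext v w
    rw [pullBilin_apply, metrIn_apply, metrIn_apply, chartD_eq_comp he he' hy hy',
      e'.left_inv hy']
    rfl
  rw [densIn, gramIn, h, det_bilinMatrix_pull, Real.sqrt_mul (sq_nonneg _), Real.sqrt_sq_eq_abs]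
  rfl

theorem contMDiffOn_chartD (he : e ∈ IsManifold.maximalAtlas (𝓡 m) ∞ X)
    (v : EuclideanSpace ℝ (Fin m)) : ContMDiffOn (𝓡 m) ((𝓡 m).prod (𝓡 m)) ∞
      (fun y => (⟨e.symm y, chartD e y v⟩ : TangentBundle (𝓡 m) X)) e.target := by
  have hs := contMDiffOn_symm_of_mem_maximalAtlas he
  have h1 := hs.contMDiffOn_tangentMapWithin (m := ∞) (by simp) e.open_target.uniqueMDiffOn
  have h2 : ContMDiffOn (𝓡 m) ((𝓡 m).prod (𝓡 m)) ∞
      (fun y => (⟨y, v⟩ : TangentBundle (𝓡 m) (EuclideanSpace ℝ (Fin m)))) e.target :=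
    contMDiffOn_vectorSpace_iff_contDiffOn.2 contDiffOn_const
  refine (h1.comp h2 fun y hy => hy).congr fun y hy => ?_
  simp only [Function.comp_apply, tangentMapWithin]
  rw [mfderivWithin_of_isOpen e.open_target hy]
  rfl

theorem contDiffOn_metrIn (g : RMetric m X) (he : e ∈ IsManifold.maximalAtlas (𝓡 m) ∞ X)
    (v w : EuclideanSpace ℝ (Fin m)) :
    ContDiffOn ℝ ∞ (fun y => metrIn g e y v w) e.target := by
  rw [← contMDiffOn_iff_contDiffOn]
  intro y hy
  have hb := contMDiffOn_symm_of_mem_maximalAtlas he y hy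
  have : ContMDiffWithinAt (𝓡 m) ((𝓡 m).prod 𝓘(ℝ)) ∞
      (fun y ↦ Bundle.TotalSpace.mk' ℝ (E := Bundle.Trivial X ℝ) (e.symm y)
        (g.inner (e.symm y) (chartD e y v) (chartD e y w))) e.target y := by
    apply ContMDiffWithinAt.clm_bundle_apply₂ (F₁ := EuclideanSpace ℝ (Fin m))
      (F₂ := EuclideanSpace ℝ (Fin m))
    · exact ContMDiffAt.comp_contMDiffWithinAt y g.contMDiff.contMDiffAt hb
    · exact contMDiffOn_chartD he v y hy
    · exact contMDiffOn_chartD he w y hy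
  simp only [Bundle.contMDiffWithinAt_totalSpace] at this
  exact this.2

theorem contDiffOn_gramIn (g : RMetric m X) (he : e ∈ IsManifold.maximalAtlas (𝓡 m) ∞ X)
    (i j : Fin m) : ContDiffOn ℝ ∞ (fun y => gramIn g e y i j) e.target :=
  contDiffOn_metrIn g he _ _

theorem contDiffOn_densIn (g : RMetric m X) (he : e ∈ IsManifold.maximalAtlas (𝓡 m) ∞ X) :
    ContDiffOn ℝ ∞ (densIn g e) e.target := by
  refine ContDiffOn.sqrt ?_ fun y hy => (det_gramIn_pos g he hy).ne'
  simp only [Matrix.det_apply]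
  exact ContDiffOn.sum fun σ _ => (contDiffOn_prod fun i _ => contDiffOn_gramIn g he _ _).const_smul _

theorem contDiffOn_inv_gramIn (g : RMetric m X) (he : e ∈ IsManifold.maximalAtlas (𝓡 m) ∞ X)
    (i j : Fin m) : ContDiffOn ℝ ∞ (fun y => (gramIn g e y)⁻¹ i j) e.target := by
  simp only [Matrix.inv_def, Matrix.smul_apply, Ring.inverse_eq_inv', smul_eq_mul]
  refine ContDiffOn.mul (ContDiffOn.inv ?_ fun y hy => (det_gramIn_pos g he hy).ne') ?_
  · simp only [Matrix.det_apply]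
    exact ContDiffOn.sum fun σ _ =>
      (contDiffOn_prod fun i _ => contDiffOn_gramIn g he _ _).const_smul _
  · simp only [Matrix.adjugate_apply, Matrix.det_apply]
    refine ContDiffOn.sum fun σ _ => (contDiffOn_prod fun k _ => ?_).const_smul _
    simp only [Matrix.updateRow_apply]
    split_ifs
    · exact contDiffOn_const
    · exact contDiffOn_gramIn g he _ _

end Chart

/-! ### The Riemannian volume in a chart -/

section Volume

variable {m : ℕ} {X : Type*} [TopologicalSpace X] [ChartedSpace (EuclideanSpace ℝ (Fin m)) X]
  [IsManifold (𝓡 m) ∞ X]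

local notation "𝔼" => EuclideanSpace ℝ (Fin m)

variable {e e' : OpenPartialHomeomorph X (EuclideanSpace ℝ (Fin m))}

/-- The measure `√ det gᵢⱼ dy` on the target of the chart `e`. -/
def densMeasure (g : RMetric m X) (e : OpenPartialHomeomorph X 𝔼) : Measure 𝔼 :=
  (volume.restrict e.target).withDensity (fun y => ENNReal.ofReal (densIn g e y))

theorem aemeasurable_densIn (g : RMetric m X) (he : e ∈ IsManifold.maximalAtlas (𝓡 m) ∞ X) :
    AEMeasurable (fun y => ENNReal.ofReal (densIn g e y)) (volume.restrict e.target) :=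
  ((contDiffOn_densIn g he).continuousOn.aemeasurable e.open_target.measurableSet).ennreal_ofReal

theorem densMeasure_absolutelyContinuous (g : RMetric m X)
    (e : OpenPartialHomeomorph X 𝔼) : densMeasure g e ≪ volume.restrict e.target :=
  withDensity_absolutelyContinuous _ _

theorem absolutelyContinuous_densMeasure (g : RMetric m X)
    (he : e ∈ IsManifold.maximalAtlas (𝓡 m) ∞ X) :
    volume.restrict e.target ≪ densMeasure g e := by
  refine withDensity_absolutelyContinuous' (aemeasurable_densIn g he) ?_
  filter_upwards [ae_restrict_mem e.open_target.measurableSet] with y hy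
  simpa using densIn_pos g he hy

variable [MeasurableSpace X] [BorelSpace X]

theorem aemeasurable_symm (g : RMetric m X) (e : OpenPartialHomeomorph X 𝔼) :
    AEMeasurable e.symm (densMeasure g e) :=
  (e.continuousOn_symm.aemeasurable e.open_target.measurableSet).mono_ac
    (densMeasure_absolutelyContinuous g e)

/-- The volume on the source of the chart `e`. -/
def chartVol (g : RMetric m X) (e : OpenPartialHomeomorph X 𝔼) : Measure X :=
  (densMeasure g e).map e.symm

theorem chartVolume_eq_chartVol (g : RMetric m X) (c : X) :
    chartVolume g c = chartVol g (chartAt _ c) := rfl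

theorem chartVol_apply (g : RMetric m X) (e : OpenPartialHomeomorph X 𝔼)
    {A : Set X} (hA : MeasurableSet A) :
    chartVol g e A = ∫⁻ y in e.symm ⁻¹' A ∩ e.target, ENNReal.ofReal (densIn g e y) := by
  rw [chartVol, Measure.map_apply_of_aemeasurable (aemeasurable_symm g e) hA, densMeasure,
    withDensity_apply', Measure.restrict_restrict' e.open_target.measurableSet]

theorem measurableSet_preimage_symm (e : OpenPartialHomeomorph X 𝔼) {A : Set X}
    (hA : MeasurableSet A) : MeasurableSet (e.symm ⁻¹' A ∩ e.target) := by
  have := e.continuousOn_symm.domRestrict.measurable hA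
  have h2 := (MeasurableEmbedding.subtype_coe e.open_target.measurableSet).measurableSet_image.2 this
  convert h2 using 1
  ext y
  simp [and_comm]

theorem measurableSet_preimage_source (e : OpenPartialHomeomorph X 𝔼) {Q : Set 𝔼}
    (hQ : MeasurableSet Q) : MeasurableSet (e ⁻¹' Q ∩ e.source) := by
  have := e.continuousOn.domRestrict.measurable hQ
  have h2 := (MeasurableEmbedding.subtype_coe e.open_source.measurableSet).measurableSet_image.2 this
  convert h2 using 1
  ext y
  simp [and_comm]

/-- Change of variables under the transition map, whose Jacobian is absorbed by `densIn_transition`.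
-/
theorem chartVol_apply_eq (g : RMetric m X) (he : e ∈ IsManifold.maximalAtlas (𝓡 m) ∞ X)
    (he' : e' ∈ IsManifold.maximalAtlas (𝓡 m) ∞ X) {A : Set X} (hA : MeasurableSet A)
    (h : A ⊆ e.source) (h' : A ⊆ e'.source) : chartVol g e A = chartVol g e' A := by
  rw [chartVol_apply g e hA, chartVol_apply g e' hA]
  have himg : (fun y => e' (e.symm y)) '' (e.symm ⁻¹' A ∩ e.target) =
      e'.symm ⁻¹' A ∩ e'.target := by
    ext z
    constructor
    · rintro ⟨y, ⟨hy, hyt⟩, rfl⟩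
      refine ⟨?_, e'.map_source (h' hy)⟩
      simpa [e'.left_inv (h' hy)] using hy
    · rintro ⟨hz, hzt⟩
      refine ⟨e (e'.symm z), ⟨?_, e.map_source (h hz)⟩, ?_⟩
      · simpa [e.left_inv (h hz)] using hz
      · simp [e.left_inv (h hz), e'.right_inv hzt]
  rw [← himg, lintegral_image_eq_lintegral_abs_det_fderiv_mul volume
    (f' := fun y => fderiv ℝ (fun y => e' (e.symm y)) y) (measurableSet_preimage_symm e hA)]
  · refine setLIntegral_congr_fun (measurableSet_preimage_symm e hA) fun y hy => ?_
    rw [densIn_transition g he he' hy.2 (h' hy.1), ENNReal.ofReal_mul (abs_nonneg _)]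
  · exact fun y hy => (hasFDerivAt_transition he he' hy.2 (h' hy.1)).hasFDerivWithinAt
  · intro y hy z hz hyz
    have := e'.injOn (h' hy.1) (h' hz.1) hyz
    exact e.symm.injOn hy.2 hz.2 this

theorem chartVol_compl_source (g : RMetric m X) (e : OpenPartialHomeomorph X 𝔼) :
    chartVol g e e.sourceᶜ = 0 := by
  rw [chartVol_apply g e e.open_source.measurableSet.compl]
  have : e.symm ⁻¹' e.sourceᶜ ∩ e.target = ∅ := by
    ext y
    simpa using fun h hy => h (e.map_target hy)
  rw [this]
  simp

theorem restrict_chartVol (g : RMetric m X) (e : OpenPartialHomeomorph X 𝔼) :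
    (chartVol g e).restrict e.source = chartVol g e :=
  Measure.restrict_eq_self_of_ae_mem (chartVol_compl_source g e)

theorem exists_seq_cover [Nonempty X] [SecondCountableTopology X] :
    ∃ c : ℕ → X, ⋃ n, (chartAt 𝔼 (c n)).source = univ := by
  obtain ⟨s, hs, hcov⟩ := TopologicalSpace.countable_cover_nhds
    (fun x : X => (chartAt 𝔼 x).open_source.mem_nhds (mem_chart_source 𝔼 x))
  have hne : s.Nonempty := by
    by_contra h
    rw [not_nonempty_iff_eq_empty] at h
    simp [h] at hcov
    exact (univ_nonempty (α := X)).ne_empty hcov.symm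
  obtain ⟨c, rfl⟩ := hs.exists_eq_range hne
  refine ⟨c, ?_⟩
  simpa using hcov

/-- A countable cover by chart domains, made disjoint, glues the chart volumes to a measure `ν` that
restricts to every chart volume. Thus `ν` dominates the supremum; conversely, each disjoint piece
lies in one chart domain, where `ν` is that chart's volume. -/
theorem riemVolume_restrict [SecondCountableTopology X] (g : RMetric m X)
    (he : e ∈ IsManifold.maximalAtlas (𝓡 m) ∞ X) :
    (riemVolume g).restrict e.source = chartVol g e := by
  rcases isEmpty_or_nonempty X with hX | hX
  · simp [Measure.eq_zero_of_isEmpty]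
  obtain ⟨c, hc⟩ := exists_seq_cover (m := m) (X := X)
  let S : ℕ → Set X := fun n => (chartAt 𝔼 (c n)).source
  have hSm : ∀ n, MeasurableSet (disjointed S n) := fun n =>
    MeasurableSet.disjointed (fun n => (chartAt 𝔼 (c n)).open_source.measurableSet) n
  have hSsub : ∀ n, disjointed S n ⊆ S n := disjointed_subset S
  have hSU : ⋃ n, disjointed S n = univ := by rw [iUnion_disjointed]; exact hc
  let ν : Measure X := Measure.sum fun n => (chartVol g (chartAt 𝔼 (c n))).restrict (disjointed S n)
  have key : ∀ e : OpenPartialHomeomorph X 𝔼, e ∈ IsManifold.maximalAtlas (𝓡 m) ∞ X →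
      ν.restrict e.source = chartVol g e := by
    intro e he
    ext A hA
    have hAe := hA.inter e.open_source.measurableSet
    rw [Measure.restrict_apply hA, Measure.sum_apply _ hAe, ← restrict_chartVol g e,
      Measure.restrict_apply hA]
    have h1 : ∀ n, (chartVol g (chartAt 𝔼 (c n))).restrict (disjointed S n) (A ∩ e.source) =
        chartVol g e (A ∩ e.source ∩ disjointed S n) := fun n => by
      rw [Measure.restrict_apply hAe]
      exact chartVol_apply_eq g (IsManifold.chart_mem_maximalAtlas _) he (hAe.inter (hSm n))
        (inter_subset_right.trans (hSsub n)) (inter_subset_left.trans inter_subset_right)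
    simp only [h1]
    rw [← measure_iUnion, ← inter_iUnion, hSU, inter_univ]
    · intro i j hij
      exact (disjoint_disjointed S hij).mono inter_subset_right inter_subset_right
    · exact fun n => hAe.inter (hSm n)
  have hν : riemVolume g = ν := by
    apply le_antisymm
    · refine iSup_le fun c => ?_
      rw [chartVolume_eq_chartVol, ← key _ (IsManifold.chart_mem_maximalAtlas _)]
      exact Measure.restrict_le_self
    · refine Measure.le_iff.2 fun A hA => ?_
      have h1 : ν = Measure.sum fun n => ν.restrict (disjointed S n) := by
        rw [← Measure.restrict_iUnion (fun i j hij => disjoint_disjointed S hij) hSm, hSU,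
          Measure.restrict_univ]
      have h2 : riemVolume g = Measure.sum fun n => (riemVolume g).restrict (disjointed S n) := by
        rw [← Measure.restrict_iUnion (fun i j hij => disjoint_disjointed S hij) hSm, hSU,
          Measure.restrict_univ]
      have h3 : ∀ n, ν.restrict (disjointed S n) ≤ (riemVolume g).restrict (disjointed S n) := by
        intro n
        rw [← inter_eq_left.2 (hSsub n), ← Measure.restrict_restrict (hSm n),
          ← Measure.restrict_restrict (hSm n), key _ (IsManifold.chart_mem_maximalAtlas _)]
        refine Measure.restrict_mono_measure ?_ _
        rw [← restrict_chartVol]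
        exact Measure.restrict_mono_measure (le_iSup (fun c => chartVolume g c) (c n)) _
      rw [h1, h2, Measure.sum_apply _ hA, Measure.sum_apply _ hA]
      exact ENNReal.tsum_le_tsum fun n => h3 n A
  rw [hν, key e he]

theorem map_chartVol (g : RMetric m X) (e : OpenPartialHomeomorph X 𝔼) :
    (chartVol g e).map e = densMeasure g e := by
  have h1 : AEMeasurable e (chartVol g e) := by
    rw [← restrict_chartVol]
    exact e.continuousOn.aemeasurable e.open_source.measurableSet
  rw [chartVol, AEMeasurable.map_map_of_aemeasurable h1 (aemeasurable_symm g e)]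
  conv_rhs => rw [← Measure.map_id (μ := densMeasure g e)]
  refine Measure.map_congr ?_
  filter_upwards [densMeasure_absolutelyContinuous g e
    (ae_restrict_mem e.open_target.measurableSet)] with y hy
  exact e.right_inv hy

theorem aemeasurable_chart (g : RMetric m X) (e : OpenPartialHomeomorph X 𝔼) :
    AEMeasurable e (chartVol g e) := by
  rw [← restrict_chartVol]
  exact e.continuousOn.aemeasurable e.open_source.measurableSet

/-- The density is positive in every chart, so Riemannian null sets are the Lebesgue null sets of
the coordinates. This and the following lemmas move almost everywhere statements, measurability and
integrals between the two. -/
theorem ae_source_of_ae_target [SecondCountableTopology X] (g : RMetric m X)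
    (he : e ∈ IsManifold.maximalAtlas (𝓡 m) ∞ X) {P : X → Prop}
    (h : ∀ᵐ y ∂volume.restrict e.target, P (e.symm y)) :
    ∀ᵐ x ∂(riemVolume g).restrict e.source, P x := by
  have h1 : ∀ᵐ y ∂(chartVol g e).map e, P (e.symm y) := by
    rw [map_chartVol]
    exact densMeasure_absolutelyContinuous g e h
  have h2 := ae_of_ae_map (aemeasurable_chart g e) h1
  rw [← riemVolume_restrict g he] at h2
  filter_upwards [h2, ae_restrict_mem e.open_source.measurableSet] with x hx hxs
  rwa [e.left_inv hxs] at hx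

theorem ae_target_of_ae_source [SecondCountableTopology X] (g : RMetric m X)
    (he : e ∈ IsManifold.maximalAtlas (𝓡 m) ∞ X) {P : X → Prop}
    (h : ∀ᵐ x ∂(riemVolume g).restrict e.source, P x) :
    ∀ᵐ y ∂volume.restrict e.target, P (e.symm y) := by
  rw [riemVolume_restrict g he, chartVol] at h
  exact absolutelyContinuous_densMeasure g he (ae_of_ae_map (aemeasurable_symm g e) h)

theorem ae_of_forall_chart [SecondCountableTopology X] (g : RMetric m X) {P : X → Prop}
    (h : ∀ c : X, ∀ᵐ y ∂volume.restrict (chartAt 𝔼 c).target, P ((chartAt 𝔼 c).symm y)) :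
    ∀ᵐ x ∂riemVolume g, P x := by
  rcases isEmpty_or_nonempty X with hX | hX
  · simp [Measure.eq_zero_of_isEmpty]
  obtain ⟨c, hc⟩ := exists_seq_cover (m := m) (X := X)
  rw [← Measure.restrict_univ (μ := riemVolume g), ← hc, ae_restrict_iUnion_iff]
  exact fun n => ae_source_of_ae_target g (IsManifold.chart_mem_maximalAtlas _) (h (c n))

theorem aemeasurable_comp_symm_of_source [SecondCountableTopology X] {β : Type*} [MeasurableSpace β]
    (g : RMetric m X)
    (he : e ∈ IsManifold.maximalAtlas (𝓡 m) ∞ X) {F : X → β}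
    (h : AEMeasurable F ((riemVolume g).restrict e.source)) :
    AEMeasurable (fun y => F (e.symm y)) (volume.restrict e.target) := by
  rw [riemVolume_restrict g he, chartVol] at h
  exact (h.comp_aemeasurable (aemeasurable_symm g e)).mono_ac (absolutelyContinuous_densMeasure g he)

theorem aemeasurable_source_of_comp_symm [SecondCountableTopology X] {β : Type*} [MeasurableSpace β]
    (g : RMetric m X) (he : e ∈ IsManifold.maximalAtlas (𝓡 m) ∞ X) {F : X → β}
    (h : AEMeasurable (fun y => F (e.symm y)) (volume.restrict e.target)) :
    AEMeasurable F ((riemVolume g).restrict e.source) := by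
  have h1 : AEMeasurable (fun y => F (e.symm y)) ((chartVol g e).map e) := by
    rw [map_chartVol]
    exact h.mono_ac (densMeasure_absolutelyContinuous g e)
  have h2 := h1.comp_aemeasurable (aemeasurable_chart g e)
  rw [← riemVolume_restrict g he] at h2
  refine h2.congr ?_
  filter_upwards [ae_restrict_mem e.open_source.measurableSet] with x hx
  simp [e.left_inv hx]

theorem aemeasurable_of_forall_chart [SecondCountableTopology X] {β : Type*} [MeasurableSpace β]
    (g : RMetric m X) {F : X → β}
    (h : ∀ c : X, AEMeasurable (fun y => F ((chartAt 𝔼 c).symm y))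
      (volume.restrict (chartAt 𝔼 c).target)) : AEMeasurable F (riemVolume g) := by
  rcases isEmpty_or_nonempty X with hX | hX
  · rw [Measure.eq_zero_of_isEmpty (riemVolume g)]
    exact ⟨F, measurable_of_empty F, by simp⟩
  obtain ⟨c, hc⟩ := exists_seq_cover (m := m) (X := X)
  rw [← Measure.restrict_univ (μ := riemVolume g), ← hc, aemeasurable_iUnion_iff]
  exact fun n => aemeasurable_source_of_comp_symm g (IsManifold.chart_mem_maximalAtlas _) (h (c n))

theorem lintegral_source [SecondCountableTopology X] (g : RMetric m X)
    (he : e ∈ IsManifold.maximalAtlas (𝓡 m) ∞ X) {F : X → ℝ≥0∞}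
    (hF : AEMeasurable F ((riemVolume g).restrict e.source)) :
    ∫⁻ x in e.source, F x ∂riemVolume g =
      ∫⁻ y in e.target, ENNReal.ofReal (densIn g e y) * F (e.symm y) := by
  have h := hF
  rw [riemVolume_restrict g he, chartVol] at h
  rw [riemVolume_restrict g he, chartVol, lintegral_map' h (aemeasurable_symm g e), densMeasure,
    lintegral_withDensity_eq_lintegral_mul₀ (aemeasurable_densIn g he)
      (aemeasurable_comp_symm_of_source g he hF)]
  rfl

theorem integral_source [SecondCountableTopology X] (g : RMetric m X)
    (he : e ∈ IsManifold.maximalAtlas (𝓡 m) ∞ X) {F : X → ℝ}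
    (hF : AEMeasurable F ((riemVolume g).restrict e.source)) :
    ∫ x in e.source, F x ∂riemVolume g = ∫ y in e.target, densIn g e y * F (e.symm y) := by
  have h := hF
  rw [riemVolume_restrict g he, chartVol] at h
  rw [riemVolume_restrict g he, chartVol, integral_map (aemeasurable_symm g e)
    h.aestronglyMeasurable, densMeasure,
    integral_withDensity_eq_integral_toReal_smul₀ (aemeasurable_densIn g he) (by simp)]
  refine setIntegral_congr_fun e.open_target.measurableSet fun y hy => ?_
  simp [ENNReal.toReal_ofReal (densIn_pos g he hy).le]

/-- The volume of a measurable part of a chart domain. -/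
theorem setLIntegral_chart [SecondCountableTopology X] (g : RMetric m X)
    (he : e ∈ IsManifold.maximalAtlas (𝓡 m) ∞ X) {F : X → ℝ≥0∞}
    (hF : AEMeasurable F ((riemVolume g).restrict e.source)) {Q : Set 𝔼} (hQ : MeasurableSet Q)
    (hQe : Q ⊆ e.target) :
    ∫⁻ x in e.source ∩ e ⁻¹' Q, F x ∂riemVolume g =
      ∫⁻ y in Q, ENNReal.ofReal (densIn g e y) * F (e.symm y) := by
  have hm : MeasurableSet (e.source ∩ e ⁻¹' Q) := by
    rw [inter_comm]; exact measurableSet_preimage_source e hQ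
  rw [← inter_eq_left.2 hQe, ← Measure.restrict_restrict hQ, ← lintegral_indicator hQ]
  have := lintegral_source g he (F := (e.source ∩ e ⁻¹' Q).indicator F) (hF.indicator hm)
  rw [lintegral_indicator hm, Measure.restrict_restrict hm, inter_right_comm, inter_self] at this
  rw [inter_eq_left.2 hQe, this]
  refine setLIntegral_congr_fun e.open_target.measurableSet fun y hy => ?_
  by_cases hyQ : y ∈ Q
  · simp [hyQ, e.map_target hy, e.right_inv hy]
  · simp [hyQ, e.right_inv hy]

theorem isLocallyFiniteMeasure_riemVolume [SecondCountableTopology X] (g : RMetric m X) :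
    IsLocallyFiniteMeasure (riemVolume g) := by
  refine ⟨fun x => ?_⟩
  let e := chartAt 𝔼 x
  have he : e ∈ IsManifold.maximalAtlas (𝓡 m) ∞ X := IsManifold.chart_mem_maximalAtlas _
  have hx : e x ∈ e.target := e.map_source (mem_chart_source 𝔼 x)
  have hc : ContinuousAt (densIn g e) (e x) :=
    (contDiffOn_densIn g he).continuousOn.continuousAt (e.open_target.mem_nhds hx)
  have h1 : ∀ᶠ y in 𝓝 (e x), densIn g e y < densIn g e (e x) + 1 :=
    hc.eventually_lt_const (by linarith)
  obtain ⟨r, hr, hr'⟩ := Metric.mem_nhds_iff.1 (inter_mem h1 (e.open_target.mem_nhds hx))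
  refine ⟨e.source ∩ e ⁻¹' Metric.ball (e x) r, (e.isOpen_inter_preimage Metric.isOpen_ball).mem_nhds
    ⟨mem_chart_source 𝔼 x, Metric.mem_ball_self hr⟩, ?_⟩
  have h2 := setLIntegral_chart g he (F := fun _ => 1) aemeasurable_const
    (Metric.isOpen_ball (x := e x) (ε := r)).measurableSet fun y hy => (hr' hy).2
  rw [setLIntegral_one] at h2
  rw [h2]
  calc _ ≤ ∫⁻ y in Metric.ball (e x) r, ENNReal.ofReal (densIn g e (e x) + 1) := by
        refine setLIntegral_mono measurable_const fun y hy => ?_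
        rw [mul_one]
        exact ENNReal.ofReal_le_ofReal (hr' hy).1.le
    _ < ⊤ := by
        rw [setLIntegral_const]
        exact ENNReal.mul_lt_top ENNReal.ofReal_lt_top measure_ball_lt_top

theorem isOpenPosMeasure_riemVolume [SecondCountableTopology X] (g : RMetric m X) :
    (riemVolume g).IsOpenPosMeasure := by
  refine ⟨fun U hU hne h0 => ?_⟩
  obtain ⟨x, hx⟩ := hne
  let e := chartAt 𝔼 x
  have he : e ∈ IsManifold.maximalAtlas (𝓡 m) ∞ X := IsManifold.chart_mem_maximalAtlas _
  have h1 : ∀ᵐ x ∂(riemVolume g).restrict e.source, x ∉ U :=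
    ae_restrict_of_ae (measure_eq_zero_iff_ae_notMem.1 h0)
  have h2 := ae_target_of_ae_source g he h1
  rw [ae_restrict_iff' e.open_target.measurableSet] at h2
  have h3 : volume (e.target ∩ e.symm ⁻¹' U) = 0 := by
    rw [measure_eq_zero_iff_ae_notMem]
    filter_upwards [h2] with y hy hy'
    exact hy hy'.1 hy'.2
  have hop : IsOpen (e.target ∩ e.symm ⁻¹' U) := e.isOpen_inter_preimage_symm hU
  refine (hop.measure_pos volume ⟨e x, e.map_source (mem_chart_source 𝔼 x), ?_⟩).ne' h3
  simpa [e.left_inv (mem_chart_source 𝔼 x)] using hx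

end Volume

/-! ### Gradients of smooth functions -/

section Gradient

variable {m : ℕ} {X : Type*} [TopologicalSpace X] [ChartedSpace (EuclideanSpace ℝ (Fin m)) X]

local notation "𝔼" => EuclideanSpace ℝ (Fin m)

variable {e e' : OpenPartialHomeomorph X (EuclideanSpace ℝ (Fin m))}

/-- The differential of a function, with the tangent space identified with the model space. -/
def diffAt (ψ : X → ℝ) (p : X) : 𝔼 →L[ℝ] ℝ := mfderiv (𝓡 m) 𝓘(ℝ, ℝ) ψ p

theorem diffAt_chartD (he : e ∈ IsManifold.maximalAtlas (𝓡 m) ∞ X) {ψ : X → ℝ}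
    {y : 𝔼} (hy : y ∈ e.target) (hψ : MDifferentiableAt (𝓡 m) 𝓘(ℝ, ℝ) ψ (e.symm y)) (v : 𝔼) :
    diffAt ψ (e.symm y) (chartD e y v) = fderiv ℝ (fun y => ψ (e.symm y)) y v := by
  have h2 : MDifferentiableAt (𝓡 m) (𝓡 m) e.symm y :=
    (chart_mdifferentiable he).mdifferentiableAt_symm hy
  have h4 := mfderiv_comp y hψ h2
  rw [mfderiv_eq_fderiv] at h4
  exact (DFunLike.congr_fun h4 v).symm

theorem contDiffOn_comp_symm (he : e ∈ IsManifold.maximalAtlas (𝓡 m) ∞ X) {ψ : X → ℝ}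
    (hψ : ContMDiffOn (𝓡 m) 𝓘(ℝ, ℝ) ∞ ψ e.source) :
    ContDiffOn ℝ ∞ (fun y => ψ (e.symm y)) e.target := by
  rw [← contMDiffOn_iff_contDiffOn]
  exact hψ.comp (contMDiffOn_symm_of_mem_maximalAtlas he) fun y hy => e.map_target hy

variable [IsManifold (𝓡 m) ∞ X]

/-- The gradient of a differentiable function. -/
def smoothGrad (g : RMetric m X) (ψ : X → ℝ) (p : X) : 𝔼 := gradAt (metr g p) (diffAt ψ p)

theorem metr_smoothGrad (g : RMetric m X) (ψ : X → ℝ) (p : X) (w : 𝔼) :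
    metr g p (smoothGrad g ψ p) w = diffAt ψ p w :=
  bilin_gradAt _ (metr_symm g p) (fun _ => metr_pos g p) _ _

theorem metr_ext (g : RMetric m X) (p : X) {v v' : 𝔼} (h : ∀ w, metr g p v w = metr g p v' w) :
    v = v' := by
  by_contra hne
  have := metr_pos g p (sub_ne_zero.2 hne)
  rw [(metr g p).map_sub, sub_apply, h, sub_self] at this
  exact this.ne rfl

/-- The inner product of the gradients of two functions. -/
def gradInner (g : RMetric m X) (ψ η : X → ℝ) (p : X) : ℝ :=
  metr g p (smoothGrad g ψ p) (smoothGrad g η p)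

/-- The inner product on the dual of the model space given by the metric in the chart `e`. -/
def cometrIn (g : RMetric m X) (e : OpenPartialHomeomorph X 𝔼) (y : 𝔼) (l l' : 𝔼 →L[ℝ] ℝ) : ℝ :=
  ∑ i, ∑ j, (gramIn g e y)⁻¹ i j * l (stdVec j) * l' (stdVec i)

theorem smoothGrad_chart (g : RMetric m X) (he : e ∈ IsManifold.maximalAtlas (𝓡 m) ∞ X)
    {ψ : X → ℝ} {y : 𝔼} (hy : y ∈ e.target)
    (hψ : MDifferentiableAt (𝓡 m) 𝓘(ℝ, ℝ) ψ (e.symm y)) :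
    smoothGrad g ψ (e.symm y) =
      chartD e y (gradAt (metrIn g e y) (fderiv ℝ (fun y => ψ (e.symm y)) y)) := by
  refine metr_ext g (e.symm y) fun w => ?_
  obtain ⟨w, rfl⟩ := (chartD_bijective he hy).2 w
  rw [metr_smoothGrad, diffAt_chartD he hy hψ, ← metrIn_apply,
    bilin_gradAt _ (metrIn_symm g e y) fun _ => metrIn_pos g he hy]

theorem gradInner_chart (g : RMetric m X) (he : e ∈ IsManifold.maximalAtlas (𝓡 m) ∞ X)
    {ψ η : X → ℝ} {y : 𝔼} (hy : y ∈ e.target)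
    (hψ : MDifferentiableAt (𝓡 m) 𝓘(ℝ, ℝ) ψ (e.symm y))
    (hη : MDifferentiableAt (𝓡 m) 𝓘(ℝ, ℝ) η (e.symm y)) :
    gradInner g ψ η (e.symm y) = cometrIn g e y (fderiv ℝ (fun y => ψ (e.symm y)) y)
      (fderiv ℝ (fun y => η (e.symm y)) y) := by
  rw [gradInner, metr_symm, metr_smoothGrad, smoothGrad_chart g he hy hψ, diffAt_chartD he hy hη,
    linearForm_eq_sum, cometrIn]
  simp only [gradAt, Matrix.mulVec, dotProduct, Finset.sum_mul]
  rfl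

theorem gradInner_comm (g : RMetric m X) (ψ η : X → ℝ) (p : X) :
    gradInner g ψ η p = gradInner g η ψ p := metr_symm _ _ _ _

theorem contDiffOn_fderiv_apply {U : Set 𝔼} (hU : IsOpen U) {F : 𝔼 → ℝ} (hF : ContDiffOn ℝ ∞ F U)
    (v : 𝔼) : ContDiffOn ℝ ∞ (fun y => fderiv ℝ F y v) U :=
  ((hF.fderiv_of_isOpen (m := ∞) hU (by simp)).clm_apply contDiffOn_const)

theorem continuous_gradInner (g : RMetric m X) {ψ η : X → ℝ}
    (hψ : ContMDiff (𝓡 m) 𝓘(ℝ, ℝ) ∞ ψ) (hη : ContMDiff (𝓡 m) 𝓘(ℝ, ℝ) ∞ η) :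
    Continuous (gradInner g ψ η) := by
  rw [continuous_iff_continuousAt]
  intro x
  let e := chartAt 𝔼 x
  have he : e ∈ IsManifold.maximalAtlas (𝓡 m) ∞ X := IsManifold.chart_mem_maximalAtlas _
  have h1 : ContinuousOn (fun y => cometrIn g e y (fderiv ℝ (fun y => ψ (e.symm y)) y)
      (fderiv ℝ (fun y => η (e.symm y)) y)) e.target := by
    unfold cometrIn
    refine continuousOn_finsetSum _ fun i _ => continuousOn_finsetSum _ fun j _ => ?_
    exact ((contDiffOn_inv_gramIn g he i j).continuousOn.mul
      (contDiffOn_fderiv_apply e.open_target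
        (contDiffOn_comp_symm he hψ.contMDiffOn) _).continuousOn).mul
      (contDiffOn_fderiv_apply e.open_target
        (contDiffOn_comp_symm he hη.contMDiffOn) _).continuousOn
  have h2 := h1.comp e.continuousOn fun x hx => e.map_source hx
  refine ((h2.continuousAt (e.open_source.mem_nhds (mem_chart_source 𝔼 x))).congr ?_)
  filter_upwards [e.open_source.mem_nhds (mem_chart_source 𝔼 x)] with z hz
  simp only [Function.comp_apply]
  rw [← gradInner_chart g he (e.map_source hz) (hψ.mdifferentiableAt (by simp))
    (hη.mdifferentiableAt (by simp)), e.left_inv hz]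

theorem diffAt_eq_zero {ψ : X → ℝ} {p : X} (hp : p ∉ tsupport ψ) : (diffAt ψ p : 𝔼 →L[ℝ] ℝ) = 0 := by
  have h : ψ =ᶠ[𝓝 p] fun _ => (0 : ℝ) := notMem_tsupport_iff_eventuallyEq.1 hp
  unfold diffAt
  rw [h.mfderiv_eq]
  exact mfderiv_const

theorem smoothGrad_eq_zero (g : RMetric m X) {ψ : X → ℝ} {p : X} (hp : p ∉ tsupport ψ) :
    smoothGrad g ψ p = 0 := by
  refine metr_ext g p fun w => ?_
  rw [metr_smoothGrad, diffAt_eq_zero hp]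
  simp

theorem support_gradInner_subset (g : RMetric m X) (ψ η : X → ℝ) :
    Function.support (gradInner g ψ η) ⊆ tsupport η := by
  intro p hp
  by_contra h
  exact hp (by simp [gradInner, smoothGrad_eq_zero g h])

theorem tsupport_gradInner_subset (g : RMetric m X) (ψ η : X → ℝ) :
    tsupport (gradInner g ψ η) ⊆ tsupport η :=
  closure_minimal (support_gradInner_subset g ψ η) (isClosed_tsupport η)

theorem diffAt_add {ψ η : X → ℝ} (hψ : ContMDiff (𝓡 m) 𝓘(ℝ, ℝ) ∞ ψ)
    (hη : ContMDiff (𝓡 m) 𝓘(ℝ, ℝ) ∞ η) (p : X) :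
    (diffAt (fun x => ψ x + η x) p : 𝔼 →L[ℝ] ℝ) = diffAt ψ p + diffAt η p :=
  mfderiv_add (hψ.mdifferentiableAt (by simp)) (hη.mdifferentiableAt (by simp))

theorem diffAt_const_mul {ψ : X → ℝ} (hψ : ContMDiff (𝓡 m) 𝓘(ℝ, ℝ) ∞ ψ) (a : ℝ) (p : X) :
    (diffAt (fun x => a * ψ x) p : 𝔼 →L[ℝ] ℝ) = a • diffAt ψ p :=
  const_smul_mfderiv (hψ.mdifferentiableAt (by simp)) a

theorem smoothGrad_add (g : RMetric m X) {ψ η : X → ℝ} (hψ : ContMDiff (𝓡 m) 𝓘(ℝ, ℝ) ∞ ψ)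
    (hη : ContMDiff (𝓡 m) 𝓘(ℝ, ℝ) ∞ η) (p : X) :
    smoothGrad g (fun x => ψ x + η x) p = smoothGrad g ψ p + smoothGrad g η p := by
  refine metr_ext g p fun w => ?_
  rw [map_add, add_apply, metr_smoothGrad, metr_smoothGrad, metr_smoothGrad, diffAt_add hψ hη,
    add_apply]

theorem smoothGrad_const_mul (g : RMetric m X) {ψ : X → ℝ} (hψ : ContMDiff (𝓡 m) 𝓘(ℝ, ℝ) ∞ ψ)
    (a : ℝ) (p : X) : smoothGrad g (fun x => a * ψ x) p = a • smoothGrad g ψ p := by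
  refine metr_ext g p fun w => ?_
  rw [map_smul, smul_apply, metr_smoothGrad, metr_smoothGrad, diffAt_const_mul hψ, smul_apply]

end Gradient

/-! ### Integration by parts in a chart -/

section Parts

variable {m : ℕ}

local notation "𝔼" => EuclideanSpace ℝ (Fin m)

theorem continuous_mul_of_tsupport_subset {X : Type*} [TopologicalSpace X] {U : Set X}
    (hU : IsOpen U) {F η : X → ℝ}
    (hF : ContinuousOn F U) (hη : Continuous η) (hsupp : tsupport η ⊆ U) :
    Continuous (fun y => F y * η y) := by
  refine continuous_of_tsupport fun y hy => ?_
  have : y ∈ U := hsupp (closure_mono (Function.support_mul_subset_right _ _) hy)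
  exact (hF.continuousAt (hU.mem_nhds this)).mul hη.continuousAt

theorem integrable_mul_of_tsupport_subset {X : Type*} [TopologicalSpace X] [MeasurableSpace X]
    [OpensMeasurableSpace X]
    {μ : Measure X} [IsFiniteMeasureOnCompacts μ] {U : Set X}
    (hU : IsOpen U) {F η : X → ℝ}
    (hF : ContinuousOn F U) (hη : Continuous η) (hc : HasCompactSupport η) (hsupp : tsupport η ⊆ U) :
    Integrable (fun y => F y * η y) μ :=
  (continuous_mul_of_tsupport_subset hU hF hη hsupp).integrable_of_hasCompactSupport hc.mul_left

theorem integral_mul_fderiv_of_contDiffOn {U : Set 𝔼} (hU : IsOpen U) {F η : 𝔼 → ℝ}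
    (hF : ContDiffOn ℝ ∞ F U) (hη : ContDiff ℝ ∞ η) (hc : HasCompactSupport η)
    (hsupp : tsupport η ⊆ U) (v : 𝔼) :
    ∫ y, F y * fderiv ℝ η y v = -∫ y, fderiv ℝ F y v * η y := by
  have hη' : Continuous fun y => fderiv ℝ η y v :=
    (hη.continuous_fderiv (by simp)).clm_apply continuous_const
  have hsupp' : tsupport (fun y => fderiv ℝ η y v) ⊆ tsupport η :=
    tsupport_fderiv_apply_subset ℝ v
  have hc' : HasCompactSupport fun y => fderiv ℝ η y v := hc.of_isClosed_subset
    (isClosed_tsupport _) hsupp'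
  refine integral_mul_fderiv_eq_neg_fderiv_mul_of_integrable ?_ ?_ ?_ ?_ ?_
  · exact integrable_mul_of_tsupport_subset hU (contDiffOn_fderiv_apply hU hF v).continuousOn
      hη.continuous hc hsupp
  · exact integrable_mul_of_tsupport_subset hU hF.continuousOn hη' hc' (hsupp'.trans hsupp)
  · exact integrable_mul_of_tsupport_subset hU hF.continuousOn hη.continuous hc hsupp
  · exact fun y hy => (hF.differentiableOn (by simp)).differentiableAt (hU.mem_nhds (hsupp hy))
  · exact fun y _ => (hη.differentiable (by simp)).differentiableAt

end Parts

/-! ### The Laplacian in a chart -/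

section Laplacian

variable {m : ℕ} {X : Type*} [TopologicalSpace X] [ChartedSpace (EuclideanSpace ℝ (Fin m)) X]
  [IsManifold (𝓡 m) ∞ X]

local notation "𝔼" => EuclideanSpace ℝ (Fin m)

variable {e e' : OpenPartialHomeomorph X (EuclideanSpace ℝ (Fin m))}

/-- A function supported in the domain of a chart, read in that chart. -/
def readIn (e : OpenPartialHomeomorph X 𝔼) (η : X → ℝ) : 𝔼 → ℝ :=
  e.target.indicator fun y => η (e.symm y)

theorem tsupport_readIn_subset [T2Space X] {η : X → ℝ} (hc : HasCompactSupport η)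
    (hsupp : tsupport η ⊆ e.source) : tsupport (readIn e η) ⊆ e '' tsupport η := by
  have hcomp : IsCompact (e '' tsupport η) :=
    IsCompact.image_of_continuousOn hc (e.continuousOn.mono hsupp)
  refine closure_minimal (fun y hy => ?_) hcomp.isClosed
  rw [readIn, Function.mem_support, indicator_apply_ne_zero] at hy
  exact ⟨e.symm y, subset_tsupport _ hy.2, e.right_inv hy.1⟩

theorem image_tsupport_subset {η : X → ℝ} (hsupp : tsupport η ⊆ e.source) :
    e '' tsupport η ⊆ e.target := by
  rintro _ ⟨x, hx, rfl⟩
  exact e.map_source (hsupp hx)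

theorem hasCompactSupport_readIn [T2Space X] {η : X → ℝ} (hc : HasCompactSupport η)
    (hsupp : tsupport η ⊆ e.source) : HasCompactSupport (readIn e η) :=
  (IsCompact.image_of_continuousOn hc (e.continuousOn.mono hsupp)).of_isClosed_subset
    (isClosed_tsupport _) (tsupport_readIn_subset hc hsupp)

theorem readIn_eventuallyEq (η : X → ℝ) {y : 𝔼} (hy : y ∈ e.target) :
    readIn e η =ᶠ[𝓝 y] fun y => η (e.symm y) := by
  filter_upwards [e.open_target.mem_nhds hy] with z hz
  exact indicator_of_mem hz _

theorem contDiff_readIn [T2Space X] (he : e ∈ IsManifold.maximalAtlas (𝓡 m) ∞ X) {η : X → ℝ}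
    (hη : ContMDiff (𝓡 m) 𝓘(ℝ, ℝ) ∞ η) (hc : HasCompactSupport η)
    (hsupp : tsupport η ⊆ e.source) : ContDiff ℝ ∞ (readIn e η) := by
  rw [← contMDiff_iff_contDiff]
  refine contMDiff_of_tsupport fun y hy => ?_
  have hyt := image_tsupport_subset hsupp (tsupport_readIn_subset hc hsupp hy)
  refine ContMDiffAt.congr_of_eventuallyEq ?_ (readIn_eventuallyEq η hyt)
  exact ((contDiffOn_comp_symm he hη.contMDiffOn).contDiffAt
    (e.open_target.mem_nhds hyt)).contMDiffAt

/-- The components of `√ det g • ∇ψ` in the chart `e`. -/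
def fluxIn (g : RMetric m X) (e : OpenPartialHomeomorph X 𝔼) (ψ : X → ℝ) (i : Fin m) (z : 𝔼) : ℝ :=
  densIn g e z * ∑ j : Fin m, (gramIn g e z)⁻¹ i j * fderiv ℝ (fun y => ψ (e.symm y)) z (stdVec j)

/-- The Laplacian in the chart `e`. -/
def lapIn (g : RMetric m X) (e : OpenPartialHomeomorph X 𝔼) (ψ : X → ℝ) (z : 𝔼) : ℝ :=
  (-(densIn g e z)⁻¹) * ∑ i : Fin m, fderiv ℝ (fluxIn g e ψ i) z (stdVec i)

theorem laplaceBeltrami_eq_lapIn (g : RMetric m X) (ψ : X → ℝ) (x : X) :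
    laplaceBeltrami g ψ x = lapIn g (chartAt 𝔼 x) ψ (chartAt 𝔼 x x) := rfl

theorem contDiffOn_fluxIn (g : RMetric m X) (he : e ∈ IsManifold.maximalAtlas (𝓡 m) ∞ X)
    {ψ : X → ℝ} (hψ : ContMDiff (𝓡 m) 𝓘(ℝ, ℝ) ∞ ψ) (i : Fin m) :
    ContDiffOn ℝ ∞ (fluxIn g e ψ i) e.target :=
  (contDiffOn_densIn g he).mul (ContDiffOn.sum fun j _ => (contDiffOn_inv_gramIn g he i j).mul
    (contDiffOn_fderiv_apply e.open_target (contDiffOn_comp_symm he hψ.contMDiffOn) _))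

theorem continuousOn_lapIn (g : RMetric m X) (he : e ∈ IsManifold.maximalAtlas (𝓡 m) ∞ X)
    {ψ : X → ℝ} (hψ : ContMDiff (𝓡 m) 𝓘(ℝ, ℝ) ∞ ψ) :
    ContinuousOn (lapIn g e ψ) e.target :=
  ((contDiffOn_densIn g he).continuousOn.inv₀ fun _ hy => (densIn_pos g he hy).ne').neg.mul
    (continuousOn_finsetSum _ fun i _ =>
      (contDiffOn_fderiv_apply e.open_target (contDiffOn_fluxIn g he hψ i) _).continuousOn)

theorem fluxIn_sum_eq (g : RMetric m X) (e : OpenPartialHomeomorph X 𝔼) (ψ : X → ℝ) (z : 𝔼)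
    (l : 𝔼 →L[ℝ] ℝ) : ∑ i, fluxIn g e ψ i z * l (stdVec i) =
      densIn g e z * cometrIn g e z (fderiv ℝ (fun y => ψ (e.symm y)) z) l := by
  simp only [fluxIn, cometrIn, Finset.mul_sum, Finset.sum_mul]
  refine Finset.sum_congr rfl fun i _ => Finset.sum_congr rfl fun j _ => ?_
  ring

/-- Multiplying by the density cancels the prefactor of the Laplacian and leaves the divergence of
the flux. Since `η`, read in the chart and continued by zero, has compact support there, one
integration by parts suffices. -/
theorem integral_readIn_mul_lapIn [T2Space X] (g : RMetric m X)
    (he : e ∈ IsManifold.maximalAtlas (𝓡 m) ∞ X)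
    {ψ η : X → ℝ} (hψ : ContMDiff (𝓡 m) 𝓘(ℝ, ℝ) ∞ ψ) (hη : ContMDiff (𝓡 m) 𝓘(ℝ, ℝ) ∞ η)
    (hc : HasCompactSupport η) (hsupp : tsupport η ⊆ e.source) :
    ∫ y in e.target, densIn g e y * (η (e.symm y) * lapIn g e ψ y) =
      ∫ y in e.target, densIn g e y * cometrIn g e y (fderiv ℝ (fun y => ψ (e.symm y)) y)
        (fderiv ℝ (fun y => η (e.symm y)) y) := by
  have hr := contDiff_readIn he hη hc hsupp
  have hrc := hasCompactSupport_readIn hc hsupp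
  have hrs : tsupport (readIn e η) ⊆ e.target :=
    (tsupport_readIn_subset hc hsupp).trans (image_tsupport_subset hsupp)
  have hrc' : ∀ i, HasCompactSupport fun y => fderiv ℝ (readIn e η) y (stdVec i) := fun i =>
    hrc.of_isClosed_subset (isClosed_tsupport _) (tsupport_fderiv_apply_subset ℝ _)
  have e1 : ∫ y in e.target, densIn g e y * (η (e.symm y) * lapIn g e ψ y) =
      ∫ y in e.target, ∑ i, -(fderiv ℝ (fluxIn g e ψ i) y (stdVec i) * readIn e η y) := by
    refine setIntegral_congr_fun e.open_target.measurableSet fun y hy => ?_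
    have hd := (densIn_pos g he hy).ne'
    simp only [lapIn, readIn, indicator_of_mem hy, Finset.sum_neg_distrib, ← Finset.sum_mul]
    field_simp
  have e2 : ∫ y in e.target, densIn g e y * cometrIn g e y (fderiv ℝ (fun y => ψ (e.symm y)) y)
        (fderiv ℝ (fun y => η (e.symm y)) y) =
      ∫ y in e.target, ∑ i, fluxIn g e ψ i y * fderiv ℝ (readIn e η) y (stdVec i) := by
    refine setIntegral_congr_fun e.open_target.measurableSet fun y hy => ?_
    rw [(readIn_eventuallyEq η hy).fderiv_eq, fluxIn_sum_eq]
  have i1 : ∀ i, Integrable fun y => fderiv ℝ (fluxIn g e ψ i) y (stdVec i) * readIn e η y := fun i =>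
    integrable_mul_of_tsupport_subset e.open_target
      (contDiffOn_fderiv_apply e.open_target (contDiffOn_fluxIn g he hψ i) _).continuousOn
      hr.continuous hrc hrs
  have i1' : ∀ i, Integrable fun y =>
      -(fderiv ℝ (fluxIn g e ψ i) y (stdVec i) * readIn e η y) := fun i => (i1 i).neg
  have i2 : ∀ i, Integrable fun y => fluxIn g e ψ i y * fderiv ℝ (readIn e η) y (stdVec i) :=
    fun i => integrable_mul_of_tsupport_subset e.open_target
      (contDiffOn_fluxIn g he hψ i).continuousOn
      ((hr.continuous_fderiv (by simp)).clm_apply continuous_const) (hrc' i)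
      ((tsupport_fderiv_apply_subset ℝ _).trans hrs)
  rw [e1, e2, integral_finsetSum _ fun i _ => (i1' i).restrict,
    integral_finsetSum _ fun i _ => (i2 i).restrict]
  refine Finset.sum_congr rfl fun i _ => ?_
  rw [integral_neg, setIntegral_eq_integral_of_forall_compl_eq_zero,
    setIntegral_eq_integral_of_forall_compl_eq_zero,
    integral_mul_fderiv_of_contDiffOn e.open_target (contDiffOn_fluxIn g he hψ i) hr hrc hrs]
  · intro y hy
    have : y ∉ tsupport (fun y => fderiv ℝ (readIn e η) y (stdVec i)) := fun h =>
      hy (hrs (tsupport_fderiv_apply_subset ℝ _ h))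
    simp [image_eq_zero_of_notMem_tsupport this]
  · intro y hy
    simp [readIn, hy]

end Laplacian

/-! ### Green's formula and the Laplacian as an operator -/

section Green

variable {m : ℕ} {X : Type*} [TopologicalSpace X] [ChartedSpace (EuclideanSpace ℝ (Fin m)) X]
  [IsManifold (𝓡 m) ∞ X] [MeasurableSpace X] [BorelSpace X] [SecondCountableTopology X] [T2Space X]

local notation "𝔼" => EuclideanSpace ℝ (Fin m)

variable {e e' : OpenPartialHomeomorph X (EuclideanSpace ℝ (Fin m))}

instance (g : RMetric m X) : IsLocallyFiniteMeasure (riemVolume g) :=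
  isLocallyFiniteMeasure_riemVolume g

instance (g : RMetric m X) : (riemVolume g).IsOpenPosMeasure := isOpenPosMeasure_riemVolume g

theorem integral_mul_lapIn (g : RMetric m X) (he : e ∈ IsManifold.maximalAtlas (𝓡 m) ∞ X)
    {ψ η : X → ℝ} (hψ : ContMDiff (𝓡 m) 𝓘(ℝ, ℝ) ∞ ψ) (hη : ContMDiff (𝓡 m) 𝓘(ℝ, ℝ) ∞ η)
    (hc : HasCompactSupport η) (hsupp : tsupport η ⊆ e.source) :
    ∫ x, η x * lapIn g e ψ (e x) ∂riemVolume g = ∫ x, gradInner g ψ η x ∂riemVolume g := by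
  have hcl : ContinuousOn (fun x => lapIn g e ψ (e x)) e.source :=
    (continuousOn_lapIn g he hψ).comp e.continuousOn fun x hx => e.map_source hx
  rw [← setIntegral_eq_integral_of_forall_compl_eq_zero (s := e.source),
    ← setIntegral_eq_integral_of_forall_compl_eq_zero (s := e.source) (f := gradInner g ψ η),
    integral_source g he, integral_source g he]
  · have h1 : ∫ y in e.target, densIn g e y * (η (e.symm y) * lapIn g e ψ (e (e.symm y))) =
        ∫ y in e.target, densIn g e y * (η (e.symm y) * lapIn g e ψ y) := by
      refine setIntegral_congr_fun e.open_target.measurableSet fun y hy => ?_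
      simp only [e.right_inv hy]
    have h2 : ∫ y in e.target, densIn g e y * gradInner g ψ η (e.symm y) =
        ∫ y in e.target, densIn g e y * cometrIn g e y (fderiv ℝ (fun y => ψ (e.symm y)) y)
        (fderiv ℝ (fun y => η (e.symm y)) y) := by
      refine setIntegral_congr_fun e.open_target.measurableSet fun y hy => ?_
      simp only [gradInner_chart g he hy (hψ.mdifferentiableAt (by simp))
        (hη.mdifferentiableAt (by simp))]
    rw [h1, h2, integral_readIn_mul_lapIn g he hψ hη hc hsupp]
  · exact (continuous_gradInner g hψ hη).measurable.aemeasurable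
  · exact (hη.continuous.continuousOn.mul hcl).aemeasurable e.open_source.measurableSet
  · intro x hx
    have : x ∉ tsupport (gradInner g ψ η) := fun h =>
      hx (hsupp (tsupport_gradInner_subset g ψ η h))
    exact image_eq_zero_of_notMem_tsupport this
  · intro x hx
    simp [image_eq_zero_of_notMem_tsupport fun h => hx (hsupp h)]

theorem locallyIntegrableOn_of_continuousOn {U : Set X} (hU : IsOpen U) {μ : Measure X}
    [IsLocallyFiniteMeasure μ] {F : X → ℝ} (hF : ContinuousOn F U) : LocallyIntegrableOn F U μ :=
  hF.locallyIntegrableOn hU.measurableSet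

variable [SigmaCompactSpace X]

/-- The Laplacian does not depend on the chart in which it is computed. -/
theorem laplaceBeltrami_eq (g : RMetric m X) (he : e ∈ IsManifold.maximalAtlas (𝓡 m) ∞ X)
    {ψ : X → ℝ} (hψ : ContMDiff (𝓡 m) 𝓘(ℝ, ℝ) ∞ ψ) {x : X} (hx : x ∈ e.source) :
    laplaceBeltrami g ψ x = lapIn g e ψ (e x) := by
  rw [laplaceBeltrami_eq_lapIn]
  let e' := chartAt 𝔼 x
  have he' : e' ∈ IsManifold.maximalAtlas (𝓡 m) ∞ X := IsManifold.chart_mem_maximalAtlas _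
  have hcl : ∀ e : OpenPartialHomeomorph X 𝔼, e ∈ IsManifold.maximalAtlas (𝓡 m) ∞ X →
      ContinuousOn (fun x => lapIn g e ψ (e x)) e.source := fun e he =>
    (continuousOn_lapIn g he hψ).comp e.continuousOn fun x hx => e.map_source hx
  have hO : IsOpen (e'.source ∩ e.source) := e'.open_source.inter e.open_source
  have c1 := (hcl e' he').mono (inter_subset_left (t := e.source))
  have c2 := (hcl e he).mono (inter_subset_right (s := e'.source))
  -- Both chart expressions have the same integrals against test functions supported in the overlap,
  -- because the right-hand side of Green's formula does not mention a chart. Continuity then turns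
  -- almost everywhere equality into equality, with no computation of coordinate changes.
  have key : ∀ᵐ z ∂riemVolume g, z ∈ e'.source ∩ e.source →
      lapIn g e' ψ (e' z) - lapIn g e ψ (e z) = 0 := by
    refine hO.ae_eq_zero_of_integral_contMDiff_smul_eq_zero (𝓡 m)
      (locallyIntegrableOn_of_continuousOn hO (c1.sub c2)) fun η hη hc hsupp => ?_
    have i1 : Integrable (fun z => η z * lapIn g e' ψ (e' z)) (riemVolume g) := by
      simp_rw [mul_comm (η _)]
      exact integrable_mul_of_tsupport_subset hO c1 hη.continuous hc hsupp
    have i2 : Integrable (fun z => η z * lapIn g e ψ (e z)) (riemVolume g) := by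
      simp_rw [mul_comm (η _)]
      exact integrable_mul_of_tsupport_subset hO c2 hη.continuous hc hsupp
    simp only [smul_eq_mul, mul_sub]
    rw [integral_sub i1 i2,
      integral_mul_lapIn g he' hψ hη hc (hsupp.trans inter_subset_left),
      integral_mul_lapIn g he hψ hη hc (hsupp.trans inter_subset_right), sub_self]
  have h2 : (fun z => lapIn g e' ψ (e' z)) =ᵐ[(riemVolume g).restrict (e'.source ∩ e.source)]
      fun z => lapIn g e ψ (e z) := by
    rw [EventuallyEq, ae_restrict_iff' hO.measurableSet]
    filter_upwards [key] with z hz hz'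
    exact sub_eq_zero.1 (hz hz')
  exact Measure.eqOn_open_of_ae_eq h2 hO c1 c2 ⟨mem_chart_source 𝔼 x, hx⟩

theorem continuous_laplaceBeltrami (g : RMetric m X) {ψ : X → ℝ}
    (hψ : ContMDiff (𝓡 m) 𝓘(ℝ, ℝ) ∞ ψ) : Continuous (laplaceBeltrami g ψ) := by
  rw [continuous_iff_continuousAt]
  intro x
  let e := chartAt 𝔼 x
  have he : e ∈ IsManifold.maximalAtlas (𝓡 m) ∞ X := IsManifold.chart_mem_maximalAtlas _
  have hcl : ContinuousOn (fun x => lapIn g e ψ (e x)) e.source :=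
    (continuousOn_lapIn g he hψ).comp e.continuousOn fun x hx => e.map_source hx
  have hn := e.open_source.mem_nhds (mem_chart_source 𝔼 x)
  refine (hcl.continuousAt hn).congr ?_
  filter_upwards [hn] with z hz
  exact (laplaceBeltrami_eq g he hψ hz).symm

theorem fluxIn_congr (g : RMetric m X) {ψ η : X → ℝ} {y : 𝔼}
    (h : (fun y => ψ (e.symm y)) =ᶠ[𝓝 y] fun y => η (e.symm y)) (i : Fin m) :
    fluxIn g e ψ i =ᶠ[𝓝 y] fluxIn g e η i := by
  filter_upwards [h.eventuallyEq_nhds] with z hz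
  simp only [fluxIn, hz.fderiv_eq]

theorem lapIn_congr (g : RMetric m X) {ψ η : X → ℝ} {y : 𝔼}
    (h : (fun y => ψ (e.symm y)) =ᶠ[𝓝 y] fun y => η (e.symm y)) :
    lapIn g e ψ y = lapIn g e η y := by
  simp only [lapIn, (fluxIn_congr g h _).fderiv_eq]

theorem laplaceBeltrami_congr (g : RMetric m X) {ψ η : X → ℝ} {x : X} (h : ψ =ᶠ[𝓝 x] η) :
    laplaceBeltrami g ψ x = laplaceBeltrami g η x := by
  refine lapIn_congr g (e := chartAt 𝔼 x) ?_
  have hc : ContinuousAt (chartAt 𝔼 x).symm (chartAt 𝔼 x x) :=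
    (chartAt 𝔼 x).continuousAt_symm ((chartAt 𝔼 x).map_source (mem_chart_source 𝔼 x))
  rw [ContinuousAt, (chartAt 𝔼 x).left_inv (mem_chart_source 𝔼 x)] at hc
  exact hc.eventually h

theorem laplaceBeltrami_zero (g : RMetric m X) (x : X) : laplaceBeltrami g (fun _ => 0) x = 0 := by
  have h : ∀ i, fluxIn g (chartAt 𝔼 x) (fun _ => 0) i = fun _ => 0 := fun i => by
    ext z
    simp [fluxIn]
  simp [laplaceBeltrami_eq_lapIn, lapIn, h]

theorem laplaceBeltrami_add (g : RMetric m X) {ψ η : X → ℝ} (hψ : ContMDiff (𝓡 m) 𝓘(ℝ, ℝ) ∞ ψ)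
    (hη : ContMDiff (𝓡 m) 𝓘(ℝ, ℝ) ∞ η) (x : X) :
    laplaceBeltrami g (fun x => ψ x + η x) x = laplaceBeltrami g ψ x + laplaceBeltrami g η x := by
  let e := chartAt 𝔼 x
  have he : e ∈ IsManifold.maximalAtlas (𝓡 m) ∞ X := IsManifold.chart_mem_maximalAtlas _
  have hx : e x ∈ e.target := e.map_source (mem_chart_source 𝔼 x)
  have hd : ∀ {ψ : X → ℝ}, ContMDiff (𝓡 m) 𝓘(ℝ, ℝ) ∞ ψ → ∀ z ∈ e.target,
      DifferentiableAt ℝ (fun y => ψ (e.symm y)) z := fun hψ z hz =>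
    ((contDiffOn_comp_symm he hψ.contMDiffOn).differentiableOn (by simp)).differentiableAt
      (e.open_target.mem_nhds hz)
  have hfd : ∀ {ψ : X → ℝ}, ContMDiff (𝓡 m) 𝓘(ℝ, ℝ) ∞ ψ → ∀ i,
      DifferentiableAt ℝ (fluxIn g e ψ i) (e x) := fun hψ i =>
    ((contDiffOn_fluxIn g he hψ i).differentiableOn (by simp)).differentiableAt
      (e.open_target.mem_nhds hx)
  have hf : ∀ i, fluxIn g e (fun x => ψ x + η x) i =ᶠ[𝓝 (e x)]
      fluxIn g e ψ i + fluxIn g e η i := by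
    intro i
    filter_upwards [e.open_target.mem_nhds hx] with z hz
    simp only [fluxIn, Pi.add_apply, fderiv_fun_add (hd hψ z hz) (hd hη z hz), add_apply, mul_add,
      Finset.sum_add_distrib]
  simp only [laplaceBeltrami_eq_lapIn]
  change lapIn g e _ (e x) = lapIn g e _ (e x) + lapIn g e _ (e x)
  simp only [lapIn, (hf _).fderiv_eq, fderiv_add (hfd hψ _) (hfd hη _), add_apply,
    Finset.sum_add_distrib, mul_add]

theorem laplaceBeltrami_const_mul (g : RMetric m X) {ψ : X → ℝ}
    (hψ : ContMDiff (𝓡 m) 𝓘(ℝ, ℝ) ∞ ψ) (a : ℝ) (x : X) :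
    laplaceBeltrami g (fun x => a * ψ x) x = a * laplaceBeltrami g ψ x := by
  let e := chartAt 𝔼 x
  have he : e ∈ IsManifold.maximalAtlas (𝓡 m) ∞ X := IsManifold.chart_mem_maximalAtlas _
  have hx : e x ∈ e.target := e.map_source (mem_chart_source 𝔼 x)
  have hd : ∀ z ∈ e.target, DifferentiableAt ℝ (fun y => ψ (e.symm y)) z := fun z hz =>
    ((contDiffOn_comp_symm he hψ.contMDiffOn).differentiableOn (by simp)).differentiableAt
      (e.open_target.mem_nhds hz)
  have hfd : ∀ i, DifferentiableAt ℝ (fluxIn g e ψ i) (e x) := fun i =>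
    ((contDiffOn_fluxIn g he hψ i).differentiableOn (by simp)).differentiableAt
      (e.open_target.mem_nhds hx)
  have hf : ∀ i, fluxIn g e (fun x => a * ψ x) i =ᶠ[𝓝 (e x)] fun z => a * fluxIn g e ψ i z := by
    intro i
    filter_upwards [e.open_target.mem_nhds hx] with z hz
    simp only [fluxIn, fderiv_const_mul (hd z hz), smul_apply, smul_eq_mul, Finset.mul_sum]
    refine Finset.sum_congr rfl fun j _ => ?_
    ring
  simp only [laplaceBeltrami_eq_lapIn]
  change lapIn g e _ (e x) = a * lapIn g e _ (e x)
  simp only [lapIn, (hf _).fderiv_eq, fderiv_const_mul (hfd _), smul_apply, smul_eq_mul,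
    ← Finset.mul_sum]
  ring

theorem support_laplaceBeltrami_subset (g : RMetric m X) (ψ : X → ℝ) :
    Function.support (laplaceBeltrami g ψ) ⊆ tsupport ψ := by
  intro x hx
  by_contra h
  refine hx ?_
  rw [laplaceBeltrami_congr g (notMem_tsupport_iff_eventuallyEq.1 h)]
  exact laplaceBeltrami_zero g x

theorem hasCompactSupport_laplaceBeltrami (g : RMetric m X) {ψ : X → ℝ}
    (hc : HasCompactSupport ψ) : HasCompactSupport (laplaceBeltrami g ψ) :=
  hc.mono' (support_laplaceBeltrami_subset g ψ)

theorem hasCompactSupport_gradInner (g : RMetric m X) (ψ : X → ℝ) {η : X → ℝ}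
    (hc : HasCompactSupport η) : HasCompactSupport (gradInner g ψ η) :=
  hc.mono' (support_gradInner_subset g ψ η)

theorem integrable_gradInner (g : RMetric m X) {ψ η : X → ℝ} (hψ : ContMDiff (𝓡 m) 𝓘(ℝ, ℝ) ∞ ψ)
    (hη : ContMDiff (𝓡 m) 𝓘(ℝ, ℝ) ∞ η) (hc : HasCompactSupport η) :
    Integrable (gradInner g ψ η) (riemVolume g) :=
  (continuous_gradInner g hψ hη).integrable_of_hasCompactSupport
    (hasCompactSupport_gradInner g ψ hc)

theorem integrable_mul_laplaceBeltrami (g : RMetric m X) {ψ η : X → ℝ}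
    (hψ : ContMDiff (𝓡 m) 𝓘(ℝ, ℝ) ∞ ψ) (hη : ContMDiff (𝓡 m) 𝓘(ℝ, ℝ) ∞ η)
    (hc : HasCompactSupport η) :
    Integrable (fun x => η x * laplaceBeltrami g ψ x) (riemVolume g) :=
  (hη.continuous.mul (continuous_laplaceBeltrami g hψ)).integrable_of_hasCompactSupport hc.mul_right

theorem green_of_tsupport_subset (g : RMetric m X) {ψ η : X → ℝ}
    (hψ : ContMDiff (𝓡 m) 𝓘(ℝ, ℝ) ∞ ψ) (hη : ContMDiff (𝓡 m) 𝓘(ℝ, ℝ) ∞ η)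
    (hc : HasCompactSupport η) {c : X} (hsupp : tsupport η ⊆ (chartAt 𝔼 c).source) :
    ∫ x, η x * laplaceBeltrami g ψ x ∂riemVolume g = ∫ x, gradInner g ψ η x ∂riemVolume g := by
  have he : chartAt 𝔼 c ∈ IsManifold.maximalAtlas (𝓡 m) ∞ X := IsManifold.chart_mem_maximalAtlas _
  rw [← integral_mul_lapIn g he hψ hη hc hsupp]
  refine integral_congr_ae (Eventually.of_forall fun x => ?_)
  by_cases hx : x ∈ tsupport η
  · simp only [laplaceBeltrami_eq g he hψ (hsupp hx)]
  · simp [image_eq_zero_of_notMem_tsupport hx]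

/-- A partition of unity subordinate to the chart domains, of which only finitely many members meet
the compact support of `η`. It reduces Green's formula to one chart. -/
theorem exists_finite_decomposition {η : X → ℝ}
    (hη : ContMDiff (𝓡 m) 𝓘(ℝ, ℝ) ∞ η) (hc : HasCompactSupport η) :
    ∃ (t : Finset X) (f : X → X → ℝ), (∀ c, ContMDiff (𝓡 m) 𝓘(ℝ, ℝ) ∞ (f c)) ∧
      (∀ c, HasCompactSupport (f c)) ∧ (∀ c, tsupport (f c) ⊆ (chartAt 𝔼 c).source) ∧
      ∀ x, η x = ∑ c ∈ t, f c x := by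
  obtain ⟨f, hf⟩ := SmoothPartitionOfUnity.exists_isSubordinate (𝓡 m) (s := (univ : Set X))
    isClosed_univ (fun c : X => (chartAt 𝔼 c).source) (fun c => (chartAt 𝔼 c).open_source)
    (fun x _ => mem_iUnion.2 ⟨x, mem_chart_source 𝔼 x⟩)
  have hfin := f.locallyFinite.finite_nonempty_inter_compact hc
  refine ⟨hfin.toFinset, fun c x => f c x * η x, fun c => (f c).contMDiff.mul hη,
    fun c => hc.mul_left, fun c => (tsupport_mul_subset_left).trans (hf c), fun x => ?_⟩
  by_cases hx : x ∈ tsupport η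
  · rw [← Finset.sum_mul]
    have h1 : ∑ c ∈ hfin.toFinset, f c x = 1 := by
      rw [← f.sum_eq_one (mem_univ x), finsum_eq_sum_of_support_subset]
      intro c hcx
      simpa using ⟨x, hcx, hx⟩
    rw [h1, one_mul]
  · simp [image_eq_zero_of_notMem_tsupport hx]

theorem gradInner_add_right (g : RMetric m X) (ψ : X → ℝ) {η η' : X → ℝ}
    (hη : ContMDiff (𝓡 m) 𝓘(ℝ, ℝ) ∞ η) (hη' : ContMDiff (𝓡 m) 𝓘(ℝ, ℝ) ∞ η') (x : X) :
    gradInner g ψ (fun x => η x + η' x) x = gradInner g ψ η x + gradInner g ψ η' x := by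
  simp only [gradInner, smoothGrad_add g hη hη', map_add]

/-- **Green's formula** for smooth functions. -/
theorem green (g : RMetric m X) {ψ η : X → ℝ} (hψ : ContMDiff (𝓡 m) 𝓘(ℝ, ℝ) ∞ ψ)
    (hη : ContMDiff (𝓡 m) 𝓘(ℝ, ℝ) ∞ η) (hc : HasCompactSupport η) :
    ∫ x, η x * laplaceBeltrami g ψ x ∂riemVolume g = ∫ x, gradInner g ψ η x ∂riemVolume g := by
  classical
  obtain ⟨t, f, hf, hfc, hfs, hsum⟩ := exists_finite_decomposition hη hc
  have key : ∀ t : Finset X, ContMDiff (𝓡 m) 𝓘(ℝ, ℝ) ∞ (fun x => ∑ c ∈ t, f c x) ∧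
      HasCompactSupport (fun x => ∑ c ∈ t, f c x) ∧
      ∫ x, (∑ c ∈ t, f c x) * laplaceBeltrami g ψ x ∂riemVolume g =
        ∫ x, gradInner g ψ (fun x => ∑ c ∈ t, f c x) x ∂riemVolume g := by
    intro t
    induction t using Finset.induction_on with
    | empty =>
      refine ⟨by simpa using contMDiff_const, HasCompactSupport.zero, ?_⟩
      have : ∀ x, gradInner g ψ (fun _ => (0 : ℝ)) x = 0 := fun x => by
        have : x ∉ tsupport (fun _ : X => (0 : ℝ)) := by simp [tsupport]
        simp [gradInner, smoothGrad_eq_zero g this]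
      simp [this]
    | insert a s ha ih =>
      obtain ⟨h1, h2, h3⟩ := ih
      simp only [Finset.sum_insert ha]
      refine ⟨(hf a).add h1, (hfc a).add h2, ?_⟩
      simp only [gradInner_add_right g ψ (hf a) h1, add_mul]
      rw [integral_add (integrable_mul_laplaceBeltrami g hψ (hf a) (hfc a))
        (integrable_mul_laplaceBeltrami g hψ h1 h2), h3,
        green_of_tsupport_subset g hψ (hf a) (hfc a) (hfs a),
        integral_add (integrable_gradInner g hψ (hf a) (hfc a)) (integrable_gradInner g hψ h1 h2)]
  have he : η = fun x => ∑ c ∈ t, f c x := funext hsum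
  rw [he]
  exact (key t).2.2

/-! #### The operator -/

theorem IsTestClass.add {g : RMetric m X} {ψ η : X → ℝ} {v w : L2 g} (h : IsTestClass g ψ v)
    (h' : IsTestClass g η w) : IsTestClass g (fun x => ψ x + η x) (v + w) := by
  refine ⟨h.1.add h'.1, h.2.1.add h'.2.1, ?_⟩
  filter_upwards [Lp.coeFn_add v w, h.2.2, h'.2.2] with x h1 h2 h3
  rw [h1, Pi.add_apply, h2, h3]

theorem IsTestClass.smul {g : RMetric m X} {ψ : X → ℝ} {v : L2 g} (h : IsTestClass g ψ v)
    (a : ℝ) : IsTestClass g (fun x => a * ψ x) (a • v) := by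
  refine ⟨contMDiff_const.mul h.1, h.2.1.mul_left, ?_⟩
  filter_upwards [Lp.coeFn_smul a v, h.2.2] with x h1 h2
  rw [h1, Pi.smul_apply, h2, smul_eq_mul]

theorem IsTestClass.sub {g : RMetric m X} {ψ η : X → ℝ} {v w : L2 g} (h : IsTestClass g ψ v)
    (h' : IsTestClass g η w) : IsTestClass g (fun x => ψ x + (-1) * η x) (v - w) := by
  have := h.add (h'.smul (-1))
  rwa [neg_one_smul, ← sub_eq_add_neg] at this

theorem isTestClass_zero (g : RMetric m X) : IsTestClass g (fun _ => 0) (0 : L2 g) :=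
  ⟨contMDiff_const, HasCompactSupport.zero, Lp.coeFn_zero _ _ _⟩

/-- The volume charges every nonempty open set, so an `L²` class has at most one continuous
representative. -/
theorem IsTestClass.eq {g : RMetric m X} {ψ η : X → ℝ} {v : L2 g} (h : IsTestClass g ψ v)
    (h' : IsTestClass g η v) : ψ = η :=
  Measure.eq_of_ae_eq (h.2.2.symm.trans h'.2.2) h.1.continuous h'.1.continuous

theorem exists_isTestClass (g : RMetric m X) {ψ : X → ℝ} (hψ : ContMDiff (𝓡 m) 𝓘(ℝ, ℝ) ∞ ψ)
    (hc : HasCompactSupport ψ) : ∃ v : L2 g, IsTestClass g ψ v := by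
  have h : MemLp ψ 2 (riemVolume g) := hψ.continuous.memLp_of_hasCompactSupport hc
  exact ⟨h.toLp ψ, hψ, hc, h.coeFn_toLp⟩

/-- The graph of the Laplacian on test functions. -/
def laplacianGraph (g : RMetric m X) : Submodule ℝ (L2 g × L2 g) where
  carrier := {p | ∃ ψ : X → ℝ, IsTestClass g ψ p.1 ∧ p.2 =ᵐ[riemVolume g] laplaceBeltrami g ψ}
  zero_mem' := by
    refine ⟨fun _ => 0, isTestClass_zero g, ?_⟩
    filter_upwards [Lp.coeFn_zero ℝ 2 (riemVolume g)] with x hx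
    rw [laplaceBeltrami_zero]
    exact hx
  add_mem' := by
    rintro ⟨v, w⟩ ⟨v', w'⟩ ⟨ψ, h1, h2⟩ ⟨ψ', h1', h2'⟩
    refine ⟨_, h1.add h1', ?_⟩
    filter_upwards [Lp.coeFn_add w w', h2, h2'] with x k1 k2 k3
    rw [laplaceBeltrami_add g h1.1 h1'.1, ← k2, ← k3]
    exact k1
  smul_mem' := by
    rintro a ⟨v, w⟩ ⟨ψ, h1, h2⟩
    refine ⟨_, h1.smul a, ?_⟩
    filter_upwards [Lp.coeFn_smul a w, h2] with x k1 k2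
    rw [laplaceBeltrami_const_mul g h1.1, ← k2]
    exact k1

theorem laplacian_eq (g : RMetric m X) : laplacian g = (laplacianGraph g).toLinearPMap := by
  have : Submodule.span ℝ {p : L2 g × L2 g | ∃ ψ : X → ℝ,
    IsTestClass g ψ p.1 ∧ p.2 =ᵐ[riemVolume g] laplaceBeltrami g ψ} = laplacianGraph g :=
    Submodule.span_eq (laplacianGraph g)
  rw [laplacian, this]

/-- Single-valuedness is what makes the graph of `toLinearPMap` equal to the given submodule. -/
theorem laplacianGraph_functional (g : RMetric m X) :
    ∀ p ∈ laplacianGraph g, p.1 = 0 → p.2 = 0 := by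
  rintro ⟨v, w⟩ ⟨ψ, h1, h2⟩ (rfl : v = 0)
  have : ψ = fun _ => 0 := h1.eq (isTestClass_zero g)
  subst this
  apply Lp.ext
  filter_upwards [h2, Lp.coeFn_zero ℝ 2 (riemVolume g)] with x k1 k2
  rw [k2]
  exact k1.trans (laplaceBeltrami_zero g x)

theorem mem_laplacian_graph (g : RMetric m X) (p : L2 g × L2 g) :
    p ∈ (laplacian g).graph ↔
      ∃ ψ : X → ℝ, IsTestClass g ψ p.1 ∧ p.2 =ᵐ[riemVolume g] laplaceBeltrami g ψ := by
  rw [laplacian_eq, Submodule.toLinearPMap_graph_eq _ (laplacianGraph_functional g)]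
  rfl

theorem mem_laplacian_domain (g : RMetric m X) (v : L2 g) :
    v ∈ (laplacian g).domain ↔ ∃ ψ : X → ℝ, IsTestClass g ψ v := by
  constructor
  · intro hv
    have := (mem_laplacian_graph g (v, laplacian g ⟨v, hv⟩)).1
      (LinearPMap.mem_graph (laplacian g) ⟨v, hv⟩)
    obtain ⟨ψ, h, -⟩ := this
    exact ⟨ψ, h⟩
  · rintro ⟨ψ, h⟩
    have hL : MemLp (laplaceBeltrami g ψ) 2 (riemVolume g) :=
      (continuous_laplaceBeltrami g h.1).memLp_of_hasCompactSupport
        (hasCompactSupport_laplaceBeltrami g h.2.1)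
    have := (mem_laplacian_graph g (v, hL.toLp _)).2 ⟨ψ, h, hL.coeFn_toLp⟩
    exact LinearPMap.mem_domain_of_mem_graph this

theorem laplacian_apply_ae (g : RMetric m X) {u : (laplacian g).domain} {ψ : X → ℝ}
    (h : IsTestClass g ψ u) : laplacian g u =ᵐ[riemVolume g] laplaceBeltrami g ψ := by
  obtain ⟨η, h1, h2⟩ := (mem_laplacian_graph g (u, laplacian g u)).1
    (LinearPMap.mem_graph (laplacian g) u)
  rwa [h.eq h1]

theorem inner_laplacian (g : RMetric m X) {u v : (laplacian g).domain} {ψ η : X → ℝ}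
    (hu : IsTestClass g ψ u) (hv : IsTestClass g η v) :
    ⟪laplacian g u, (v : L2 g)⟫_ℝ = ∫ x, gradInner g ψ η x ∂riemVolume g := by
  rw [L2.inner_def, ← green g hu.1 hv.1 hv.2.1]
  refine integral_congr_ae ?_
  filter_upwards [laplacian_apply_ae g hu, hv.2.2] with x h1 h2
  simp [h1, h2]

theorem laplacian_symmetric (g : RMetric m X) (u v : (laplacian g).domain) :
    ⟪laplacian g u, (v : L2 g)⟫_ℝ = ⟪(u : L2 g), laplacian g v⟫_ℝ := by
  obtain ⟨ψ, hu⟩ := (mem_laplacian_domain g u).1 u.2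
  obtain ⟨η, hv⟩ := (mem_laplacian_domain g v).1 v.2
  rw [inner_laplacian g hu hv, real_inner_comm, inner_laplacian g hv hu]
  exact integral_congr_ae (Eventually.of_forall fun x => gradInner_comm g _ _ _)

theorem laplacian_nonneg (g : RMetric m X) (u : (laplacian g).domain) :
    0 ≤ ⟪laplacian g u, (u : L2 g)⟫_ℝ := by
  obtain ⟨ψ, hu⟩ := (mem_laplacian_domain g u).1 u.2
  rw [inner_laplacian g hu hu]
  exact integral_nonneg fun x => metr_nonneg g x _

/-- An `L²` function orthogonal to all test functions vanishes almost everywhere, by the fundamental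
lemma of the calculus of variations. -/
theorem laplacian_dense (g : RMetric m X) : Dense ((laplacian g).domain : Set (L2 g)) := by
  rw [Submodule.dense_iff_topologicalClosure_eq_top, Submodule.topologicalClosure_eq_top_iff,
    Submodule.eq_bot_iff]
  intro u hu
  rw [Submodule.mem_orthogonal] at hu
  apply Lp.ext
  have h0 : ∀ᵐ x ∂riemVolume g, u x = 0 := by
    refine ae_eq_zero_of_integral_contMDiff_smul_eq_zero (𝓡 m) ?_ fun ψ hψ hc => ?_
    · exact (Lp.memLp u).locallyIntegrable (by norm_num)
    · obtain ⟨v, hv⟩ := exists_isTestClass g hψ hc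
      have := hu v ((mem_laplacian_domain g v).2 ⟨ψ, hv⟩)
      rw [L2.inner_def] at this
      rw [← this]
      refine integral_congr_ae ?_
      filter_upwards [hv.2.2] with x h1
      simp [h1, mul_comm]
  filter_upwards [h0, Lp.coeFn_zero ℝ 2 (riemVolume g)] with x h1 h2
  rw [h1, h2]
  rfl

end Green

/-! ### Weak gradients -/

section WeakGradient

variable {m : ℕ} {X : Type*} [TopologicalSpace X] [ChartedSpace (EuclideanSpace ℝ (Fin m)) X]
  [IsManifold (𝓡 m) ∞ X]

local notation "𝔼" => EuclideanSpace ℝ (Fin m)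

variable {e e' : OpenPartialHomeomorph X (EuclideanSpace ℝ (Fin m))}

/-- The covariant components of the vector field `V` in the chart `e`. -/
def compIn (g : RMetric m X) (e : OpenPartialHomeomorph X 𝔼) (V : X → 𝔼) (i : Fin m) (y : 𝔼) : ℝ :=
  metr g (e.symm y) (V (e.symm y)) (chartD e y (stdVec i))

theorem isWeakGradient_iff (g : RMetric m X) (u : X → ℝ) (V : X → 𝔼) :
    IsWeakGradient g u V ↔ ∀ c : X,
      LocallyIntegrableOn (fun y => u ((chartAt 𝔼 c).symm y)) (chartAt 𝔼 c).target volume ∧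
      ∀ i : Fin m, LocallyIntegrableOn (compIn g (chartAt 𝔼 c) V i) (chartAt 𝔼 c).target volume ∧
        ∀ ψ : 𝔼 → ℝ, ContDiff ℝ ∞ ψ → HasCompactSupport ψ → tsupport ψ ⊆ (chartAt 𝔼 c).target →
          ∫ y, u ((chartAt 𝔼 c).symm y) * fderiv ℝ ψ y (stdVec i) =
            -∫ y, compIn g (chartAt 𝔼 c) V i y * ψ y := Iff.rfl

theorem metr_eq_sum_compIn (g : RMetric m X) (he : e ∈ IsManifold.maximalAtlas (𝓡 m) ∞ X)
    {y : 𝔼} (hy : y ∈ e.target) (V W : X → 𝔼) :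
    metr g (e.symm y) (V (e.symm y)) (W (e.symm y)) =
      ∑ i, ∑ j, (gramIn g e y)⁻¹ i j * compIn g e V j y * compIn g e W i y := by
  let l : 𝔼 →L[ℝ] ℝ := (metr g (e.symm y) (V (e.symm y))).comp (chartD e y)
  have hV : V (e.symm y) = chartD e y (gradAt (metrIn g e y) l) := by
    refine metr_ext g (e.symm y) fun w => ?_
    obtain ⟨w, rfl⟩ := (chartD_bijective he hy).2 w
    rw [← metrIn_apply, bilin_gradAt _ (metrIn_symm g e y) fun _ => metrIn_pos g he hy]
    rfl
  rw [metr_symm, hV]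
  let l' : 𝔼 →L[ℝ] ℝ := (metr g (e.symm y) (W (e.symm y))).comp (chartD e y)
  change l' (gradAt (metrIn g e y) l) = _
  rw [linearForm_eq_sum l']
  simp only [gradAt, Matrix.mulVec, dotProduct, Finset.sum_mul]
  rfl

theorem compIn_sub (g : RMetric m X) (e : OpenPartialHomeomorph X 𝔼) (V W : X → 𝔼) (i : Fin m)
    (y : 𝔼) : compIn g e (fun x => V x - W x) i y = compIn g e V i y - compIn g e W i y := by
  simp only [compIn]
  rw [(metr g (e.symm y)).map_sub, sub_apply]

theorem compIn_sq_le (g : RMetric m X) (e : OpenPartialHomeomorph X 𝔼) (V : X → 𝔼) (i : Fin m)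
    (y : 𝔼) : compIn g e V i y ^ 2 ≤
      metr g (e.symm y) (V (e.symm y)) (V (e.symm y)) * gramIn g e y i i :=
  metr_cauchy_schwarz _ _ _ _

theorem compIn_smoothGrad (g : RMetric m X) (he : e ∈ IsManifold.maximalAtlas (𝓡 m) ∞ X)
    {ψ : X → ℝ} (hψ : ContMDiff (𝓡 m) 𝓘(ℝ, ℝ) ∞ ψ) (i : Fin m) {y : 𝔼} (hy : y ∈ e.target) :
    compIn g e (smoothGrad g ψ) i y = fderiv ℝ (fun y => ψ (e.symm y)) y (stdVec i) := by
  rw [compIn, metr_smoothGrad, diffAt_chartD he hy (hψ.mdifferentiableAt (by simp))]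

theorem integral_mul_congr_of_tsupport_subset {U : Set 𝔼} (hU : MeasurableSet U) {F G η : 𝔼 → ℝ}
    (hsupp : tsupport η ⊆ U) (h : ∀ᵐ y ∂volume.restrict U, F y = G y) :
    ∫ y, F y * η y = ∫ y, G y * η y := by
  refine integral_congr_ae ?_
  filter_upwards [(ae_restrict_iff' hU).1 h] with y hy
  by_cases hyU : y ∈ U
  · rw [hy hyU]
  · simp [image_eq_zero_of_notMem_tsupport fun h => hyU (hsupp h)]

theorem isWeakGradient_smoothGrad (g : RMetric m X) {ψ : X → ℝ}
    (hψ : ContMDiff (𝓡 m) 𝓘(ℝ, ℝ) ∞ ψ) : IsWeakGradient g ψ (smoothGrad g ψ) := by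
  rw [isWeakGradient_iff]
  intro c
  have he : chartAt 𝔼 c ∈ IsManifold.maximalAtlas (𝓡 m) ∞ X := IsManifold.chart_mem_maximalAtlas _
  have hm := (chartAt 𝔼 c).open_target.measurableSet
  have hs := contDiffOn_comp_symm he hψ.contMDiffOn
  refine ⟨hs.continuousOn.locallyIntegrableOn hm, fun i => ⟨?_, fun η hη hc hsupp => ?_⟩⟩
  · refine ((contDiffOn_fderiv_apply (chartAt 𝔼 c).open_target hs
      (stdVec i)).continuousOn.locallyIntegrableOn hm).congr ?_
    filter_upwards [ae_restrict_mem hm] with y hy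
    rw [compIn_smoothGrad g he hψ i hy]
  · rw [integral_mul_fderiv_of_contDiffOn (chartAt 𝔼 c).open_target hs hη hc hsupp]
    congr 1
    refine integral_mul_congr_of_tsupport_subset hm hsupp ?_
    filter_upwards [ae_restrict_mem hm] with y hy
    rw [compIn_smoothGrad g he hψ i hy]

variable [MeasurableSpace X] [BorelSpace X] [SecondCountableTopology X] [T2Space X]

theorem ae_eq_comp_symm (g : RMetric m X) {β : Type*} {u u' : X → β}
    (h : u =ᵐ[riemVolume g] u') (c : X) :
    ∀ᵐ y ∂volume.restrict (chartAt 𝔼 c).target,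
      u ((chartAt 𝔼 c).symm y) = u' ((chartAt 𝔼 c).symm y) :=
  ae_target_of_ae_source g (IsManifold.chart_mem_maximalAtlas _) (ae_restrict_of_ae h)

theorem IsWeakGradient.congr {g : RMetric m X} {u u' : X → ℝ} {V : X → 𝔼}
    (h : IsWeakGradient g u V) (hu : u =ᵐ[riemVolume g] u') : IsWeakGradient g u' V := by
  rw [isWeakGradient_iff] at h ⊢
  intro c
  obtain ⟨h1, h2⟩ := h c
  have hc := ae_eq_comp_symm g hu c
  refine ⟨h1.congr hc, fun i => ⟨(h2 i).1, fun ψ hψ hcs hsupp => ?_⟩⟩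
  rw [← (h2 i).2 ψ hψ hcs hsupp]
  exact (integral_mul_congr_of_tsupport_subset (chartAt 𝔼 c).open_target.measurableSet
    ((tsupport_fderiv_apply_subset ℝ _).trans hsupp) hc).symm

theorem integrable_mul_of_locallyIntegrableOn {U : Set 𝔼} {F η : 𝔼 → ℝ}
    (hF : LocallyIntegrableOn F U volume) (hη : Continuous η) (hc : HasCompactSupport η)
    (hsupp : tsupport η ⊆ U) : Integrable fun y => F y * η y := by
  have h := (hF.integrableOn_compact_subset hsupp hc).mul_continuousOn hη.continuousOn hc
  rwa [integrableOn_iff_integrable_of_support_subset] at h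
  exact (Function.support_mul_subset_right _ _).trans (subset_tsupport _)

theorem IsWeakGradient.sub {g : RMetric m X} {u u' : X → ℝ} {V V' : X → 𝔼}
    (h : IsWeakGradient g u V) (h' : IsWeakGradient g u' V') :
    IsWeakGradient g (fun x => u x - u' x) (fun x => V x - V' x : X → 𝔼) := by
  rw [isWeakGradient_iff] at h h' ⊢
  intro c
  have ho := (chartAt 𝔼 c).open_target
  obtain ⟨h1, h2⟩ := h c
  obtain ⟨h1', h2'⟩ := h' c
  have hcomp : ∀ i, compIn g (chartAt 𝔼 c) (fun x => V x - V' x) i =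
      compIn g (chartAt 𝔼 c) V i - compIn g (chartAt 𝔼 c) V' i := fun i => by
    ext y
    exact compIn_sub _ _ _ _ _ _
  refine ⟨h1.sub h1', fun i => ⟨?_, fun ψ hψ hcs hsupp => ?_⟩⟩
  · rw [hcomp]
    exact (h2 i).1.sub (h2' i).1
  · have hη' : Continuous fun y => fderiv ℝ ψ y (stdVec i) :=
      (hψ.continuous_fderiv (by simp)).clm_apply continuous_const
    have hsupp' : tsupport (fun y => fderiv ℝ ψ y (stdVec i)) ⊆ tsupport ψ :=
      tsupport_fderiv_apply_subset ℝ _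
    have hcs' : HasCompactSupport fun y => fderiv ℝ ψ y (stdVec i) := hcs.of_isClosed_subset
      (isClosed_tsupport _) hsupp'
    have hs' := hsupp'.trans hsupp
    simp only [hcomp, Pi.sub_apply, sub_mul]
    rw [integral_sub (integrable_mul_of_locallyIntegrableOn h1 hη' hcs' hs')
      (integrable_mul_of_locallyIntegrableOn h1' hη' hcs' hs'),
      integral_sub (integrable_mul_of_locallyIntegrableOn (h2 i).1 hψ.continuous hcs hsupp)
        (integrable_mul_of_locallyIntegrableOn (h2' i).1 hψ.continuous hcs hsupp),
      (h2 i).2 ψ hψ hcs hsupp, (h2' i).2 ψ hψ hcs hsupp]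
    ring

theorem eq_of_compIn_eq (g : RMetric m X) (he : e ∈ IsManifold.maximalAtlas (𝓡 m) ∞ X)
    {V V' : X → 𝔼} {y : 𝔼} (hy : y ∈ e.target) (h : ∀ i, compIn g e V i y = compIn g e V' i y) :
    V (e.symm y) = V' (e.symm y) := by
  refine metr_ext g (e.symm y) fun w => ?_
  obtain ⟨w, rfl⟩ := (chartD_bijective he hy).2 w
  rw [← sum_smul_stdVec w]
  simp only [map_sum, map_smul]
  exact Finset.sum_congr rfl fun i _ => by congr 1; exact h i

/-- The covariant components are determined almost everywhere by their integrals against test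
functions, and they determine the vector since the coordinate vectors span. -/
theorem IsWeakGradient.ae_eq {g : RMetric m X} {u : X → ℝ} {V V' : X → 𝔼}
    (h : IsWeakGradient g u V) (h' : IsWeakGradient g u V') : V =ᵐ[riemVolume g] V' := by
  rw [isWeakGradient_iff] at h h'
  refine ae_of_forall_chart g fun c => ?_
  have ho := (chartAt 𝔼 c).open_target
  have key : ∀ i, ∀ᵐ y ∂volume, y ∈ (chartAt 𝔼 c).target →
      compIn g (chartAt 𝔼 c) V i y - compIn g (chartAt 𝔼 c) V' i y = 0 := by
    intro i
    have hV := ((h c).2 i)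
    have hV' := ((h' c).2 i)
    refine ho.ae_eq_zero_of_integral_contDiff_smul_eq_zero (hV.1.sub hV'.1)
      fun ψ hψ hcs hsupp => ?_
    simp only [smul_eq_mul, mul_comm (ψ _), sub_mul]
    rw [integral_sub (integrable_mul_of_locallyIntegrableOn hV.1 hψ.continuous hcs hsupp)
        (integrable_mul_of_locallyIntegrableOn hV'.1 hψ.continuous hcs hsupp)]
    have e1 := hV.2 ψ hψ hcs hsupp
    have e2 := hV'.2 ψ hψ hcs hsupp
    linarith
  rw [ae_restrict_iff' ho.measurableSet]
  filter_upwards [ae_all_iff.2 key] with y hy hyt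
  exact eq_of_compIn_eq g (IsManifold.chart_mem_maximalAtlas _) hyt
    fun i => sub_eq_zero.1 (hy i hyt)

/-- The field in `energy` is an arbitrary choice; uniqueness up to null sets allows any weak
gradient in its place. -/
theorem energy_eq {g : RMetric m X} {u : L2 g} {V : X → 𝔼} (h : IsWeakGradient g u V) :
    energy g u = ∫ x, metr g x (V x) (V x) ∂riemVolume g := by
  have hex : ∃ V, IsWeakGradient g u V := ⟨V, h⟩
  have hw : IsWeakGradient g u (weakGrad g u) := by
    rw [weakGrad, dif_pos hex]
    exact hex.choose_spec
  refine integral_congr_ae ?_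
  filter_upwards [IsWeakGradient.ae_eq hw h] with x hx
  rw [hx]
  rfl

/-! #### Measurability of vector fields -/

/-- Measurability of a vector field, up to null sets. -/
def IsMeasurableField (g : RMetric m X) (V : X → 𝔼) : Prop :=
  ∀ (c : X) (i : Fin m), AEMeasurable (compIn g (chartAt 𝔼 c) V i)
    (volume.restrict (chartAt 𝔼 c).target)

theorem IsWeakGradient.isMeasurableField {g : RMetric m X} {u : X → ℝ} {V : X → 𝔼}
    (h : IsWeakGradient g u V) : IsMeasurableField g V := fun c i =>
  ((((isWeakGradient_iff g u V).1 h c).2 i).1.aestronglyMeasurable).aemeasurable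

theorem IsMeasurableField.sub {g : RMetric m X} {V W : X → 𝔼} (hV : IsMeasurableField g V)
    (hW : IsMeasurableField g W) : IsMeasurableField g (fun x => V x - W x) := fun c i =>
  ((hV c i).sub (hW c i)).congr (Eventually.of_forall fun y => (compIn_sub g _ V W i y).symm)

theorem IsMeasurableField.aemeasurable_metr {g : RMetric m X} {V : X → 𝔼}
    (hV : IsMeasurableField g V) : AEMeasurable (fun x => metr g x (V x) (V x)) (riemVolume g) := by
  refine aemeasurable_of_forall_chart g fun c => ?_
  have he : chartAt 𝔼 c ∈ IsManifold.maximalAtlas (𝓡 m) ∞ X := IsManifold.chart_mem_maximalAtlas _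
  have hm := (chartAt 𝔼 c).open_target.measurableSet
  have : AEMeasurable (fun y => ∑ i, ∑ j, (gramIn g (chartAt 𝔼 c) y)⁻¹ i j *
      compIn g (chartAt 𝔼 c) V j y * compIn g (chartAt 𝔼 c) V i y)
      (volume.restrict (chartAt 𝔼 c).target) := by
    refine Finset.aemeasurable_fun_sum _ fun i _ => Finset.aemeasurable_fun_sum _ fun j _ => ?_
    exact (((contDiffOn_inv_gramIn g he i j).continuousOn.aemeasurable hm).mul (hV c j)).mul
      (hV c i)
  refine this.congr ?_
  filter_upwards [ae_restrict_mem hm] with y hy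
  rw [metr_eq_sum_compIn g he hy]

theorem IsMeasurableField.of_tendsto {g : RMetric m X} {V : ℕ → X → 𝔼} {W : X → 𝔼}
    (hV : ∀ k, IsMeasurableField g (V k))
    (h : ∀ᵐ x ∂riemVolume g, Tendsto (fun k => V k x) atTop (𝓝 (W x))) :
    IsMeasurableField g W := by
  intro c i
  refine aemeasurable_of_tendsto_metrizable_ae atTop (fun k => hV k c i) ?_
  have := ae_target_of_ae_source g (IsManifold.chart_mem_maximalAtlas c) (ae_restrict_of_ae h)
  filter_upwards [this] with y hy
  have hc : Continuous fun v : 𝔼 => metr g ((chartAt 𝔼 c).symm y) v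
      (chartD (chartAt 𝔼 c) y (stdVec i)) :=
    (metr g ((chartAt 𝔼 c).symm y)).continuous.clm_apply continuous_const
  exact (hc.tendsto _).comp hy

/-! #### Comparison of integrals over compact subsets of a chart -/

/-- The density has a positive minimum on a compact set. This transfers `L²` convergence on the
manifold to the coordinates, where weak derivatives are tested. -/
theorem exists_lintegral_compact_le (g : RMetric m X)
    (he : e ∈ IsManifold.maximalAtlas (𝓡 m) ∞ X) {K : Set 𝔼} (hK : IsCompact K)
    (hKe : K ⊆ e.target) : ∃ C : ℝ≥0∞, C ≠ ⊤ ∧ ∀ F : X → ℝ≥0∞,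
      AEMeasurable F (riemVolume g) → ∫⁻ y in K, F (e.symm y) ≤ C * ∫⁻ x, F x ∂riemVolume g := by
  obtain ⟨δ, hδ, hδK⟩ : ∃ δ > 0, ∀ y ∈ K, δ ≤ densIn g e y := by
    rcases K.eq_empty_or_nonempty with rfl | hne
    · exact ⟨1, one_pos, by simp⟩
    obtain ⟨y, hy, hmin⟩ := hK.exists_isMinOn hne ((contDiffOn_densIn g he).continuousOn.mono hKe)
    exact ⟨_, densIn_pos g he (hKe hy), fun z hz => hmin hz⟩
  refine ⟨(ENNReal.ofReal δ)⁻¹, by simpa using hδ, fun F hF => ?_⟩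
  have h0 : ENNReal.ofReal δ ≠ 0 := by simpa using hδ
  rw [← ENNReal.mul_le_iff_le_inv h0 ENNReal.ofReal_ne_top]
  calc ENNReal.ofReal δ * ∫⁻ y in K, F (e.symm y)
      = ∫⁻ y in K, ENNReal.ofReal δ * F (e.symm y) :=
        (lintegral_const_mul' _ _ ENNReal.ofReal_ne_top).symm
    _ ≤ ∫⁻ y in K, ENNReal.ofReal (densIn g e y) * F (e.symm y) := by
        refine lintegral_mono_ae ?_
        filter_upwards [ae_restrict_mem hK.measurableSet] with y hy
        gcongr
        exact hδK y hy
    _ ≤ ∫⁻ y in e.target, ENNReal.ofReal (densIn g e y) * F (e.symm y) :=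
        lintegral_mono_set hKe
    _ = ∫⁻ x in e.source, F x ∂riemVolume g := (lintegral_source g he hF.restrict).symm
    _ ≤ ∫⁻ x, F x ∂riemVolume g := setLIntegral_le_lintegral _ _

theorem exists_lintegral_compIn_sq_le (g : RMetric m X) (c : X) {K : Set 𝔼} (hK : IsCompact K)
    (hKe : K ⊆ (chartAt 𝔼 c).target) (i : Fin m) : ∃ C : ℝ≥0∞, C ≠ ⊤ ∧ ∀ V : X → 𝔼,
      IsMeasurableField g V → ∫⁻ y in K, ‖compIn g (chartAt 𝔼 c) V i y‖ₑ ^ 2 ≤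
        C * ∫⁻ x, ENNReal.ofReal (metr g x (V x) (V x)) ∂riemVolume g := by
  let e := chartAt 𝔼 c
  have he : e ∈ IsManifold.maximalAtlas (𝓡 m) ∞ X := IsManifold.chart_mem_maximalAtlas _
  obtain ⟨C, hC, hCF⟩ := exists_lintegral_compact_le g he hK hKe
  obtain ⟨b, hb⟩ := hK.exists_bound_of_continuousOn
    ((contDiffOn_gramIn g he i i).continuousOn.mono hKe)
  refine ⟨ENNReal.ofReal b * C, ENNReal.mul_ne_top ENNReal.ofReal_ne_top hC, fun V hV => ?_⟩
  calc ∫⁻ y in K, ‖compIn g e V i y‖ₑ ^ 2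
      ≤ ∫⁻ y in K, ENNReal.ofReal b *
          ENNReal.ofReal (metr g (e.symm y) (V (e.symm y)) (V (e.symm y))) := by
        refine lintegral_mono_ae ?_
        filter_upwards [ae_restrict_mem hK.measurableSet] with y hy
        have h1 := compIn_sq_le g e V i y
        have h2 : gramIn g e y i i ≤ b := (le_abs_self _).trans (hb y hy)
        rw [Real.enorm_eq_ofReal_abs, ← ENNReal.ofReal_pow (abs_nonneg _), sq_abs, mul_comm,
          ← ENNReal.ofReal_mul (metr_nonneg _ _ _)]
        exact ENNReal.ofReal_le_ofReal
          (h1.trans (mul_le_mul_of_nonneg_left h2 (metr_nonneg _ _ _)))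
    _ = ENNReal.ofReal b * ∫⁻ y in K,
          ENNReal.ofReal (metr g (e.symm y) (V (e.symm y)) (V (e.symm y))) :=
        lintegral_const_mul' _ _ ENNReal.ofReal_ne_top
    _ ≤ ENNReal.ofReal b *
          (C * ∫⁻ x, ENNReal.ofReal (metr g x (V x) (V x)) ∂riemVolume g) := by
        gcongr
        exact hCF (fun x => ENNReal.ofReal (metr g x (V x) (V x))) hV.aemeasurable_metr.ennreal_ofReal
    _ = _ := by rw [mul_assoc]

theorem integrableOn_of_lintegral_sq_lt_top {K : Set 𝔼} (hK : IsCompact K) {F : 𝔼 → ℝ}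
    (hF : AEMeasurable F (volume.restrict K)) (h : ∫⁻ y in K, ‖F y‖ₑ ^ 2 < ⊤) :
    IntegrableOn F K := by
  have : IsFiniteMeasure (volume.restrict K) := ⟨by simpa using hK.measure_lt_top⟩
  have h2 : MemLp F 2 (volume.restrict K) := by
    refine ⟨hF.aestronglyMeasurable, ?_⟩
    rw [eLpNorm_lt_top_iff_lintegral_rpow_enorm_lt_top (by norm_num) (by norm_num)]
    simpa using h
  exact h2.integrable (by norm_num)

theorem locallyIntegrableOn_L2 (g : RMetric m X) (u : L2 g) (c : X) :
    LocallyIntegrableOn (fun y => u ((chartAt 𝔼 c).symm y)) (chartAt 𝔼 c).target volume := by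
  rw [locallyIntegrableOn_iff (chartAt 𝔼 c).open_target.isLocallyClosed]
  intro K hKe hK
  have he : chartAt 𝔼 c ∈ IsManifold.maximalAtlas (𝓡 m) ∞ X := IsManifold.chart_mem_maximalAtlas _
  obtain ⟨C, hC, hCF⟩ := exists_lintegral_compact_le g he hK hKe
  have hu : AEMeasurable u (riemVolume g) := (Lp.aestronglyMeasurable u).aemeasurable
  refine integrableOn_of_lintegral_sq_lt_top hK ?_ ?_
  · exact (aemeasurable_comp_symm_of_source g he hu.restrict).mono_measure
      (Measure.restrict_mono hKe le_rfl)
  · refine (hCF (fun x => ‖u x‖ₑ ^ 2) (hu.enorm.pow_const 2)).trans_lt ?_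
    refine ENNReal.mul_lt_top hC.lt_top ?_
    have := (Lp.memLp u).2
    rw [eLpNorm_lt_top_iff_lintegral_rpow_enorm_lt_top (by norm_num) (by norm_num)] at this
    simpa using this

theorem enorm_integral_mul_le {K : Set 𝔼} {F η : 𝔼 → ℝ} (hF : AEMeasurable F (volume.restrict K))
    (hη : Continuous η) (hsupp : tsupport η ⊆ K) :
    ‖∫ y, F y * η y‖ₑ ≤ (∫⁻ y in K, ‖F y‖ₑ ^ 2) ^ (1 / 2 : ℝ) * (∫⁻ y in K, ‖η y‖ₑ ^ 2) ^ (1 / 2 : ℝ) := by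
  have h0 : ∫ y, F y * η y = ∫ y in K, F y * η y := by
    symm
    refine setIntegral_eq_integral_of_forall_compl_eq_zero fun y hy => ?_
    simp [image_eq_zero_of_notMem_tsupport fun h => hy (hsupp h)]
  rw [h0]
  refine (enorm_integral_le_lintegral_enorm _).trans ?_
  have := ENNReal.lintegral_mul_le_Lp_mul_Lq (volume.restrict K) Real.HolderConjugate.two_two
    hF.enorm hη.measurable.enorm.aemeasurable
  simpa [enorm_mul] using this

end WeakGradient

/-! ### Closedness of the weak gradient -/

/-- Removes the span from the definition of `formDomain`: in the form space every element of it is a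
single limit of the required kind. -/
theorem exists_seq_of_mem_formDomain {H : Type*} [NormedAddCommGroup H] [InnerProductSpace ℝ H]
    [CompleteSpace H] (T : H →ₗ.[ℝ] H)
    (hs : ∀ u v : T.domain, ⟪T u, (v : H)⟫_ℝ = ⟪(u : H), T v⟫_ℝ)
    (hp : ∀ u : T.domain, 0 ≤ ⟪T u, (u : H)⟫_ℝ) {u : H} (hu : u ∈ formDomain T) :
    ∃ s : ℕ → T.domain, Tendsto (fun k => (s k : H)) atTop (𝓝 u) ∧
      ∀ ε > 0, ∃ K : ℕ, ∀ k ≥ K, ∀ l ≥ K,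
        |⟪T (s k - s l), ((s k - s l : T.domain) : H)⟫_ℝ| < ε := by
  obtain ⟨V, _, _, _, ⟨F⟩⟩ := exists_formSpace T hs hp
  obtain ⟨x, rfl⟩ := (F.mem_formDomain_iff u).1 hu
  obtain ⟨s, -, h1, h2⟩ := F.exists_seq x
  exact ⟨s, h1, h2⟩

section Closed

variable {m : ℕ} {X : Type*} [TopologicalSpace X] [ChartedSpace (EuclideanSpace ℝ (Fin m)) X]
  [IsManifold (𝓡 m) ∞ X]

local notation "𝔼" => EuclideanSpace ℝ (Fin m)

/-- The coordinates of `v` are its inner products with the vectors dual to the coordinate forms, so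
Cauchy–Schwarz applies. The constant may depend on `p`, since only pointwise convergence is deduced
from it. -/
theorem exists_norm_sq_le_metr (g : RMetric m X) (p : X) :
    ∃ C : ℝ, 0 ≤ C ∧ ∀ v : 𝔼, ‖v‖ ^ 2 ≤ C * metr g p v v := by
  let G : Fin m → 𝔼 := fun i => gradAt (metr g p) (EuclideanSpace.proj i)
  refine ⟨∑ i, metr g p (G i) (G i), Finset.sum_nonneg fun i _ => metr_nonneg g p _, fun v => ?_⟩
  rw [EuclideanSpace.real_norm_sq_eq, Finset.sum_mul]
  refine Finset.sum_le_sum fun i _ => ?_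
  have h := bilin_gradAt (metr g p) (metr_symm g p) (fun _ => metr_pos g p)
    (EuclideanSpace.proj i : 𝔼 →L[ℝ] ℝ) v
  have h2 := metr_cauchy_schwarz g p (G i) v
  rw [h] at h2
  simpa using h2

theorem exists_tendsto_of_metr_geometric (g : RMetric m X) (p : X) {v : ℕ → 𝔼} {S : ℝ}
    (h : ∀ j, metr g p (v (j + 1) - v j) (v (j + 1) - v j) * 2 ^ j ≤ S) :
    ∃ w, Tendsto v atTop (𝓝 w) := by
  obtain ⟨C, hC, hCv⟩ := exists_norm_sq_le_metr g p
  refine cauchySeq_tendsto_of_complete (cauchySeq_of_le_geometric (√(1 / 2)) (√(C * S)) ?_ ?_)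
  · rw [Real.sqrt_lt' one_pos]
    norm_num
  · intro j
    rw [dist_comm, dist_eq_norm]
    have h1 : ‖v (j + 1) - v j‖ ^ 2 ≤ (C * S) * (1 / 2) ^ j := by
      refine (hCv _).trans ?_
      rw [mul_assoc]
      gcongr
      rw [one_div, inv_pow, ← div_eq_mul_inv, le_div_iff₀ (by positivity)]
      exact h j
    have hS : 0 ≤ S := by
      have := h 0
      rw [pow_zero, mul_one] at this
      exact (metr_nonneg g p _).trans this
    refine le_of_sq_le_sq ?_ (by positivity)
    rw [mul_pow, Real.sq_sqrt (by positivity), ← pow_mul, mul_comm j, pow_mul,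
      Real.sq_sqrt (by norm_num)]
    exact h1

theorem metr_add_le (g : RMetric m X) (p : X) (v w : 𝔼) :
    metr g p (v + w) (v + w) ≤ 2 * metr g p v v + 2 * metr g p w w := by
  have h := metr_nonneg g p (v - w)
  rw [metr_add_self]
  simp only [sub_eq_add_neg] at h
  rw [metr_add_self] at h
  simp only [map_neg, neg_apply, neg_neg] at h
  linarith

theorem metr_sub_comm (g : RMetric m X) (p : X) (v w : 𝔼) :
    metr g p (v - w) (v - w) = metr g p (w - v) (w - v) := by
  rw [← neg_sub w v]
  simp only [map_neg, neg_apply, neg_neg]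

theorem abs_metr_sub_le (g : RMetric m X) (p : X) (v w : 𝔼) {δ : ℝ} (hδ : 0 < δ) :
    |metr g p v v - metr g p w w| ≤
      δ * metr g p w w + (1 + δ⁻¹) * metr g p (v - w) (v - w) := by
  obtain ⟨d, rfl⟩ : ∃ d, v = w + d := ⟨v - w, by abel⟩
  rw [metr_add_self, add_sub_cancel_left]
  have h1 := metr_nonneg g p (δ • w + d)
  have h2 := metr_nonneg g p (δ • w - d)
  have hd := metr_nonneg g p d
  rw [sub_eq_add_neg, metr_add_self] at h2
  rw [metr_add_self] at h1
  simp only [map_smul, map_neg, neg_apply, smul_apply, smul_eq_mul, neg_neg] at h1 h2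
  have e1 : δ * (2 * metr g p w d) ≤ δ * (δ * metr g p w w + δ⁻¹ * metr g p d d) := by
    rw [mul_add, mul_inv_cancel_left₀ hδ.ne']
    nlinarith
  have e2 : δ * (-(2 * metr g p w d)) ≤ δ * (δ * metr g p w w + δ⁻¹ * metr g p d d) := by
    rw [mul_add, mul_inv_cancel_left₀ hδ.ne']
    nlinarith
  have e1' := le_of_mul_le_mul_left e1 hδ
  have e2' := le_of_mul_le_mul_left e2 hδ
  rw [abs_le]
  constructor <;> linarith

variable [MeasurableSpace X] [BorelSpace X]

/-- The square of the `L²` distance of two vector fields. -/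
def fieldDist (g : RMetric m X) (V W : X → 𝔼) : ℝ≥0∞ :=
  ∫⁻ x, ENNReal.ofReal (metr g x (V x - W x) (V x - W x)) ∂riemVolume g

variable [SecondCountableTopology X] [T2Space X]

/-- The Riesz–Fischer argument: `∑ 2^j |V_{j+1} - V_j|²` has integral at most `∑ 2^{-j}`, so it is
finite almost everywhere, and there the increments decay geometrically. -/
theorem exists_ae_limit (g : RMetric m X) {V : ℕ → X → 𝔼} (hV : ∀ k, IsMeasurableField g (V k))
    (h : ∀ j, fieldDist g (V (j + 1)) (V j) ≤ (1 / 4) ^ j) :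
    ∃ W : X → 𝔼, ∀ᵐ x ∂riemVolume g, Tendsto (fun k => V k x) atTop (𝓝 (W x)) := by
  classical
  let F : ℕ → X → ℝ≥0∞ := fun j x =>
    2 ^ j * ENNReal.ofReal (metr g x (V (j + 1) x - V j x) (V (j + 1) x - V j x))
  have hF : ∀ j, AEMeasurable (F j) (riemVolume g) := fun j =>
    (((hV (j + 1)).sub (hV j)).aemeasurable_metr.ennreal_ofReal).const_mul _
  have hsum : ∫⁻ x, ∑' j, F j x ∂riemVolume g ≠ ⊤ := by
    rw [lintegral_tsum hF]
    refine ne_top_of_le_ne_top (b := ∑' j : ℕ, (2⁻¹ : ℝ≥0∞) ^ j) ?_ (ENNReal.tsum_le_tsum fun j => ?_)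
    · rw [ENNReal.tsum_geometric]
      simp
    · rw [lintegral_const_mul' _ _ (by simp)]
      refine (mul_le_mul_right (h j) (2 ^ j)).trans (le_of_eq ?_)
      rw [← mul_pow]
      congr 1
      rw [one_div, show (4 : ℝ≥0∞) = 2 * 2 by norm_num, ENNReal.mul_inv (by simp) (by simp),
        ← mul_assoc, ENNReal.mul_inv_cancel (by simp) (by simp), one_mul]
  have hae := ae_lt_top' (AEMeasurable.tsum hF) hsum
  refine ⟨fun x => if hx : ∃ w, Tendsto (fun k => V k x) atTop (𝓝 w) then hx.choose else 0, ?_⟩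
  filter_upwards [hae] with x hx
  have hex : ∃ w, Tendsto (fun k => V k x) atTop (𝓝 w) := by
    refine exists_tendsto_of_metr_geometric g x (S := (∑' j, F j x).toReal) fun j => ?_
    have h1 : F j x ≤ ∑' j, F j x := ENNReal.le_tsum j
    have h2 := ENNReal.toReal_mono hx.ne h1
    simp only [F, ENNReal.toReal_mul, ENNReal.toReal_pow, ENNReal.toReal_ofNat,
      ENNReal.toReal_ofReal (metr_nonneg g x _)] at h2
    rw [mul_comm]
    exact h2
  rw [dif_pos hex]
  exact hex.choose_spec

/-- Fatou's lemma along the sequence of squared distances. -/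
theorem fieldDist_le_of_tendsto (g : RMetric m X) {V : ℕ → X → 𝔼} {U W : X → 𝔼}
    (hV : ∀ k, IsMeasurableField g (V k)) (hU : IsMeasurableField g U)
    (h : ∀ᵐ x ∂riemVolume g, Tendsto (fun k => V k x) atTop (𝓝 (W x))) {ε : ℝ≥0∞} {K : ℕ}
    (hε : ∀ k ≥ K, fieldDist g U (V k) ≤ ε) : fieldDist g U W ≤ ε := by
  calc fieldDist g U W
      = ∫⁻ x, liminf (fun k => ENNReal.ofReal (metr g x (U x - V k x) (U x - V k x))) atTop
          ∂riemVolume g := by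
        refine lintegral_congr_ae ?_
        filter_upwards [h] with x hx
        have hc : Continuous fun v : 𝔼 => ENNReal.ofReal (metr g x (U x - v) (U x - v)) :=
          ENNReal.continuous_ofReal.comp
            (((metr g x).continuous.comp (continuous_const.sub continuous_id)).clm_apply
              (continuous_const.sub continuous_id))
        exact (((hc.tendsto _).comp hx).liminf_eq).symm
    _ ≤ liminf (fun k => fieldDist g U (V k)) atTop :=
        lintegral_liminf_le' fun k => (hU.sub (hV k)).aemeasurable_metr.ennreal_ofReal
    _ ≤ ε := by
        refine liminf_le_of_frequently_le' (Eventually.frequently ?_)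
        filter_upwards [eventually_ge_atTop K] with k hk
        exact hε k hk

theorem lintegral_L2_sub (g : RMetric m X) (u v : L2 g) :
    ∫⁻ x, ‖u x - v x‖ₑ ^ 2 ∂riemVolume g = ENNReal.ofReal (‖u - v‖ ^ 2) := by
  have h1 : ∫⁻ x, ‖u x - v x‖ₑ ^ 2 ∂riemVolume g = ∫⁻ x, ‖(u - v) x‖ₑ ^ 2 ∂riemVolume g := by
    refine lintegral_congr_ae ?_
    filter_upwards [Lp.coeFn_sub u v] with x hx
    rw [hx, Pi.sub_apply]
  have h2 := eLpNorm_eq_lintegral_rpow_enorm_toReal (μ := riemVolume g) (f := (u - v : L2 g))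
    (p := 2) (by norm_num) (by norm_num)
  rw [h1, ENNReal.ofReal_pow (norm_nonneg _), Lp.norm_def, ENNReal.ofReal_toReal (Lp.eLpNorm_ne_top _),
    h2]
  simp only [ENNReal.toReal_ofNat, ENNReal.rpow_ofNat]
  rw [← ENNReal.rpow_natCast, ← ENNReal.rpow_mul]
  norm_num

/-- For a fixed test function, both sides of the defining identity are integrals over its compact
support. They are continuous under `L²` convergence by Cauchy–Schwarz and the comparison of volumes
on compact sets. -/
theorem isWeakGradient_of_limit (g : RMetric m X) {u : ℕ → L2 g} {w : L2 g} {V : ℕ → X → 𝔼}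
    {W : X → 𝔼} (hV : ∀ k, IsWeakGradient g (u k) (V k)) (hu : Tendsto u atTop (𝓝 w))
    (hW : IsMeasurableField g W) (hd : Tendsto (fun k => fieldDist g (V k) W) atTop (𝓝 0)) :
    IsWeakGradient g w W := by
  rw [isWeakGradient_iff]
  intro c
  have he : chartAt 𝔼 c ∈ IsManifold.maximalAtlas (𝓡 m) ∞ X := IsManifold.chart_mem_maximalAtlas _
  have ho := (chartAt 𝔼 c).open_target
  refine ⟨locallyIntegrableOn_L2 g w c, fun i => ?_⟩
  have hVk := fun k => ((isWeakGradient_iff g _ _).1 (hV k) c).2 i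
  have hmeas := fun k => (hV k).isMeasurableField.sub hW
  have hcomp : ∀ k y, compIn g (chartAt 𝔼 c) (fun x => V k x - W x) i y =
      compIn g (chartAt 𝔼 c) (V k) i y - compIn g (chartAt 𝔼 c) W i y :=
    fun k y => compIn_sub _ _ _ _ _ _
  have hloc : LocallyIntegrableOn (compIn g (chartAt 𝔼 c) W i) (chartAt 𝔼 c).target volume := by
    rw [locallyIntegrableOn_iff ho.isLocallyClosed]
    intro K hKe hK
    obtain ⟨C, hC, hCV⟩ := exists_lintegral_compIn_sq_le g c hK hKe i
    obtain ⟨k, hk⟩ := (hd.eventually_lt_const (u := 1) one_pos).exists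
    have h1 : IntegrableOn (compIn g (chartAt 𝔼 c) (fun x => V k x - W x) i) K := by
      refine integrableOn_of_lintegral_sq_lt_top hK
        ((hmeas k c i).mono_measure (Measure.restrict_mono hKe le_rfl)) ?_
      refine (hCV _ (hmeas k)).trans_lt (ENNReal.mul_lt_top hC.lt_top ?_)
      exact hk.trans ENNReal.one_lt_top
    have h2 := ((hVk k).1.integrableOn_compact_subset hKe hK).sub h1
    refine h2.congr (Eventually.of_forall fun y => ?_)
    simp [hcomp]
  refine ⟨hloc, fun ψ hψ hcs hsupp => ?_⟩
  have hη' : Continuous fun y => fderiv ℝ ψ y (stdVec i) :=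
    (hψ.continuous_fderiv (by simp)).clm_apply continuous_const
  have hsupp' : tsupport (fun y => fderiv ℝ ψ y (stdVec i)) ⊆ tsupport ψ :=
    tsupport_fderiv_apply_subset ℝ _
  have hcs' : HasCompactSupport fun y => fderiv ℝ ψ y (stdVec i) := hcs.of_isClosed_subset
    (isClosed_tsupport _) hsupp'
  have hK : IsCompact (tsupport ψ) := hcs
  have hfin : ∀ {η : 𝔼 → ℝ}, Continuous η → (∫⁻ y in tsupport ψ, ‖η y‖ₑ ^ 2) ^ (1 / 2 : ℝ) ≠ ⊤ := by
    intro η hη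
    refine ENNReal.rpow_ne_top_of_nonneg (by norm_num) ?_
    have hi : IntegrableOn (fun y => η y ^ 2) (tsupport ψ) :=
      (hη.pow 2).continuousOn.integrableOn_compact hK
    have := hi.2
    rw [HasFiniteIntegral] at this
    simpa using this.ne
  have zero_of : ∀ {F : ℕ → 𝔼 → ℝ} {η : 𝔼 → ℝ}, Continuous η → tsupport η ⊆ tsupport ψ →
      (∀ k, AEMeasurable (F k) (volume.restrict (tsupport ψ))) →
      Tendsto (fun k => ∫⁻ y in tsupport ψ, ‖F k y‖ₑ ^ 2) atTop (𝓝 0) →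
      Tendsto (fun k => ∫ y, F k y * η y) atTop (𝓝 0) := by
    intro F η hη hs hF h0
    rw [tendsto_zero_iff_enorm_tendsto_zero]
    have h1 : Tendsto (fun k => (∫⁻ y in tsupport ψ, ‖F k y‖ₑ ^ 2) ^ (1 / 2 : ℝ) *
        (∫⁻ y in tsupport ψ, ‖η y‖ₑ ^ 2) ^ (1 / 2 : ℝ)) atTop (𝓝 0) := by
      have h2 := (h0.ennrpow_const (1 / 2 : ℝ))
      rw [ENNReal.zero_rpow_of_pos (by norm_num)] at h2
      have h3 := ENNReal.Tendsto.mul_const h2 (Or.inr (hfin hη))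
      simpa using h3
    exact tendsto_of_tendsto_of_tendsto_of_le_of_le tendsto_const_nhds h1 (fun _ => zero_le)
      fun k => enorm_integral_mul_le (hF k) hη hs
  have hL : Tendsto (fun k => ∫ y, u k ((chartAt 𝔼 c).symm y) * fderiv ℝ ψ y (stdVec i)) atTop
      (𝓝 (∫ y, w ((chartAt 𝔼 c).symm y) * fderiv ℝ ψ y (stdVec i))) := by
    have hmu : ∀ u : L2 g, AEMeasurable u (riemVolume g) := fun u =>
      (Lp.aestronglyMeasurable u).aemeasurable
    obtain ⟨C, hC, hCF⟩ := exists_lintegral_compact_le g he hK hsupp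
    have h0 := zero_of (F := fun k y => u k ((chartAt 𝔼 c).symm y) - w ((chartAt 𝔼 c).symm y))
      hη' hsupp' (fun k => (aemeasurable_comp_symm_of_source g he
        ((hmu (u k)).sub (hmu w)).restrict).mono_measure (Measure.restrict_mono hsupp le_rfl)) (by
        have h1 : Tendsto (fun k => C * ENNReal.ofReal (‖u k - w‖ ^ 2)) atTop (𝓝 0) := by
          have h2 : Tendsto (fun k => ‖u k - w‖ ^ 2) atTop (𝓝 0) := by
            have := (tendsto_iff_norm_sub_tendsto_zero.1 hu).pow 2
            simpa using this
          have h3 := ENNReal.Tendsto.const_mul (a := C) (ENNReal.tendsto_ofReal h2) (Or.inr hC)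
          simpa using h3
        refine tendsto_of_tendsto_of_tendsto_of_le_of_le tendsto_const_nhds h1 (fun _ => zero_le)
          fun k => ?_
        have := hCF (fun x => ‖u k x - w x‖ₑ ^ 2) (((hmu (u k)).sub (hmu w)).enorm.pow_const 2)
        rwa [lintegral_L2_sub] at this)
    rw [tendsto_iff_norm_sub_tendsto_zero]
    rw [tendsto_zero_iff_norm_tendsto_zero] at h0
    refine h0.congr fun k => ?_
    rw [← integral_sub (integrable_mul_of_locallyIntegrableOn (locallyIntegrableOn_L2 g (u k) c)
      hη' hcs' (hsupp'.trans hsupp)) (integrable_mul_of_locallyIntegrableOn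
        (locallyIntegrableOn_L2 g w c) hη' hcs' (hsupp'.trans hsupp))]
    simp only [sub_mul]
  have hR : Tendsto (fun k => ∫ y, compIn g (chartAt 𝔼 c) (V k) i y * ψ y) atTop
      (𝓝 (∫ y, compIn g (chartAt 𝔼 c) W i y * ψ y)) := by
    obtain ⟨C, hC, hCV⟩ := exists_lintegral_compIn_sq_le g c hK hsupp i
    have h0 := zero_of (F := fun k y => compIn g (chartAt 𝔼 c) (fun x => V k x - W x) i y)
      hψ.continuous subset_rfl (fun k => (hmeas k c i).mono_measure
        (Measure.restrict_mono hsupp le_rfl)) (by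
        have h3 := ENNReal.Tendsto.const_mul (a := C) hd (Or.inr hC)
        rw [mul_zero] at h3
        exact tendsto_of_tendsto_of_tendsto_of_le_of_le tendsto_const_nhds h3 (fun _ => zero_le)
          fun k => hCV _ (hmeas k))
    rw [tendsto_iff_norm_sub_tendsto_zero]
    rw [tendsto_zero_iff_norm_tendsto_zero] at h0
    refine h0.congr fun k => ?_
    rw [← integral_sub (integrable_mul_of_locallyIntegrableOn (hVk k).1 hψ.continuous hcs hsupp)
      (integrable_mul_of_locallyIntegrableOn hloc hψ.continuous hcs hsupp)]
    simp only [hcomp, sub_mul]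
  have hL' := hR.neg
  refine tendsto_nhds_unique hL (hL'.congr fun k => ?_)
  exact ((hVk k).2 ψ hψ hcs hsupp).symm

/-- Completeness of `W^{1,2}`: a fast subsequence of the gradients converges almost everywhere, and
the Cauchy condition with Fatou's lemma then makes the whole sequence converge to its limit in `L²`.
-/
theorem exists_limit_weakGradient (g : RMetric m X) {u : ℕ → L2 g} {w : L2 g} {V : ℕ → X → 𝔼}
    (hV : ∀ k, IsWeakGradient g (u k) (V k)) (hu : Tendsto u atTop (𝓝 w))
    (hC : ∀ ε : ℝ≥0∞, 0 < ε → ∃ K, ∀ k ≥ K, ∀ l ≥ K, fieldDist g (V k) (V l) ≤ ε) :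
    ∃ W : X → 𝔼, IsWeakGradient g w W ∧ Tendsto (fun k => fieldDist g (V k) W) atTop (𝓝 0) := by
  have hmeas := fun k => (hV k).isMeasurableField
  obtain ⟨φ, hφ, hφP⟩ := extraction_forall_of_eventually'
    (P := fun (j K : ℕ) => ∀ k ≥ K, ∀ l ≥ K, fieldDist g (V k) (V l) ≤ (1 / 4) ^ j) fun j => by
      obtain ⟨K, hK⟩ := hC ((1 / 4) ^ j) (ENNReal.pow_pos (by simp) j)
      exact ⟨K, fun K' hK' k hk l hl => hK k (hK'.trans hk) l (hK'.trans hl)⟩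
  obtain ⟨W, hW⟩ := exists_ae_limit g (V := fun j => V (φ j)) (fun j => hmeas _)
    fun j => hφP j _ (hφ.monotone (Nat.le_succ j)) _ le_rfl
  have hWm : IsMeasurableField g W := IsMeasurableField.of_tendsto (fun j => hmeas (φ j)) hW
  have hd : Tendsto (fun k => fieldDist g (V k) W) atTop (𝓝 0) := by
    rw [ENNReal.tendsto_nhds_zero]
    intro ε hε
    obtain ⟨K, hK⟩ := hC ε hε
    filter_upwards [eventually_ge_atTop K] with k hk
    exact fieldDist_le_of_tendsto g (fun j => hmeas (φ j)) (hmeas k) hW (K := K)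
      fun j hj => hK k hk _ (hj.trans (hφ.id_le j))
  exact ⟨W, isWeakGradient_of_limit g hV hu hWm hd, hd⟩

end Closed

/-! ### The form domain of the Laplacian -/

section FormDomain

variable {m : ℕ} {X : Type*} [TopologicalSpace X] [ChartedSpace (EuclideanSpace ℝ (Fin m)) X]
  [IsManifold (𝓡 m) ∞ X] [MeasurableSpace X] [BorelSpace X] [SecondCountableTopology X] [T2Space X]

local notation "𝔼" => EuclideanSpace ℝ (Fin m)

theorem IsTestClass.isWeakGradient {g : RMetric m X} {ψ : X → ℝ} {v : L2 g}
    (h : IsTestClass g ψ v) : IsWeakGradient g v (smoothGrad g ψ) :=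
  (isWeakGradient_smoothGrad g h.1).congr h.2.2.symm

theorem IsWeakGradient.subL2 {g : RMetric m X} {u v : L2 g} {V W : X → 𝔼}
    (hu : IsWeakGradient g u V) (hv : IsWeakGradient g v W) :
    IsWeakGradient g (u - v : L2 g) (fun x => V x - W x : X → 𝔼) :=
  (hu.sub hv).congr (Lp.coeFn_sub u v).symm

theorem integrable_metr_of_lintegral (g : RMetric m X) {V : X → 𝔼} (hV : IsMeasurableField g V)
    (h : ∫⁻ x, ENNReal.ofReal (metr g x (V x) (V x)) ∂riemVolume g < ⊤) :
    Integrable (fun x => metr g x (V x) (V x)) (riemVolume g) := by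
  refine ⟨hV.aemeasurable_metr.aestronglyMeasurable, ?_⟩
  rw [hasFiniteIntegral_iff_ofReal (Eventually.of_forall fun x => metr_nonneg g x _)]
  exact h

theorem integrable_metr_sub (g : RMetric m X) {V W : X → 𝔼} (hV : IsMeasurableField g V)
    (hW : IsMeasurableField g W) (hVi : Integrable (fun x => metr g x (V x) (V x)) (riemVolume g))
    (hWi : Integrable (fun x => metr g x (W x) (W x)) (riemVolume g)) :
    Integrable (fun x => metr g x (V x - W x) (V x - W x)) (riemVolume g) := by
  refine ((hVi.const_mul 2).add (hWi.const_mul 2)).mono'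
    (hV.sub hW).aemeasurable_metr.aestronglyMeasurable (Eventually.of_forall fun x => ?_)
  rw [Real.norm_of_nonneg (metr_nonneg g x _), sub_eq_add_neg]
  refine (metr_add_le g x _ _).trans (le_of_eq ?_)
  simp only [map_neg, neg_apply, neg_neg, Pi.add_apply]

theorem toReal_fieldDist (g : RMetric m X) {V W : X → 𝔼} (hV : IsMeasurableField g V)
    (hW : IsMeasurableField g W) :
    (fieldDist g V W).toReal = ∫ x, metr g x (V x - W x) (V x - W x) ∂riemVolume g := by
  rw [integral_eq_lintegral_of_nonneg_ae (Eventually.of_forall fun x => metr_nonneg g x _)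
    (hV.sub hW).aemeasurable_metr.aestronglyMeasurable]
  rfl

variable [SigmaCompactSpace X]

theorem IsTestClass.integrable_metr {g : RMetric m X} {ψ : X → ℝ} {v : L2 g}
    (h : IsTestClass g ψ v) :
    Integrable (fun x => metr g x (smoothGrad g ψ x) (smoothGrad g ψ x)) (riemVolume g) :=
  integrable_gradInner g h.1 h.1 h.2.1

theorem smoothGrad_sub (g : RMetric m X) {ψ η : X → ℝ} (hψ : ContMDiff (𝓡 m) 𝓘(ℝ, ℝ) ∞ ψ)
    (hη : ContMDiff (𝓡 m) 𝓘(ℝ, ℝ) ∞ η) (x : X) :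
    smoothGrad g (fun x => ψ x + (-1) * η x) x = smoothGrad g ψ x - smoothGrad g η x := by
  have hη' : ContMDiff (𝓡 m) 𝓘(ℝ, ℝ) ∞ fun x => (-1) * η x := contMDiff_const.mul hη
  rw [smoothGrad_add g hψ hη', smoothGrad_const_mul g hη, neg_one_smul,
    sub_eq_add_neg]

theorem inner_laplacian_sub (g : RMetric m X) {u v : (laplacian g).domain} {ψ η : X → ℝ}
    (hu : IsTestClass g ψ u) (hv : IsTestClass g η v) :
    ⟪laplacian g (u - v), ((u - v : (laplacian g).domain) : L2 g)⟫_ℝ =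
      (fieldDist g (smoothGrad g ψ) (smoothGrad g η)).toReal := by
  rw [toReal_fieldDist g (isWeakGradient_smoothGrad g hu.1).isMeasurableField
    (isWeakGradient_smoothGrad g hv.1).isMeasurableField]
  have h : IsTestClass g (fun x => ψ x + (-1) * η x) ((u - v : (laplacian g).domain) : L2 g) := by
    rw [Submodule.coe_sub]
    exact hu.sub hv
  rw [inner_laplacian g h h]
  simp only [gradInner, smoothGrad_sub g hu.1 hv.1]

theorem IsTestClass.fieldDist_ne_top {g : RMetric m X} {ψ η : X → ℝ} {u v : L2 g}
    (hu : IsTestClass g ψ u) (hv : IsTestClass g η v) :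
    fieldDist g (smoothGrad g ψ) (smoothGrad g η) ≠ ⊤ := by
  have h := integrable_metr_sub g (isWeakGradient_smoothGrad g hu.1).isMeasurableField
    (isWeakGradient_smoothGrad g hv.1).isMeasurableField hu.integrable_metr hv.integrable_metr
  have := h.2
  rw [hasFiniteIntegral_iff_ofReal (Eventually.of_forall fun x => metr_nonneg g x _)] at this
  exact this.ne

/-- A sequence of test functions that converges in `L²` and is Cauchy for the form converges in
`W^{1,2}`. -/
theorem exists_weakGradient_of_cauchy (g : RMetric m X) {u : L2 g} {s : ℕ → (laplacian g).domain}
    {ψ : ℕ → X → ℝ} (hψ : ∀ k, IsTestClass g (ψ k) (s k))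
    (hs : Tendsto (fun k => (s k : L2 g)) atTop (𝓝 u))
    (hc : ∀ ε > 0, ∃ K : ℕ, ∀ k ≥ K, ∀ l ≥ K,
      |⟪laplacian g (s k - s l), ((s k - s l : (laplacian g).domain) : L2 g)⟫_ℝ| < ε) :
    ∃ W : X → 𝔼, IsWeakGradient g u W ∧
      Integrable (fun x => metr g x (W x) (W x)) (riemVolume g) ∧
      Tendsto (fun k => ∫ x, metr g x (smoothGrad g (ψ k) x - W x)
        (smoothGrad g (ψ k) x - W x) ∂riemVolume g) atTop (𝓝 0) := by
  obtain ⟨W, hW, hd⟩ := exists_limit_weakGradient g (fun k => (hψ k).isWeakGradient) hs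
    fun ε hε => by
      by_cases hε' : ε = ⊤
      · exact ⟨0, fun k _ l _ => by simp [hε']⟩
      obtain ⟨K, hK⟩ := hc ε.toReal (ENNReal.toReal_pos hε.ne' hε')
      refine ⟨K, fun k hk l hl => ?_⟩
      have := hK k hk l hl
      rw [inner_laplacian_sub g (hψ k) (hψ l), abs_of_nonneg ENNReal.toReal_nonneg] at this
      exact ((ENNReal.toReal_lt_toReal ((hψ k).fieldDist_ne_top (hψ l)) hε').1 this).le
  have hWm := hW.isMeasurableField
  have hkm := fun k => (isWeakGradient_smoothGrad g (hψ k).1).isMeasurableField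
  refine ⟨W, hW, ?_, ?_⟩
  · obtain ⟨k, hk⟩ := (hd.eventually_lt_const (u := 1) one_pos).exists
    have h1 := integrable_metr_of_lintegral g ((hkm k).sub hWm)
      (lt_trans (show _ < (1 : ℝ≥0∞) from hk) ENNReal.one_lt_top)
    have h2 := integrable_metr_sub g (hkm k) ((hkm k).sub hWm) (hψ k).integrable_metr h1
    simpa using h2
  · have := (ENNReal.continuousAt_toReal ENNReal.zero_ne_top).tendsto.comp hd
    simp only [ENNReal.toReal_zero] at this
    refine this.congr fun k => ?_
    exact toReal_fieldDist g (hkm k) hWm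

theorem tendsto_integral_metr (g : RMetric m X) {V : ℕ → X → 𝔼} {W : X → 𝔼}
    (hV : ∀ k, IsMeasurableField g (V k)) (hW : IsMeasurableField g W)
    (hVi : ∀ k, Integrable (fun x => metr g x (V k x) (V k x)) (riemVolume g))
    (hWi : Integrable (fun x => metr g x (W x) (W x)) (riemVolume g))
    (h : Tendsto (fun k => ∫ x, metr g x (V k x - W x) (V k x - W x) ∂riemVolume g)
      atTop (𝓝 0)) :
    Tendsto (fun k => ∫ x, metr g x (V k x) (V k x) ∂riemVolume g) atTop
      (𝓝 (∫ x, metr g x (W x) (W x) ∂riemVolume g)) := by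
  rw [Metric.tendsto_atTop]
  intro ε hε
  let I := ∫ x, metr g x (W x) (W x) ∂riemVolume g
  have hI : 0 ≤ I := integral_nonneg fun x => metr_nonneg g x _
  -- In the Young inequality `abs_metr_sub_le` the term `δ I` must be below `ε / 2`; dividing by `I
  -- + 1` covers `I = 0`.
  let δ : ℝ := ε / (2 * (I + 1))
  have hδ : 0 < δ := by positivity
  have hδI : δ * I < ε / 2 := by
    have : δ * (I + 1) = ε / 2 := by
      simp only [δ]
      field_simp
    nlinarith
  have h2 : Tendsto (fun k => (1 + δ⁻¹) *
      ∫ x, metr g x (V k x - W x) (V k x - W x) ∂riemVolume g) atTop (𝓝 0) := by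
    simpa using h.const_mul (1 + δ⁻¹)
  obtain ⟨K, hK⟩ := (h2.eventually_lt_const (u := ε / 2) (by positivity)).exists_forall_of_atTop
  refine ⟨K, fun k hk => ?_⟩
  have hsub := integrable_metr_sub g (hV k) hW (hVi k) hWi
  rw [Real.dist_eq, ← integral_sub (hVi k) hWi]
  calc _ ≤ ∫ x, |metr g x (V k x) (V k x) - metr g x (W x) (W x)| ∂riemVolume g :=
        abs_integral_le_integral_abs
    _ ≤ ∫ x, (δ * metr g x (W x) (W x) + (1 + δ⁻¹) * metr g x (V k x - W x) (V k x - W x))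
          ∂riemVolume g :=
        integral_mono ((hVi k).sub hWi).abs ((hWi.const_mul _).add (hsub.const_mul _))
          fun x => abs_metr_sub_le g x _ _ hδ
    _ = δ * I + (1 + δ⁻¹) * ∫ x, metr g x (V k x - W x) (V k x - W x) ∂riemVolume g := by
        rw [integral_add (hWi.const_mul _) (hsub.const_mul _), integral_const_mul,
          integral_const_mul]
    _ < ε := by linarith [hK k hk]

/-- Identifies the closure of the form of the Laplacian with the Dirichlet integral, so that
`energy` can play the role of `q` in `friedrichs_spectral_theorem`. -/
theorem tendsto_form_energy (g : RMetric m X) (u : L2 g) (s : ℕ → (laplacian g).domain)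
    (hs : Tendsto (fun k => (s k : L2 g)) atTop (𝓝 u))
    (hc : ∀ ε > 0, ∃ K : ℕ, ∀ k ≥ K, ∀ l ≥ K,
      |⟪laplacian g (s k - s l), ((s k - s l : (laplacian g).domain) : L2 g)⟫_ℝ| < ε) :
    Tendsto (fun k => ⟪laplacian g (s k), (s k : L2 g)⟫_ℝ) atTop (𝓝 (energy g u)) := by
  choose ψ hψ using fun k => (mem_laplacian_domain g (s k)).1 (s k).2
  obtain ⟨W, hW, hWi, hd⟩ := exists_weakGradient_of_cauchy g hψ hs hc
  rw [energy_eq hW]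
  refine (tendsto_integral_metr g (fun k => (isWeakGradient_smoothGrad g (hψ k).1).isMeasurableField)
    hW.isMeasurableField (fun k => (hψ k).integrable_metr) hWi hd).congr fun k => ?_
  rw [inner_laplacian g (hψ k) (hψ k)]
  rfl

theorem mem_W12_of_mem_formDomain (g : RMetric m X) {u : L2 g}
    (hu : u ∈ formDomain (laplacian g)) : u ∈ W12 g := by
  obtain ⟨s, hs, hc⟩ := exists_seq_of_mem_formDomain _ (laplacian_symmetric g)
    (laplacian_nonneg g) hu
  choose ψ hψ using fun k => (mem_laplacian_domain g (s k)).1 (s k).2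
  obtain ⟨W, hW, hWi, -⟩ := exists_weakGradient_of_cauchy g hψ hs hc
  exact ⟨W, hW, hWi⟩

theorem mem_W12Zero_of_mem_formDomain (g : RMetric m X) {u : L2 g}
    (hu : u ∈ formDomain (laplacian g)) : u ∈ W12Zero g := by
  refine ⟨mem_W12_of_mem_formDomain g hu, fun ε hε => ?_⟩
  obtain ⟨s, hs, hc⟩ := exists_seq_of_mem_formDomain _ (laplacian_symmetric g)
    (laplacian_nonneg g) hu
  choose ψ hψ using fun k => (mem_laplacian_domain g (s k)).1 (s k).2
  obtain ⟨W, hW, hWi, hd⟩ := exists_weakGradient_of_cauchy g hψ hs hc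
  have h1 : Tendsto (fun k => ‖u - s k‖ ^ 2 + energy g (u - s k)) atTop (𝓝 0) := by
    have e1 : Tendsto (fun k => ‖u - s k‖ ^ 2) atTop (𝓝 0) := by
      have := (tendsto_iff_norm_sub_tendsto_zero.1 hs).pow 2
      simp_rw [norm_sub_rev u]
      simpa using this
    have e2 : Tendsto (fun k => energy g (u - s k)) atTop (𝓝 0) := by
      refine hd.congr fun k => ?_
      rw [energy_eq (hW.subL2 (hψ k).isWeakGradient)]
      simp only [metr_sub_comm g _ (W _)]
    simpa using e1.add e2
  obtain ⟨k, hk⟩ := (h1.eventually_lt_const hε).exists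
  exact ⟨ψ k, s k, hψ k, hk⟩

theorem mem_formDomain_of_mem_W12Zero (g : RMetric m X) {u : L2 g} (hu : u ∈ W12Zero g) :
    u ∈ formDomain (laplacian g) := by
  obtain ⟨⟨W', hW', hWi⟩, hε⟩ := hu
  let W : X → 𝔼 := W'
  have hW : IsWeakGradient g u W := hW'
  have hWi' : Integrable (fun x => metr g x (W x) (W x)) (riemVolume g) := hWi
  choose ψ v hv hlt using fun k : ℕ => hε (1 / ((k : ℝ) + 1)) Nat.one_div_pos_of_nat
  let s : ℕ → (laplacian g).domain := fun k => ⟨v k, (mem_laplacian_domain g _).2 ⟨ψ k, hv k⟩⟩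
  have hnn : ∀ k, 0 ≤ energy g (u - v k) := fun k => integral_nonneg fun x => metr_nonneg g x _
  refine Submodule.subset_span ⟨s, ?_, ?_⟩
  · rw [tendsto_iff_norm_sub_tendsto_zero]
    have h1 : Tendsto (fun k => ‖(s k : L2 g) - u‖ ^ 2) atTop (𝓝 0) := by
      refine squeeze_zero (fun k => sq_nonneg _) (fun k => ?_) tendsto_one_div_add_atTop_nhds_zero_nat
      rw [norm_sub_rev]
      have := hlt k
      have := hnn k
      change ‖u - v k‖ ^ 2 ≤ _
      linarith
    have h2 := h1.sqrt
    simpa using h2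
  · intro ε hε
    -- The energy of a difference of two approximants is at most twice the sum of their energy
    -- distances to `u`, whence `ε / 4`.
    obtain ⟨K, hK⟩ := exists_nat_one_div_lt (show 0 < ε / 4 by positivity)
    have hsmall : ∀ k ≥ K, energy g (u - v k) < ε / 4 := by
      intro k hk
      have h1 : (1 : ℝ) / ((k : ℝ) + 1) ≤ 1 / ((K : ℝ) + 1) := by gcongr
      have := hlt k
      nlinarith [sq_nonneg ‖u - v k‖]
    refine ⟨K, fun k hk l hl => ?_⟩
    have hm := fun k => (isWeakGradient_smoothGrad g (hv k).1).isMeasurableField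
    have hen : ∀ k, energy g (u - v k) = ∫ x, metr g x (W x - smoothGrad g (ψ k) x)
        (W x - smoothGrad g (ψ k) x) ∂riemVolume g := fun k =>
      energy_eq (hW.subL2 (hv k).isWeakGradient)
    have hi := fun k => integrable_metr_sub g hW.isMeasurableField (hm k) hWi' (hv k).integrable_metr
    rw [inner_laplacian_sub g (u := s k) (v := s l) (hv k) (hv l), toReal_fieldDist g (hm k) (hm l),
      abs_of_nonneg (integral_nonneg fun x => metr_nonneg g x _)]
    calc _ ≤ ∫ x, (2 * metr g x (W x - smoothGrad g (ψ k) x) (W x - smoothGrad g (ψ k) x) +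
          2 * metr g x (W x - smoothGrad g (ψ l) x) (W x - smoothGrad g (ψ l) x))
            ∂riemVolume g := by
          refine integral_mono (integrable_metr_sub g (hm k) (hm l) (hv k).integrable_metr
            (hv l).integrable_metr) (((hi k).const_mul 2).add ((hi l).const_mul 2)) fun x => ?_
          have := metr_add_le g x (smoothGrad g (ψ k) x - W x) (W x - smoothGrad g (ψ l) x)
          rw [sub_add_sub_cancel, metr_sub_comm g x _ (W x)] at this
          exact this
      _ = 2 * energy g (u - v k) + 2 * energy g (u - v l) := by
          rw [integral_add ((hi k).const_mul 2) ((hi l).const_mul 2), integral_const_mul,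
            integral_const_mul, hen, hen]
      _ < ε := by linarith [hsmall k hk, hsmall l hl]

theorem coe_formDomain (g : RMetric m X) :
    (formDomain (laplacian g) : Set (L2 g)) = W12Zero g :=
  Subset.antisymm (fun _ hu => mem_W12Zero_of_mem_formDomain g hu)
    fun _ hu => mem_formDomain_of_mem_W12Zero g hu

end FormDomain

/-! ### Charts of an open submanifold -/

section Opens

open TopologicalSpace (Opens)

variable {m : ℕ} {M : Type*} [TopologicalSpace M] [ChartedSpace (EuclideanSpace ℝ (Fin m)) M]
  [IsManifold (𝓡 m) ∞ M]

local notation "𝔼" => EuclideanSpace ℝ (Fin m)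

variable {e : OpenPartialHomeomorph M (EuclideanSpace ℝ (Fin m))} {O : Opens M} (hO : Nonempty O)

theorem restr_mem_maximalAtlas (he : e ∈ IsManifold.maximalAtlas (𝓡 m) ∞ M) :
    e.subtypeRestr hO ∈ IsManifold.maximalAtlas (𝓡 m) ∞ O := by
  intro e' he'
  obtain ⟨x, rfl⟩ := Opens.chart_eq hO he'
  have hx : chartAt 𝔼 (x : M) ∈ (contDiffGroupoid ∞ (𝓡 m)).maximalAtlas M :=
    StructureGroupoid.chart_mem_maximalAtlas _ _
  have key : ∀ f f' : OpenPartialHomeomorph M 𝔼, f ∈ (contDiffGroupoid ∞ (𝓡 m)).maximalAtlas M →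
      f' ∈ (contDiffGroupoid ∞ (𝓡 m)).maximalAtlas M →
      (f.subtypeRestr hO).symm.trans (f'.subtypeRestr hO) ∈ contDiffGroupoid ∞ (𝓡 m) := by
    intro f f' hf hf'
    refine (contDiffGroupoid ∞ (𝓡 m)).mem_of_eqOnSource ?_
      (OpenPartialHomeomorph.subtypeRestr_symm_trans_subtypeRestr hO f f')
    exact closedUnderRestriction'
      (StructureGroupoid.compatible_of_mem_maximalAtlas hf hf') (f.isOpen_inter_preimage_symm O.2)
  exact ⟨key _ _ he hx, key _ _ hx he⟩

theorem mem_restr_target {y : 𝔼} :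
    y ∈ (e.subtypeRestr hO).target ↔ y ∈ e.target ∧ e.symm y ∈ O := by
  rw [OpenPartialHomeomorph.subtypeRestr_def, OpenPartialHomeomorph.trans_target,
    O.openPartialHomeomorphSubtypeCoe_target]
  rfl

theorem coe_restr_symm {y : 𝔼} (hy : y ∈ (e.subtypeRestr hO).target) :
    (((e.subtypeRestr hO).symm y : O) : M) = e.symm y :=
  e.subtypeRestr_symm_apply hO hy

theorem mem_restr_source {x : O} : x ∈ (e.subtypeRestr hO).source ↔ (x : M) ∈ e.source := by
  rw [OpenPartialHomeomorph.subtypeRestr_source]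
  rfl

theorem restr_apply (x : O) : e.subtypeRestr hO x = e x := rfl

/-- The differential of the inclusion of an open submanifold. -/
def inclD (p : O) : 𝔼 →L[ℝ] 𝔼 := mfderiv (𝓡 m) (𝓡 m) (Subtype.val : O → M) p

/-- The inclusion carries the coordinate vectors of the restricted chart to those of `e`. Hence
block conditions stated on vectors of `M` can be read in the Gram matrix of `gt`. -/
theorem inclD_chartD (he : e ∈ IsManifold.maximalAtlas (𝓡 m) ∞ M) {y : 𝔼}
    (hy : y ∈ (e.subtypeRestr hO).target) (v : 𝔼) :
    inclD ((e.subtypeRestr hO).symm y) (chartD (e.subtypeRestr hO) y v) = chartD e y v := by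
  have h1 : e.symm =ᶠ[𝓝 y] Subtype.val ∘ (e.subtypeRestr hO).symm := by
    filter_upwards [(e.subtypeRestr hO).open_target.mem_nhds hy] with z hz
    exact (coe_restr_symm hO hz).symm
  have h2 : MDifferentiableAt (𝓡 m) (𝓡 m) (Subtype.val : O → M) ((e.subtypeRestr hO).symm y) :=
    (contMDiff_subtype_val (n := ∞)).mdifferentiableAt (by simp)
  have h3 : MDifferentiableAt (𝓡 m) (𝓡 m) (e.subtypeRestr hO).symm y :=
    (chart_mdifferentiable (restr_mem_maximalAtlas hO he)).mdifferentiableAt_symm hy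
  have h4 := mfderiv_comp y h2 h3
  have h5 : (chartD e y : 𝔼 →L[ℝ] 𝔼) = (inclD ((e.subtypeRestr hO).symm y)).comp
      (chartD (e.subtypeRestr hO) y) := by
    unfold chartD
    rw [h1.mfderiv_eq]
    exact h4
  rw [h5]
  rfl

end Opens

/-! ### The rescaled metric in adapted coordinates -/

section Gram

variable {m : ℕ} {X : Type*} [TopologicalSpace X] [ChartedSpace (EuclideanSpace ℝ (Fin m)) X]
  [IsManifold (𝓡 m) ∞ X]

local notation "𝔼" => EuclideanSpace ℝ (Fin m)

theorem gramIn_apply (g : RMetric m X) (e : OpenPartialHomeomorph X 𝔼) (y : 𝔼) (i j : Fin m) :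
    gramIn g e y i j = metr g (e.symm y) (chartD e y (stdVec i)) (chartD e y (stdVec j)) := rfl

theorem gramIn_symm (g : RMetric m X) (e : OpenPartialHomeomorph X 𝔼) (y : 𝔼) (i j : Fin m) :
    gramIn g e y i j = gramIn g e y j i := by
  rw [gramIn_apply, gramIn_apply, metr_symm]

end Gram

section Rescaling

variable {m n : ℕ} {M : Type*} [TopologicalSpace M] [ChartedSpace (EuclideanSpace ℝ (Fin m)) M]
  [IsManifold (𝓡 m) ∞ M]

local notation "𝔼" => EuclideanSpace ℝ (Fin m)

/-- The factor `F` on the coordinates `x` and `1` on the coordinates `y`. -/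
def scale (m n : ℕ) (F : ℝ) (i : Fin m) : ℝ := if (i : ℕ) + n < m then F else 1

theorem prod_scale (F : ℝ) : ∏ i : Fin m, scale m n F i = F ^ (m - n) := by
  unfold scale
  rw [Finset.prod_ite, Finset.prod_const, Finset.prod_const_one, mul_one]
  congr 1
  have h : (Finset.univ.filter fun i : Fin m => (i : ℕ) + n < m) =
      Finset.univ.filter fun i : Fin m => (i : ℕ) < m - n := by
    ext i
    simp only [Finset.mem_filter]
    constructor <;> intro h <;> refine ⟨h.1, ?_⟩ <;> have := h.2 <;> omega
  rw [h, Fin.card_filter_val_lt]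
  omega

theorem chartDInv_chartD_stdVec {e : OpenPartialHomeomorph M 𝔼}
    (he : e ∈ IsManifold.maximalAtlas (𝓡 m) ∞ M) {y : 𝔼} (hy : y ∈ e.target) {i j : Fin m}
    (hij : i ≠ j) : chartDInv e (e.symm y) (chartD e y (stdVec i)) j = 0 := by
  rw [chartDInv_chartD he hy]
  simp [stdVec, hij.symm]

variable [T2Space M]

theorem IsBlockRescaling.metr_eq {g : RMetric m M} {N : Set M} {hN : IsCompact N}
    {𝒜 : Set (OpenPartialHomeomorph M 𝔼)} {gt : RMetric m (puncture N hN)} {f : M → ℝ} {U : Set M}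
    (hgt : IsBlockRescaling g N hN n 𝒜 gt f U) {e : OpenPartialHomeomorph M 𝔼} (heA : e ∈ 𝒜)
    {p : puncture N hN} (hp : (p : M) ∈ e.source) (hpU : (p : M) ∈ U) (v w : 𝔼) :
    ((∀ i : Fin m, m ≤ i + n → chartDInv e (p : M) (inclD p v) i = 0) →
      (∀ i : Fin m, m ≤ i + n → chartDInv e (p : M) (inclD p w) i = 0) →
      metr gt p v w = f p ^ 2 * metr g (p : M) (inclD p v) (inclD p w)) ∧
    ((∀ i : Fin m, i + n < m → chartDInv e (p : M) (inclD p v) i = 0) →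
      (∀ i : Fin m, i + n < m → chartDInv e (p : M) (inclD p w) i = 0) →
      metr gt p v w = metr g (p : M) (inclD p v) (inclD p w)) ∧
    ((∀ i : Fin m, m ≤ i + n → chartDInv e (p : M) (inclD p v) i = 0) →
      (∀ i : Fin m, i + n < m → chartDInv e (p : M) (inclD p w) i = 0) →
      metr gt p v w = 0) :=
  hgt e heA p hp hpU v w

theorem IsDiagonalizedNear.metr_eq_zero {g : RMetric m M} {N : Set M}
    {𝒜 : Set (OpenPartialHomeomorph M 𝔼)} (h𝒜 : IsDiagonalizedNear g N n 𝒜)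
    {e : OpenPartialHomeomorph M 𝔼} (heA : e ∈ 𝒜) {p : M} (hp : p ∈ e.source) (v w : 𝔼)
    (hv : ∀ i : Fin m, m ≤ i + n → chartDInv e p v i = 0)
    (hw : ∀ i : Fin m, i + n < m → chartDInv e p w i = 0) : metr g p v w = 0 :=
  h𝒜.block e heA p hp v w hv hw

/-- Every coordinate vector of an adapted chart is an `x`-vector or a `y`-vector, so the block
conditions give all entries. The mixed entries vanish for both metrics, which is why one formula
covers all four cases. -/
theorem gramIn_rescaling {g : RMetric m M} {N : Set M} {hN : IsCompact N}
    {𝒜 : Set (OpenPartialHomeomorph M 𝔼)} (h𝒜 : IsDiagonalizedNear g N n 𝒜)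
    {gt : RMetric m (puncture N hN)} {f : M → ℝ} {U : Set M}
    (hgt : IsBlockRescaling g N hN n 𝒜 gt f U) (hO : Nonempty (puncture N hN))
    {e : OpenPartialHomeomorph M 𝔼} (heA : e ∈ 𝒜) {y : 𝔼}
    (hy : y ∈ (e.subtypeRestr hO).target) (hU : e.symm y ∈ U) (i j : Fin m) :
    gramIn gt (e.subtypeRestr hO) y i j =
      scale m n (f (e.symm y)) i * gramIn g e y i j * scale m n (f (e.symm y)) j := by
  have he := h𝒜.mem_maximalAtlas e heA
  have hyt := (mem_restr_target hO).1 hy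
  have hc := coe_restr_symm hO hy
  have key := fun i j : Fin m => hgt.metr_eq heA (p := (e.subtypeRestr hO).symm y)
    (by rw [hc]; exact e.map_target hyt.1) (by rwa [hc]) (chartD (e.subtypeRestr hO) y (stdVec i))
    (chartD (e.subtypeRestr hO) y (stdVec j))
  simp only [inclD_chartD hO he hy, hc] at key
  have hvec : ∀ i j : Fin m, i ≠ j → chartDInv e (e.symm y) (chartD e y (stdVec i)) j = 0 :=
    fun i j hij => chartDInv_chartD_stdVec he hyt.1 hij
  have hX : ∀ i : Fin m, (i : ℕ) + n < m → ∀ k : Fin m, m ≤ k + n →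
      chartDInv e (e.symm y) (chartD e y (stdVec i)) k = 0 := fun i hi k hk =>
    hvec i k (by rintro rfl; omega)
  have hY : ∀ i : Fin m, ¬ (i : ℕ) + n < m → ∀ k : Fin m, k + n < m →
      chartDInv e (e.symm y) (chartD e y (stdVec i)) k = 0 := fun i hi k hk =>
    hvec i k (by rintro rfl; exact hi hk)
  have hg0 : ∀ i j : Fin m, (i : ℕ) + n < m → ¬ (j : ℕ) + n < m → gramIn g e y i j = 0 :=
    fun i j hi hj => by
      rw [gramIn_apply]
      exact h𝒜.metr_eq_zero heA (e.map_target hyt.1) _ _ (hX i hi) (hY j hj)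
  have hgt0 : ∀ i j : Fin m, (i : ℕ) + n < m → ¬ (j : ℕ) + n < m →
      gramIn gt (e.subtypeRestr hO) y i j = 0 :=
    fun i j hi hj => by
      rw [gramIn_apply]
      exact (key i j).2.2 (hX i hi) (hY j hj)
  unfold scale
  by_cases hi : (i : ℕ) + n < m <;> by_cases hj : (j : ℕ) + n < m
  · have h' : gramIn gt (e.subtypeRestr hO) y i j = f (e.symm y) ^ 2 * gramIn g e y i j := by
      rw [gramIn_apply, gramIn_apply]
      exact (key i j).1 (hX i hi) (hX j hj)
    rw [h', if_pos hi, if_pos hj]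
    ring
  · rw [hgt0 i j hi hj, hg0 i j hi hj, mul_zero, zero_mul]
  · rw [gramIn_symm gt, gramIn_symm g, hgt0 j i hj hi, hg0 j i hj hi, mul_zero, zero_mul]
  · have h' : gramIn gt (e.subtypeRestr hO) y i j = gramIn g e y i j := by
      rw [gramIn_apply, gramIn_apply]
      exact (key i j).2.1 (hY i hi) (hY j hj)
    rw [h', if_neg hi, if_neg hj]
    ring

theorem gramIn_rescaling_eq {g : RMetric m M} {N : Set M} {hN : IsCompact N}
    {𝒜 : Set (OpenPartialHomeomorph M 𝔼)} (h𝒜 : IsDiagonalizedNear g N n 𝒜)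
    {gt : RMetric m (puncture N hN)} {f : M → ℝ} {U : Set M}
    (hgt : IsBlockRescaling g N hN n 𝒜 gt f U) (hO : Nonempty (puncture N hN))
    {e : OpenPartialHomeomorph M 𝔼} (heA : e ∈ 𝒜) {y : 𝔼}
    (hy : y ∈ (e.subtypeRestr hO).target) (hU : e.symm y ∈ U) :
    gramIn gt (e.subtypeRestr hO) y = Matrix.diagonal (scale m n (f (e.symm y))) * gramIn g e y *
      Matrix.diagonal (scale m n (f (e.symm y))) := by
  ext i j
  rw [Matrix.mul_diagonal, Matrix.diagonal_mul, gramIn_rescaling h𝒜 hgt hO heA hy hU]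

theorem densIn_rescaling {g : RMetric m M} {N : Set M} {hN : IsCompact N}
    {𝒜 : Set (OpenPartialHomeomorph M 𝔼)} (h𝒜 : IsDiagonalizedNear g N n 𝒜)
    {gt : RMetric m (puncture N hN)} {f : M → ℝ} {U : Set M}
    (hgt : IsBlockRescaling g N hN n 𝒜 gt f U) (hO : Nonempty (puncture N hN))
    {e : OpenPartialHomeomorph M 𝔼} (heA : e ∈ 𝒜) {y : 𝔼}
    (hy : y ∈ (e.subtypeRestr hO).target) (hU : e.symm y ∈ U) :
    densIn gt (e.subtypeRestr hO) y = |f (e.symm y)| ^ (m - n) * densIn g e y := by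
  rw [densIn, gramIn_rescaling_eq h𝒜 hgt hO heA hy hU, Matrix.det_mul, Matrix.det_mul,
    Matrix.det_diagonal, prod_scale, mul_right_comm, ← sq, Real.sqrt_mul (sq_nonneg _),
    Real.sqrt_sq_eq_abs, abs_pow]
  rfl

/-- The density of `gt` is positive and contains the factor `|f| ^ (m - n)` with a positive
exponent. -/
theorem rescaling_ne_zero {g : RMetric m M} {N : Set M} {hN : IsCompact N}
    {𝒜 : Set (OpenPartialHomeomorph M 𝔼)} (h𝒜 : IsDiagonalizedNear g N n 𝒜)
    {gt : RMetric m (puncture N hN)} {f : M → ℝ} {U : Set M} (hmn : n < m)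
    (hgt : IsBlockRescaling g N hN n 𝒜 gt f U) (hO : Nonempty (puncture N hN))
    {e : OpenPartialHomeomorph M 𝔼} (heA : e ∈ 𝒜) {y : 𝔼}
    (hy : y ∈ (e.subtypeRestr hO).target) (hU : e.symm y ∈ U) : f (e.symm y) ≠ 0 := by
  intro h0
  have h := densIn_pos gt (restr_mem_maximalAtlas hO (h𝒜.mem_maximalAtlas e heA)) hy
  rw [densIn_rescaling h𝒜 hgt hO heA hy hU, h0, abs_zero, zero_pow (by omega), zero_mul] at h
  exact h.ne rfl

theorem cometrIn_rescaling {g : RMetric m M} {N : Set M} {hN : IsCompact N}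
    {𝒜 : Set (OpenPartialHomeomorph M 𝔼)} (h𝒜 : IsDiagonalizedNear g N n 𝒜)
    {gt : RMetric m (puncture N hN)} {f : M → ℝ} {U : Set M} (hmn : n < m)
    (hgt : IsBlockRescaling g N hN n 𝒜 gt f U) (hO : Nonempty (puncture N hN))
    {e : OpenPartialHomeomorph M 𝔼} (heA : e ∈ 𝒜) {y : 𝔼}
    (hy : y ∈ (e.subtypeRestr hO).target) (hU : e.symm y ∈ U) (l l' : 𝔼 →L[ℝ] ℝ) :
    cometrIn gt (e.subtypeRestr hO) y l l' = ∑ i, ∑ j, (gramIn g e y)⁻¹ i j *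
      ((scale m n (f (e.symm y)) j)⁻¹ * l (stdVec j)) *
      ((scale m n (f (e.symm y)) i)⁻¹ * l' (stdVec i)) := by
  have hF := rescaling_ne_zero h𝒜 hmn hgt hO heA hy hU
  have hs : ∀ i, scale m n (f (e.symm y)) i ≠ 0 := fun i => by
    unfold scale
    split_ifs
    · exact hF
    · exact one_ne_zero
  have hD : (Matrix.diagonal (scale m n (f (e.symm y))))⁻¹ =
      Matrix.diagonal (fun i => (scale m n (f (e.symm y)) i)⁻¹) := by
    refine Matrix.inv_eq_right_inv ?_
    rw [Matrix.diagonal_mul_diagonal, ← Matrix.diagonal_one]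
    congr 1
    ext i
    exact mul_inv_cancel₀ (hs i)
  unfold cometrIn
  rw [gramIn_rescaling_eq h𝒜 hgt hO heA hy hU, Matrix.mul_inv_rev, Matrix.mul_inv_rev, hD]
  refine Finset.sum_congr rfl fun i _ => Finset.sum_congr rfl fun j _ => ?_
  rw [← Matrix.mul_assoc, Matrix.mul_diagonal, Matrix.diagonal_mul]
  ring

end Rescaling

/-! ### Uniform bounds on compact subsets of a chart -/

section Bounds

variable {m : ℕ} {X : Type*} [TopologicalSpace X] [ChartedSpace (EuclideanSpace ℝ (Fin m)) X]
  [IsManifold (𝓡 m) ∞ X]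

local notation "𝔼" => EuclideanSpace ℝ (Fin m)

variable {e : OpenPartialHomeomorph X (EuclideanSpace ℝ (Fin m))}

/-- The linear form with the given coefficients. -/
def coeffForm (a : Fin m → ℝ) : 𝔼 →L[ℝ] ℝ := ∑ i, a i • (EuclideanSpace.proj i : 𝔼 →L[ℝ] ℝ)

theorem coeffForm_stdVec (a : Fin m → ℝ) (i : Fin m) : coeffForm a (stdVec i) = a i := by
  simp [coeffForm, stdVec]

theorem sq_coeff_le_cometrIn (g : RMetric m X) (he : e ∈ IsManifold.maximalAtlas (𝓡 m) ∞ X)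
    {y : 𝔼} (hy : y ∈ e.target) (l : 𝔼 →L[ℝ] ℝ) (i : Fin m) :
    l (stdVec i) ^ 2 ≤ gramIn g e y i i * cometrIn g e y l l := by
  let v := gradAt (metrIn g e y) l
  have hv : ∀ w, metrIn g e y v w = l w :=
    bilin_gradAt _ (metrIn_symm g e y) (fun _ => metrIn_pos g he hy) l
  have h1 : cometrIn g e y l l = metrIn g e y v v := by
    rw [hv, linearForm_eq_sum l, cometrIn]
    simp only [v, gradAt, Matrix.mulVec, dotProduct, Finset.sum_mul]
    rfl
  rw [h1, ← hv, mul_comm]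
  exact metr_cauchy_schwarz _ _ _ _

/-- Cauchy–Schwarz bounds each coefficient by `a_i² ≤ g_ii |a|²`, with the dual norm on the right.
The trace of the Gram matrix is bounded on compact sets. -/
theorem exists_cometrIn_lower (g : RMetric m X) (he : e ∈ IsManifold.maximalAtlas (𝓡 m) ∞ X)
    {K : Set 𝔼} (hK : IsCompact K) (hKe : K ⊆ e.target) :
    ∃ C : ℝ, 0 < C ∧ ∀ y ∈ K, ∀ a : Fin m → ℝ,
      ∑ i, a i ^ 2 ≤ C * ∑ i, ∑ j, (gramIn g e y)⁻¹ i j * a j * a i := by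
  obtain ⟨b, hb⟩ := hK.exists_bound_of_continuousOn (f := fun y => ∑ i, gramIn g e y i i)
    (continuousOn_finsetSum _ fun i _ => (contDiffOn_gramIn g he i i).continuousOn.mono hKe)
  refine ⟨|b| + 1, by positivity, fun y hy a => ?_⟩
  have h1 : cometrIn g e y (coeffForm a) (coeffForm a) =
      ∑ i, ∑ j, (gramIn g e y)⁻¹ i j * a j * a i := by
    simp only [cometrIn, coeffForm_stdVec]
  have h2 : ∀ i, a i ^ 2 ≤ gramIn g e y i i * cometrIn g e y (coeffForm a) (coeffForm a) :=
    fun i => by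
      have := sq_coeff_le_cometrIn g he (hKe hy) (coeffForm a) i
      rwa [coeffForm_stdVec] at this
  rw [← h1]
  have h3 : 0 ≤ cometrIn g e y (coeffForm a) (coeffForm a) := by
    by_contra hneg
    push Not at hneg
    rcases isEmpty_or_nonempty (Fin m) with hm | ⟨⟨i⟩⟩
    · simp [cometrIn] at hneg
    · have hp : 0 < gramIn g e y i i := metrIn_pos g he (hKe hy) (by simp [stdVec])
      nlinarith [h2 i, sq_nonneg (a i)]
  calc ∑ i, a i ^ 2 ≤ ∑ i, gramIn g e y i i * cometrIn g e y (coeffForm a) (coeffForm a) :=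
        Finset.sum_le_sum fun i _ => h2 i
    _ = (∑ i, gramIn g e y i i) * cometrIn g e y (coeffForm a) (coeffForm a) := by
        rw [Finset.sum_mul]
    _ ≤ _ := by
        refine mul_le_mul_of_nonneg_right ?_ h3
        have := (le_abs_self _).trans (hb y hy)
        have := le_abs_self b
        linarith

theorem exists_cometrIn_upper (g : RMetric m X) (he : e ∈ IsManifold.maximalAtlas (𝓡 m) ∞ X)
    {K : Set 𝔼} (hK : IsCompact K) (hKe : K ⊆ e.target) :
    ∃ C : ℝ, 0 < C ∧ ∀ y ∈ K, ∀ a : Fin m → ℝ,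
      ∑ i, ∑ j, (gramIn g e y)⁻¹ i j * a j * a i ≤ C * ∑ i, a i ^ 2 := by
  obtain ⟨b, hb⟩ := hK.exists_bound_of_continuousOn
    (f := fun y => ∑ i, ∑ j, |(gramIn g e y)⁻¹ i j|)
    (continuousOn_finsetSum _ fun i _ => continuousOn_finsetSum _ fun j _ =>
      ((contDiffOn_inv_gramIn g he i j).continuousOn.mono hKe).abs)
  refine ⟨|b| + 1, by positivity, fun y hy a => ?_⟩
  have hnn : 0 ≤ ∑ i, a i ^ 2 := Finset.sum_nonneg fun i _ => sq_nonneg _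
  calc ∑ i, ∑ j, (gramIn g e y)⁻¹ i j * a j * a i
      ≤ ∑ i, ∑ j, |(gramIn g e y)⁻¹ i j| * ∑ k, a k ^ 2 := by
        refine Finset.sum_le_sum fun i _ => Finset.sum_le_sum fun j _ => ?_
        rw [mul_assoc]
        refine (le_abs_self _).trans ?_
        rw [abs_mul]
        refine mul_le_mul_of_nonneg_left ?_ (abs_nonneg _)
        have hi : a i ^ 2 ≤ ∑ k, a k ^ 2 :=
          Finset.single_le_sum (f := fun k => a k ^ 2) (fun k _ => sq_nonneg _) (Finset.mem_univ i)
        have hj : a j ^ 2 ≤ ∑ k, a k ^ 2 :=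
          Finset.single_le_sum (f := fun k => a k ^ 2) (fun k _ => sq_nonneg _) (Finset.mem_univ j)
        rw [abs_le]
        constructor <;> nlinarith [sq_nonneg (a j - a i), sq_nonneg (a j + a i)]
    _ = (∑ i, ∑ j, |(gramIn g e y)⁻¹ i j|) * ∑ k, a k ^ 2 := by
        simp only [Finset.sum_mul]
    _ ≤ _ := by
        refine mul_le_mul_of_nonneg_right ?_ hnn
        have := (le_abs_self _).trans (hb y hy)
        have := le_abs_self b
        linarith

end Bounds

/-! ### Cutoff functions around a coordinate plane -/

section Cutoff

variable {m : ℕ}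

local notation "𝔼" => EuclideanSpace ℝ (Fin m)

/-- The squared distance to the plane `x = 0`. -/
def planeDistSq (n : ℕ) (y : 𝔼) : ℝ := ∑ i : Fin m, if (i : ℕ) + n < m then y i ^ 2 else 0

/-- A cutoff function that is `1` near the plane `x = 0` and `0` where `|x|² ≥ 2 / J²`. -/
def planeCutoff (n : ℕ) (J : ℝ) (y : 𝔼) : ℝ :=
  Real.smoothTransition (2 - J ^ 2 * planeDistSq n y)

theorem planeDistSq_nonneg (n : ℕ) (y : 𝔼) : 0 ≤ planeDistSq n y :=
  Finset.sum_nonneg fun i _ => by split_ifs <;> positivity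

theorem planeDistSq_eq_zero_iff {n : ℕ} {y : 𝔼} :
    planeDistSq n y = 0 ↔ ∀ i : Fin m, (i : ℕ) + n < m → y i = 0 := by
  unfold planeDistSq
  rw [Finset.sum_eq_zero_iff_of_nonneg fun i _ => by split_ifs <;> positivity]
  refine forall_congr' fun i => ?_
  by_cases h : (i : ℕ) + n < m <;> simp [h]

theorem sq_le_planeDistSq {n : ℕ} (y : 𝔼) {i : Fin m} (hi : (i : ℕ) + n < m) :
    y i ^ 2 ≤ planeDistSq n y := by
  have := Finset.single_le_sum (f := fun i : Fin m => if (i : ℕ) + n < m then y i ^ 2 else 0)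
    (fun i _ => by dsimp only; split_ifs <;> positivity) (Finset.mem_univ i)
  simp only [hi, if_true] at this
  exact this

theorem contDiff_planeDistSq (n : ℕ) : ContDiff ℝ ∞ (planeDistSq n : 𝔼 → ℝ) := by
  refine ContDiff.sum fun i _ => ?_
  by_cases h : (i : ℕ) + n < m
  · simp only [h, if_true]
    exact (contDiff_euclidean.1 contDiff_id i).pow 2
  · simp only [h, if_false]
    exact contDiff_const

theorem contDiff_planeCutoff (n : ℕ) (J : ℝ) : ContDiff ℝ ∞ (planeCutoff n J : 𝔼 → ℝ) :=
  Real.smoothTransition.contDiff.comp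
    (contDiff_const.sub (contDiff_const.mul (contDiff_planeDistSq n)))

theorem fderiv_planeDistSq (n : ℕ) (y : 𝔼) (i : Fin m) :
    fderiv ℝ (planeDistSq n : 𝔼 → ℝ) y (stdVec i) = if (i : ℕ) + n < m then 2 * y i else 0 := by
  have h : HasFDerivAt (planeDistSq n : 𝔼 → ℝ)
      (∑ j : Fin m, if (j : ℕ) + n < m then
        (2 * y j) • (EuclideanSpace.proj j : 𝔼 →L[ℝ] ℝ) else 0) y := by
    unfold planeDistSq
    refine HasFDerivAt.fun_sum fun j _ => ?_
    by_cases hj : (j : ℕ) + n < m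
    · simp only [hj, if_true]
      have h1 : HasFDerivAt (fun y : 𝔼 => y j) (EuclideanSpace.proj j : 𝔼 →L[ℝ] ℝ) y :=
        (EuclideanSpace.proj j : 𝔼 →L[ℝ] ℝ).hasFDerivAt
      simpa using h1.pow 2
    · simp only [hj, if_false]
      exact hasFDerivAt_const _ _
  rw [h.fderiv, _root_.sum_apply]
  rw [Finset.sum_eq_single i]
  · split_ifs <;> simp [stdVec]
  · intro j _ hj
    split_ifs <;> simp [stdVec, hj]
  · simp

theorem fderiv_planeCutoff (n : ℕ) (J : ℝ) (y : 𝔼) (i : Fin m) :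
    fderiv ℝ (planeCutoff n J : 𝔼 → ℝ) y (stdVec i) =
      deriv Real.smoothTransition (2 - J ^ 2 * planeDistSq n y) *
        -(J ^ 2 * if (i : ℕ) + n < m then 2 * y i else 0) := by
  have h0 : DifferentiableAt ℝ (planeDistSq n : 𝔼 → ℝ) y :=
    (contDiff_planeDistSq n).differentiable (by simp) y
  have h1 : HasFDerivAt (fun y : 𝔼 => 2 - J ^ 2 * planeDistSq n y)
      (-(J ^ 2 • fderiv ℝ (planeDistSq n : 𝔼 → ℝ) y)) y :=
    (h0.hasFDerivAt.const_mul _).const_sub _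
  have h2 : HasDerivAt Real.smoothTransition _ (2 - J ^ 2 * planeDistSq n y) :=
    ((Real.smoothTransition.contDiff (n := 1)).differentiable (by simp) _).hasDerivAt
  have h3 := h2.comp_hasFDerivAt y h1
  have h4 : fderiv ℝ (planeCutoff n J : 𝔼 → ℝ) y = _ := h3.fderiv
  rw [h4, ← fderiv_planeDistSq]
  simp

/-- With `ρ` the distance to the plane, the squared gradient is `4 J² (J² ρ²)` times the square of
the derivative of the transition function. Where the gradient can be nonzero, `J² ρ² ≤ 2`, whence
the constant `8 b²`. -/
theorem exists_fderiv_planeCutoff_le (n : ℕ) :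
    ∃ L : ℝ, 0 ≤ L ∧ ∀ J : ℝ, 0 < J → ∀ y : 𝔼,
      ∑ i, fderiv ℝ (planeCutoff n J : 𝔼 → ℝ) y (stdVec i) ^ 2 ≤
        L * J ^ 2 * {y : 𝔼 | planeDistSq n y ≤ 2 / J ^ 2}.indicator 1 y := by
  have hc : Continuous (deriv Real.smoothTransition) :=
    (Real.smoothTransition.contDiff (n := 1)).continuous_deriv le_rfl
  obtain ⟨b, hb⟩ := (isCompact_Icc (a := (0 : ℝ)) (b := 2)).exists_bound_of_continuousOn
    hc.continuousOn
  refine ⟨8 * b ^ 2, by positivity, fun J hJ y => ?_⟩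
  by_cases hy : planeDistSq n y ≤ 2 / J ^ 2
  · rw [indicator_of_mem (show y ∈ {y : 𝔼 | planeDistSq n y ≤ 2 / J ^ 2} from hy)]
    have h1 : J ^ 2 * planeDistSq n y ≤ 2 := by
      rw [le_div_iff₀ (by positivity)] at hy
      linarith
    have h2 : 0 ≤ J ^ 2 * planeDistSq n y := mul_nonneg (by positivity) (planeDistSq_nonneg n y)
    have h3 := hb (2 - J ^ 2 * planeDistSq n y) ⟨by linarith, by linarith⟩
    have h4 : deriv Real.smoothTransition (2 - J ^ 2 * planeDistSq n y) ^ 2 ≤ b ^ 2 := by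
      rw [← sq_abs]
      exact pow_le_pow_left₀ (abs_nonneg _) h3 2
    have h5 : ∑ i, fderiv ℝ (planeCutoff n J : 𝔼 → ℝ) y (stdVec i) ^ 2 =
        deriv Real.smoothTransition (2 - J ^ 2 * planeDistSq n y) ^ 2 *
          (4 * J ^ 2 * (J ^ 2 * planeDistSq n y)) := by
      unfold planeDistSq
      simp only [Finset.mul_sum]
      refine Finset.sum_congr rfl fun i _ => ?_
      rw [fderiv_planeCutoff]
      unfold planeDistSq
      split_ifs <;> simp only [Finset.mul_sum] <;> ring
    rw [h5]
    calc _ ≤ b ^ 2 * (4 * J ^ 2 * 2) := by gcongr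
      _ = _ := by simp only [Pi.one_apply]; ring
  · rw [indicator_of_notMem (show y ∉ {y : 𝔼 | planeDistSq n y ≤ 2 / J ^ 2} from hy), mul_zero]
    push Not at hy
    have hev : (planeCutoff n J : 𝔼 → ℝ) =ᶠ[𝓝 y] fun _ => 0 := by
      filter_upwards [(contDiff_planeDistSq n).continuous.continuousAt.eventually
        (lt_mem_nhds hy)] with w hw
      refine Real.smoothTransition.zero_of_nonpos ?_
      rw [div_lt_iff₀ (by positivity)] at hw
      linarith
    rw [hev.fderiv_eq]
    simp

theorem planeCutoff_eventually_one {n : ℕ} (J : ℝ) {y : 𝔼} (hy : planeDistSq n y = 0) :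
    ∀ᶠ w in 𝓝 y, planeCutoff n J w = 1 := by
  have hc : Continuous fun w : 𝔼 => 2 - J ^ 2 * planeDistSq n w :=
    continuous_const.sub (continuous_const.mul (contDiff_planeDistSq n).continuous)
  filter_upwards [hc.continuousAt.eventually (lt_mem_nhds (a := 1) (by simp [hy]))] with w hw
  exact Real.smoothTransition.one_of_one_le hw.le

theorem tendsto_planeCutoff {n : ℕ} {y : 𝔼} (hy : planeDistSq n y ≠ 0) :
    Tendsto (fun j : ℕ => planeCutoff n ((j : ℝ) + 1) y) atTop (𝓝 0) := by
  have hpos := (planeDistSq_nonneg n y).lt_of_ne' hy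
  obtain ⟨j₀, hj₀⟩ := exists_nat_gt (2 / planeDistSq n y)
  refine tendsto_const_nhds.congr' ?_
  filter_upwards [eventually_ge_atTop j₀] with j hj
  refine (Real.smoothTransition.zero_of_nonpos ?_).symm
  rw [div_lt_iff₀ hpos] at hj₀
  have h1 : (j₀ : ℝ) ≤ j := by exact_mod_cast hj
  have h2 : (0 : ℝ) ≤ j₀ := Nat.cast_nonneg _
  nlinarith [mul_le_mul_of_nonneg_right h1 hpos.le, mul_nonneg h2 hpos.le,
    mul_nonneg (h2.trans h1) hpos.le, mul_nonneg (mul_nonneg (h2.trans h1) (h2.trans h1)) hpos.le]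

theorem prod_plane (n : ℕ) (a b : ℝ≥0∞) :
    ∏ i : Fin m, (if (i : ℕ) + n < m then a else b) = a ^ (m - n) * b ^ (m - (m - n)) := by
  have h : (Finset.univ.filter fun i : Fin m => (i : ℕ) + n < m) =
      Finset.univ.filter fun i : Fin m => (i : ℕ) < m - n := by
    ext i
    simp only [Finset.mem_filter]
    constructor <;> intro h <;> refine ⟨h.1, ?_⟩ <;> have := h.2 <;> omega
  have h1 : (Finset.univ.filter fun i : Fin m => (i : ℕ) + n < m).card = m - n := by
    rw [h, Fin.card_filter_val_lt]
    omega
  rw [Finset.prod_ite, Finset.prod_const, Finset.prod_const, h1]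
  congr 2
  have h2 := Finset.card_filter_add_card_filter_not (s := (Finset.univ : Finset (Fin m)))
    (fun i : Fin m => (i : ℕ) + n < m)
  rw [h1, Finset.card_univ, Fintype.card_fin] at h2
  omega

/-- The set lies in a box with side `4 / J` in the `m - n` directions `x`, since `√2 / J ≤ 2 / J`,
and side `2 r` in the others. Only the power `J^{-(m-n)}` matters. -/
theorem volume_slab_le (n : ℕ) (z : 𝔼) (r J : ℝ) (hJ : 0 < J) :
    volume ({y : 𝔼 | planeDistSq n y ≤ 2 / J ^ 2} ∩ Metric.ball z r) ≤
      ENNReal.ofReal (4 / J) ^ (m - n) * ENNReal.ofReal (2 * r) ^ (m - (m - n)) := by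
  let a : Fin m → ℝ := fun i => if (i : ℕ) + n < m then -(2 / J) else z i - r
  let b : Fin m → ℝ := fun i => if (i : ℕ) + n < m then 2 / J else z i + r
  have hmp := EuclideanSpace.volume_preserving_symm_measurableEquiv_toLp (Fin m)
  have hsub : {y : 𝔼 | planeDistSq n y ≤ 2 / J ^ 2} ∩ Metric.ball z r ⊆
      (MeasurableEquiv.toLp 2 (Fin m → ℝ)).symm ⁻¹' (univ.pi fun i => Icc (a i) (b i)) := by
    rintro y ⟨hy, hyz⟩ i -
    change a i ≤ y i ∧ y i ≤ b i
    by_cases hi : (i : ℕ) + n < m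
    · simp only [a, b, hi, if_true]
      have h1 : y i ^ 2 ≤ (2 / J) ^ 2 := by
        refine (sq_le_planeDistSq y hi).trans (le_trans hy ?_)
        rw [div_pow]
        gcongr
        norm_num
      exact abs_le.1 (abs_le_of_sq_le_sq h1 (by positivity))
    · simp only [a, b, hi, if_false]
      have h1 : ‖(y - z) i‖ ≤ ‖y - z‖ := PiLp.norm_apply_le _ _
      rw [mem_ball_iff_norm] at hyz
      have h2 := abs_le.1 (h1.trans hyz.le)
      simp only [PiLp.sub_apply] at h2
      constructor <;> linarith [h2.1, h2.2]
  refine (measure_mono hsub).trans ?_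
  rw [hmp.measure_preimage_emb (MeasurableEquiv.measurableEmbedding _), pi_univ_Icc,
    Real.volume_Icc_pi, ← prod_plane]
  refine (Finset.prod_congr rfl fun i _ => ?_).le
  simp only [a, b]
  split_ifs
  · congr 1; ring
  · congr 1; ring

theorem volume_plane {n : ℕ} (hmn : n < m) :
    volume {y : 𝔼 | planeDistSq n y = 0} = 0 := by
  let i₀ : Fin m := ⟨0, by omega⟩
  let S : Submodule ℝ 𝔼 := LinearMap.ker (EuclideanSpace.proj i₀ : 𝔼 →L[ℝ] ℝ).toLinearMap
  refine measure_mono_null (t := (S : Set 𝔼)) ?_ (Measure.addHaar_submodule volume S ?_)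
  · intro y hy
    exact planeDistSq_eq_zero_iff.1 hy i₀ (by simpa [i₀] using hmn)
  · intro h
    have : stdVec i₀ ∈ S := h ▸ Submodule.mem_top
    have h1 : (stdVec i₀ : 𝔼) i₀ = 0 := this
    simp [stdVec] at h1

end Cutoff

/-! ### Patches -/

section Patch

open TopologicalSpace (Opens)

variable {m : ℕ} {M : Type*} [TopologicalSpace M] [ChartedSpace (EuclideanSpace ℝ (Fin m)) M]
  [IsManifold (𝓡 m) ∞ M]

local notation "𝔼" => EuclideanSpace ℝ (Fin m)

/-- A coordinate ball of `M` on which the metric `gt` of the open submanifold `O` controls the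
Euclidean Dirichlet form, has a density in `L^q` with `q > max 1 (m / 2)`, and on which the
complement of `O` has vanishing capacity in a weak sense. -/
structure IsPatch {O : Opens M} (gt : RMetric m O) (hO : Nonempty O)
    (e : OpenPartialHomeomorph M (EuclideanSpace ℝ (Fin m))) (z : EuclideanSpace ℝ (Fin m))
    (r : ℝ) : Prop where
  mem_maximalAtlas : e ∈ IsManifold.maximalAtlas (𝓡 m) ∞ M
  pos : 0 < r
  subset_target : Metric.ball z r ⊆ e.target
  null : volume (Metric.ball z r \ (e.subtypeRestr hO).target) = 0
  dens : ∃ q : ℝ, 1 < q ∧ (m : ℝ) / 2 < q ∧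
    ∫⁻ y in Metric.ball z r, ENNReal.ofReal (densIn gt (e.subtypeRestr hO) y) ^ q < ⊤
  lower : ∃ C : ℝ, 0 < C ∧ ∀ y ∈ Metric.ball z r, y ∈ (e.subtypeRestr hO).target →
    ∀ l : EuclideanSpace ℝ (Fin m) →L[ℝ] ℝ, ∑ i, l (stdVec i) ^ 2 ≤
      C * (densIn gt (e.subtypeRestr hO) y * cometrIn gt (e.subtypeRestr hO) y l l)
  upper : ∃ h : EuclideanSpace ℝ (Fin m) → ℝ≥0∞,
    AEMeasurable h (volume.restrict (Metric.ball z r)) ∧ ∫⁻ y in Metric.ball z r, h y < ⊤ ∧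
    ∀ y ∈ Metric.ball z r, y ∈ (e.subtypeRestr hO).target →
    ∀ l : EuclideanSpace ℝ (Fin m) →L[ℝ] ℝ,
      ENNReal.ofReal (densIn gt (e.subtypeRestr hO) y * cometrIn gt (e.subtypeRestr hO) y l l) ≤
        h y * ENNReal.ofReal (∑ i, l (stdVec i) ^ 2)
  cutoff : ∃ θ : ℕ → EuclideanSpace ℝ (Fin m) → ℝ, (∀ j, ContDiff ℝ ∞ (θ j)) ∧
    (∀ j y, 0 ≤ θ j y ∧ θ j y ≤ 1) ∧
    (∀ j, ∀ y ∈ Metric.ball z r, y ∉ (e.subtypeRestr hO).target → ∀ᶠ w in 𝓝 y, θ j w = 1) ∧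
    (∀ y ∈ Metric.ball z r, y ∈ (e.subtypeRestr hO).target →
      Tendsto (fun j => θ j y) atTop (𝓝 0)) ∧
    ∃ B : ℝ≥0∞, B < ⊤ ∧ ∀ j, ∫⁻ y in Metric.ball z r,
      ENNReal.ofReal (densIn gt (e.subtypeRestr hO) y *
        cometrIn gt (e.subtypeRestr hO) y (fderiv ℝ (θ j) y) (fderiv ℝ (θ j) y)) ≤ B

theorem exists_densIn_bounds {X : Type*} [TopologicalSpace X]
    [ChartedSpace (EuclideanSpace ℝ (Fin m)) X] [IsManifold (𝓡 m) ∞ X] (g : RMetric m X)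
    {e : OpenPartialHomeomorph X 𝔼} (he : e ∈ IsManifold.maximalAtlas (𝓡 m) ∞ X) {K : Set 𝔼}
    (hK : IsCompact K) (hKe : K ⊆ e.target) :
    ∃ a b : ℝ, 0 < a ∧ 0 < b ∧ ∀ y ∈ K, a ≤ densIn g e y ∧ densIn g e y ≤ b := by
  rcases K.eq_empty_or_nonempty with rfl | hne
  · exact ⟨1, 1, one_pos, one_pos, by simp⟩
  have hc : ContinuousOn (densIn g e) K := (contDiffOn_densIn g he).continuousOn.mono hKe
  obtain ⟨y₀, hy₀, h₀⟩ := hK.exists_isMinOn hne hc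
  obtain ⟨y₁, hy₁, h₁⟩ := hK.exists_isMaxOn hne hc
  exact ⟨densIn g e y₀, densIn g e y₁, densIn_pos g he (hKe hy₀), densIn_pos g he (hKe hy₁),
    fun y hy => ⟨h₀ hy, h₁ hy⟩⟩

/-- Inside `O` the metric is smooth, hence comparable with the Euclidean one on a small closed ball.
There is nothing to cut out, so the zero function serves as cutoff. -/
theorem exists_isPatch_of_mem {O : Opens M} (gt : RMetric m O) (hO : Nonempty O) {p : M}
    (hp : p ∈ O) : ∃ (e : OpenPartialHomeomorph M 𝔼) (z : 𝔼) (r : ℝ),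
      IsPatch gt hO e z r ∧ p ∈ e.source ∧ e p = z := by
  let e := chartAt 𝔼 p
  have hps : p ∈ e.source := mem_chart_source 𝔼 p
  have he : e ∈ IsManifold.maximalAtlas (𝓡 m) ∞ M := IsManifold.chart_mem_maximalAtlas p
  have he' := restr_mem_maximalAtlas hO he
  have hz : e p ∈ (e.subtypeRestr hO).target :=
    (mem_restr_target hO).2 ⟨e.map_source hps, by rwa [e.left_inv hps]⟩
  obtain ⟨r, hr, hsub⟩ := Metric.nhds_basis_closedBall.mem_iff.1
    ((e.subtypeRestr hO).open_target.mem_nhds hz)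
  have hbc : Metric.ball (e p) r ⊆ Metric.closedBall (e p) r := Metric.ball_subset_closedBall
  have hK : IsCompact (Metric.closedBall (e p) r) := isCompact_closedBall _ _
  obtain ⟨a, b, ha, hb, hab⟩ := exists_densIn_bounds gt he' hK hsub
  obtain ⟨C₁, hC₁, h₁⟩ := exists_cometrIn_lower gt he' hK hsub
  obtain ⟨C₂, hC₂, h₂⟩ := exists_cometrIn_upper gt he' hK hsub
  have hfin : volume (Metric.ball (e p) r) < ⊤ := measure_ball_lt_top
  refine ⟨e, e p, r, ⟨he, hr, fun y hy => ((mem_restr_target hO).1 (hsub (hbc hy))).1, ?_, ?_, ?_,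
    ?_, ?_⟩, hps, rfl⟩
  · rw [sdiff_eq_empty.2 (hbc.trans hsub), measure_empty]
  -- The density is bounded here, so any exponent above `1` and `m / 2` will do.
  · refine ⟨(m : ℝ) / 2 + 2, by have : (0 : ℝ) ≤ m := Nat.cast_nonneg m; linarith, by linarith, ?_⟩
    have hq : (0 : ℝ) ≤ (m : ℝ) / 2 + 2 := by positivity
    refine (setLIntegral_mono measurable_const fun y hy =>
      ENNReal.rpow_le_rpow (ENNReal.ofReal_le_ofReal (hab y (hbc hy)).2) hq).trans_lt ?_
    rw [setLIntegral_const]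
    exact ENNReal.mul_lt_top (ENNReal.rpow_lt_top_of_nonneg hq ENNReal.ofReal_ne_top) hfin
  · refine ⟨C₁ / a, by positivity, fun y hy _ l => ?_⟩
    have h := h₁ y (hbc hy) (fun i => l (stdVec i))
    have h' : ∑ i, l (stdVec i) ^ 2 ≤ C₁ * cometrIn gt (e.subtypeRestr hO) y l l := h
    have hn : 0 ≤ cometrIn gt (e.subtypeRestr hO) y l l := by
      have : 0 ≤ ∑ i, l (stdVec i) ^ 2 := Finset.sum_nonneg fun i _ => sq_nonneg _
      exact nonneg_of_mul_nonneg_right (this.trans h') hC₁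
    refine h'.trans ?_
    rw [div_mul_eq_mul_div, le_div_iff₀ ha, mul_assoc]
    refine mul_le_mul_of_nonneg_left ?_ hC₁.le
    rw [mul_comm]
    exact mul_le_mul_of_nonneg_right (hab y (hbc hy)).1 hn
  · refine ⟨fun _ => ENNReal.ofReal (b * C₂), aemeasurable_const, ?_, fun y hy _ l => ?_⟩
    · rw [setLIntegral_const]
      exact ENNReal.mul_lt_top ENNReal.ofReal_lt_top hfin
    · rw [← ENNReal.ofReal_mul (by positivity)]
      refine ENNReal.ofReal_le_ofReal ?_
      have h := h₂ y (hbc hy) (fun i => l (stdVec i))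
      have h' : cometrIn gt (e.subtypeRestr hO) y l l ≤ C₂ * ∑ i, l (stdVec i) ^ 2 := h
      have hd := hab y (hbc hy)
      have hn : 0 ≤ C₂ * ∑ i, l (stdVec i) ^ 2 :=
        mul_nonneg hC₂.le (Finset.sum_nonneg fun i _ => sq_nonneg _)
      calc _ ≤ densIn gt (e.subtypeRestr hO) y * (C₂ * ∑ i, l (stdVec i) ^ 2) :=
            mul_le_mul_of_nonneg_left h' (ha.le.trans hd.1)
        _ ≤ b * (C₂ * ∑ i, l (stdVec i) ^ 2) := mul_le_mul_of_nonneg_right hd.2 hn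
        _ = _ := by ring
  · refine ⟨fun _ _ => 0, fun _ => contDiff_const, fun _ _ => ⟨le_rfl, zero_le_one⟩,
      fun _ y hy hy' => absurd (hsub (hbc hy)) hy', fun _ _ _ => tendsto_const_nhds, 0,
      ENNReal.zero_lt_top, fun j => ?_⟩
    simp [cometrIn]

end Patch

/-! ### Patches around the singular set -/

section Singular

variable {m n : ℕ} {M : Type*} [TopologicalSpace M] [ChartedSpace (EuclideanSpace ℝ (Fin m)) M]
  [IsManifold (𝓡 m) ∞ M] [T2Space M]

local notation "𝔼" => EuclideanSpace ℝ (Fin m)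

variable {g : RMetric m M} {N : Set M} {hN : IsCompact N}
  {𝒜 : Set (OpenPartialHomeomorph M (EuclideanSpace ℝ (Fin m)))}
  {gt : RMetric m (puncture N hN)} {f : M → ℝ} {U : Set M}
  {e : OpenPartialHomeomorph M (EuclideanSpace ℝ (Fin m))}

/-- Density times inverse metric weights the `x` components of a covector by `|f| ^ (m - n - 2)` and
the `y` components by `|f| ^ (m - n)`. The second lower bound is required only for `0 < n`, since
otherwise there are no `y` components. -/
theorem exists_rescaling_lower (h𝒜 : IsDiagonalizedNear g N n 𝒜) (hmn : n + 2 ≤ m)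
    (hgt : IsBlockRescaling g N hN n 𝒜 gt f U) (hO : Nonempty (puncture N hN)) (heA : e ∈ 𝒜)
    {c : ℝ} (hc : 0 < c) (hlow : ∀ p ∈ Nᶜ, c ≤ |f p| ^ (m - n - 2) ∧ (0 < n → c ≤ |f p| ^ (m - n)))
    {K : Set 𝔼} (hK : IsCompact K) (hKe : K ⊆ e.target) (hKU : ∀ y ∈ K, e.symm y ∈ U) :
    ∃ C : ℝ, 0 < C ∧ ∀ y ∈ K, y ∈ (e.subtypeRestr hO).target → ∀ l : 𝔼 →L[ℝ] ℝ,
      ∑ i, l (stdVec i) ^ 2 ≤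
        C * (densIn gt (e.subtypeRestr hO) y * cometrIn gt (e.subtypeRestr hO) y l l) := by
  have he := h𝒜.mem_maximalAtlas e heA
  obtain ⟨a, b, ha, hb, hab⟩ := exists_densIn_bounds g he hK hKe
  obtain ⟨C, hC, h⟩ := exists_cometrIn_lower g he hK hKe
  refine ⟨C / (a * c), by positivity, fun y hy hyt l => ?_⟩
  have hF := rescaling_ne_zero h𝒜 (by omega) hgt hO heA hyt (hKU y hy)
  have hN' : e.symm y ∈ Nᶜ := ((mem_restr_target hO).1 hyt).2
  have hlow' := hlow _ hN'
  rw [densIn_rescaling h𝒜 hgt hO heA hyt (hKU y hy),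
    cometrIn_rescaling h𝒜 (by omega) hgt hO heA hyt (hKU y hy)]
  have h' := h y hy (fun i => (scale m n (f (e.symm y)) i)⁻¹ * l (stdVec i))
  set F := f (e.symm y)
  set S := ∑ i, ∑ j, (gramIn g e y)⁻¹ i j * ((scale m n F j)⁻¹ * l (stdVec j)) *
      ((scale m n F i)⁻¹ * l (stdVec i))
  have hsc : ∀ i : Fin m, c * l (stdVec i) ^ 2 ≤
      |F| ^ (m - n) * ((scale m n F i)⁻¹ * l (stdVec i)) ^ 2 := fun i => by
    by_cases hi : (i : ℕ) + n < m
    · have h1 : |F| ^ (m - n) = |F| ^ (m - n - 2) * F ^ 2 := by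
        rw [← sq_abs F, ← pow_add]
        congr 1
        omega
      have h2 : |F| ^ (m - n) * ((scale m n F i)⁻¹ * l (stdVec i)) ^ 2 =
          |F| ^ (m - n - 2) * l (stdVec i) ^ 2 := by
        rw [h1, scale, if_pos hi]
        field_simp
      rw [h2]
      exact mul_le_mul_of_nonneg_right hlow'.1 (sq_nonneg _)
    · rw [scale, if_neg hi, inv_one, one_mul]
      exact mul_le_mul_of_nonneg_right (hlow'.2 (by have := i.2; omega)) (sq_nonneg _)
  have h3 : c * ∑ i, l (stdVec i) ^ 2 ≤ |F| ^ (m - n) * (C * S) := by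
    rw [Finset.mul_sum]
    refine (Finset.sum_le_sum fun i _ => hsc i).trans ?_
    rw [← Finset.mul_sum]
    exact mul_le_mul_of_nonneg_left h' (by positivity)
  have hS : 0 ≤ S := by
    have : 0 ≤ ∑ i, ((scale m n F i)⁻¹ * l (stdVec i)) ^ 2 :=
      Finset.sum_nonneg fun i _ => sq_nonneg _
    exact nonneg_of_mul_nonneg_right (this.trans h') hC
  rw [div_mul_eq_mul_div, le_div_iff₀ (by positivity)]
  calc (∑ i, l (stdVec i) ^ 2) * (a * c) = a * (c * ∑ i, l (stdVec i) ^ 2) := by ring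
    _ ≤ a * (|F| ^ (m - n) * (C * S)) := mul_le_mul_of_nonneg_left h3 ha.le
    _ ≤ densIn g e y * (|F| ^ (m - n) * (C * S)) :=
        mul_le_mul_of_nonneg_right (hab y hy).1 (by positivity)
    _ = _ := by ring

/-- The same weights as for the lower bound. They are kept separate because the cutoffs depend on
`x` alone and must only pay `|f| ^ (m - n - 2)`. -/
theorem exists_rescaling_upper (h𝒜 : IsDiagonalizedNear g N n 𝒜) (hmn : n + 2 ≤ m)
    (hgt : IsBlockRescaling g N hN n 𝒜 gt f U) (hO : Nonempty (puncture N hN)) (heA : e ∈ 𝒜)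
    {K : Set 𝔼} (hK : IsCompact K) (hKe : K ⊆ e.target) (hKU : ∀ y ∈ K, e.symm y ∈ U) :
    ∃ C : ℝ, 0 < C ∧ ∀ y ∈ K, y ∈ (e.subtypeRestr hO).target → ∀ l : 𝔼 →L[ℝ] ℝ,
      densIn gt (e.subtypeRestr hO) y * cometrIn gt (e.subtypeRestr hO) y l l ≤
        C * ∑ i : Fin m, (if (i : ℕ) + n < m then |f (e.symm y)| ^ (m - n - 2) else
          |f (e.symm y)| ^ (m - n)) * l (stdVec i) ^ 2 := by
  have he := h𝒜.mem_maximalAtlas e heA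
  obtain ⟨a, b, ha, hb, hab⟩ := exists_densIn_bounds g he hK hKe
  obtain ⟨C, hC, h⟩ := exists_cometrIn_upper g he hK hKe
  refine ⟨b * C, by positivity, fun y hy hyt l => ?_⟩
  have hF := rescaling_ne_zero h𝒜 (by omega) hgt hO heA hyt (hKU y hy)
  rw [densIn_rescaling h𝒜 hgt hO heA hyt (hKU y hy),
    cometrIn_rescaling h𝒜 (by omega) hgt hO heA hyt (hKU y hy)]
  have h' := h y hy (fun i => (scale m n (f (e.symm y)) i)⁻¹ * l (stdVec i))
  set F := f (e.symm y)
  set S := ∑ i, ∑ j, (gramIn g e y)⁻¹ i j * ((scale m n F j)⁻¹ * l (stdVec j)) *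
      ((scale m n F i)⁻¹ * l (stdVec i))
  have hsc : ∀ i : Fin m, |F| ^ (m - n) * ((scale m n F i)⁻¹ * l (stdVec i)) ^ 2 =
      (if (i : ℕ) + n < m then |F| ^ (m - n - 2) else |F| ^ (m - n)) * l (stdVec i) ^ 2 := fun i => by
    by_cases hi : (i : ℕ) + n < m
    · have h1 : |F| ^ (m - n) = |F| ^ (m - n - 2) * F ^ 2 := by
        rw [← sq_abs F, ← pow_add]
        congr 1
        omega
      rw [h1, scale, if_pos hi, if_pos hi]
      field_simp
    · rw [scale, if_neg hi, if_neg hi, inv_one, one_mul]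
  simp only [← hsc]
  rw [← Finset.mul_sum]
  have hn : 0 ≤ C * ∑ i, ((scale m n F i)⁻¹ * l (stdVec i)) ^ 2 :=
    mul_nonneg hC.le (Finset.sum_nonneg fun i _ => sq_nonneg _)
  have hd := hab y hy
  have hd0 : 0 ≤ densIn g e y := ha.le.trans hd.1
  calc |F| ^ (m - n) * densIn g e y * S
      ≤ |F| ^ (m - n) * densIn g e y * (C * ∑ i, ((scale m n F i)⁻¹ * l (stdVec i)) ^ 2) :=
        mul_le_mul_of_nonneg_left h' (by positivity)
    _ ≤ |F| ^ (m - n) * b * (C * ∑ i, ((scale m n F i)⁻¹ * l (stdVec i)) ^ 2) := by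
        refine mul_le_mul_of_nonneg_right ?_ hn
        exact mul_le_mul_of_nonneg_left hd.2 (by positivity)
    _ = _ := by ring

end Singular

section Singular

variable {m n : ℕ} {M : Type*} [TopologicalSpace M] [ChartedSpace (EuclideanSpace ℝ (Fin m)) M]
  [IsManifold (𝓡 m) ∞ M] [T2Space M]

local notation "𝔼" => EuclideanSpace ℝ (Fin m)

variable {g : RMetric m M} {N : Set M} {hN : IsCompact N}
  {𝒜 : Set (OpenPartialHomeomorph M (EuclideanSpace ℝ (Fin m)))}
  {gt : RMetric m (puncture N hN)} {f : M → ℝ} {U : Set M}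
  {e : OpenPartialHomeomorph M (EuclideanSpace ℝ (Fin m))}

theorem enorm_pow_eq_ofReal (x : ℝ) (k : ℕ) : ‖x‖ₑ ^ k = ENNReal.ofReal (|x| ^ k) := by
  rw [Real.enorm_eq_ofReal_abs, ENNReal.ofReal_pow (abs_nonneg _)]

theorem volume_ball_sdiff_restr (h𝒜 : IsDiagonalizedNear g N n 𝒜) (hmn : n < m)
    (hO : Nonempty (puncture N hN)) (heA : e ∈ 𝒜) {B : Set 𝔼} (hB : B ⊆ e.target) :
    (∀ y ∈ B, y ∉ (e.subtypeRestr hO).target ↔ planeDistSq n y = 0) ∧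
      volume (B \ (e.subtypeRestr hO).target) = 0 := by
  have h : ∀ y ∈ B, y ∉ (e.subtypeRestr hO).target ↔ planeDistSq n y = 0 := by
    intro y hy
    rw [planeDistSq_eq_zero_iff, mem_restr_target]
    have h1 := h𝒜.slice e heA (e.symm y) (e.map_target (hB hy))
    rw [e.right_inv (hB hy)] at h1
    rw [← h1]
    change ¬ (y ∈ e.target ∧ e.symm y ∈ Nᶜ) ↔ e.symm y ∈ N
    simp [hB hy]
  exact ⟨h, measure_mono_null (fun y hy => (h y hy.1).1 hy.2) (volume_plane hmn)⟩

variable [MeasurableSpace M] [BorelSpace M] [SecondCountableTopology M]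

theorem setLIntegral_rpow_lt_top (he : e ∈ IsManifold.maximalAtlas (𝓡 m) ∞ M)
    (hfm : AEStronglyMeasurable f (riemVolume g)) {s : ℝ}
    (hfs : ∫⁻ x, ‖f x‖ₑ ^ s ∂riemVolume g < ⊤) {B K : Set 𝔼} (hBm : MeasurableSet B)
    (hBK : B ⊆ K) (hK : IsCompact K) (hKe : K ⊆ e.target) :
    ∫⁻ y in B, ‖f (e.symm y)‖ₑ ^ s < ⊤ := by
  obtain ⟨a, b, ha, hb, hab⟩ := exists_densIn_bounds g he hK hKe
  have h1 := setLIntegral_chart g he (F := fun x => ‖f x‖ₑ ^ s)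
    (hfm.enorm.pow_const s).restrict hBm (hBK.trans hKe)
  have h2 : ENNReal.ofReal a * ∫⁻ y in B, ‖f (e.symm y)‖ₑ ^ s < ⊤ := by
    rw [← lintegral_const_mul' _ _ ENNReal.ofReal_ne_top]
    calc _ ≤ ∫⁻ y in B, ENNReal.ofReal (densIn g e y) * ‖f (e.symm y)‖ₑ ^ s := by
          refine setLIntegral_mono' hBm fun y hy => ?_
          gcongr
          exact (hab y (hBK hy)).1
      _ = _ := h1.symm
      _ ≤ ∫⁻ x, ‖f x‖ₑ ^ s ∂riemVolume g := setLIntegral_le_lintegral _ _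
      _ < ⊤ := hfs
  refine lt_of_not_ge fun h => ?_
  rw [top_le_iff.1 h, ENNReal.mul_top (by simpa using ha)] at h2
  exact lt_irrefl _ h2

/-- Hölder's inequality with the weights `(k - 2) / k` and `2 / k`: the slab volume, of order
`J^{-k}`, enters with the power `2 / k` and cancels `J²` exactly. So in codimension `k ≥ 2` the
energies of the cutoffs stay bounded as soon as `G ∈ L^k`; the constant `16` is `4²` from the sides
`4 / J`. -/
theorem setLIntegral_planeCutoff_le {B : Set 𝔼} {G : 𝔼 → ℝ≥0∞} {k : ℕ} (hk : 2 ≤ k) (hkm : k = m - n)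
    (hG : AEMeasurable G (volume.restrict B)) {z : 𝔼} {r : ℝ} (hB : B = Metric.ball z r)
    (hGk : ∫⁻ y in B, G y ^ k < ⊤) :
    ∃ D : ℝ≥0∞, D < ⊤ ∧ ∀ J : ℝ, 0 < J → ENNReal.ofReal (J ^ 2) *
      ∫⁻ y in B, {y : 𝔼 | planeDistSq n y ≤ 2 / J ^ 2}.indicator 1 y * G y ^ (k - 2) ≤ D := by
  have hk0 : (0 : ℝ) < k := by exact_mod_cast (by omega : 0 < k)
  have hk2 : (2 : ℝ) ≤ k := by exact_mod_cast hk
  have hBm : MeasurableSet B := hB ▸ Metric.isOpen_ball.measurableSet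
  set R : ℝ≥0∞ := ENNReal.ofReal (2 * r) ^ (m - (m - n))
  have hR : R ≠ ⊤ := ENNReal.pow_ne_top ENNReal.ofReal_ne_top
  set p : ℝ := (k - 2) / k
  have hp : 0 ≤ p := div_nonneg (by linarith) hk0.le
  have hq : 0 ≤ 2 / (k : ℝ) := by positivity
  refine ⟨16 * ((∫⁻ y in B, G y ^ k) ^ p * R ^ (2 / (k : ℝ))), ?_, fun J hJ => ?_⟩
  · exact ENNReal.mul_lt_top (by norm_num) (ENNReal.mul_lt_top
      (ENNReal.rpow_lt_top_of_nonneg hp hGk.ne) (ENNReal.rpow_lt_top_of_nonneg hq hR))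
  set S : Set 𝔼 := {y : 𝔼 | planeDistSq n y ≤ 2 / J ^ 2}
  have hS : MeasurableSet S :=
    (isClosed_le (contDiff_planeDistSq n).continuous continuous_const).measurableSet
  have h1 : ∀ y, S.indicator (1 : 𝔼 → ℝ≥0∞) y * G y ^ (k - 2) =
      (G y ^ k) ^ p * (S.indicator (1 : 𝔼 → ℝ≥0∞) y) ^ (2 / (k : ℝ)) := fun y => by
    have e1 : (G y ^ k) ^ p = G y ^ (k - 2) := by
      rw [← ENNReal.rpow_natCast, ← ENNReal.rpow_mul, ← ENNReal.rpow_natCast]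
      congr 1
      rw [Nat.cast_sub hk]
      simp only [p]
      field_simp
      norm_num
    rw [e1, mul_comm]
    by_cases hy : y ∈ S
    · simp [hy]
    · simp only [indicator_of_notMem hy]
      rw [ENNReal.zero_rpow_of_pos (by positivity)]
  have h2 : ∫⁻ y in B, S.indicator (1 : 𝔼 → ℝ≥0∞) y * G y ^ (k - 2) ≤
      (∫⁻ y in B, G y ^ k) ^ p * (volume (S ∩ B)) ^ (2 / (k : ℝ)) := by
    simp only [h1]
    refine (ENNReal.lintegral_mul_norm_pow_le (hG.pow_const k)
      ((measurable_one.indicator hS).aemeasurable) hp hq ?_).trans ?_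
    · simp only [p]
      field_simp
      ring
    · rw [lintegral_indicator_one hS, Measure.restrict_apply hS]
  have h3 : (volume (S ∩ B)) ^ (2 / (k : ℝ)) ≤ ENNReal.ofReal (16 / J ^ 2) * R ^ (2 / (k : ℝ)) := by
    have h4 := volume_slab_le n z r J hJ
    rw [← hB] at h4
    refine (ENNReal.rpow_le_rpow h4 hq).trans ?_
    rw [ENNReal.mul_rpow_of_nonneg _ _ hq]
    refine mul_le_mul_left (le_of_eq ?_) _
    rw [← hkm, ← ENNReal.rpow_natCast, ← ENNReal.rpow_mul, mul_div_cancel₀ _ hk0.ne']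
    rw [show (2 : ℝ) = ((2 : ℕ) : ℝ) by norm_num, ENNReal.rpow_natCast,
      ← ENNReal.ofReal_pow (by positivity), div_pow]
    norm_num
  calc _ ≤ ENNReal.ofReal (J ^ 2) * ((∫⁻ y in B, G y ^ k) ^ p *
        (ENNReal.ofReal (16 / J ^ 2) * R ^ (2 / (k : ℝ)))) := by gcongr; exact h2.trans (by gcongr)
    _ = (ENNReal.ofReal (J ^ 2) * ENNReal.ofReal (16 / J ^ 2)) *
        ((∫⁻ y in B, G y ^ k) ^ p * R ^ (2 / (k : ℝ))) := by ring
    _ = _ := by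
      rw [← ENNReal.ofReal_mul (by positivity), mul_div_cancel₀ _ (by positivity)]
      norm_num

theorem exists_isPatch_of_singular (h𝒜 : IsDiagonalizedNear g N n 𝒜) (hmn : n + 2 ≤ m)
    (hgt : IsBlockRescaling g N hN n 𝒜 gt f U) (hU : U ∈ 𝓝ˢ N) (hO : Nonempty (puncture N hN))
    {c : ℝ} (hc : 0 < c)
    (hlow : ∀ p ∈ Nᶜ, c ≤ |f p| ^ (m - n - 2) ∧ (0 < n → c ≤ |f p| ^ (m - n)))
    (hfm : AEStronglyMeasurable f (riemVolume g)) {q : ℝ} (hq : 1 < q) (hqm : (m : ℝ) / 2 < q)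
    (hfq : ∫⁻ x, ‖f x‖ₑ ^ (((m - n : ℕ) : ℝ) * q) ∂riemVolume g < ⊤) {p : M} (hp : p ∈ N) :
    ∃ (e : OpenPartialHomeomorph M 𝔼) (z : 𝔼) (r : ℝ),
      IsPatch gt hO e z r ∧ p ∈ e.source ∧ e p = z := by
  obtain ⟨e, heA, hpe⟩ := h𝒜.covers p hp
  have he := h𝒜.mem_maximalAtlas e heA
  have hnhd : e.target ∩ e.symm ⁻¹' U ∈ 𝓝 (e p) := by
    refine inter_mem (e.open_target.mem_nhds (e.map_source hpe)) ?_
    refine (e.continuousAt_symm (e.map_source hpe)).preimage_mem_nhds ?_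
    rw [e.left_inv hpe]
    exact mem_nhdsSet_iff_forall.1 hU p hp
  obtain ⟨r, hr, hsub⟩ := Metric.nhds_basis_closedBall.mem_iff.1 hnhd
  set K := Metric.closedBall (e p) r with hKdef
  set B := Metric.ball (e p) r with hBdef
  have hBK : B ⊆ K := Metric.ball_subset_closedBall
  have hK : IsCompact K := isCompact_closedBall _ _
  have hKe : K ⊆ e.target := fun y hy => (hsub hy).1
  have hKU : ∀ y ∈ K, e.symm y ∈ U := fun y hy => (hsub hy).2
  have hBm : MeasurableSet B := Metric.isOpen_ball.measurableSet
  have hBfin : volume B < ⊤ := measure_ball_lt_top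
  obtain ⟨hplane, hnull⟩ := volume_ball_sdiff_restr h𝒜 (by omega) hO heA (hBK.trans hKe)
  obtain ⟨a, b, ha, hb, hab⟩ := exists_densIn_bounds g he hK hKe
  obtain ⟨C₂, hC₂, hup⟩ := exists_rescaling_upper h𝒜 hmn hgt hO heA hK hKe hKU
  obtain ⟨L, hL, hcut⟩ := exists_fderiv_planeCutoff_le (m := m) n
  have hae : ∀ᵐ y ∂volume.restrict B, y ∈ B ∧ y ∈ (e.subtypeRestr hO).target := by
    refine (ae_restrict_mem hBm).and ?_
    rw [ae_restrict_iff' hBm, ae_iff]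
    refine measure_mono_null (fun y hy => ?_) hnull
    simp only [mem_ofPred_eq, Classical.not_imp] at hy
    exact hy
  set k := m - n with hk
  have hk2 : 2 ≤ k := by omega
  have hI := setLIntegral_rpow_lt_top he hfm hfq hBm hBK hK hKe
  have hGm : AEMeasurable (fun y => ‖f (e.symm y)‖ₑ) (volume.restrict B) :=
    (aemeasurable_comp_symm_of_source g he (F := fun x => ‖f x‖ₑ) hfm.enorm.restrict).mono_measure
      (Measure.restrict_mono (hBK.trans hKe) le_rfl)
  have hpow : ∀ y, ‖f (e.symm y)‖ₑ ^ ((k : ℝ) * q) = (‖f (e.symm y)‖ₑ ^ k) ^ q := fun y => by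
    rw [ENNReal.rpow_mul, ENNReal.rpow_natCast]
  simp only [hpow] at hI
  -- On a ball, of finite measure, `L^q` integrability of `|f|^k` gives integrability, through `t ≤
  -- 1 + t^q`.
  have hIk : ∫⁻ y in B, ‖f (e.symm y)‖ₑ ^ k < ⊤ := by
    calc ∫⁻ y in B, ‖f (e.symm y)‖ₑ ^ k ≤ ∫⁻ y in B, (1 + (‖f (e.symm y)‖ₑ ^ k) ^ q) := by
          refine lintegral_mono fun y => ?_
          rcases le_total (‖f (e.symm y)‖ₑ ^ k) 1 with h | h
          · exact h.trans le_self_add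
          · refine le_trans ?_ le_add_self
            calc ‖f (e.symm y)‖ₑ ^ k = (‖f (e.symm y)‖ₑ ^ k) ^ (1 : ℝ) := (ENNReal.rpow_one _).symm
              _ ≤ _ := ENNReal.rpow_le_rpow_of_exponent_le h hq.le
      _ = volume B + ∫⁻ y in B, (‖f (e.symm y)‖ₑ ^ k) ^ q := by
          rw [lintegral_add_left measurable_const, lintegral_const, one_mul,
            Measure.restrict_apply_univ]
      _ < ⊤ := ENNReal.add_lt_top.2 ⟨hBfin, hI⟩
  have hpow_le : ∀ y, ‖f (e.symm y)‖ₑ ^ (k - 2) ≤ 1 + ‖f (e.symm y)‖ₑ ^ k := fun y => by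
    rcases le_total ‖f (e.symm y)‖ₑ 1 with h | h
    · exact (pow_le_one' h _).trans le_self_add
    · exact (pow_le_pow_right' h (by omega)).trans le_add_self
  refine ⟨e, e p, r, ⟨he, hr, hBK.trans hKe, hnull, ⟨q, hq, hqm, ?_⟩, ?_, ?_, ?_⟩, hpe, rfl⟩
  · calc _ ≤ ∫⁻ y in B, ENNReal.ofReal b ^ q * (‖f (e.symm y)‖ₑ ^ k) ^ q := by
          refine lintegral_mono_ae (hae.mono fun y hy => ?_)
          rw [densIn_rescaling h𝒜 hgt hO heA hy.2 (hKU y (hBK hy.1)),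
            ENNReal.ofReal_mul (by positivity), ← enorm_pow_eq_ofReal, mul_comm,
            ENNReal.mul_rpow_of_nonneg _ _ (by linarith)]
          refine mul_le_mul_left ?_ _
          exact ENNReal.rpow_le_rpow (ENNReal.ofReal_le_ofReal (hab y (hBK hy.1)).2) (by linarith)
      _ = ENNReal.ofReal b ^ q * ∫⁻ y in B, (‖f (e.symm y)‖ₑ ^ k) ^ q :=
          lintegral_const_mul' _ _
            (ENNReal.rpow_lt_top_of_nonneg (by linarith) ENNReal.ofReal_ne_top).ne
      _ < ⊤ := ENNReal.mul_lt_top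
          (ENNReal.rpow_lt_top_of_nonneg (by linarith) ENNReal.ofReal_ne_top) hI
  · obtain ⟨C, hC, h⟩ := exists_rescaling_lower h𝒜 hmn hgt hO heA hc hlow hK hKe hKU
    exact ⟨C, hC, fun y hy => h y (hBK hy)⟩
  · refine ⟨fun y => ENNReal.ofReal C₂ * (1 + ‖f (e.symm y)‖ₑ ^ k),
      ((hGm.pow_const k).const_add 1).const_mul _, ?_, fun y hy hyt l => ?_⟩
    · rw [lintegral_const_mul' _ _ ENNReal.ofReal_ne_top, lintegral_add_left measurable_const,
        lintegral_const, one_mul, Measure.restrict_apply_univ]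
      exact ENNReal.mul_lt_top ENNReal.ofReal_lt_top (ENNReal.add_lt_top.2 ⟨hBfin, hIk⟩)
    · have h1 : 1 + ‖f (e.symm y)‖ₑ ^ k = ENNReal.ofReal (1 + |f (e.symm y)| ^ k) := by
        rw [ENNReal.ofReal_add zero_le_one (by positivity), ENNReal.ofReal_one, enorm_pow_eq_ofReal]
      simp only [h1]
      rw [← ENNReal.ofReal_mul hC₂.le, ← ENNReal.ofReal_mul (by positivity)]
      refine ENNReal.ofReal_le_ofReal ((hup y (hBK hy) hyt l).trans ?_)
      rw [mul_assoc C₂, Finset.mul_sum _ _ (1 + |f (e.symm y)| ^ k)]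
      refine mul_le_mul_of_nonneg_left (Finset.sum_le_sum fun i _ => ?_) hC₂.le
      refine mul_le_mul_of_nonneg_right ?_ (sq_nonneg _)
      split_ifs
      · have := hpow_le y
        rw [h1, enorm_pow_eq_ofReal] at this
        exact (ENNReal.ofReal_le_ofReal_iff (by positivity)).1 this
      · linarith
  · obtain ⟨D, hD, hDle⟩ := setLIntegral_planeCutoff_le hk2 hk hGm hBdef hIk
    refine ⟨fun j => planeCutoff n ((j : ℝ) + 1), fun j => contDiff_planeCutoff n _,
      fun j y => ⟨Real.smoothTransition.nonneg _, Real.smoothTransition.le_one _⟩,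
      fun j y hy hyt => planeCutoff_eventually_one _ ((hplane y hy).1 hyt),
      fun y hy hyt => tendsto_planeCutoff fun h => (hplane y hy).2 h hyt,
      ENNReal.ofReal (C₂ * L) * D, ENNReal.mul_lt_top ENNReal.ofReal_lt_top hD, fun j => ?_⟩
    have hJ : (0 : ℝ) < (j : ℝ) + 1 := by positivity
    refine le_trans ?_ (mul_le_mul_right (hDle _ hJ) _)
    rw [← mul_assoc, ← lintegral_const_mul' _ _
      (ENNReal.mul_ne_top ENNReal.ofReal_ne_top ENNReal.ofReal_ne_top)]
    refine lintegral_mono_ae (hae.mono fun y hy => ?_)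
    set l := fderiv ℝ (planeCutoff n ((j : ℝ) + 1) : 𝔼 → ℝ) y
    -- The cutoff does not depend on `y`, so the weight `|f|^k` drops out and only `|f|^(k - 2)`
    -- remains.
    have h1 : ∑ i : Fin m, (if (i : ℕ) + n < m then |f (e.symm y)| ^ (k - 2) else
        |f (e.symm y)| ^ k) * l (stdVec i) ^ 2 =
        |f (e.symm y)| ^ (k - 2) * ∑ i, l (stdVec i) ^ 2 := by
      rw [Finset.mul_sum]
      refine Finset.sum_congr rfl fun i _ => ?_
      split_ifs with hi
      · rfl
      · have : l (stdVec i) = 0 := by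
          rw [fderiv_planeCutoff, if_neg hi]
          simp
        simp [this]
    have h2 := hup y (hBK hy.1) hy.2 l
    rw [h1] at h2
    have h3 := h2.trans (mul_le_mul_of_nonneg_left
      (mul_le_mul_of_nonneg_left (hcut _ hJ y) (by positivity)) hC₂.le)
    refine (ENNReal.ofReal_le_ofReal h3).trans (le_of_eq ?_)
    by_cases hyS : planeDistSq n y ≤ 2 / ((j : ℝ) + 1) ^ 2
    · simp only [indicator_of_mem (show y ∈ {y : 𝔼 | planeDistSq n y ≤ 2 / ((j : ℝ) + 1) ^ 2}
        from hyS), Pi.one_apply, one_mul, mul_one]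
      rw [enorm_pow_eq_ofReal, ← ENNReal.ofReal_mul (by positivity),
        ← ENNReal.ofReal_mul (by positivity)]
      congr 1
      ring
    · simp only [indicator_of_notMem (show y ∉ {y : 𝔼 | planeDistSq n y ≤ 2 / ((j : ℝ) + 1) ^ 2}
        from hyS), zero_mul, mul_zero, ENNReal.ofReal_zero]

end Singular

/-! ### Cubes -/

section Cube

variable {m : ℕ}

local notation "𝔼" => EuclideanSpace ℝ (Fin m)

/-- The half-open cube of side `h` with index `κ` in the cubical grid. -/
def cube (h : ℝ) (κ : Fin m → ℤ) : Set 𝔼 := {y | ∀ i, y i ∈ Ico (κ i * h) ((κ i + 1) * h)}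

theorem cube_eq_preimage (h : ℝ) (κ : Fin m → ℤ) :
    cube h κ = (MeasurableEquiv.toLp 2 (Fin m → ℝ)).symm ⁻¹'
      (univ.pi fun i => Ico (κ i * h) ((κ i + 1) * h)) := by
  ext y
  simp only [cube, mem_preimage, mem_univ_pi]
  rfl

theorem measurableSet_cube (h : ℝ) (κ : Fin m → ℤ) : MeasurableSet (cube h κ) := by
  rw [cube_eq_preimage]
  exact (MeasurableEquiv.measurable _) (MeasurableSet.univ_pi fun i => measurableSet_Ico)

theorem volume_cube (h : ℝ) (κ : Fin m → ℤ) : volume (cube h κ) = ENNReal.ofReal h ^ m := by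
  rw [cube_eq_preimage, (EuclideanSpace.volume_preserving_symm_measurableEquiv_toLp
    (Fin m)).measure_preimage_emb (MeasurableEquiv.measurableEmbedding _), Real.volume_pi_Ico]
  have : ∀ i : Fin m, ((κ i : ℝ) + 1) * h - κ i * h = h := fun i => by ring
  simp [this]

theorem convex_cube (h : ℝ) (κ : Fin m → ℤ) : Convex ℝ (cube h κ) := by
  intro x hx y hy a b ha hb hab i
  exact convex_Ico (κ i * h) ((κ i + 1) * h) (hx i) (hy i) ha hb hab

theorem norm_sub_le_of_mem_cube {h : ℝ} {κ : Fin m → ℤ} {x y : 𝔼} (hx : x ∈ cube h κ)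
    (hy : y ∈ cube h κ) : ‖y - x‖ ≤ m * h := by
  calc ‖y - x‖ = ‖∑ i, (y - x) i • (stdVec i : 𝔼)‖ := by rw [sum_smul_stdVec]
    _ ≤ ∑ i : Fin m, ‖(y - x) i • (stdVec i : 𝔼)‖ := norm_sum_le _ _
    _ ≤ ∑ i : Fin m, h := by
        refine Finset.sum_le_sum fun i _ => ?_
        rw [norm_smul, stdVec, PiLp.norm_single, norm_one, mul_one, PiLp.sub_apply,
          Real.norm_eq_abs, abs_le]
        have h1 := hx i
        have h2 := hy i
        constructor <;> nlinarith [h1.1, h1.2, h2.1, h2.2]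
    _ = m * h := by simp

theorem pairwise_disjoint_cube {h : ℝ} (hh : 0 < h) :
    Pairwise (Function.onFun Disjoint (cube h : (Fin m → ℤ) → Set 𝔼)) := by
  intro κ κ' hne
  refine disjoint_left.2 fun y hy hy' => hne (funext fun i => ?_)
  have key : ∀ κ : Fin m → ℤ, y ∈ cube h κ → ⌊y i / h⌋ = κ i := fun κ hy => by
    rw [Int.floor_eq_iff, le_div_iff₀ hh, div_lt_iff₀ hh]
    exact hy i
  rw [← key κ hy, ← key κ' hy']

theorem mem_cube_floor {h : ℝ} (hh : 0 < h) (y : 𝔼) : y ∈ cube h (fun i => ⌊y i / h⌋) := fun i => by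
  constructor
  · rw [← le_div_iff₀ hh]
    exact Int.floor_le _
  · rw [← div_lt_iff₀ hh]
    exact Int.lt_floor_add_one _

theorem finite_cube_inter_ball {h : ℝ} (hh : 0 < h) (z : 𝔼) (r : ℝ) :
    {κ : Fin m → ℤ | (cube h κ ∩ Metric.ball z r).Nonempty}.Finite := by
  refine (Set.Finite.pi' (t := fun i => Icc ⌊(z i - r) / h⌋ ⌊(z i + r) / h⌋)
    fun i => finite_Icc _ _).subset ?_
  rintro κ ⟨y, hy, hyz⟩ i
  have key : ⌊y i / h⌋ = κ i := by
    rw [Int.floor_eq_iff, le_div_iff₀ hh, div_lt_iff₀ hh]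
    exact hy i
  have h1 : ‖(y - z) i‖ ≤ ‖y - z‖ := PiLp.norm_apply_le _ _
  rw [mem_ball_iff_norm] at hyz
  have h2 := abs_le.1 (h1.trans hyz.le)
  simp only [PiLp.sub_apply] at h2
  rw [← key]
  exact ⟨Int.floor_le_floor (by gcongr; linarith [h2.1]),
    Int.floor_le_floor (by gcongr; linarith [h2.2])⟩

end Cube

/-! ### The Poincaré inequality on a patch -/

section Poincare

open TopologicalSpace (Opens)

variable {m : ℕ} {M : Type*} [TopologicalSpace M] [ChartedSpace (EuclideanSpace ℝ (Fin m)) M]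
  [IsManifold (𝓡 m) ∞ M]

local notation "𝔼" => EuclideanSpace ℝ (Fin m)

variable {O : Opens M} {gt : RMetric m O} {hO : Nonempty O}
  {e : OpenPartialHomeomorph M (EuclideanSpace ℝ (Fin m))} {z : EuclideanSpace ℝ (Fin m)} {r : ℝ}

/-- The part of the open submanifold with coordinates in `Q`. -/
def patchSet (hO : Nonempty O) (e : OpenPartialHomeomorph M 𝔼) (Q : Set 𝔼) : Set O :=
  (e.subtypeRestr hO).source ∩ e.subtypeRestr hO ⁻¹' Q

theorem mem_patchSet {Q : Set 𝔼} {x : O} :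
    x ∈ patchSet hO e Q ↔ (x : M) ∈ e.source ∧ e x ∈ Q := by
  rw [patchSet, mem_inter_iff, mem_restr_source, mem_preimage, restr_apply]

theorem patchSet_inter_target (Q : Set 𝔼) :
    patchSet hO e (Q ∩ (e.subtypeRestr hO).target) = patchSet hO e Q := by
  ext x
  simp only [patchSet, mem_inter_iff, mem_preimage]
  exact ⟨fun h => ⟨h.1, h.2.1⟩, fun h => ⟨h.1, h.2, (e.subtypeRestr hO).map_source h.1⟩⟩

theorem IsPatch.ae_target (hP : IsPatch gt hO e z r) {Q : Set 𝔼} (hQ : MeasurableSet Q)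
    (hQz : Q ⊆ Metric.ball z r) :
    ∀ᵐ y ∂volume.restrict Q, y ∈ Q ∧ y ∈ (e.subtypeRestr hO).target := by
  refine (ae_restrict_mem hQ).and ?_
  rw [ae_restrict_iff' hQ, ae_iff]
  refine measure_mono_null (fun y hy => ?_) hP.null
  simp only [mem_ofPred_eq, Classical.not_imp] at hy
  exact ⟨hQz hy.1, hy.2⟩

theorem IsPatch.restrict_inter_target (hP : IsPatch gt hO e z r) {Q : Set 𝔼} (hQ : MeasurableSet Q)
    (hQz : Q ⊆ Metric.ball z r) :
    volume.restrict (Q ∩ (e.subtypeRestr hO).target) = volume.restrict Q := by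
  refine Measure.restrict_congr_set ?_
  have h := (ae_restrict_iff' hQ).1 (hP.ae_target hQ hQz)
  filter_upwards [h] with y hy
  exact propext ⟨fun h => h.1, fun h => hy h⟩

theorem IsPatch.aemeasurable_densIn (hP : IsPatch gt hO e z r) {Q : Set 𝔼} (hQ : MeasurableSet Q)
    (hQz : Q ⊆ Metric.ball z r) :
    AEMeasurable (fun y => ENNReal.ofReal (densIn gt (e.subtypeRestr hO) y))
      (volume.restrict Q) := by
  rw [← hP.restrict_inter_target hQ hQz]
  have h := ((contDiffOn_densIn gt (restr_mem_maximalAtlas hO hP.mem_maximalAtlas)).continuousOn.mono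
    inter_subset_right).aemeasurable (μ := volume)
    (hQ.inter (e.subtypeRestr hO).open_target.measurableSet)
  exact h.ennreal_ofReal

theorem norm_sq_le_sum (l : 𝔼 →L[ℝ] ℝ) : ‖l‖ₑ ^ 2 ≤ ENNReal.ofReal (∑ i, l (stdVec i) ^ 2) := by
  have h : ‖l‖ ≤ √(∑ i, l (stdVec i) ^ 2) := by
    refine l.opNorm_le_bound (Real.sqrt_nonneg _) fun v => ?_
    rw [linearForm_eq_sum l v, EuclideanSpace.norm_eq, ← Real.sqrt_mul
      (Finset.sum_nonneg fun i _ => sq_nonneg _), Real.norm_eq_abs]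
    refine Real.abs_le_sqrt ?_
    have := Finset.sum_mul_sq_le_sq_mul_sq Finset.univ (fun i => l (stdVec i)) (fun i => v i)
    simp only [Real.norm_eq_abs, sq_abs]
    refine le_trans (le_of_eq ?_) this
    congr 1
    exact Finset.sum_congr rfl fun i _ => by ring
  rw [← ofReal_norm, ← ENNReal.ofReal_pow (norm_nonneg _)]
  refine ENNReal.ofReal_le_ofReal ?_
  calc ‖l‖ ^ 2 ≤ √(∑ i, l (stdVec i) ^ 2) ^ 2 := by gcongr
    _ = _ := Real.sq_sqrt (Finset.sum_nonneg fun i _ => sq_nonneg _)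

variable [T2Space M] [MeasurableSpace M] [BorelSpace M] [SecondCountableTopology M]

theorem measurableSet_patchSet {Q : Set 𝔼} (hQ : MeasurableSet Q) :
    MeasurableSet (patchSet hO e Q) := by
  rw [patchSet, inter_comm]
  exact measurableSet_preimage_source _ hQ

theorem IsPatch.setLIntegral (hP : IsPatch gt hO e z r) {F : O → ℝ≥0∞}
    (hF : AEMeasurable F (riemVolume gt)) {Q : Set 𝔼} (hQ : MeasurableSet Q)
    (hQz : Q ⊆ Metric.ball z r) :
    ∫⁻ x in patchSet hO e Q, F x ∂riemVolume gt =
      ∫⁻ y in Q, ENNReal.ofReal (densIn gt (e.subtypeRestr hO) y) *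
        F ((e.subtypeRestr hO).symm y) := by
  rw [← hP.restrict_inter_target hQ hQz, ← patchSet_inter_target, patchSet]
  exact setLIntegral_chart gt (restr_mem_maximalAtlas hO hP.mem_maximalAtlas) hF.restrict
    (hQ.inter (e.subtypeRestr hO).open_target.measurableSet) inter_subset_right

theorem IsPatch.volume_lt_top (hP : IsPatch gt hO e z r) {Q : Set 𝔼} (hQz : Q ⊆ Metric.ball z r) :
    riemVolume gt (patchSet hO e Q) < ⊤ := by
  have hB : MeasurableSet (Metric.ball z r) := Metric.isOpen_ball.measurableSet
  refine (measure_mono (t := patchSet hO e (Metric.ball z r)) fun x hx =>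
    mem_patchSet.2 ⟨(mem_patchSet.1 hx).1, hQz (mem_patchSet.1 hx).2⟩).trans_lt ?_
  rw [← setLIntegral_one, hP.setLIntegral aemeasurable_const hB Subset.rfl]
  obtain ⟨q, hq, -, hI⟩ := hP.dens
  calc _ ≤ ∫⁻ y in Metric.ball z r,
        (1 + ENNReal.ofReal (densIn gt (e.subtypeRestr hO) y) ^ q) := by
        refine lintegral_mono fun y => ?_
        rw [mul_one]
        rcases le_total (ENNReal.ofReal (densIn gt (e.subtypeRestr hO) y)) 1 with h | h
        · exact h.trans le_self_add
        · refine le_trans ?_ le_add_self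
          calc _ = ENNReal.ofReal (densIn gt (e.subtypeRestr hO) y) ^ (1 : ℝ) :=
                (ENNReal.rpow_one _).symm
            _ ≤ _ := ENNReal.rpow_le_rpow_of_exponent_le h hq.le
    _ = volume (Metric.ball z r) +
        ∫⁻ y in Metric.ball z r, ENNReal.ofReal (densIn gt (e.subtypeRestr hO) y) ^ q := by
        rw [lintegral_add_left measurable_const, lintegral_const, one_mul,
          Measure.restrict_apply_univ]
    _ < ⊤ := ENNReal.add_lt_top.2 ⟨measure_ball_lt_top, hI⟩

/-- A test function on the open submanifold, extended by zero, in the coordinates `e`. -/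
def extIn (e : OpenPartialHomeomorph M 𝔼) (ψ : O → ℝ) (y : 𝔼) : ℝ :=
  Function.extend Subtype.val ψ 0 (e.symm y)

/-- Compact support inside `O` makes the extension by zero smooth across the complement. The
Euclidean Poincaré inequality may therefore be used on convex sets that meet the singular set. -/
theorem contDiffOn_extIn (he : e ∈ IsManifold.maximalAtlas (𝓡 m) ∞ M) {ψ : O → ℝ}
    (hψ : ContMDiff (𝓡 m) 𝓘(ℝ, ℝ) ∞ ψ) (hc : HasCompactSupport ψ) :
    ContDiffOn ℝ ∞ (extIn e ψ) e.target :=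
  contDiffOn_comp_symm he (ContMDiff.extend_zero hc hψ).contMDiffOn

theorem extIn_eq (ψ : O → ℝ) {y : 𝔼} (hy : y ∈ (e.subtypeRestr hO).target) :
    extIn e ψ y = ψ ((e.subtypeRestr hO).symm y) := by
  rw [extIn, ← coe_restr_symm hO hy, Subtype.val_injective.extend_apply]

theorem gradInner_extIn (he : e ∈ IsManifold.maximalAtlas (𝓡 m) ∞ M) {ψ : O → ℝ}
    (hψ : ContMDiff (𝓡 m) 𝓘(ℝ, ℝ) ∞ ψ) {y : 𝔼} (hy : y ∈ (e.subtypeRestr hO).target) :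
    gradInner gt ψ ψ ((e.subtypeRestr hO).symm y) =
      cometrIn gt (e.subtypeRestr hO) y (fderiv ℝ (extIn e ψ) y) (fderiv ℝ (extIn e ψ) y) := by
  have h := gradInner_chart gt (restr_mem_maximalAtlas hO he) hy
    (hψ.mdifferentiableAt (by simp)) (hψ.mdifferentiableAt (by simp))
  have hev : (fun y => ψ ((e.subtypeRestr hO).symm y)) =ᶠ[𝓝 y] extIn e ψ := by
    filter_upwards [(e.subtypeRestr hO).open_target.mem_nhds hy] with w hw
    exact (extIn_eq ψ hw).symm
  rw [h, hev.fderiv_eq]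

/-- The weighted Poincaré inequality with the density of `gt` as weight, whose `L^q` norm over the
whole ball serves for all `Q`. The field `lower` turns the Euclidean Dirichlet integral into the
energy of `gt`; the gain is `s = 2 - m / q`, positive because `q > m / 2`. -/
theorem IsPatch.exists_poincare (hP : IsPatch gt hO e z r) :
    ∃ (D : ℝ≥0∞) (s : ℝ), D < ⊤ ∧ 0 < s ∧ ∀ (Q : Set 𝔼) (d : ℝ) (ψ : O → ℝ),
      Convex ℝ Q → MeasurableSet Q → Q ⊆ Metric.ball z r → 0 < d →
      (∀ x ∈ Q, ∀ y ∈ Q, ‖y - x‖ ≤ d) → ContMDiff (𝓡 m) 𝓘(ℝ, ℝ) ∞ ψ → HasCompactSupport ψ →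
      ∀ K : ℝ≥0∞, D * ENNReal.ofReal (d ^ (m + s)) *
          ∫⁻ x in patchSet hO e Q, ENNReal.ofReal (gradInner gt ψ ψ x) ∂riemVolume gt <
            K * volume Q →
        ∃ c : ℝ, ∫⁻ x in patchSet hO e Q, ‖ψ x - c‖ₑ ^ 2 ∂riemVolume gt ≤ K := by
  obtain ⟨q, hq, hqm, hI⟩ := hP.dens
  obtain ⟨C, hC, hlow⟩ := hP.lower
  have hq0 : 0 < q := by linarith
  obtain ⟨C', hC', hpoin⟩ := exists_lintegral_sub_sq_le (volume : Measure 𝔼) hq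
    (by rwa [finrank_euclideanSpace_fin])
  rw [finrank_euclideanSpace_fin] at hpoin
  set W := (∫⁻ y in Metric.ball z r, ENNReal.ofReal (densIn gt (e.subtypeRestr hO) y) ^ q) ^ (1 / q)
  have hW : W < ⊤ := ENNReal.rpow_lt_top_of_nonneg (by positivity) hI.ne
  refine ⟨C' * W * ENNReal.ofReal C, 2 - m / q, ENNReal.mul_lt_top (ENNReal.mul_lt_top hC' hW)
    ENNReal.ofReal_lt_top, ?_, fun Q d ψ hQc hQ hQz hd hQd hψ hψc K hK => ?_⟩
  · have : (m : ℝ) / q < 2 := by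
      rw [div_lt_iff₀ hq0]
      linarith
    linarith
  have hgr : AEMeasurable (fun x => ENNReal.ofReal (gradInner gt ψ ψ x)) (riemVolume gt) :=
    (continuous_gradInner gt hψ hψ).measurable.ennreal_ofReal.aemeasurable
  have hfd : ∫⁻ y in Q, ‖fderiv ℝ (extIn e ψ) y‖ₑ ^ 2 ≤ ENNReal.ofReal C *
      ∫⁻ x in patchSet hO e Q, ENNReal.ofReal (gradInner gt ψ ψ x) ∂riemVolume gt := by
    rw [hP.setLIntegral hgr hQ hQz, ← lintegral_const_mul' _ _ ENNReal.ofReal_ne_top]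
    refine lintegral_mono_ae ((hP.ae_target hQ hQz).mono fun y hy => ?_)
    refine (norm_sq_le_sum _).trans ?_
    have hd0 := (densIn_pos gt (restr_mem_maximalAtlas hO hP.mem_maximalAtlas) hy.2).le
    rw [gradInner_extIn hP.mem_maximalAtlas hψ hy.2, ← ENNReal.ofReal_mul hd0,
      ← ENNReal.ofReal_mul hC.le]
    exact ENNReal.ofReal_le_ofReal (hlow y (hQz hy.1) hy.2 _)
  have hWQ : (∫⁻ y in Q, ENNReal.ofReal (densIn gt (e.subtypeRestr hO) y) ^ q) ^ (1 / q) ≤ W :=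
    ENNReal.rpow_le_rpow (lintegral_mono_set hQz) (by positivity)
  obtain ⟨c, hc⟩ := hpoin Q (Metric.ball z r) (extIn e ψ)
    (fun y => ENNReal.ofReal (densIn gt (e.subtypeRestr hO) y)) d hQc hQ Metric.isOpen_ball hQz
    (((contDiffOn_extIn hP.mem_maximalAtlas hψ hψc).of_le (by simp)).mono hP.subset_target)
    (hP.aemeasurable_densIn hQ hQz) hd hQd K (by
      refine lt_of_le_of_lt ?_ hK
      calc _ ≤ C' * ENNReal.ofReal (d ^ (m + (2 - m / q))) * W * (ENNReal.ofReal C *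
            ∫⁻ x in patchSet hO e Q, ENNReal.ofReal (gradInner gt ψ ψ x) ∂riemVolume gt) := by
            gcongr
        _ = _ := by ring)
  refine ⟨c, ?_⟩
  rw [hP.setLIntegral _ hQ hQz]
  · refine le_trans (le_of_eq (lintegral_congr_ae ((hP.ae_target hQ hQz).mono fun y hy => ?_))) hc
    simp only [extIn_eq ψ hy.2]
  · have : Measurable fun x => ψ x - c := (hψ.continuous.sub continuous_const).measurable
    exact (this.enorm.pow_const 2).aemeasurable

/-- With the diameter bound `(m + 1) h`, the factor `h^(m + s)` splits into the volume `h^m` of the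
cube and `h^s`. The term `τ` provides the strict inequality required by the Poincaré lemma, even
when the energy vanishes. -/
theorem ennreal_scale_lt {D E : ℝ≥0∞} (hD : D < ⊤) (hE : E < ⊤) {h s : ℝ} (hh : 0 < h) (m : ℕ)
    {τ : ℝ≥0∞} (hτ : 0 < τ) :
    D * ENNReal.ofReal (((m : ℝ) * h + h) ^ ((m : ℝ) + s)) * E <
      (D * ENNReal.ofReal (((m : ℝ) + 1) ^ ((m : ℝ) + s) * h ^ s) * E + τ) *
        ENNReal.ofReal h ^ m := by
  have h1 : ((m : ℝ) * h + h) ^ ((m : ℝ) + s) =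
      ((m : ℝ) + 1) ^ ((m : ℝ) + s) * h ^ s * h ^ m := by
    rw [show (m : ℝ) * h + h = ((m : ℝ) + 1) * h by ring, Real.mul_rpow (by positivity) hh.le,
      Real.rpow_add hh, Real.rpow_natCast]
    ring
  rw [h1, ENNReal.ofReal_mul (p := ((m : ℝ) + 1) ^ ((m : ℝ) + s) * h ^ s) (by positivity),
    ENNReal.ofReal_pow hh.le]
  have hh0 : 0 < ENNReal.ofReal h ^ m := ENNReal.pow_pos (by simpa using hh) m
  have hht : ENNReal.ofReal h ^ m ≠ ⊤ := ENNReal.pow_ne_top ENNReal.ofReal_ne_top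
  rw [add_mul]
  have h2 : D * (ENNReal.ofReal (((m : ℝ) + 1) ^ ((m : ℝ) + s) * h ^ s) * ENNReal.ofReal h ^ m) * E
      = D * ENNReal.ofReal (((m : ℝ) + 1) ^ ((m : ℝ) + s) * h ^ s) * E * ENNReal.ofReal h ^ m := by
    ring
  rw [h2]
  refine ENNReal.lt_add_right ?_ (mul_ne_zero hτ.ne' hh0.ne')
  exact ENNReal.mul_ne_top (ENNReal.mul_ne_top (ENNReal.mul_ne_top hD.ne ENNReal.ofReal_ne_top)
    hE.ne) hht

end Poincare

/-! ### From local Poincaré inequalities to control up to a finite rank error. -/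

section Cover

variable {m : ℕ} {X : Type*} [TopologicalSpace X] [ChartedSpace (EuclideanSpace ℝ (Fin m)) X]
  [IsManifold (𝓡 m) ∞ X] [MeasurableSpace X] [BorelSpace X] [SecondCountableTopology X] [T2Space X]
  [SigmaCompactSpace X]

theorem gradInner_self_nonneg (g : RMetric m X) (ψ : X → ℝ) (x : X) : 0 ≤ gradInner g ψ ψ x :=
  metr_nonneg g x _

theorem integral_indicatorLp (g : RMetric m X) {A : Set X} (hA : MeasurableSet A)
    (hAt : riemVolume g A ≠ ⊤) (v : L2 g) :
    ⟪indicatorConstLp 2 hA hAt (1 : ℝ), v⟫_ℝ = ∫ x in A, v x ∂riemVolume g :=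
  L2.inner_indicatorConstLp_one hA hAt v

/-- A relative compactness criterion for the form domain: if for every `ε` the manifold is a finite
union of sets of finite volume with a Poincaré inequality with constant `ε`, and with bounded
overlap, then the form controls the norm up to a finite rank error. -/
theorem exists_finite_rank_of_cover (g : RMetric m X) (L : ℝ) (hL : 0 < L)
    (hcov : ∀ ε : ℝ, 0 < ε → ∃ (ι : Type) (_ : Fintype ι) (A : ι → Set X),
      (∀ i, MeasurableSet (A i)) ∧ (∀ i, riemVolume g (A i) ≠ ⊤) ∧ (⋃ i, A i) = univ ∧
      (∀ F : X → ℝ, (∀ x, 0 ≤ F x) → Integrable F (riemVolume g) →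
        ∑ i, ∫ x in A i, F x ∂riemVolume g ≤ L * ∫ x, F x ∂riemVolume g) ∧
      ∀ (ψ : X → ℝ), ContMDiff (𝓡 m) 𝓘(ℝ, ℝ) ∞ ψ → HasCompactSupport ψ → ∀ i,
        ∫ x in A i, ψ x ^ 2 ∂riemVolume g ≤ ε * ∫ x in A i, gradInner g ψ ψ x ∂riemVolume g +
          (∫ x in A i, ψ x ∂riemVolume g) ^ 2 / (riemVolume g).real (A i))
    (ε : ℝ) (hε : 0 < ε) :
    ∃ (r : ℕ) (l : L2 g →L[ℝ] (Fin r → ℝ)), ∀ u : (laplacian g).domain,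
      ‖(u : L2 g)‖ ^ 2 ≤ ε * (⟪laplacian g u, (u : L2 g)⟫_ℝ + ‖(u : L2 g)‖ ^ 2) +
        ‖l (u : L2 g)‖ ^ 2 := by
  obtain ⟨ι, _, A, hA, hAt, hAu, hov, hpoin⟩ := hcov (ε / L) (by positivity)
  let r := Fintype.card ι
  let σ : Fin r ≃ ι := (Fintype.equivFin ι).symm
  -- The functionals are normalised integrals over the sets `A i`. The target carries the sup norm,
  -- so each of the `r` squared terms is made at most `‖l u‖² / r`, and they sum to at most `‖l
  -- u‖²`.
  let l : L2 g →L[ℝ] (Fin r → ℝ) := ContinuousLinearMap.pi fun i =>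
    (√((r : ℝ) / (riemVolume g).real (A (σ i)))) •
      innerSL ℝ (indicatorConstLp 2 (hA (σ i)) (hAt (σ i)) (1 : ℝ))
  refine ⟨r, l, fun u => ?_⟩
  obtain ⟨ψ, hψ⟩ := (mem_laplacian_domain g u).1 u.2
  have hm2 : MemLp ψ 2 (riemVolume g) := hψ.1.continuous.memLp_of_hasCompactSupport hψ.2.1
  have hint : Integrable (fun x => ψ x ^ 2) (riemVolume g) := hm2.integrable_sq
  have hnorm : ‖(u : L2 g)‖ ^ 2 = ∫ x, ψ x ^ 2 ∂riemVolume g := by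
    rw [← real_inner_self_eq_norm_sq, L2.inner_def]
    refine integral_congr_ae (hψ.2.2.mono fun x hx => ?_)
    simp [hx, sq]
  have hform := inner_laplacian g hψ hψ
  have hgi : Integrable (gradInner g ψ ψ) (riemVolume g) := integrable_gradInner g hψ.1 hψ.1 hψ.2.1
  have hl : ∀ i : ι, (∫ x in A i, ψ x ∂riemVolume g) ^ 2 / (riemVolume g).real (A i) ≤
      ‖l (u : L2 g)‖ ^ 2 / r := fun i => by
    have hr : (0 : ℝ) < r := by
      have : 0 < Fintype.card ι := Fintype.card_pos_iff.2 ⟨i⟩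
      exact_mod_cast this
    have h1 : ‖l (u : L2 g) (σ.symm i)‖ ≤ ‖l (u : L2 g)‖ := norm_le_pi_norm _ _
    have h2 : l (u : L2 g) (σ.symm i) = √((r : ℝ) / (riemVolume g).real (A i)) *
        ∫ x in A i, ψ x ∂riemVolume g := by
      have h3 : l (u : L2 g) (σ.symm i) =
          √((r : ℝ) / (riemVolume g).real (A (σ (σ.symm i)))) *
          ⟪indicatorConstLp 2 (hA (σ (σ.symm i))) (hAt (σ (σ.symm i))) (1 : ℝ), (u : L2 g)⟫_ℝ := rfl
      rw [h3, integral_indicatorLp, σ.apply_symm_apply]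
      congr 1
      exact integral_congr_ae (ae_restrict_of_ae hψ.2.2)
    rw [le_div_iff₀ hr]
    calc _ = ‖l (u : L2 g) (σ.symm i)‖ ^ 2 := by
          rw [h2, Real.norm_eq_abs, sq_abs, mul_pow, Real.sq_sqrt (by positivity)]
          ring
      _ ≤ _ := by gcongr
  rw [hnorm, hform]
  have hcov1 : ∫ x, ψ x ^ 2 ∂riemVolume g ≤ ∑ i, ∫ x in A i, ψ x ^ 2 ∂riemVolume g := by
    have h1 : ∀ s : Set X, ∫⁻ x in s, ENNReal.ofReal (ψ x ^ 2) ∂riemVolume g =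
        ENNReal.ofReal (∫ x in s, ψ x ^ 2 ∂riemVolume g) := fun s =>
      (ofReal_integral_eq_lintegral_ofReal hint.restrict
        (Eventually.of_forall fun x => sq_nonneg _)).symm
    have h2 : ∫⁻ x in univ, ENNReal.ofReal (ψ x ^ 2) ∂riemVolume g ≤
        ∑ i, ∫⁻ x in A i, ENNReal.ofReal (ψ x ^ 2) ∂riemVolume g := by
      rw [← hAu]
      exact (lintegral_iUnion_le _ _).trans (tsum_fintype _).le
    simp only [h1] at h2
    rw [← ENNReal.ofReal_sum_of_nonneg fun i _ => integral_nonneg fun x => sq_nonneg _,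
      ENNReal.ofReal_le_ofReal_iff (Finset.sum_nonneg fun i _ => integral_nonneg fun x =>
        sq_nonneg _), setIntegral_univ] at h2
    exact h2
  have hgn : 0 ≤ ∫ x, gradInner g ψ ψ x ∂riemVolume g :=
    integral_nonneg fun x => gradInner_self_nonneg g ψ x
  have hnn : 0 ≤ ∫ x, ψ x ^ 2 ∂riemVolume g := integral_nonneg fun x => sq_nonneg _
  calc _ ≤ _ := hcov1
    _ ≤ ∑ i, (ε / L * ∫ x in A i, gradInner g ψ ψ x ∂riemVolume g + ‖l (u : L2 g)‖ ^ 2 / r) :=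
        Finset.sum_le_sum fun i _ => (hpoin ψ hψ.1 hψ.2.1 i).trans (add_le_add le_rfl (hl i))
    _ = ε / L * ∑ i, ∫ x in A i, gradInner g ψ ψ x ∂riemVolume g + r * (‖l (u : L2 g)‖ ^ 2 / r) := by
        rw [Finset.sum_add_distrib, ← Finset.mul_sum, Finset.sum_const, nsmul_eq_mul]
        rfl
    _ ≤ ε / L * (L * ∫ x, gradInner g ψ ψ x ∂riemVolume g) + ‖l (u : L2 g)‖ ^ 2 := by
        gcongr
        · exact hov _ (gradInner_self_nonneg g ψ) hgi
        · rcases eq_or_ne (r : ℝ) 0 with h | h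
          · rw [h, zero_mul]
            positivity
          · exact (mul_div_cancel₀ _ h).le
    _ ≤ _ := by
        have : ε / L * (L * ∫ x, gradInner g ψ ψ x ∂riemVolume g) =
            ε * ∫ x, gradInner g ψ ψ x ∂riemVolume g := by field_simp
        rw [this]
        gcongr
        linarith

end Cover

/-! ### Discreteness from patches -/

section Patches

open TopologicalSpace (Opens)

variable {m : ℕ} {M : Type*} [TopologicalSpace M] [ChartedSpace (EuclideanSpace ℝ (Fin m)) M]
  [IsManifold (𝓡 m) ∞ M]

local notation "𝔼" => EuclideanSpace ℝ (Fin m)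

variable {O : Opens M} {gt : RMetric m O} {hO : Nonempty O}
  {e : OpenPartialHomeomorph M (EuclideanSpace ℝ (Fin m))} {z : EuclideanSpace ℝ (Fin m)} {r : ℝ}

variable [T2Space M] [MeasurableSpace M] [BorelSpace M] [SecondCountableTopology M]
  [SecondCountableTopology O] [T2Space O] [SigmaCompactSpace O]

/-- The Poincaré constant on a cube of side `h` is `D' h^s`, which falls below `ε`. The unknown
constant `c` is then traded for the mean, which is a continuous functional of `ψ`. -/
theorem IsPatch.exists_cube_estimate (hP : IsPatch gt hO e z r) {ε : ℝ} (hε : 0 < ε) :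
    ∃ h₀ : ℝ, 0 < h₀ ∧ ∀ h : ℝ, 0 < h → h ≤ h₀ → ∀ κ : Fin m → ℤ, cube h κ ⊆ Metric.ball z r →
      ∀ ψ : O → ℝ, ContMDiff (𝓡 m) 𝓘(ℝ, ℝ) ∞ ψ → HasCompactSupport ψ →
        ∫ x in patchSet hO e (cube h κ), ψ x ^ 2 ∂riemVolume gt ≤
          ε * ∫ x in patchSet hO e (cube h κ), gradInner gt ψ ψ x ∂riemVolume gt +
          (∫ x in patchSet hO e (cube h κ), ψ x ∂riemVolume gt) ^ 2 /
            (riemVolume gt).real (patchSet hO e (cube h κ)) := by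
  obtain ⟨D, s, hD, hs, hpoin⟩ := hP.exists_poincare
  set D' : ℝ := D.toReal * ((m : ℝ) + 1) ^ ((m : ℝ) + s)
  have hD' : 0 ≤ D' := by positivity
  -- For `h` below this value `D' h^s ≤ ε`; the `+ 1` covers `D' = 0`.
  refine ⟨(ε / (D' + 1)) ^ (1 / s), by positivity, fun h hh hh₀ κ hκ ψ hψ hψc => ?_⟩
  have hsmall : D' * h ^ s ≤ ε := by
    have h1 : h ^ s ≤ ε / (D' + 1) := by
      calc h ^ s ≤ ((ε / (D' + 1)) ^ (1 / s)) ^ s := Real.rpow_le_rpow hh.le hh₀ hs.le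
        _ = _ := by rw [← Real.rpow_mul (by positivity), one_div_mul_cancel hs.ne', Real.rpow_one]
    calc D' * h ^ s ≤ D' * (ε / (D' + 1)) := by gcongr
      _ ≤ (D' + 1) * (ε / (D' + 1)) := by gcongr; linarith
      _ = ε := mul_div_cancel₀ _ (by positivity)
  set A := patchSet hO e (cube h κ)
  have hAt : riemVolume gt A < ⊤ := hP.volume_lt_top hκ
  have hfin : IsFiniteMeasure ((riemVolume gt).restrict A) :=
    ⟨by rwa [Measure.restrict_apply_univ]⟩
  have hgi : Integrable (gradInner gt ψ ψ) ((riemVolume gt).restrict A) :=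
    (integrable_gradInner gt hψ hψ hψc).restrict
  have hgn : 0 ≤ ∫ x in A, gradInner gt ψ ψ x ∂riemVolume gt :=
    integral_nonneg fun x => gradInner_self_nonneg gt ψ x
  have hE : ∫⁻ x in A, ENNReal.ofReal (gradInner gt ψ ψ x) ∂riemVolume gt =
      ENNReal.ofReal (∫ x in A, gradInner gt ψ ψ x ∂riemVolume gt) :=
    (ofReal_integral_eq_lintegral_ofReal hgi
      (Eventually.of_forall fun x => gradInner_self_nonneg gt ψ x)).symm
  have hm2 : MemLp ψ 2 ((riemVolume gt).restrict A) :=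
    (hψ.continuous.memLp_of_hasCompactSupport hψc).restrict A
  -- The Poincaré lemma needs a strict inequality, so a slack `τ` is carried and removed at the end.
  refine le_of_forall_pos_le_add fun τ hτ => ?_
  obtain ⟨c, hc⟩ := hpoin (cube h κ) (m * h + h) ψ (convex_cube h κ) (measurableSet_cube h κ) hκ
    (by positivity) (fun x hx y hy => (norm_sub_le_of_mem_cube hx hy).trans (by linarith)) hψ hψc
    (D * ENNReal.ofReal (((m : ℝ) + 1) ^ ((m : ℝ) + s) * h ^ s) *
      (∫⁻ x in A, ENNReal.ofReal (gradInner gt ψ ψ x) ∂riemVolume gt) + ENNReal.ofReal τ) (by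
      rw [volume_cube]
      refine ennreal_scale_lt hD ?_ hh m (by simpa using hτ)
      rw [hE]
      exact ENNReal.ofReal_lt_top)
  have h1 : ∫ x in A, (ψ x - c) ^ 2 ∂riemVolume gt ≤
      ε * ∫ x in A, gradInner gt ψ ψ x ∂riemVolume gt + τ := by
    have h2 : Integrable (fun x => (ψ x - c) ^ 2) ((riemVolume gt).restrict A) :=
      (hm2.sub (memLp_const c)).integrable_sq
    have h3 : ∫⁻ x in A, ‖ψ x - c‖ₑ ^ 2 ∂riemVolume gt =
        ENNReal.ofReal (∫ x in A, (ψ x - c) ^ 2 ∂riemVolume gt) := by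
      rw [ofReal_integral_eq_lintegral_ofReal h2 (Eventually.of_forall fun x => sq_nonneg _)]
      refine lintegral_congr fun x => ?_
      rw [enorm_pow_eq_ofReal, sq_abs]
    rw [h3, hE, ← ENNReal.ofReal_toReal hD.ne, ← ENNReal.ofReal_mul ENNReal.toReal_nonneg,
      ← ENNReal.ofReal_mul (by positivity), ← ENNReal.ofReal_add (by positivity) hτ.le,
      ENNReal.ofReal_le_ofReal_iff (by positivity)] at hc
    refine hc.trans ?_
    rw [← mul_assoc]
    gcongr
  have h4 := integral_sq_le_add_sq_integral hm2 c
  rw [measureReal_restrict_apply_univ] at h4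
  linarith

/-- One grid side `h` serves all patches. In each patch the cubes meeting the half ball are kept; as
`m h ≤ rc a / 2`, they lie in the full ball, where the cube estimate holds. Cubes of one grid are
disjoint, so the overlap is at most the number of patches, whatever `ε`. -/
theorem exists_finite_rank_of_patches {ι : Type} [Fintype ι] [Nonempty ι] {gt : RMetric m O}
    {ec : ι → OpenPartialHomeomorph M 𝔼} {zc : ι → 𝔼} {rc : ι → ℝ}
    (hP : ∀ a, IsPatch gt hO (ec a) (zc a) (rc a))
    (hcov : ∀ x : O, ∃ a, (x : M) ∈ (ec a).source ∧ ec a x ∈ Metric.ball (zc a) (rc a / 2))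
    (ε : ℝ) (hε : 0 < ε) :
    ∃ (r : ℕ) (l : L2 gt →L[ℝ] (Fin r → ℝ)), ∀ u : (laplacian gt).domain,
      ‖(u : L2 gt)‖ ^ 2 ≤ ε * (⟪laplacian gt u, (u : L2 gt)⟫_ℝ + ‖(u : L2 gt)‖ ^ 2) +
        ‖l (u : L2 gt)‖ ^ 2 := by
  refine exists_finite_rank_of_cover gt (Fintype.card ι) (by exact_mod_cast Fintype.card_pos)
    (fun ε hε => ?_) ε hε
  choose h₀ hh₀ hest using fun a => (hP a).exists_cube_estimate hε
  obtain ⟨h, hh, hha⟩ : ∃ h : ℝ, 0 < h ∧ ∀ a, h ≤ h₀ a ∧ m * h ≤ rc a / 2 := by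
    let b : ι → ℝ := fun a => min (h₀ a) (rc a / 2 / (m + 1))
    have hb : ∀ a, 0 < b a := fun a =>
      lt_min (hh₀ a) (div_pos (half_pos (hP a).pos) (by positivity))
    obtain ⟨a₀, ha₀⟩ := Finite.exists_min b
    refine ⟨b a₀, hb a₀, fun a => ⟨(ha₀ a).trans (min_le_left _ _), ?_⟩⟩
    have h1 : b a₀ ≤ rc a / 2 / (m + 1) := (ha₀ a).trans (min_le_right _ _)
    rw [le_div_iff₀ (by positivity)] at h1
    nlinarith [hb a₀]
  have hfin : ∀ a, {κ : Fin m → ℤ | (cube h κ ∩ Metric.ball (zc a) (rc a / 2)).Nonempty}.Finite :=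
    fun a => finite_cube_inter_ball hh _ _
  let S : ι → Finset (Fin m → ℤ) := fun a => (hfin a).toFinset
  have hS : ∀ a κ, κ ∈ S a → cube h κ ⊆ Metric.ball (zc a) (rc a) := by
    intro a κ hκ y hy
    obtain ⟨w, hw, hwz⟩ := (hfin a).mem_toFinset.1 hκ
    rw [mem_ball_iff_norm] at hwz ⊢
    have h1 := norm_sub_le_of_mem_cube hw hy
    calc ‖y - zc a‖ = ‖(y - w) + (w - zc a)‖ := by abel_nf
      _ ≤ ‖y - w‖ + ‖w - zc a‖ := norm_add_le _ _
      _ < rc a := by linarith [(hha a).2]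
  let A : (Σ a : ι, S a) → Set O := fun i => patchSet hO (ec i.1) (cube h i.2)
  refine ⟨Σ a : ι, S a, inferInstance, A, fun i => measurableSet_patchSet (measurableSet_cube _ _),
    fun i => ((hP i.1).volume_lt_top (hS i.1 i.2 i.2.2)).ne, ?_, ?_, ?_⟩
  · refine eq_univ_of_forall fun x => mem_iUnion.2 ?_
    obtain ⟨a, hxs, hxb⟩ := hcov x
    have hc := mem_cube_floor hh (ec a x)
    exact ⟨⟨a, ⟨_, (hfin a).mem_toFinset.2 ⟨ec a x, hc, hxb⟩⟩⟩, mem_patchSet.2 ⟨hxs, hc⟩⟩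
  · intro F hF hFi
    rw [Fintype.sum_sigma]
    have h1 : ∀ a : ι, ∑ κ : S a, ∫ x in A ⟨a, κ⟩, F x ∂riemVolume gt ≤
        ∫ x, F x ∂riemVolume gt := fun a => by
      rw [← integral_iUnion_fintype (fun κ => measurableSet_patchSet (measurableSet_cube _ _)) ?_
        fun κ => hFi.integrableOn]
      · exact setIntegral_le_integral hFi (Eventually.of_forall hF)
      · intro κ κ' hne
        refine disjoint_left.2 fun x hx hx' => ?_
        exact disjoint_left.1 (pairwise_disjoint_cube hh fun h => hne (Subtype.ext h))
          (mem_patchSet.1 hx).2 (mem_patchSet.1 hx').2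
    refine (Finset.sum_le_sum fun a _ => h1 a).trans (le_of_eq ?_)
    simp
  · intro ψ hψ hψc i
    exact hest i.1 h hh (hha i.1).1 i.2 (hS i.1 i.2 i.2.2) ψ hψ hψc

end Patches

/-! ### The kernel of the form -/

section Kernel

open TopologicalSpace (Opens)

/-- The second moment is smallest about the mean, so the variance is at most every `δ` and vanishes.
-/
theorem ae_eq_const_of_integral_sub_sq_le {α : Type*} [MeasurableSpace α] {ν : Measure α}
    [IsFiniteMeasure ν] {u : α → ℝ} (hu : MemLp u 2 ν)
    (h : ∀ δ : ℝ, 0 < δ → ∃ c : ℝ, ∫ x, (u x - c) ^ 2 ∂ν ≤ δ) : ∃ c : ℝ, ∀ᵐ x ∂ν, u x = c := by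
  rcases eq_or_ne ν 0 with rfl | hν
  · exact ⟨0, by simp⟩
  have hv : 0 < ν.real univ := by
    rw [measureReal_def]
    exact ENNReal.toReal_pos (by simpa using hν) (measure_ne_top _ _)
  have hu1 : Integrable u ν := hu.integrable (by norm_num)
  have hu2 : Integrable (fun x => u x ^ 2) ν := hu.integrable_sq
  have h1 : ∫ x, u x ^ 2 ∂ν ≤ (∫ x, u x ∂ν) ^ 2 / ν.real univ := by
    refine le_of_forall_pos_le_add fun δ hδ => ?_
    obtain ⟨c, hc⟩ := h δ hδ
    linarith [integral_sq_le_add_sq_integral hu c]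
  set c := (∫ x, u x ∂ν) / ν.real univ with hc
  have h2 : ∫ x, (u x - c) ^ 2 ∂ν = ∫ x, u x ^ 2 ∂ν - (∫ x, u x ∂ν) ^ 2 / ν.real univ := by
    have e : ∀ x, (u x - c) ^ 2 = u x ^ 2 - 2 * c * u x + c ^ 2 := fun x => by ring
    simp only [e]
    have hs : Integrable (fun x => u x ^ 2 - 2 * c * u x) ν := hu2.sub (hu1.const_mul _)
    rw [integral_add hs (integrable_const _),
      integral_sub hu2 (hu1.const_mul _), integral_const_mul, integral_const, smul_eq_mul, hc]
    field_simp
    ring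
  have hi : Integrable (fun x => (u x - c) ^ 2) ν := (hu.sub (memLp_const c)).integrable_sq
  have h3 : ∫ x, (u x - c) ^ 2 ∂ν = 0 :=
    le_antisymm (by rw [h2]; linarith) (integral_nonneg fun x => sq_nonneg _)
  rw [integral_eq_zero_iff_of_nonneg (fun x => sq_nonneg _) hi] at h3
  refine ⟨c, h3.mono fun x hx => ?_⟩
  have : (u x - c) ^ 2 = 0 := hx
  exact sub_eq_zero.1 (pow_eq_zero_iff two_ne_zero |>.1 this)

variable {m : ℕ} {M : Type*} [TopologicalSpace M] [ChartedSpace (EuclideanSpace ℝ (Fin m)) M]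
  [IsManifold (𝓡 m) ∞ M]

local notation "𝔼" => EuclideanSpace ℝ (Fin m)

variable {O : Opens M} {gt : RMetric m O} {hO : Nonempty O}
  {e : OpenPartialHomeomorph M (EuclideanSpace ℝ (Fin m))} {z : EuclideanSpace ℝ (Fin m)} {r : ℝ}

/-- In a patch the complement of `O` is Lebesgue null, while a neighbourhood of a point has positive
measure. -/
theorem dense_of_patches (hP : ∀ p : M, ∃ (e : OpenPartialHomeomorph M 𝔼) (z : 𝔼) (r : ℝ),
    IsPatch gt hO e z r ∧ p ∈ e.source ∧ e p = z) : Dense (O : Set M) := by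
  intro p
  rw [mem_closure_iff_nhds]
  intro W hW
  obtain ⟨e, z, r, hP, hps, hz⟩ := hP p
  have hzt : z ∈ e.target := hz ▸ e.map_source hps
  have h1 : e.symm ⁻¹' W ∩ Metric.ball z r ∈ 𝓝 z := by
    refine inter_mem ((e.continuousAt_symm hzt).preimage_mem_nhds ?_)
      (Metric.ball_mem_nhds z hP.pos)
    rw [← hz, e.left_inv hps]
    exact hW
  have h2 : 0 < volume (e.symm ⁻¹' W ∩ Metric.ball z r) := Measure.measure_pos_of_mem_nhds _ h1
  by_contra hne
  have h3 : e.symm ⁻¹' W ∩ Metric.ball z r ⊆ Metric.ball z r \ (e.subtypeRestr hO).target :=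
    fun y hy => ⟨hy.2, fun hyt => hne ⟨e.symm y, hy.1, ((mem_restr_target hO).1 hyt).2⟩⟩
  exact h2.ne' (measure_mono_null h3 hP.null)

variable [T2Space M] [MeasurableSpace M] [BorelSpace M] [SecondCountableTopology M]
  [SecondCountableTopology O] [T2Space O] [SigmaCompactSpace O]

/-- The Poincaré inequality is available for test functions only. Approximants of `u` in `L²` whose
energies tend to `0` are, by Poincaré on the whole ball, close to constants there, hence so is `u`.
Each of the two errors is `δ / 4` and enters doubled. -/
theorem IsPatch.exists_ae_eq_const (hP : IsPatch gt hO e z r) {u : L2 gt}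
    (hu : u ∈ formDomain (laplacian gt)) (hE : energy gt u = 0) :
    ∃ c : ℝ, ∀ᵐ x ∂(riemVolume gt).restrict (patchSet hO e (Metric.ball z r)), u x = c := by
  set A := patchSet hO e (Metric.ball z r)
  have hB : MeasurableSet (Metric.ball z r) := Metric.isOpen_ball.measurableSet
  have hAt : riemVolume gt A < ⊤ := hP.volume_lt_top Subset.rfl
  have hfin : IsFiniteMeasure ((riemVolume gt).restrict A) :=
    ⟨by rwa [Measure.restrict_apply_univ]⟩
  have huA : MemLp u 2 ((riemVolume gt).restrict A) := (Lp.memLp u).restrict A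
  refine ae_eq_const_of_integral_sub_sq_le huA fun δ hδ => ?_
  obtain ⟨s, hs, hsc⟩ := exists_seq_of_mem_formDomain (laplacian gt) (laplacian_symmetric gt)
    (laplacian_nonneg gt) hu
  have hform := tendsto_form_energy gt u s hs hsc
  rw [hE] at hform
  obtain ⟨D, t, hD, ht, hpoin⟩ := hP.exists_poincare
  set R := D * ENNReal.ofReal ((r + r) ^ ((m : ℝ) + t))
  have hR : R ≠ ⊤ := ENNReal.mul_ne_top hD.ne ENNReal.ofReal_ne_top
  have hlim1 : Tendsto (fun k => R * ENNReal.ofReal ⟪laplacian gt (s k), (s k : L2 gt)⟫_ℝ) atTop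
      (𝓝 0) := by
    have h1 := ENNReal.Tendsto.const_mul (ENNReal.tendsto_ofReal hform) (Or.inr hR)
    simpa using h1
  have hlim2 : Tendsto (fun k => ‖u - s k‖ ^ 2) atTop (𝓝 0) := by
    have h1 := (tendsto_const_nhds (x := u)).sub hs
    have h2 := (h1.norm).pow 2
    simpa using h2
  have hBv : 0 < volume (Metric.ball z r) := Metric.measure_ball_pos _ _ hP.pos
  have hδB : 0 < ENNReal.ofReal (δ / 4) * volume (Metric.ball z r) :=
    ENNReal.mul_pos (by simpa using hδ) hBv.ne'
  obtain ⟨k, hk1, hk2⟩ := ((hlim1.eventually (gt_mem_nhds hδB)).and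
    (hlim2.eventually (gt_mem_nhds (show (0 : ℝ) < δ / 4 by positivity)))).exists
  obtain ⟨ψ, hψ⟩ := (mem_laplacian_domain gt (s k)).1 (s k).2
  have hgi : Integrable (gradInner gt ψ ψ) (riemVolume gt) :=
    integrable_gradInner gt hψ.1 hψ.1 hψ.2.1
  obtain ⟨c, hc⟩ := hpoin (Metric.ball z r) (r + r) ψ (convex_ball z r) hB Subset.rfl
    (by linarith [hP.pos]) (fun x hx y hy => by
      rw [mem_ball_iff_norm] at hx hy
      calc ‖y - x‖ = ‖(y - z) - (x - z)‖ := by abel_nf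
        _ ≤ ‖y - z‖ + ‖x - z‖ := norm_sub_le _ _
        _ ≤ r + r := by linarith) hψ.1 hψ.2.1 (ENNReal.ofReal (δ / 4)) (by
      refine lt_of_le_of_lt ?_ hk1
      gcongr
      rw [inner_laplacian gt hψ hψ, ofReal_integral_eq_lintegral_ofReal hgi
        (Eventually.of_forall fun x => gradInner_self_nonneg gt ψ x)]
      exact setLIntegral_le_lintegral _ _)
  refine ⟨c, ?_⟩
  have hm2 : MemLp ψ 2 ((riemVolume gt).restrict A) :=
    (hψ.1.continuous.memLp_of_hasCompactSupport hψ.2.1).restrict A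
  have hi1 : Integrable (fun x => (ψ x - c) ^ 2) ((riemVolume gt).restrict A) :=
    (hm2.sub (memLp_const c)).integrable_sq
  have h1 : ∫ x in A, (ψ x - c) ^ 2 ∂riemVolume gt ≤ δ / 4 := by
    have h3 : ∫⁻ x in A, ‖ψ x - c‖ₑ ^ 2 ∂riemVolume gt =
        ENNReal.ofReal (∫ x in A, (ψ x - c) ^ 2 ∂riemVolume gt) := by
      rw [ofReal_integral_eq_lintegral_ofReal hi1 (Eventually.of_forall fun x => sq_nonneg _)]
      refine lintegral_congr fun x => ?_
      rw [enorm_pow_eq_ofReal, sq_abs]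
    rw [h3, ENNReal.ofReal_le_ofReal_iff (by positivity)] at hc
    exact hc
  have hi2 : Integrable (fun x => (u - s k : L2 gt) x ^ 2) (riemVolume gt) :=
    (Lp.memLp (u - s k : L2 gt)).integrable_sq
  have h2 : ∫ x in A, (u - s k : L2 gt) x ^ 2 ∂riemVolume gt ≤ δ / 4 := by
    refine (setIntegral_le_integral hi2 (Eventually.of_forall fun x => sq_nonneg _)).trans
      (le_trans (le_of_eq ?_) hk2.le)
    rw [← real_inner_self_eq_norm_sq, L2.inner_def]
    exact integral_congr_ae (Eventually.of_forall fun x => by simp [sq])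
  calc ∫ x in A, (u x - c) ^ 2 ∂riemVolume gt
      ≤ ∫ x in A, (2 * (u - s k : L2 gt) x ^ 2 + 2 * (ψ x - c) ^ 2) ∂riemVolume gt := by
        refine integral_mono_ae (huA.sub (memLp_const c)).integrable_sq
          ((hi2.restrict.const_mul 2).add (hi1.const_mul 2)) ?_
        filter_upwards [ae_restrict_of_ae hψ.2.2, ae_restrict_of_ae (Lp.coeFn_sub u (s k : L2 gt))]
          with x hx hx'
        rw [hx', Pi.sub_apply, hx]
        nlinarith [sq_nonneg ((u x - ψ x) - (ψ x - c))]
    _ = 2 * ∫ x in A, (u - s k : L2 gt) x ^ 2 ∂riemVolume gt +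
        2 * ∫ x in A, (ψ x - c) ^ 2 ∂riemVolume gt := by
        rw [integral_add (hi2.restrict.const_mul 2) (hi1.const_mul 2), integral_const_mul,
          integral_const_mul]
    _ ≤ δ := by linarith

/-- Two overlapping patch neighbourhoods meet in an open set which, by density, contains points of
`O` and so has positive volume; hence their constants agree. The constant is then a locally constant
function on `M`, so only the connectedness of `M`, not that of `O`, enters. -/
theorem exists_ae_eq_const_of_energy_eq_zero [ConnectedSpace M]
    (hP : ∀ p : M, ∃ (e : OpenPartialHomeomorph M 𝔼) (z : 𝔼) (r : ℝ),
      IsPatch gt hO e z r ∧ p ∈ e.source ∧ e p = z) {u : L2 gt}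
    (hu : u ∈ formDomain (laplacian gt)) (hE : energy gt u = 0) :
    ∃ c : ℝ, ∀ᵐ x ∂riemVolume gt, u x = c := by
  have hdense := dense_of_patches hP
  have key : ∀ p : M, ∃ (V : Set M) (c : ℝ), IsOpen V ∧ p ∈ V ∧
      riemVolume gt {x : O | (x : M) ∈ V ∧ u x ≠ c} = 0 := fun p => by
    obtain ⟨e, z, r, hP, hps, hz⟩ := hP p
    obtain ⟨c, hc⟩ := hP.exists_ae_eq_const hu hE
    refine ⟨e.source ∩ e ⁻¹' Metric.ball z r, c, e.isOpen_inter_preimage Metric.isOpen_ball,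
      ⟨hps, by rw [mem_preimage, hz]; exact Metric.mem_ball_self hP.pos⟩, ?_⟩
    rw [ae_restrict_iff' (measurableSet_patchSet Metric.isOpen_ball.measurableSet), ae_iff] at hc
    refine measure_mono_null (fun x hx => ?_) hc
    simp only [mem_ofPred_eq, Classical.not_imp]
    exact ⟨mem_patchSet.2 hx.1, hx.2⟩
  choose V c hV hpV hnull using key
  have hloc : IsLocallyConstant c := by
    refine (IsLocallyConstant.iff_eventually_eq c).2 fun p => ?_
    filter_upwards [(hV p).mem_nhds (hpV p)] with p' hp'
    obtain ⟨x₀, hx₀, hx₀O⟩ := hdense.inter_open_nonempty (V p ∩ V p') ((hV p).inter (hV p'))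
      ⟨p', hp', hpV p'⟩
    have hopen : IsOpen ((Subtype.val : O → M) ⁻¹' (V p ∩ V p')) :=
      ((hV p).inter (hV p')).preimage continuous_subtype_val
    have hpos := hopen.measure_pos (riemVolume gt) ⟨⟨x₀, hx₀O⟩, hx₀⟩
    by_contra hne
    refine hpos.ne' (measure_mono_null (fun x hx => ?_)
      (measure_union_null (hnull p) (hnull p')))
    by_cases h : u x = c p
    · exact Or.inr ⟨hx.2, fun h' => hne (h'.symm.trans h)⟩
    · exact Or.inl ⟨hx.1, h⟩
  obtain ⟨p₀⟩ := (inferInstance : Nonempty M)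
  refine ⟨c p₀, ?_⟩
  rw [ae_iff]
  refine measure_null_of_locally_null _ fun x _ => ?_
  refine ⟨{x' : O | (x' : M) ∈ V x ∧ u x' ≠ c p₀}, ?_, ?_⟩
  · rw [mem_nhdsWithin]
    refine ⟨Subtype.val ⁻¹' V x, (hV x).preimage continuous_subtype_val, hpV x, ?_⟩
    rintro x' ⟨h1, h2⟩
    exact ⟨h1, h2⟩
  · rw [hloc.apply_eq_of_preconnectedSpace p₀ x]
    exact hnull x

end Kernel

/-! ### Constants in the form domain -/

section Cometric

variable {m : ℕ} {X : Type*} [TopologicalSpace X] [ChartedSpace (EuclideanSpace ℝ (Fin m)) X]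
  [IsManifold (𝓡 m) ∞ X]

local notation "𝔼" => EuclideanSpace ℝ (Fin m)

variable {e : OpenPartialHomeomorph X (EuclideanSpace ℝ (Fin m))}

theorem cometrIn_self_nonneg (g : RMetric m X) (he : e ∈ IsManifold.maximalAtlas (𝓡 m) ∞ X)
    {y : 𝔼} (hy : y ∈ e.target) (l : 𝔼 →L[ℝ] ℝ) : 0 ≤ cometrIn g e y l l := by
  obtain ⟨C, hC, h⟩ := exists_cometrIn_lower g he (isCompact_singleton (x := y)) (by simpa using hy)
  have h1 : ∑ i, l (stdVec i) ^ 2 ≤ C * cometrIn g e y l l := h y rfl fun i => l (stdVec i)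
  exact nonneg_of_mul_nonneg_right
    ((Finset.sum_nonneg fun i _ => sq_nonneg (l (stdVec i))).trans h1) hC

theorem cometrIn_smul_sub_le (g : RMetric m X) (he : e ∈ IsManifold.maximalAtlas (𝓡 m) ∞ X)
    {y : 𝔼} (hy : y ∈ e.target) (a b : ℝ) (l l' : 𝔼 →L[ℝ] ℝ) :
    cometrIn g e y (a • l - b • l') (a • l - b • l') ≤
      2 * (a ^ 2 * cometrIn g e y l l + b ^ 2 * cometrIn g e y l' l') := by
  have h := cometrIn_self_nonneg g he hy (a • l + b • l')
  have h1 : cometrIn g e y (a • l - b • l') (a • l - b • l') +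
      cometrIn g e y (a • l + b • l') (a • l + b • l') =
      2 * (a ^ 2 * cometrIn g e y l l + b ^ 2 * cometrIn g e y l' l') := by
    simp only [cometrIn, Finset.mul_sum, ← Finset.sum_add_distrib]
    refine Finset.sum_congr rfl fun i _ => Finset.sum_congr rfl fun j _ => ?_
    simp only [_root_.sub_apply, _root_.add_apply, _root_.smul_apply, smul_eq_mul]
    ring
  linarith

end Cometric

section Constants

open TopologicalSpace (Opens)

variable {m : ℕ} {M : Type*} [TopologicalSpace M] [ChartedSpace (EuclideanSpace ℝ (Fin m)) M]
  [IsManifold (𝓡 m) ∞ M]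

local notation "𝔼" => EuclideanSpace ℝ (Fin m)

variable {O : Opens M} {gt : RMetric m O} {hO : Nonempty O}
  {e : OpenPartialHomeomorph M (EuclideanSpace ℝ (Fin m))} {z : EuclideanSpace ℝ (Fin m)} {r : ℝ}

/-- The function `η` cut off by `θ` in the coordinates `e`. -/
def cutBy (e : OpenPartialHomeomorph M 𝔼) (η : M → ℝ) (θ : 𝔼 → ℝ) (p : M) : ℝ :=
  η p * (1 - θ (e p))

theorem tsupport_cutBy_subset (η : M → ℝ) (θ : 𝔼 → ℝ) : tsupport (cutBy e η θ) ⊆ tsupport η :=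
  closure_mono fun p hp h => hp (by rw [cutBy, h, zero_mul])

theorem contMDiff_cutBy (he : e ∈ IsManifold.maximalAtlas (𝓡 m) ∞ M) {η : M → ℝ}
    (hη : ContMDiff (𝓡 m) 𝓘(ℝ, ℝ) ∞ η) (hs : tsupport η ⊆ e.source) {θ : 𝔼 → ℝ}
    (hθ : ContDiff ℝ ∞ θ) : ContMDiff (𝓡 m) 𝓘(ℝ, ℝ) ∞ (cutBy e η θ) := by
  refine contMDiff_of_tsupport fun p hp => ?_
  have hpe := hs (tsupport_cutBy_subset η θ hp)
  have h1 : ContMDiffAt (𝓡 m) (𝓡 m) ∞ e p :=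
    (contMDiffOn_of_mem_maximalAtlas he).contMDiffAt (e.open_source.mem_nhds hpe)
  have h2 : ContMDiffAt (𝓡 m) 𝓘(ℝ, ℝ) ∞ (fun p => θ (e p)) p :=
    (hθ.contMDiff.contMDiffAt (x := e p)).comp p h1
  exact hη.contMDiffAt.mul (contMDiffAt_const.sub h2)

/-- The cutoff equals `1` near each point of the ball outside `O`, so the product vanishes near it.
Its support is closed in the compact `M` and contained in `O`. -/
theorem hasCompactSupport_cutBy [CompactSpace M] [T2Space M] {η : M → ℝ}
    (hs : tsupport η ⊆ e.source ∩ e ⁻¹' Metric.ball z r) {θ : 𝔼 → ℝ}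
    (hθ : ∀ y ∈ Metric.ball z r, y ∉ (e.subtypeRestr hO).target → ∀ᶠ w in 𝓝 y, θ w = 1) :
    HasCompactSupport fun x : O => cutBy e η θ x := by
  have hsub : tsupport (cutBy e η θ) ⊆ O := by
    intro p hp
    by_contra hpO
    have hps := hs (tsupport_cutBy_subset η θ hp)
    have hnt : e p ∉ (e.subtypeRestr hO).target := fun h => hpO (by
      have := ((mem_restr_target hO).1 h).2
      rwa [e.left_inv hps.1] at this)
    have hev : ∀ᶠ q in 𝓝 p, θ (e q) = 1 := (e.continuousAt hps.1).eventually (hθ _ hps.2 hnt)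
    have h0 : cutBy e η θ =ᶠ[𝓝 p] 0 := by
      filter_upwards [hev] with q hq
      rw [cutBy, hq, sub_self, mul_zero]
      rfl
    exact (notMem_tsupport_iff_eventuallyEq.2 h0) hp
  have hK : IsCompact ((Subtype.val : O → M) ⁻¹' tsupport (cutBy e η θ)) :=
    Topology.IsInducing.subtypeVal.isCompact_preimage' (isClosed_tsupport _).isCompact (by
      rw [Subtype.range_val]
      exact hsub)
  refine HasCompactSupport.of_support_subset_isCompact hK fun x hx => ?_
  exact subset_tsupport _ hx

variable [T2Space M] [MeasurableSpace M] [BorelSpace M] [SecondCountableTopology M]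
  [SecondCountableTopology O] [T2Space O] [SigmaCompactSpace O]

theorem exists_fderiv_bound [CompactSpace M] (he : e ∈ IsManifold.maximalAtlas (𝓡 m) ∞ M) {η : M → ℝ}
    (hη : ContMDiff (𝓡 m) 𝓘(ℝ, ℝ) ∞ η) (hs : tsupport η ⊆ e.source) :
    ∃ b : ℝ, 0 ≤ b ∧ ∀ y ∈ e.target,
      ∑ i, fderiv ℝ (fun y => η (e.symm y)) y (stdVec i) ^ 2 ≤ b := by
  have hK : IsCompact (e '' tsupport η) :=
    (isClosed_tsupport η).isCompact.image_of_continuousOn (e.continuousOn.mono hs)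
  have hKt : e '' tsupport η ⊆ e.target := by
    rintro _ ⟨p, hp, rfl⟩
    exact e.map_source (hs hp)
  have hη' := contDiffOn_comp_symm he hη.contMDiffOn
  obtain ⟨b, hb⟩ := hK.exists_bound_of_continuousOn
    (f := fun y => ∑ i, fderiv ℝ (fun y => η (e.symm y)) y (stdVec i) ^ 2)
    (continuousOn_finsetSum _ fun i _ =>
      ((contDiffOn_fderiv_apply e.open_target hη' (stdVec i)).continuousOn.mono hKt).pow 2)
  refine ⟨|b|, abs_nonneg b, fun y hy => ?_⟩
  by_cases hyK : y ∈ e '' tsupport η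
  · exact (le_abs_self _).trans ((hb y hyK).trans (le_abs_self b))
  · have h1 : e.symm y ∉ tsupport η := fun h => hyK ⟨_, h, e.right_inv hy⟩
    have h2 : (fun y => η (e.symm y)) =ᶠ[𝓝 y] fun _ => 0 := by
      have := (e.continuousAt_symm hy).eventually (notMem_tsupport_iff_eventuallyEq.1 h1)
      filter_upwards [this] with w hw
      exact hw
    rw [h2.fderiv_eq]
    simp

/-- The product rule `d(η (1 - θ)) = (1 - θ) dη - η dθ` and the inequality `|v - w|² ≤ 2 |v|² + 2
|w|²`. The first term is controlled by the integrable function `h`, uniformly in `θ`. -/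
theorem lintegral_gradInner_cutBy_le [CompactSpace M] (hP : IsPatch gt hO e z r) {η : M → ℝ}
    (hη : ContMDiff (𝓡 m) 𝓘(ℝ, ℝ) ∞ η) (hs : tsupport η ⊆ e.source ∩ e ⁻¹' Metric.ball z r)
    {a b : ℝ} (ha : ∀ p, |η p| ≤ a)
    (hb : ∀ y ∈ e.target, ∑ i, fderiv ℝ (fun y => η (e.symm y)) y (stdVec i) ^ 2 ≤ b)
    {h : 𝔼 → ℝ≥0∞} (hh : AEMeasurable h (volume.restrict (Metric.ball z r)))
    (hup : ∀ y ∈ Metric.ball z r, y ∈ (e.subtypeRestr hO).target → ∀ l : 𝔼 →L[ℝ] ℝ,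
      ENNReal.ofReal (densIn gt (e.subtypeRestr hO) y * cometrIn gt (e.subtypeRestr hO) y l l) ≤
        h y * ENNReal.ofReal (∑ i, l (stdVec i) ^ 2))
    {θ : 𝔼 → ℝ} (hθ : ContDiff ℝ ∞ θ) (hθ01 : ∀ y, 0 ≤ θ y ∧ θ y ≤ 1) :
    ∫⁻ x, ENNReal.ofReal (gradInner gt (fun x : O => cutBy e η θ x)
        (fun x : O => cutBy e η θ x) x) ∂riemVolume gt ≤
      2 * ((∫⁻ y in Metric.ball z r, h y) * ENNReal.ofReal b) +
      ENNReal.ofReal (2 * a ^ 2) * ∫⁻ y in Metric.ball z r,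
        ENNReal.ofReal (densIn gt (e.subtypeRestr hO) y *
          cometrIn gt (e.subtypeRestr hO) y (fderiv ℝ θ y) (fderiv ℝ θ y)) := by
  have he := hP.mem_maximalAtlas
  have he' := restr_mem_maximalAtlas hO he
  have hB : MeasurableSet (Metric.ball z r) := Metric.isOpen_ball.measurableSet
  set ψ : O → ℝ := fun x => cutBy e η θ x with hψdef
  have hψ : ContMDiff (𝓡 m) 𝓘(ℝ, ℝ) ∞ ψ :=
    (contMDiff_cutBy he hη (fun p hp => (hs hp).1) hθ).comp contMDiff_subtype_val
  have hsupp : (fun x => ENNReal.ofReal (gradInner gt ψ ψ x)) =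
      (patchSet hO e (Metric.ball z r)).indicator fun x => ENNReal.ofReal (gradInner gt ψ ψ x) := by
    refine (indicator_eq_self.2 fun x hx => ?_).symm
    have h1 : x ∈ tsupport (gradInner gt ψ ψ) :=
      subset_tsupport _ fun h0 => hx (by simp only [h0, ENNReal.ofReal_zero])
    have h2 : x ∈ tsupport ψ := tsupport_gradInner_subset gt ψ ψ h1
    have h3 : (x : M) ∈ tsupport η := by
      have : tsupport ψ ⊆ Subtype.val ⁻¹' tsupport η :=
        closure_minimal (fun x hx => subset_tsupport _ fun h0 => hx (by
          simp only [hψdef, cutBy, h0, zero_mul])) ((isClosed_tsupport η).preimage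
          continuous_subtype_val)
      exact this h2
    exact mem_patchSet.2 (hs h3)
  rw [hsupp, lintegral_indicator (measurableSet_patchSet hB), hP.setLIntegral
    (continuous_gradInner gt hψ hψ).measurable.ennreal_ofReal.aemeasurable hB Subset.rfl]
  have hpt : ∀ y ∈ Metric.ball z r, y ∈ (e.subtypeRestr hO).target →
      ENNReal.ofReal (densIn gt (e.subtypeRestr hO) y) *
        ENNReal.ofReal (gradInner gt ψ ψ ((e.subtypeRestr hO).symm y)) ≤
      2 * (h y * ENNReal.ofReal b) + ENNReal.ofReal (2 * a ^ 2) *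
        ENNReal.ofReal (densIn gt (e.subtypeRestr hO) y *
          cometrIn gt (e.subtypeRestr hO) y (fderiv ℝ θ y) (fderiv ℝ θ y)) := by
    intro y hy hyt
    have hye := hP.subset_target hy
    have hd0 := (densIn_pos gt he' hyt).le
    have hη' : DifferentiableAt ℝ (fun y => η (e.symm y)) y :=
      ((contDiffOn_comp_symm he hη.contMDiffOn).differentiableOn (by simp)).differentiableAt
        (e.open_target.mem_nhds hye)
    have hθ' : DifferentiableAt ℝ θ y := hθ.differentiable (by simp) y
    have hev : (fun y => ψ ((e.subtypeRestr hO).symm y)) =ᶠ[𝓝 y]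
        fun y => η (e.symm y) * (1 - θ y) := by
      filter_upwards [(e.subtypeRestr hO).open_target.mem_nhds hyt] with w hw
      simp only [hψdef, cutBy]
      rw [coe_restr_symm hO hw, e.right_inv ((mem_restr_target hO).1 hw).1]
    have hfd : fderiv ℝ (fun y => ψ ((e.subtypeRestr hO).symm y)) y =
        (1 - θ y) • fderiv ℝ (fun y => η (e.symm y)) y - η (e.symm y) • fderiv ℝ θ y := by
      rw [hev.fderiv_eq, (hη'.hasFDerivAt.fun_mul (hθ'.hasFDerivAt.const_sub 1)).fderiv]
      rw [smul_neg]
      abel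
    have hgr : gradInner gt ψ ψ ((e.subtypeRestr hO).symm y) ≤
        2 * (1 * cometrIn gt (e.subtypeRestr hO) y (fderiv ℝ (fun y => η (e.symm y)) y)
          (fderiv ℝ (fun y => η (e.symm y)) y) +
          a ^ 2 * cometrIn gt (e.subtypeRestr hO) y (fderiv ℝ θ y) (fderiv ℝ θ y)) := by
      rw [gradInner_chart gt he' hyt (hψ.mdifferentiableAt (by simp))
        (hψ.mdifferentiableAt (by simp)), hfd]
      refine (cometrIn_smul_sub_le gt he' hyt _ _ _ _).trans ?_
      have h1 := cometrIn_self_nonneg gt he' hyt (fderiv ℝ (fun y => η (e.symm y)) y)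
      have h2 := cometrIn_self_nonneg gt he' hyt (fderiv ℝ θ y)
      have h3 : (1 - θ y) ^ 2 ≤ 1 := by nlinarith [(hθ01 y).1, (hθ01 y).2]
      have h4 : η (e.symm y) ^ 2 ≤ a ^ 2 := by
        rw [← sq_abs]
        exact pow_le_pow_left₀ (abs_nonneg _) (ha _) 2
      gcongr
    rw [← ENNReal.ofReal_mul hd0]
    refine (ENNReal.ofReal_le_ofReal (mul_le_mul_of_nonneg_left hgr hd0)).trans ?_
    have h1 : 0 ≤ densIn gt (e.subtypeRestr hO) y * cometrIn gt (e.subtypeRestr hO) y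
        (fderiv ℝ (fun y => η (e.symm y)) y) (fderiv ℝ (fun y => η (e.symm y)) y) :=
      mul_nonneg hd0 (cometrIn_self_nonneg gt he' hyt _)
    have h2 : 0 ≤ densIn gt (e.subtypeRestr hO) y * cometrIn gt (e.subtypeRestr hO) y
        (fderiv ℝ θ y) (fderiv ℝ θ y) := mul_nonneg hd0 (cometrIn_self_nonneg gt he' hyt _)
    rw [show ∀ d p q : ℝ, d * (2 * (1 * p + a ^ 2 * q)) = 2 * (d * p) + 2 * a ^ 2 * (d * q) from
      fun d p q => by ring, ENNReal.ofReal_add (by positivity) (by positivity),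
      ENNReal.ofReal_mul (q := densIn gt (e.subtypeRestr hO) y *
        cometrIn gt (e.subtypeRestr hO) y (fderiv ℝ θ y) (fderiv ℝ θ y)) (by positivity),
      ENNReal.ofReal_mul (p := 2) zero_le_two, ENNReal.ofReal_ofNat]
    gcongr
    exact (hup y hy hyt _).trans (by gcongr; exact hb y hye)
  calc _ ≤ ∫⁻ y in Metric.ball z r, (2 * (h y * ENNReal.ofReal b) + ENNReal.ofReal (2 * a ^ 2) *
        ENNReal.ofReal (densIn gt (e.subtypeRestr hO) y *
          cometrIn gt (e.subtypeRestr hO) y (fderiv ℝ θ y) (fderiv ℝ θ y))) :=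
        lintegral_mono_ae ((hP.ae_target hB Subset.rfl).mono fun y hy => hpt y hy.1 hy.2)
    _ = _ := by
      rw [lintegral_add_left' ((hh.mul_const _).const_mul _), lintegral_const_mul' _ _ (by simp),
        lintegral_mul_const' _ _ ENNReal.ofReal_ne_top,
        lintegral_const_mul' _ _ ENNReal.ofReal_ne_top]

/-- A smooth function supported in a patch lies in the form domain. -/
theorem IsPatch.mem_formDomain [CompactSpace M] (hP : IsPatch gt hO e z r) {η : M → ℝ}
    (hη : ContMDiff (𝓡 m) 𝓘(ℝ, ℝ) ∞ η) (hs : tsupport η ⊆ e.source ∩ e ⁻¹' Metric.ball z r)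
    {v : L2 gt} (hv : ∀ᵐ x ∂riemVolume gt, v x = η x) : v ∈ formDomain (laplacian gt) := by
  have he := hP.mem_maximalAtlas
  have hse : tsupport η ⊆ e.source := fun p hp => (hs hp).1
  obtain ⟨h, hh, hhi, hup⟩ := hP.upper
  obtain ⟨θ, hθ, hθ01, hθ1, hθ0, B, hB, hBle⟩ := hP.cutoff
  obtain ⟨a, ha⟩ : ∃ a, ∀ p, |η p| ≤ a := by
    obtain ⟨a, ha⟩ := isCompact_univ.exists_bound_of_continuousOn hη.continuous.continuousOn
    exact ⟨a, fun p => ha p (mem_univ p)⟩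
  obtain ⟨b, hb0, hb⟩ := exists_fderiv_bound he hη hse
  have hψ : ∀ j, ContMDiff (𝓡 m) 𝓘(ℝ, ℝ) ∞ fun x : O => cutBy e η (θ j) x := fun j =>
    (contMDiff_cutBy he hη hse (hθ j)).comp contMDiff_subtype_val
  have hψc : ∀ j, HasCompactSupport fun x : O => cutBy e η (θ j) x := fun j =>
    hasCompactSupport_cutBy hs (hθ1 j)
  choose s hs' using fun j => exists_isTestClass gt (hψ j) (hψc j)
  have hle : ∀ j (x : O), |cutBy e η (θ j) x| ≤ |η x| := fun j x => by
    rw [cutBy, abs_mul]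
    refine mul_le_of_le_one_right (abs_nonneg _) (abs_le.2 ?_)
    have := hθ01 j (e x)
    constructor <;> linarith [this.1, this.2]
  set Bd : ℝ≥0∞ := 2 * ((∫⁻ y in Metric.ball z r, h y) * ENNReal.ofReal b) +
    ENNReal.ofReal (2 * a ^ 2) * B
  have hBd : Bd ≠ ⊤ := ENNReal.add_ne_top.2 ⟨ENNReal.mul_ne_top (by simp)
    (ENNReal.mul_ne_top hhi.ne ENNReal.ofReal_ne_top), ENNReal.mul_ne_top ENNReal.ofReal_ne_top hB.ne⟩
  -- The energies of the approximants are known to be bounded, not to converge, so no Cauchy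
  -- property for the form is available. Boundedness together with weak convergence in `L²` is
  -- enough.
  refine mem_formDomain_of_bounded (laplacian gt) (laplacian_symmetric gt) (laplacian_nonneg gt)
    (s := fun j => ⟨s j, (mem_laplacian_domain gt (s j)).2 ⟨_, hs' j⟩⟩)
    (C := ‖v‖ ^ 2 + Bd.toReal) (fun w => ?_) fun j => ?_
  · simp only [L2.inner_def]
    refine tendsto_integral_of_dominated_convergence (fun x => ‖⟪v x, w x⟫_ℝ‖)
      (fun j => (L2.integrable_inner (𝕜 := ℝ) (s j) w).1) (L2.integrable_inner (𝕜 := ℝ) v w).norm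
      (fun j => ?_) ?_
    · filter_upwards [(hs' j).2.2, hv] with x hx hx'
      simp only [hx, hx', RCLike.inner_apply, conj_trivial, norm_mul,
        Real.norm_eq_abs]
      exact mul_le_mul_of_nonneg_left (hle j x) (abs_nonneg _)
    · filter_upwards [ae_all_iff.2 fun j => (hs' j).2.2, hv] with x hx hx'
      simp only [hx, hx']
      refine Tendsto.inner ?_ tendsto_const_nhds
      simp only [cutBy]
      by_cases hxs : (x : M) ∈ tsupport η
      · have h1 := hθ0 (e x) (hs hxs).2 ((mem_restr_target hO).2
          ⟨e.map_source (hse hxs), by rw [e.left_inv (hse hxs)]; exact x.2⟩)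
        have h2 := (tendsto_const_nhds (x := η x)).mul ((tendsto_const_nhds (x := (1 : ℝ))).sub h1)
        simpa using h2
      · simp [image_eq_zero_of_notMem_tsupport hxs]
  · refine add_le_add ?_ ?_
    · refine pow_le_pow_left₀ (norm_nonneg _) ?_ 2
      refine Lp.norm_le_norm_of_ae_le ?_
      filter_upwards [(hs' j).2.2, hv] with x hx hx'
      rw [hx, hx']
      exact hle j x
    · have h1 := inner_laplacian gt (u := ⟨s j, (mem_laplacian_domain gt (s j)).2 ⟨_, hs' j⟩⟩)
        (v := ⟨s j, (mem_laplacian_domain gt (s j)).2 ⟨_, hs' j⟩⟩) (hs' j) (hs' j)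
      rw [h1, ← ENNReal.ofReal_le_iff_le_toReal hBd, ofReal_integral_eq_lintegral_ofReal
        (integrable_gradInner gt (hψ j) (hψ j) (hψc j))
        (Eventually.of_forall fun x => gradInner_self_nonneg gt _ x)]
      refine (lintegral_gradInner_cutBy_le hP hη hs ha hb hh hup (hθ j) (hθ01 j)).trans ?_
      exact add_le_add le_rfl (mul_le_mul_right (hBle j) _)

/-- A partition of unity on `M` writes `1` as a finite sum of smooth functions, each supported in a
patch. -/
theorem one_mem_formDomain [CompactSpace M] {ι : Type} [Fintype ι]
    {ec : ι → OpenPartialHomeomorph M 𝔼} {zc : ι → 𝔼} {rc : ι → ℝ}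
    (hP : ∀ a, IsPatch gt hO (ec a) (zc a) (rc a))
    (hcov : ∀ p : M, ∃ a, p ∈ (ec a).source ∧ ec a p ∈ Metric.ball (zc a) (rc a))
    {v : L2 gt} (hv : ∀ᵐ x ∂riemVolume gt, v x = 1) : v ∈ formDomain (laplacian gt) := by
  obtain ⟨ρ, hρ⟩ := SmoothPartitionOfUnity.exists_isSubordinate (𝓡 m) isClosed_univ
    (fun a => (ec a).source ∩ ec a ⁻¹' Metric.ball (zc a) (rc a))
    (fun a => (ec a).isOpen_inter_preimage Metric.isOpen_ball)
    (fun p _ => mem_iUnion.2 (hcov p))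
  have hone : ∀ x : O, ∑ a, ρ a (x : M) = 1 := fun x => by
    rw [← finsum_eq_sum_of_fintype]
    exact ρ.sum_eq_one (mem_univ _)
  have hL : ∀ a, MemLp (fun x : O => ρ a (x : M)) 2 (riemVolume gt) := fun a => by
    have h1 : MemLp (fun _ : O => (1 : ℝ)) 2 (riemVolume gt) :=
      (memLp_congr_ae hv).1 (Lp.memLp v)
    refine h1.mono ((ρ a).contMDiff.continuous.comp continuous_subtype_val).aestronglyMeasurable
      (Eventually.of_forall fun x => ?_)
    rw [norm_one, Real.norm_eq_abs, abs_of_nonneg (ρ.nonneg a _)]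
    exact ρ.le_one a _
  let w : ι → L2 gt := fun a => (hL a).toLp _
  have hw : ∀ a, ∀ᵐ x ∂riemVolume gt, w a x = ρ a (x : M) := fun a => (hL a).coeFn_toLp
  have hsum : v = ∑ a, w a := by
    refine Lp.ext ?_
    filter_upwards [hv, Lp.coeFn_finsetSum Finset.univ w, ae_all_iff.2 hw] with x h2 h3 h4
    rw [h2, h3, Finset.sum_apply]
    simp only [h4, hone]
  rw [hsum]
  exact Submodule.sum_mem _ fun a _ => (hP a).mem_formDomain (ρ a).contMDiff (hρ a) (hw a)

theorem energy_eq_zero_of_ae_eq_one {v : L2 gt} (hv : ∀ᵐ x ∂riemVolume gt, v x = 1) :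
    energy gt v = 0 := by
  have h1 : ContMDiff (𝓡 m) 𝓘(ℝ, ℝ) ∞ fun _ : O => (1 : ℝ) := contMDiff_const
  have h2 : IsWeakGradient gt v (smoothGrad gt fun _ : O => (1 : ℝ)) :=
    (isWeakGradient_smoothGrad gt h1).congr (hv.mono fun x hx => hx.symm)
  rw [energy_eq h2]
  refine integral_eq_zero_of_ae (Eventually.of_forall fun x => ?_)
  change metr gt x (smoothGrad gt (fun _ => 1) x) (smoothGrad gt (fun _ => 1) x) = 0
  rw [metr_smoothGrad]
  unfold diffAt
  rw [mfderiv_const]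
  rfl

end Constants

/-! ### The spectral theorem for a metric with patches -/

section Main

open TopologicalSpace (Opens)

variable {m : ℕ}

local notation "𝔼" => EuclideanSpace ℝ (Fin m)

theorem infinite_of_chart {X : Type*} [TopologicalSpace X]
    [ChartedSpace (EuclideanSpace ℝ (Fin m)) X] [Nonempty X] (hm : 0 < m) : Infinite X := by
  obtain ⟨x⟩ := (inferInstance : Nonempty X)
  have : Nontrivial 𝔼 := by
    have : Nonempty (Fin m) := ⟨⟨0, hm⟩⟩
    infer_instance
  have h : (chartAt 𝔼 x).target.Infinite := infinite_of_mem_nhds (chartAt 𝔼 x x)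
    (chart_target_mem_nhds 𝔼 x)
  exact infinite_univ_iff.1 ((h.image (chartAt 𝔼 x).symm.injOn).mono (subset_univ _))

/-- Indicators of infinitely many disjoint nonempty open sets are orthogonal and nonzero. This
ensures that the eigenvalues form an infinite sequence. -/
theorem not_finiteDimensional_L2 {X : Type*} [TopologicalSpace X]
    [ChartedSpace (EuclideanSpace ℝ (Fin m)) X] [IsManifold (𝓡 m) ∞ X] [MeasurableSpace X]
    [BorelSpace X] [SecondCountableTopology X] [T2Space X] [Infinite X] (g : RMetric m X)
    (hfin : riemVolume g univ < ⊤) : ¬ FiniteDimensional ℝ (L2 g) := by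
  intro hfd
  obtain ⟨U, hU, hUo, hUd⟩ := exists_seq_infinite_isOpen_pairwise_disjoint X
  have hUt : ∀ k, riemVolume g (U k) ≠ ⊤ := fun k =>
    ((measure_mono (subset_univ _)).trans_lt hfin).ne
  let w : ℕ → L2 g := fun k => indicatorConstLp 2 (hUo k).measurableSet (hUt k) (1 : ℝ)
  have hinner : ∀ k l, ⟪w k, w l⟫_ℝ = (riemVolume g).real (U k ∩ U l) := fun k l =>
    L2.real_inner_indicatorConstLp_one_indicatorConstLp_one _ _ (hUt k) (hUt l)
  have hli : LinearIndependent ℝ w := by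
    refine linearIndependent_of_ne_zero_of_inner_eq_zero (𝕜 := ℝ) (fun k h0 => ?_) fun k l hkl => ?_
    · have h1 := hinner k k
      rw [h0, inner_zero_left, inter_self] at h1
      have h2 := (hUo k).measure_pos (riemVolume g) (hU k).nonempty
      exact (ENNReal.toReal_pos h2.ne' (hUt k)).ne h1
    · change ⟪w k, w l⟫_ℝ = 0
      rw [hinner, (hUd hkl).inter_eq, measureReal_empty]
  have := hli.finite_of_isNoetherian
  exact not_finite ℕ

variable {M : Type*} [TopologicalSpace M] [ChartedSpace (EuclideanSpace ℝ (Fin m)) M]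
  [IsManifold (𝓡 m) ∞ M] {O : Opens M} {gt : RMetric m O} {hO : Nonempty O}

/-- Covering by half balls leaves room for the small cubes that meet a half ball to stay inside the
full one. -/
theorem exists_finite_patches [CompactSpace M]
    (hP : ∀ p : M, ∃ (e : OpenPartialHomeomorph M 𝔼) (z : 𝔼) (r : ℝ),
      IsPatch gt hO e z r ∧ p ∈ e.source ∧ e p = z) :
    ∃ (k : ℕ) (ec : Fin k → OpenPartialHomeomorph M 𝔼) (zc : Fin k → 𝔼) (rc : Fin k → ℝ),
      (∀ a, IsPatch gt hO (ec a) (zc a) (rc a)) ∧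
      ∀ p : M, ∃ a, p ∈ (ec a).source ∧ ec a p ∈ Metric.ball (zc a) (rc a / 2) := by
  choose e z r hP hpe hpz using hP
  obtain ⟨t, ht⟩ := CompactSpace.elim_nhds_subcover
    (fun p => (e p).source ∩ e p ⁻¹' Metric.ball (z p) (r p / 2)) (fun p =>
      ((e p).isOpen_inter_preimage Metric.isOpen_ball).mem_nhds ⟨hpe p, by
        rw [mem_preimage, hpz]
        exact Metric.mem_ball_self (half_pos (hP p).pos)⟩)
  refine ⟨t.card, fun a => e (t.equivFin.symm a), fun a => z (t.equivFin.symm a),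
    fun a => r (t.equivFin.symm a), fun a => hP _, fun p => ?_⟩
  have hp : p ∈ ⋃ x ∈ t, (e x).source ∩ e x ⁻¹' Metric.ball (z x) (r x / 2) := by
    rw [ht]
    exact mem_univ p
  obtain ⟨x, hx, hpx⟩ := mem_iUnion₂.1 hp
  exact ⟨t.equivFin ⟨x, hx⟩, by simpa using hpx⟩

/-- The constant `1` has zero energy and lies in the form domain, so the lower bound of the form
forces the first eigenvalue to be `0`. If the second were `0` as well, the first two basis vectors
would both be multiples of `1` and could not be orthogonal. -/
theorem friedrichsLaplacian_spectral_of_patches [CompactSpace M] [T2Space M] [ConnectedSpace M]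
    [MeasurableSpace M] [BorelSpace M] (hm : 0 < m)
    (hP : ∀ p : M, ∃ (e : OpenPartialHomeomorph M 𝔼) (z : 𝔼) (r : ℝ),
      IsPatch gt hO e z r ∧ p ∈ e.source ∧ e p = z) :
    laplacian gt ≤ friedrichsLaplacian gt ∧
    IsSelfAdjoint (friedrichsLaplacian gt) ∧
    HasDiscreteSpectrum (friedrichsLaplacian gt) ∧
    ∃ ev : ℕ → ℝ,
      ev 0 = 0 ∧ 0 < ev 1 ∧ Monotone ev ∧ Tendsto ev atTop atTop ∧
      spectrum (friedrichsLaplacian gt) = range ev ∧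
      (∀ z : ℝ, {j | ev j = z}.ncard =
        Module.finrank ℝ (eigenspace (friedrichsLaplacian gt) z)) ∧
      (∃ b : HilbertBasis ℕ ℝ (L2 gt), ∀ j : ℕ,
        b j ∈ W12 gt ∧
        ∃ h : b j ∈ (friedrichsLaplacian gt).domain,
          friedrichsLaplacian gt ⟨b j, h⟩ = ev j • b j) ∧
      ∀ j : ℕ,
        ((ev j : ℝ) : EReal) =
          ⨅ (V : Submodule ℝ (L2 gt)) (_ : (V : Set (L2 gt)) ⊆ W12Zero gt)
            (_ : Module.finrank ℝ V = j + 1),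
            ⨆ (u : L2 gt) (_ : u ∈ V) (_ : u ≠ 0),
              ((energy gt u / ‖u‖ ^ 2 : ℝ) : EReal) := by
  have : SecondCountableTopology M := ChartedSpace.secondCountable_of_sigmaCompact 𝔼 M
  have : LocallyCompactSpace O := ChartedSpace.locallyCompactSpace 𝔼 O
  have : Infinite O := infinite_of_chart hm
  obtain ⟨k, ec, zc, rc, hPc, hcov⟩ := exists_finite_patches hP
  have hcov' : ∀ p : M, ∃ a, p ∈ (ec a).source ∧ ec a p ∈ Metric.ball (zc a) (rc a) := fun p => by
    obtain ⟨a, h1, h2⟩ := hcov p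
    exact ⟨a, h1, Metric.ball_subset_ball (half_le_self (hPc a).pos.le) h2⟩
  have hk : Nonempty (Fin k) := by
    obtain ⟨x⟩ := hO
    exact ⟨(hcov x).choose⟩
  have hfin : riemVolume gt univ < ⊤ := by
    refine (measure_mono (t := ⋃ a, patchSet hO (ec a) (Metric.ball (zc a) (rc a)))
      fun x _ => ?_).trans_lt ((measure_iUnion_le _).trans_lt ?_)
    · obtain ⟨a, ha⟩ := hcov' x
      exact mem_iUnion.2 ⟨a, mem_patchSet.2 ha⟩
    · rw [tsum_fintype]
      exact ENNReal.sum_lt_top.2 fun a _ => (hPc a).volume_lt_top Subset.rfl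
  obtain ⟨h1, h2, h3, ev, hev0, hmono, htend, hspec, hmult, ⟨b, hb⟩, hbot, hminmax⟩ :=
    friedrichs_spectral_theorem (laplacian gt) (laplacian_dense gt) (laplacian_symmetric gt)
      (laplacian_nonneg gt) (exists_finite_rank_of_patches hPc fun x => hcov x)
      (not_finiteDimensional_L2 gt hfin) (energy gt) (tendsto_form_energy gt)
  let one : L2 gt := indicatorConstLp 2 MeasurableSet.univ hfin.ne (1 : ℝ)
  have hone : ∀ᵐ x ∂riemVolume gt, one x = 1 := by
    filter_upwards [indicatorConstLp_coeFn (p := 2) (hs := MeasurableSet.univ) (hμs := hfin.ne)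
      (c := (1 : ℝ))] with x hx
    rw [hx, indicator_of_mem (mem_univ x)]
  have hone0 : one ≠ 0 := by
    intro h0
    have h4 : ∀ᵐ x ∂riemVolume gt, False := by
      have h5 : ∀ᵐ x ∂riemVolume gt, (0 : L2 gt) x = 1 := h0 ▸ hone
      filter_upwards [Lp.coeFn_zero ℝ 2 (riemVolume gt), h5] with x h6 h7
      rw [h6] at h7
      exact zero_ne_one h7
    rw [ae_iff] at h4
    have h5 := isOpen_univ.measure_pos (riemVolume gt) univ_nonempty
    exact h5.ne' (by simpa using h4)
  have hnorm : 0 < ‖one‖ := norm_pos_iff.2 hone0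
  have hconst : ∀ j, ev j = 0 → ∃ c : ℝ, b j = c • one := fun j hj => by
    obtain ⟨c, hc⟩ := exists_ae_eq_const_of_energy_eq_zero hP (hb j).1 ((hb j).2.1.trans hj)
    refine ⟨c, Lp.ext ?_⟩
    filter_upwards [hc, Lp.coeFn_smul c one, hone] with x h4 h5 h6
    rw [h4, h5, Pi.smul_apply, h6, smul_eq_mul, mul_one]
  have hev00 : ev 0 = 0 := by
    have h4 := hbot one (one_mem_formDomain hPc hcov' hone)
    rw [energy_eq_zero_of_ae_eq_one hone] at h4
    exact le_antisymm (nonpos_of_mul_nonpos_left h4 (by positivity)) (hev0 0)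
  refine ⟨h1, h2, h3, ev, hev00, (hev0 1).lt_of_ne' fun hev1 => ?_, hmono, htend, hspec, hmult,
    ⟨b, fun j => ⟨mem_W12_of_mem_formDomain gt (hb j).1, (hb j).2.2⟩⟩, fun j => ?_⟩
  · obtain ⟨c₀, hc₀⟩ := hconst 0 hev00
    obtain ⟨c₁, hc₁⟩ := hconst 1 hev1
    have hne : ∀ j, b j ≠ 0 := fun j => b.orthonormal.ne_zero j
    have h4 : ⟪b 0, b 1⟫_ℝ = 0 := b.orthonormal.2 zero_ne_one
    rw [hc₀, hc₁, real_inner_smul_left, real_inner_smul_right, real_inner_self_eq_norm_sq] at h4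
    rcases mul_eq_zero.1 h4 with h5 | h5
    · exact hne 0 (by rw [hc₀, h5, zero_smul])
    · rcases mul_eq_zero.1 h5 with h6 | h6
      · exact hne 1 (by rw [hc₁, h6, zero_smul])
      · exact (pow_pos hnorm 2).ne' h6
  · rw [hminmax j]
    simp only [coe_formDomain]

end Main

/-! ### Integrability and lower bounds of the conformal factor -/

section Factor

variable {m n : ℕ} {M : Type*} [TopologicalSpace M] [ChartedSpace (EuclideanSpace ℝ (Fin m)) M]
  [IsManifold (𝓡 m) ∞ M]

/-- If `N` were all of `M`, the slice condition would place the open target of an adapted chart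
inside the null set `x = 0`. -/
theorem nonempty_puncture [T2Space M] [Nonempty M] {g : RMetric m M} {N : Set M}
    {hN : IsCompact N} {𝒜 : Set (OpenPartialHomeomorph M (EuclideanSpace ℝ (Fin m)))}
    (h𝒜 : IsDiagonalizedNear g N n 𝒜) (hmn : n < m) : Nonempty (puncture N hN) := by
  by_contra hne
  have hall : ∀ p : M, p ∈ N := fun p => by
    by_contra hp
    exact hne ⟨⟨p, hp⟩⟩
  obtain ⟨p⟩ := (inferInstance : Nonempty M)
  obtain ⟨e, heA, hpe⟩ := h𝒜.covers p (hall p)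
  have h1 : e.target ⊆ {y | planeDistSq n y = 0} := fun y hy => by
    refine planeDistSq_eq_zero_iff.2 ?_
    have h2 := (h𝒜.slice e heA (e.symm y) (e.map_target hy)).1 (hall _)
    rwa [e.right_inv hy] at h2
  exact (e.open_target.measure_pos volume ⟨_, e.map_source hpe⟩).ne'
    (measure_mono_null h1 (volume_plane hmn))

variable [MeasurableSpace M] [BorelSpace M]

/-- Writing `m (m - n) / 2 + ε = (m - n) q` gives `q = m / 2 + ε / (m - n)`, which exceeds `m / 2 ≥
1`. For `m = 2` one has `n = 0`, and the exponent `2 + ε` has the same shape. -/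
theorem exists_exponent {g : RMetric m M} {f : M → ℝ} (hmn : n + 2 ≤ m)
    (hf_two : m = 2 → ∃ ε : ℝ, 0 < ε ∧ MemLp f (ENNReal.ofReal (2 + ε)) (riemVolume g))
    (hf_three : 3 ≤ m → ∃ ε : ℝ, 0 < ε ∧
      MemLp f (ENNReal.ofReal ((m : ℝ) * ((m : ℝ) - (n : ℝ)) / 2 + ε)) (riemVolume g)) :
    AEStronglyMeasurable f (riemVolume g) ∧ ∃ q : ℝ, 1 < q ∧ (m : ℝ) / 2 < q ∧
      ∫⁻ x, ‖f x‖ₑ ^ (((m - n : ℕ) : ℝ) * q) ∂riemVolume g < ⊤ := by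
  obtain ⟨ε, hε, hf⟩ : ∃ ε : ℝ, 0 < ε ∧
      MemLp f (ENNReal.ofReal ((m : ℝ) * ((m : ℝ) - (n : ℝ)) / 2 + ε)) (riemVolume g) := by
    rcases eq_or_lt_of_le (show 2 ≤ m by omega) with h | h
    · obtain ⟨ε, hε, hf⟩ := hf_two h.symm
      refine ⟨ε, hε, ?_⟩
      have hn : n = 0 := by omega
      subst hn
      subst h
      convert hf using 3
      norm_num
    · exact hf_three h
  have hk : ((m - n : ℕ) : ℝ) = (m : ℝ) - n := Nat.cast_sub (by omega)
  have hk2 : (2 : ℝ) ≤ (m : ℝ) - n := by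
    rw [← hk]
    exact_mod_cast (by omega : 2 ≤ m - n)
  have hm2 : (2 : ℝ) ≤ m := by exact_mod_cast (by omega : 2 ≤ m)
  have hs : 0 < (m : ℝ) * ((m : ℝ) - (n : ℝ)) / 2 + ε := by
    have : 0 ≤ (m : ℝ) * ((m : ℝ) - (n : ℝ)) / 2 := by
      have := mul_nonneg (show (0 : ℝ) ≤ m by linarith) (show (0 : ℝ) ≤ (m : ℝ) - n by linarith)
      linarith
    linarith
  have hdiv : 0 < ε / ((m : ℝ) - n) := div_pos hε (by linarith)
  refine ⟨hf.1, (m : ℝ) / 2 + ε / ((m : ℝ) - n), by linarith, by linarith, ?_⟩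
  have h1 := lintegral_rpow_enorm_lt_top_of_eLpNorm_lt_top (by simpa using hs)
    ENNReal.ofReal_ne_top hf.2
  rw [ENNReal.toReal_ofReal hs.le] at h1
  have h2 : ((m - n : ℕ) : ℝ) * ((m : ℝ) / 2 + ε / ((m : ℝ) - n)) =
      (m : ℝ) * ((m : ℝ) - (n : ℝ)) / 2 + ε := by
    rw [hk, mul_add, mul_div_cancel₀ _ (by linarith : (m : ℝ) - n ≠ 0)]
    ring
  rw [h2]
  exact h1

/-- For `m = 2` necessarily `n = 0`: the first power has exponent `0` and the second is not
required, so no lower bound on `f` is needed. -/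
theorem exists_factor_lower {N : Set M} {f : M → ℝ} (hmn : n + 2 ≤ m)
    (hf : 3 ≤ m → ∃ a : ℝ, 0 < a ∧ ∀ p ∈ Nᶜ, a ≤ f p) :
    ∃ c : ℝ, 0 < c ∧ ∀ p ∈ Nᶜ, c ≤ |f p| ^ (m - n - 2) ∧ (0 < n → c ≤ |f p| ^ (m - n)) := by
  rcases eq_or_lt_of_le (show 2 ≤ m by omega) with h | h
  · have hn : n = 0 := by omega
    subst hn
    subst h
    exact ⟨1, one_pos, fun p _ => ⟨by simp, fun h => absurd h (lt_irrefl 0)⟩⟩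
  · obtain ⟨a, ha, hfa⟩ := hf h
    refine ⟨min (a ^ (m - n - 2)) (a ^ (m - n)), by positivity, fun p hp => ?_⟩
    have h1 : a ≤ |f p| := (hfa p hp).trans (le_abs_self _)
    exact ⟨(min_le_left _ _).trans (pow_le_pow_left₀ ha.le h1 _),
      fun _ => (min_le_right _ _).trans (pow_le_pow_left₀ ha.le h1 _)⟩

end Factor

end IncompleteSpectrum

end

/-! ### The spectrum of the rescaled metric on `M ∖ N`. -/

open IncompleteSpectrum in
theorem corollary1p1 {m n : ℕ} (hmn : n + 2 ≤ m)
    {M : Type*} [TopologicalSpace M] [ChartedSpace (EuclideanSpace ℝ (Fin m)) M]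
    [IsManifold (𝓡 m) ∞ M] [CompactSpace M] [T2Space M] [ConnectedSpace M]
    [MeasurableSpace M] [BorelSpace M]
    (g : RMetric m M) (N : Set M) (hN : IsCompact N)
    (𝒜 : Set (OpenPartialHomeomorph M (EuclideanSpace ℝ (Fin m))))
    (h𝒜 : IsDiagonalizedNear g N n 𝒜)
    (gt : RMetric m (puncture N hN))
    (f : M → ℝ) (hf : ContMDiffOn (𝓡 m) 𝓘(ℝ, ℝ) ∞ f Nᶜ)
    (hgt : ∃ U ∈ 𝓝ˢ N, IsBlockRescaling g N hN n 𝒜 gt f U)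
    (hf_two : m = 2 →
      ∃ ε : ℝ, 0 < ε ∧ MemLp f (ENNReal.ofReal (2 + ε)) (riemVolume g))
    (hf_three : 3 ≤ m →
      (∃ a : ℝ, 0 < a ∧ ∀ p ∈ Nᶜ, a ≤ f p) ∧
      ∃ ε : ℝ, 0 < ε ∧
        MemLp f (ENNReal.ofReal ((m : ℝ) * ((m : ℝ) - (n : ℝ)) / 2 + ε)) (riemVolume g)) :
    laplacian gt ≤ friedrichsLaplacian gt ∧
    IsSelfAdjoint (friedrichsLaplacian gt) ∧
    HasDiscreteSpectrum (friedrichsLaplacian gt) ∧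
    ∃ ev : ℕ → ℝ,
      ev 0 = 0 ∧ 0 < ev 1 ∧ Monotone ev ∧ Tendsto ev atTop atTop ∧
      spectrum (friedrichsLaplacian gt) = range ev ∧
      (∀ z : ℝ, {j | ev j = z}.ncard =
        Module.finrank ℝ (eigenspace (friedrichsLaplacian gt) z)) ∧
      (∃ b : HilbertBasis ℕ ℝ (L2 gt), ∀ j : ℕ,
        b j ∈ W12 gt ∧
        ∃ h : b j ∈ (friedrichsLaplacian gt).domain,
          friedrichsLaplacian gt ⟨b j, h⟩ = ev j • b j) ∧
      ∀ j : ℕ,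
        ((ev j : ℝ) : EReal) =
          ⨅ (V : Submodule ℝ (L2 gt)) (_ : (V : Set (L2 gt)) ⊆ W12Zero gt)
            (_ : Module.finrank ℝ V = j + 1),
            ⨆ (u : L2 gt) (_ : u ∈ V) (_ : u ≠ 0),
              ((energy gt u / ‖u‖ ^ 2 : ℝ) : EReal) := by
  obtain ⟨U, hU, hgt⟩ := hgt
  have : SecondCountableTopology M :=
    ChartedSpace.secondCountable_of_sigmaCompact (EuclideanSpace ℝ (Fin m)) M
  have hO : Nonempty (puncture N hN) := nonempty_puncture h𝒜 (by omega)
  obtain ⟨hfm, q, hq, hqm, hfq⟩ := exists_exponent hmn hf_two fun h => (hf_three h).2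
  obtain ⟨c, hc, hlow⟩ := exists_factor_lower (N := N) hmn fun h => (hf_three h).1
  refine friedrichsLaplacian_spectral_of_patches (hO := hO) (by omega) fun p => ?_
  by_cases hp : p ∈ N
  · exact exists_isPatch_of_singular h𝒜 hmn hgt hU hO hc hlow hfm hq hqm hfq hp
  · exact exists_isPatch_of_mem gt hO (p := p) hp
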